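/- **Conventions.** A vocabulary $\tau$ is a finite set of relation symbols (each with an arity in $\mathbb N$) and constants; it is *relational* if it has no constants. A $\tau$-structure $\mathbf A$ has a finite nonempty universe $A$, and its size is $|\mathbf A|=|\tau|+|A|+\sum_{R}|R^{\mathbf A}|\cdot \mathrm{ar}(R)+\sum_{c}1$, where $R$ and $c$ range over the relation symbols and the constants of $\tau$. Formulas are built from atoms $t{=}t'$ and $R(t_1,\dots,t_r)$ (terms are variables or constants) by $\wedge,\vee,\neg,\exists x,\forall x$. For a formula $\varphi$, $|\varphi|$ is the length of its binary encoding, $\|\varphi\|$ is the number of nodes of its syntax tree, and the width $w(\varphi)$ is the maximal number of free variables of a subformula of $\varphi$. $\Sigma_0=\Pi_0$ is the class of quantifier-free formulas, and $\Sigma_{t+1}$ (resp. $\Pi_{t+1}$) is the closure of $\Pi_t$ (resp. $\Sigma_t$) under $\wedge$, $\vee$ and existential (resp. universal) quantification. $\Sigma^s_t$ is the class of those formulas in $\Sigma_t$ over a relational vocabulary that contain at most $s$ variables (free or bound). For a class $\Phi$ of formulas, $\textsc{mc}(\Phi)\subseteq\{0,1\}^*$ is the set of binary encodings of pairs $(\varphi,\mathbf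 A)$ of a sentence $\varphi\in\Phi$ and a structure $\mathbf A$ of the same vocabulary with $\mathbf A\models\varphi$; structures are encoded by listing the tuples of their relations. $p$-$\textsc{mc}(\Phi)$ is this problem with parameter $|\varphi|$. Algorithms are deterministic Turing machines with a read-only input tape and several work tapes, which halt with the correct answer on every binary string; space is the number of work tape cells visited. **Theorem.** 1. For all $s,t\in\mathbb N$ there are a Turing machine deciding $p$-$\textsc{mc}(\Sigma^s_t)$ and a constant $C$ such that the machine, on the encoding of any pair $(\varphi,\mathbf A)$ of a first-order sentence $\varphi$ and a structure $\mathbf A$ of the same vocabulary, uses space at most $$C\cdot\log|\varphi|\cdot(\log|\varphi|+\log|\mathbf A|).$$ 2. For all $t\ge 1$ there are a Turing machine deciding $\textsc{mc}(\Sigma_t)$ and a constant $C$ such that the machine, on the encoding of any pair $(\varphi,\mathbf A)$ of a first-order sentence $\varphi$ and a structure $\mathbf A$ of the same vocabulary, uses space at most $$C\cdot\big(\log\|\varphi\|\cdot w(\varphi)\cdot\log|A|+\log\|\varphi\|\cdot\log|\varphi|+\log|\mathbf A|\big).$$ -/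

import Mathlib

namespace ModelChecking

/-! ### Turing machines with a read-only input tape and several work tapes -/

/-- A head movement. -/
inductive Move
  | left
  | stay
  | right

/-- What the input head sees: one of the two end markers or an input bit. -/
inductive InputSymbol
  | leftEnd
  | bit (b : Bool)
  | rightEnd

/-- A deterministic Turing machine with a read-only input tape over `{0,1}` and `numTapes`
one-way infinite read-write work tapes. `halt q = some b` means that `q` is a halting state,
accepting if `b = true` and rejecting if `b = false`. -/
structure TuringMachine where
  State : Type
  Symbol : Type
  finiteState : Finite State
  finiteSymbol : Finite Symbol
  numTapes : ℕ
  start : State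
  blank : Symbol
  halt : State → Option Bool
  transition : State → InputSymbol → (Fin numTapes → Symbol) →
    State × Move × (Fin numTapes → Symbol × Move)

namespace TuringMachine

/-- A configuration: state, position of the input head, contents of the work tapes and
positions of the work heads. -/
structure Config (M : TuringMachine) where
  state : M.State
  inputHead : ℕ
  tape : Fin M.numTapes → ℕ → M.Symbol
  head : Fin M.numTapes → ℕ

/-- The input occupies the cells `1, …, |x|`; cell `0` holds the left end marker and cell
`|x| + 1` the right end marker. -/
def readInput (x : List Bool) : ℕ → InputSymbol
  | 0 => .leftEnd
  | p + 1 => match x[p]? with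
    | some b => .bit b
    | none => .rightEnd

/-- A move on a one-way infinite tape: at cell `0` a left move has no effect. -/
def moveHead : Move → ℕ → ℕ
  | .left, p => p - 1
  | .stay, p => p
  | .right, p => p + 1

/-- One step of `M` on input `x`. Halting configurations are left unchanged, and the input head
never leaves the cells `0, …, |x| + 1`. -/
def step (M : TuringMachine) (x : List Bool) (c : M.Config) : M.Config :=
  match M.halt c.state with
  | some _ => c
  | none =>
    let r := M.transition c.state (readInput x c.inputHead) (fun i => c.tape i (c.head i))
    { state := r.1
      inputHead := min (moveHead r.2.1 c.inputHead) (x.length + 1)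
      tape := fun i => Function.update (c.tape i) (c.head i) (r.2.2 i).1
      head := fun i => moveHead (r.2.2 i).2 (c.head i) }

/-- The initial configuration: all work tapes are blank, all heads are on cell `0`. -/
def init (M : TuringMachine) : M.Config where
  state := M.start
  inputHead := 0
  tape := fun _ _ => M.blank
  head := fun _ => 0

/-- The configuration of `M` on input `x` after `n` steps. -/
def run (M : TuringMachine) (x : List Bool) (n : ℕ) : M.Config :=
  (M.step x)^[n] M.init

/-- `M` decides `Q`: on every binary string it halts, and it accepts exactly the strings in `Q`. -/
def Decides (M : TuringMachine) (Q : Set (List Bool)) : Prop :=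
  ∀ x : List Bool, ∃ (n : ℕ) (b : Bool), M.halt (M.run x n).state = some b ∧ (b = true ↔ x ∈ Q)

/-- The work tape cells visited by `M` on input `x`. -/
def visitedCells (M : TuringMachine) (x : List Bool) : Set (Fin M.numTapes × ℕ) :=
  {c | ∃ n : ℕ, (M.run x n).head c.1 = c.2}

/-- On input `x` the machine `M` visits at most `S` work tape cells. -/
def RunsInSpace (M : TuringMachine) (x : List Bool) (S : ℝ) : Prop :=
  (M.visitedCells x).Finite ∧ ((M.visitedCells x).ncard : ℝ) ≤ S

end TuringMachine

/-! ### Structures and formulas -/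

/-- A finite vocabulary of relation symbols (with arities, possibly `0`) and constants. -/
structure Vocabulary where
  numConsts : ℕ
  numRels : ℕ
  arity : Fin numRels → ℕ

/-- A finite structure with nonempty universe `{0, …, card - 1}`. -/
structure FinStructure (τ : Vocabulary) where
  card : ℕ
  card_pos : 0 < card
  const : Fin τ.numConsts → Fin card
  rel : (i : Fin τ.numRels) → Finset (Fin (τ.arity i) → Fin card)

/-- The size `|𝐀| = |τ| + |A| + ∑_R |R^𝐀| · ar(R) + ∑_c |A|^0`. -/
def FinStructure.size {τ : Vocabulary} (A : FinStructure τ) : ℕ :=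
  (τ.numRels + τ.numConsts) + A.card + ∑ i, (A.rel i).card * τ.arity i +
    ∑ _c : Fin τ.numConsts, A.card ^ 0

/-- A term: a variable or a constant. -/
inductive Term (τ : Vocabulary)
  | var (x : ℕ)
  | const (c : Fin τ.numConsts)

/-- First-order formulas with named variables. -/
inductive Formula (τ : Vocabulary)
  | equal (t u : Term τ)
  | rel (i : Fin τ.numRels) (ts : Fin (τ.arity i) → Term τ)
  | neg (φ : Formula τ)
  | and (φ ψ : Formula τ)
  | or (φ ψ : Formula τ)
  | ex (x : ℕ) (φ : Formula τ)
  | all (x : ℕ) (φ : Formula τ)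

/-- The variables of a term. -/
def Term.vars {τ : Vocabulary} : Term τ → Finset ℕ
  | .var x => {x}
  | .const _ => ∅

/-- The value of a term under an assignment. -/
def Term.value {τ : Vocabulary} (A : FinStructure τ) (v : ℕ → Fin A.card) : Term τ → Fin A.card
  | .var x => v x
  | .const c => A.const c

namespace Formula

variable {τ : Vocabulary}

/-- All variables, free or bound. -/
def vars : Formula τ → Finset ℕ
  | equal t u => t.vars ∪ u.vars
  | rel _ ts => Finset.univ.biUnion fun j => (ts j).vars
  | neg φ => φ.vars
  | and φ ψ => φ.vars ∪ ψ.vars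
  | or φ ψ => φ.vars ∪ ψ.vars
  | ex x φ => insert x φ.vars
  | all x φ => insert x φ.vars

/-- The free variables. -/
def freeVars : Formula τ → Finset ℕ
  | equal t u => t.vars ∪ u.vars
  | rel _ ts => Finset.univ.biUnion fun j => (ts j).vars
  | neg φ => φ.freeVars
  | and φ ψ => φ.freeVars ∪ ψ.freeVars
  | or φ ψ => φ.freeVars ∪ ψ.freeVars
  | ex x φ => φ.freeVars.erase x
  | all x φ => φ.freeVars.erase x

/-- A sentence is a formula without free variables. -/
def IsSentence (φ : Formula τ) : Prop := φ.freeVars = ∅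

/-- The number `‖φ‖` of nodes of the syntax tree. -/
def nodes : Formula τ → ℕ
  | equal _ _ => 1
  | rel _ _ => 1
  | neg φ => 1 + φ.nodes
  | and φ ψ => 1 + φ.nodes + ψ.nodes
  | or φ ψ => 1 + φ.nodes + ψ.nodes
  | ex _ φ => 1 + φ.nodes
  | all _ φ => 1 + φ.nodes

/-- The width `w(φ)`: the maximal number of free variables of a subformula. -/
def width : Formula τ → ℕ
  | equal t u => (equal t u).freeVars.card
  | rel i ts => (rel i ts).freeVars.card
  | neg φ => max (neg φ).freeVars.card φ.width
  | and φ ψ => max (and φ ψ).freeVars.card (max φ.width ψ.width)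
  | or φ ψ => max (or φ ψ).freeVars.card (max φ.width ψ.width)
  | ex x φ => max (ex x φ).freeVars.card φ.width
  | all x φ => max (all x φ).freeVars.card φ.width

/-- Satisfaction under an assignment. -/
def Realize (A : FinStructure τ) : Formula τ → (ℕ → Fin A.card) → Prop
  | equal t u, v => t.value A v = u.value A v
  | rel i ts, v => (fun j => (ts j).value A v) ∈ A.rel i
  | neg φ, v => ¬ φ.Realize A v
  | and φ ψ, v => φ.Realize A v ∧ ψ.Realize A v
  | or φ ψ, v => φ.Realize A v ∨ ψ.Realize A v
  | ex x φ, v => ∃ a, φ.Realize A (Function.update v x a)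
  | all x φ, v => ∀ a, φ.Realize A (Function.update v x a)

/-- `𝐀 ⊨ φ`, used for sentences `φ` (for which the assignment is irrelevant). -/
def Holds (φ : Formula τ) (A : FinStructure τ) : Prop :=
  ∀ v : ℕ → Fin A.card, φ.Realize A v

/-- Quantifier-free formulas. -/
def QuantifierFree : Formula τ → Prop
  | equal _ _ => True
  | rel _ _ => True
  | neg φ => φ.QuantifierFree
  | and φ ψ => φ.QuantifierFree ∧ ψ.QuantifierFree
  | or φ ψ => φ.QuantifierFree ∧ ψ.QuantifierFree
  | ex _ _ => False
  | all _ _ => False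

end Formula

/-- The two kinds of prefix classes. -/
inductive Polarity
  | sigma
  | pi

/-- The opposite kind. -/
def Polarity.dual : Polarity → Polarity
  | .sigma => .pi
  | .pi => .sigma

/-- `InLevel .sigma t φ` is `φ ∈ Σ_t` and `InLevel .pi t φ` is `φ ∈ Π_t`: level `0` consists of
the quantifier-free formulas, and `Σ_{t+1}` (`Π_{t+1}`) is the closure of `Π_t` (`Σ_t`) under
conjunction, disjunction and existential (universal) quantification. -/
inductive InLevel {τ : Vocabulary} : Polarity → ℕ → Formula τ → Prop
  | base {p : Polarity} {φ : Formula τ} (h : φ.QuantifierFree) : InLevel p 0 φ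
  | incl {p : Polarity} {t : ℕ} {φ : Formula τ} (h : InLevel p.dual t φ) : InLevel p (t + 1) φ
  | and {p : Polarity} {t : ℕ} {φ ψ : Formula τ} (h₁ : InLevel p (t + 1) φ)
      (h₂ : InLevel p (t + 1) ψ) : InLevel p (t + 1) (.and φ ψ)
  | or {p : Polarity} {t : ℕ} {φ ψ : Formula τ} (h₁ : InLevel p (t + 1) φ)
      (h₂ : InLevel p (t + 1) ψ) : InLevel p (t + 1) (.or φ ψ)
  | ex {t : ℕ} {x : ℕ} {φ : Formula τ} (h : InLevel .sigma (t + 1) φ) :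
      InLevel .sigma (t + 1) (.ex x φ)
  | all {t : ℕ} {x : ℕ} {φ : Formula τ} (h : InLevel .pi (t + 1) φ) :
      InLevel .pi (t + 1) (.all x φ)

/-- A class of formulas (over varying vocabularies). -/
abbrev FormulaClass := (τ : Vocabulary) → Set (Formula τ)

/-- `Σ_t`, over vocabularies of relation symbols and constants. -/
def SigmaClass (t : ℕ) : FormulaClass := fun _ => {φ | InLevel .sigma t φ}

/-- `FO^s`: formulas over a relational vocabulary with at most `s` variables, free or bound. -/
def FOClass (s : ℕ) : FormulaClass := fun τ => {φ | τ.numConsts = 0 ∧ φ.vars.card ≤ s}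

/-- `Σ_t^s = FO^s ∩ Σ_t`. -/
def BoundedSigmaClass (s t : ℕ) : FormulaClass := fun τ => FOClass s τ ∩ SigmaClass t τ

/-! ### Binary encodings -/

/-- The letters used to write formulas and structures. -/
inductive Letter
  | zero
  | one
  | var
  | con
  | rel
  | equal
  | neg
  | and
  | or
  | ex
  | all
  | univ
  | tup
  | elt
  | sep

/-- Each letter is written as a block of four bits. -/
def Letter.toBits : Letter → List Bool
  | .zero  => [false, false, false, false]
  | .one   => [false, false, false, true]
  | .var   => [false, false, true, false]
  | .con   => [false, false, true, true]
  | .rel   => [false, true, false, false]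
  | .equal => [false, true, false, true]
  | .neg   => [false, true, true, false]
  | .and   => [false, true, true, true]
  | .or    => [true, false, false, false]
  | .ex    => [true, false, false, true]
  | .all   => [true, false, true, false]
  | .univ  => [true, false, true, true]
  | .tup   => [true, true, false, false]
  | .elt   => [true, true, false, true]
  | .sep   => [true, true, true, false]

/-- The binary string of a word of letters. -/
def toBinary (w : List Letter) : List Bool := w.flatMap Letter.toBits

/-- A natural number in binary, least significant digit first. -/
def writeNat (n : ℕ) : List Letter := n.bits.map fun b => if b then .one else .zero

/-- A term: a letter for its kind, then its index in binary. -/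
def Term.write {τ : Vocabulary} : Term τ → List Letter
  | .var x => .var :: writeNat x
  | .const c => .con :: writeNat c

/-- A formula in Polish notation. -/
def Formula.write {τ : Vocabulary} : Formula τ → List Letter
  | .equal t u => .equal :: (t.write ++ u.write)
  | .rel i ts => .rel :: (writeNat i ++ (List.finRange (τ.arity i)).flatMap fun j => (ts j).write)
  | .neg φ => .neg :: φ.write
  | .and φ ψ => .and :: (φ.write ++ ψ.write)
  | .or φ ψ => .or :: (φ.write ++ ψ.write)
  | .ex x φ => .ex :: (writeNat x ++ φ.write)
  | .all x φ => .all :: (writeNat x ++ φ.write)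

/-- All `r`-tuples over `{0, …, n - 1}` in lexicographic order. -/
def allTuples (n : ℕ) : (r : ℕ) → List (Fin r → Fin n)
  | 0 => [Fin.elim0]
  | r + 1 => (List.finRange n).flatMap fun a => (allTuples n r).map fun t => Fin.cons a t

/-- A tuple, as the sequence of its components in binary. -/
def writeTuple {n r : ℕ} (t : Fin r → Fin n) : List Letter :=
  .tup :: (List.finRange r).flatMap fun j => .elt :: writeNat (t j)

/-- A structure (sparse encoding): the size of the universe, the values of the constants, for every
relation symbol the list of the tuples in its interpretation in lexicographic order, and finally
the arities of the relation symbols in unary. -/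
def FinStructure.write {τ : Vocabulary} (A : FinStructure τ) : List Letter :=
  .univ :: (writeNat A.card ++
    ((List.finRange τ.numConsts).flatMap fun c => .con :: writeNat (A.const c)) ++
    ((List.finRange τ.numRels).flatMap fun i =>
      .rel :: ((allTuples A.card (τ.arity i)).filter fun t => decide (t ∈ A.rel i)).flatMap
        writeTuple) ++
    .sep :: (List.finRange τ.numRels).flatMap fun i => .rel :: List.replicate (τ.arity i) .one)

/-- The size `|φ|`: the length of the binary encoding of `φ`. -/
def Formula.size {τ : Vocabulary} (φ : Formula τ) : ℕ := (toBinary φ.write).length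

/-- The binary string that encodes the pair `(φ, 𝐀)`. -/
def encodePair {τ : Vocabulary} (φ : Formula τ) (A : FinStructure τ) : List Bool :=
  toBinary (φ.write ++ .sep :: A.write)

/-- The model-checking problem `mc(Φ)`: the set of binary strings that encode a pair `(φ, 𝐀)` of a
sentence `φ ∈ Φ` and a structure `𝐀` of its vocabulary with `𝐀 ⊨ φ`. -/
def mc (Φ : FormulaClass) : Set (List Bool) :=
  {x | ∃ (τ : Vocabulary) (φ : Formula τ) (A : FinStructure τ),
    x = encodePair φ A ∧ φ.IsSentence ∧ φ ∈ Φ τ ∧ φ.Holds A}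

end ModelChecking

/-! All computations take place in space $O(\log N)$ for one number $N$ that bounds the number of
tokens of the formula and of the structure, the lengths of the variable indices, the universe, and
the duration of a search. The theorem then amounts to exhibiting such an $N$ with small logarithm.

The search evaluates a two-player game. Plain recursion on the formula would keep up to
$\|\varphi\|$ assignments at a time, while only about $\log\|\varphi\|$ of them fit. The remedy is
to balance the syntax tree, as one does for Boolean formulas. A claim speaks about the subformula at
a position $u$ in which the subformula at $v$ is replaced by a hole (`Formula.Ev`); the hole is
filled either with falsity or with the requirement that the free variables have prescribed values.
To prove a claim a player chooses a node $c$ below $u$ and an assignment at $c$. What remains to be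
shown is the claim about $u$ with its hole at $c$, filled with this assignment, and claims about
immediate subformulas of $c$ with the old hole at $v$. The opponent challenges one of them. A single
assignment at $c$ is enough because, as long as no quantifier above $c$ is universal for the player,
the evaluation reaches $c$ under essentially one assignment (`ev_linear`). The node $c$ is chosen by
`Game.exists_focus` so that the measure `rank` decreases; two units of it correspond to halving the
number of nodes.

When a claim starts with a quantifier of the wrong kind, its negation is handed to the opponent as a
claim of the next lower level. Levels run from $t$ down to $0$, so the game lasts
$O((t+1)(1+\log\|\varphi\|))$ moves (`Game.win_iff`). A position consists of twelve numbers below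
$M$, where $M$ exceeds $t+3$, the number of tokens of $\varphi$ and every $|A|^f$ for the number $f$
of free variables of a subformula. Depth-first search keeps the current path as one number in base
$M^{12}$ and stops after at most $(M^{12}+3)^{\mathrm{depth}+1}$ steps (`search_eq`). With $N$ of
this order, up to the size of the input, $\log N$ is
$O\big((1+\log\|\varphi\|)(1+\log|\varphi|+w(\varphi)\log|A|)+\log|\mathbf A|\big)$
(`log_search_le`). In the first part $w(\varphi)\le s$ and $\|\varphi\|\le|\varphi|$, which gives
the bound there.

The number $N$ is not given: the machine tries $N=0,1,2,\dots$ until the test `ready` succeeds. The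
answer is correct for every $N$ that passes (`accepts_iff`), hence for the space bound it suffices
that some small $N$ passes. One case of the second part is delicate: if $\|\varphi\|=1$, then
$\log\|\varphi\|=0$ and only $O(\log|\mathbf A|)$ cells are available. Then $\varphi$ is atomic
without variables, and its length is bounded in terms of $|\mathbf A|$ unless its relation is empty,
in which case it is rejected without being read (`emptyAtom`).

On the side of the machine model, small programs over stacks of bits are compiled to Turing machines
(`Prog.simulate`). The predicate `LS` singles out functions that such programs compute in space
linear in the length of their arguments; it is closed under composition, pairing, case distinction
and bounded iteration. Since time is irrelevant, arithmetic can be done by counting, and the whole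
algorithm is shown to lie in `LS` by closure properties. -/

namespace ModelChecking

open TuringMachine

/-! ### A structured programming language over stacks of bits -/

/-- The tests of the programming language. -/
inductive Test
  | nonempty (r : ℕ)
  | topTrue (r : ℕ)
  | topFalse (r : ℕ)
  | notLeft
  | notRight
  | bitTrue

/-- The value of a test, as a function of the scanned input symbol and of the tops of the
registers. -/
def Test.holds (s : InputSymbol) (top : ℕ → Option Bool) : Test → Bool
  | .nonempty r => (top r).isSome
  | .topTrue r => top r == some true
  | .topFalse r => top r == some false
  | .notLeft => match s with
    | .leftEnd => false
    | _ => true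
  | .notRight => match s with
    | .rightEnd => false
    | _ => true
  | .bitTrue => match s with
    | .bit b => b
    | _ => false

/-- Programs over registers that hold stacks of bits, with a two-way read-only input. The
constructor `write` only occurs as the second half of a `push`. -/
inductive Prog
  | halt (b : Bool)
  | push (r : ℕ) (b : Bool)
  | write (r : ℕ) (b : Bool)
  | pop (r : ℕ)
  | left
  | right
  | seq (p q : Prog)
  | ite (t : Test) (p q : Prog)
  | loop (t : Test) (p : Prog)

/-- The contents of the registers and the position of the input head. -/
@[ext] structure PState where
  regs : ℕ → List Bool
  head : ℕ

/-- The value of a test in a state. -/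
def Test.eval (x : List Bool) (σ : PState) (t : Test) : Bool :=
  t.holds (readInput x σ.head) fun r => (σ.regs r).head?

/-- Big-step semantics. Every push respects the bound `S` on the length of the registers. -/
inductive Exec (x : List Bool) (S : ℕ) : Prog → PState → PState → Prop
  | push {r : ℕ} {b : Bool} {σ : PState} (h : (σ.regs r).length < S) :
      Exec x S (.push r b) σ ⟨Function.update σ.regs r (b :: σ.regs r), σ.head⟩
  | pop {r : ℕ} {σ : PState} :
      Exec x S (.pop r) σ ⟨Function.update σ.regs r (σ.regs r).tail, σ.head⟩
  | left {σ : PState} : Exec x S .left σ ⟨σ.regs, min (σ.head - 1) (x.length + 1)⟩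
  | right {σ : PState} : Exec x S .right σ ⟨σ.regs, min (σ.head + 1) (x.length + 1)⟩
  | seq {p q : Prog} {σ σ' σ'' : PState} (h1 : Exec x S p σ σ') (h2 : Exec x S q σ' σ'') :
      Exec x S (.seq p q) σ σ''
  | iteT {t : Test} {p q : Prog} {σ σ' : PState} (ht : t.eval x σ = true)
      (h : Exec x S p σ σ') : Exec x S (.ite t p q) σ σ'
  | iteF {t : Test} {p q : Prog} {σ σ' : PState} (ht : t.eval x σ = false)
      (h : Exec x S q σ σ') : Exec x S (.ite t p q) σ σ'
  | loopT {t : Test} {p : Prog} {σ σ' σ'' : PState} (ht : t.eval x σ = true)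
      (h1 : Exec x S p σ σ') (h2 : Exec x S (.loop t p) σ' σ'') : Exec x S (.loop t p) σ σ''
  | loopF {t : Test} {p : Prog} {σ : PState} (ht : t.eval x σ = false) :
      Exec x S (.loop t p) σ σ

theorem Exec.mono {x : List Bool} {S S' : ℕ} (hS : S ≤ S') {p : Prog} {σ σ' : PState}
    (h : Exec x S p σ σ') : Exec x S' p σ σ' := by
  induction h with
  | push h => exact .push (h.trans_le hS)
  | pop => exact .pop
  | left => exact .left
  | right => exact .right
  | seq _ _ h1 h2 => exact .seq h1 h2
  | iteT ht _ h => exact .iteT ht h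
  | iteF ht _ h => exact .iteF ht h
  | loopT ht _ _ h1 h2 => exact .loopT ht h1 h2
  | loopF ht => exact .loopF ht

theorem Exec.length_le {x : List Bool} {S : ℕ} {p : Prog} {σ σ' : PState}
    (h : Exec x S p σ σ') (r : ℕ) : (σ'.regs r).length ≤ max (σ.regs r).length S := by
  induction h with
  | @push r' b σ h =>
    by_cases hr : r = r'
    · subst hr; simp; omega
    · simp [hr]
  | @pop r' σ =>
    by_cases hr : r = r'
    · subst hr; simp
    · simp [hr]
  | left => simp
  | right => simp
  | seq _ _ h1 h2 => omega
  | iteT _ _ h => exact h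
  | iteF _ _ h => exact h
  | loopT _ _ _ h1 h2 => omega
  | loopF _ => simp

/-- The register tested by a test is below `K`. -/
def Test.RegsBelow (K : ℕ) : Test → Prop
  | .nonempty r => r < K
  | .topTrue r => r < K
  | .topFalse r => r < K
  | _ => True

/-- All registers of a program are below `K`. -/
def Prog.RegsBelow (K : ℕ) : Prog → Prop
  | .push r _ => r < K
  | .write r _ => r < K
  | .pop r => r < K
  | .seq p q => p.RegsBelow K ∧ q.RegsBelow K
  | .ite t p q => t.RegsBelow K ∧ p.RegsBelow K ∧ q.RegsBelow K
  | .loop t p => t.RegsBelow K ∧ p.RegsBelow K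
  | _ => True

theorem Prog.RegsBelow.mono {K K' : ℕ} (hK : K ≤ K') {p : Prog} (h : p.RegsBelow K) :
    p.RegsBelow K' := by
  have ht : ∀ t : Test, t.RegsBelow K → t.RegsBelow K' := by
    intro t; cases t <;> simp [Test.RegsBelow] <;> omega
  induction p with
  | seq p q hp hq => exact ⟨hp h.1, hq h.2⟩
  | ite t p q hp hq => exact ⟨ht _ h.1, hp h.2.1, hq h.2.2⟩
  | loop t p hp => exact ⟨ht _ h.1, hp h.2⟩
  | _ => simp [Prog.RegsBelow] at * <;> omega

/-! ### Compilation to Turing machines -/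

namespace Prog

/-- The control states that occur when a program is executed with a given continuation. -/
def conts : Prog → List Prog → Set (List Prog)
  | .push r b, k => {.push r b :: k, .write r b :: k}
  | .seq p q, k => insert (.seq p q :: k) (conts p (q :: k) ∪ conts q k)
  | .ite t p q, k => insert (.ite t p q :: k) (conts p k ∪ conts q k)
  | .loop t p, k => insert (.loop t p :: k) (conts p (.loop t p :: k))
  | p, k => {p :: k}

/-- The next control state. -/
def next (s : InputSymbol) (top : ℕ → Option Bool) : List Prog → List Prog
  | [] => []
  | .push r b :: k => .write r b :: k
  | .seq p q :: k => p :: q :: k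
  | .ite t p q :: k => if t.holds s top then p :: k else q :: k
  | .loop t p :: k => if t.holds s top then p :: .loop t p :: k else k
  | _ :: k => k

/-- The continuation of the body of a loop is the loop itself. So no loop is ever unrolled, and each
constructor adds only finitely many control states. -/
theorem conts_finite (p : Prog) (k : List Prog) : (conts p k).Finite := by
  induction p generalizing k with
  | push => simp [conts]
  | seq p q hp hq => exact ((hp _).union (hq _)).insert _
  | ite t p q hp hq => exact ((hp _).union (hq _)).insert _
  | loop t p hp => exact (hp _).insert _
  | _ => simp [conts]

theorem cons_mem_conts (p : Prog) (k : List Prog) : p :: k ∈ conts p k := by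
  cases p <;> simp [conts]

/-- Control cannot escape from `conts p k` except by finishing `p` and arriving at `k`. With `k =
[]` this yields a transition function on a finite set of states. -/
theorem next_mem_conts (s : InputSymbol) (top : ℕ → Option Bool) (p : Prog) (k l : List Prog)
    (h : l ∈ conts p k) : next s top l ∈ conts p k ∨ next s top l = k := by
  induction p generalizing k l with
  | push r b =>
    simp only [conts, Set.mem_insert_iff, Set.mem_singleton_iff] at h
    rcases h with rfl | rfl <;> simp [next, conts]
  | seq p q hp hq =>
    simp only [conts, Set.mem_insert_iff, Set.mem_union] at h ⊢
    rcases h with rfl | h | h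
    · exact .inl (.inr (.inl (cons_mem_conts p _)))
    · rcases hp _ _ h with h | h
      · exact .inl (.inr (.inl h))
      · rw [h]; exact .inl (.inr (.inr (cons_mem_conts q _)))
    · rcases hq _ _ h with h | h
      · exact .inl (.inr (.inr h))
      · exact .inr h
  | ite t p q hp hq =>
    simp only [conts, Set.mem_insert_iff, Set.mem_union] at h ⊢
    rcases h with rfl | h | h
    · simp only [next]
      split
      · exact .inl (.inr (.inl (cons_mem_conts p _)))
      · exact .inl (.inr (.inr (cons_mem_conts q _)))
    · rcases hp _ _ h with h | h
      · exact .inl (.inr (.inl h))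
      · exact .inr h
    · rcases hq _ _ h with h | h
      · exact .inl (.inr (.inr h))
      · exact .inr h
  | loop t p hp =>
    simp only [conts, Set.mem_insert_iff] at h ⊢
    rcases h with rfl | h
    · simp only [next]
      split
      · exact .inl (.inr (cons_mem_conts p _))
      · exact .inr rfl
    · rcases hp _ _ h with h | h
      · exact .inl (.inr h)
      · exact .inl (.inl h)
  | _ =>
    simp only [conts, Set.mem_singleton_iff] at h
    subst h
    simp [next]

/-- The movement of the input head. -/
def inputMove : List Prog → Move
  | .left :: _ => .left
  | .right :: _ => .right
  | _ => .stay

/-- The action on tape `i`, on which the symbol `a` is scanned. -/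
def tapeAction (i : ℕ) (a : Option Bool) : List Prog → Option Bool × Move
  | .push r _ :: _ => (a, if i = r then .right else .stay)
  | .write r b :: _ => (if i = r then some b else a, .stay)
  | .pop r :: _ => (a, if i = r then .left else .stay)
  | _ => (a, .stay)

/-- The decision made in a control state, if it is a halting one. -/
def verdict : List Prog → Option Bool
  | [] => some false
  | .halt b :: _ => some b
  | _ => none

/-- The Turing machine that executes a program, with one tape for each register below `K`. -/
def toTM (P : Prog) (K : ℕ) : TuringMachine where
  State := {l // l ∈ conts P [] ∨ l = []}
  Symbol := Option Bool
  finiteState := ((conts_finite P []).union (Set.finite_singleton [])).to_subtype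
  finiteSymbol := inferInstance
  numTapes := K
  start := ⟨[P], .inl (cons_mem_conts P [])⟩
  blank := none
  halt := fun l => verdict l.1
  transition := fun l s a =>
    (⟨next s (fun r => if h : r < K then a ⟨r, h⟩ else none) l.1, by
      obtain ⟨l, hl | rfl⟩ := l
      · exact next_mem_conts _ _ _ _ _ hl
      · exact .inr rfl⟩,
      inputMove l.1, fun i => tapeAction i (a i) l.1)

/-- A configuration of the machine that executes a program. -/
structure Cfg (K : ℕ) where
  control : List Prog
  input : ℕ
  tape : Fin K → ℕ → Option Bool
  head : Fin K → ℕ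

/-- The tops of the stacks in a configuration. -/
def Cfg.top {K : ℕ} (c : Cfg K) (r : ℕ) : Option Bool :=
  if h : r < K then c.tape ⟨r, h⟩ (c.head ⟨r, h⟩) else none

/-- One step of the machine that executes a program. -/
def Cfg.step {K : ℕ} (x : List Bool) (c : Cfg K) : Cfg K :=
  match verdict c.control with
  | some _ => c
  | none =>
    { control := next (readInput x c.input) c.top c.control
      input := min (moveHead (inputMove c.control) c.input) (x.length + 1)
      tape := fun i => Function.update (c.tape i) (c.head i)
        (tapeAction i (c.tape i (c.head i)) c.control).1
      head := fun i => moveHead (tapeAction i (c.tape i (c.head i)) c.control).2 (c.head i) }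

/-- The configuration of the program in a configuration of its Turing machine. -/
def ofConfig {P : Prog} {K : ℕ} (c : (P.toTM K).Config) : Cfg K :=
  ⟨c.state.1, c.inputHead, c.tape, c.head⟩

/-- States of the machine carry a membership proof. Dropping it turns runs into iterations of
`Cfg.step`, whose controls are plain lists. -/
theorem ofConfig_step {P : Prog} {K : ℕ} (x : List Bool) (c : (P.toTM K).Config) :
    ofConfig ((P.toTM K).step x c) = (ofConfig c).step x := by
  have h : (P.toTM K).halt c.state = verdict (ofConfig c).control := rfl
  unfold TuringMachine.step Cfg.step
  rw [h]
  cases verdict (ofConfig c).control <;> rfl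

theorem ofConfig_run (P : Prog) (K : ℕ) (x : List Bool) (n : ℕ) :
    ofConfig ((P.toTM K).run x n) = (Cfg.step x)^[n] ⟨[P], 0, fun _ _ => none, fun _ => 0⟩ := by
  induction n with
  | zero => rfl
  | succ n ih =>
    unfold TuringMachine.run at *
    rw [Function.iterate_succ_apply', Function.iterate_succ_apply', ofConfig_step, ih]

/-- The cells `1, …, |s|` of a tape hold the stack `s`, its top last; cell `0` is blank. -/
def TapeRep (t : ℕ → Option Bool) : List Bool → Prop
  | [] => t 0 = none
  | b :: s => t (s.length + 1) = some b ∧ TapeRep t s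

theorem TapeRep.apply_length {t : ℕ → Option Bool} {s : List Bool} (h : TapeRep t s) :
    t s.length = s.head? := by
  cases s with
  | nil => exact h
  | cons b s => exact h.1

theorem TapeRep.tail {t : ℕ → Option Bool} {s : List Bool} (h : TapeRep t s) :
    TapeRep t s.tail := by
  cases s with
  | nil => exact h
  | cons b s => exact h.2

/-- Cells above the top of a stack are unconstrained. Hence `pop` may leave its symbol behind and
merely move the head, and a later `push` overwrites it. -/
theorem TapeRep.update {t : ℕ → Option Bool} {s : List Bool} (h : TapeRep t s) {n : ℕ}
    (hn : s.length < n) (a : Option Bool) : TapeRep (Function.update t n a) s := by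
  induction s with
  | nil => simp only [TapeRep] at *; rw [Function.update_of_ne (by simp at hn; omega)]; exact h
  | cons b s ih =>
    simp only [List.length_cons] at hn
    refine ⟨?_, ih h.2 (by omega)⟩
    rw [Function.update_of_ne (by omega)]; exact h.1

variable {K : ℕ}

/-- The configuration `c` represents the state `σ` with control `l`. -/
structure Rep (c : Cfg K) (l : List Prog) (σ : PState) : Prop where
  control : c.control = l
  input : c.input = σ.head
  head : ∀ i : Fin K, c.head i = (σ.regs i).length
  tape : ∀ i : Fin K, TapeRep (c.tape i) (σ.regs i)

theorem Rep.top_eq {c : Cfg K} {l : List Prog} {σ : PState} (h : Rep c l σ) {r : ℕ}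
    (hr : r < K) : c.top r = (σ.regs r).head? := by
  unfold Cfg.top
  rw [dif_pos hr, h.head]
  exact (h.tape ⟨r, hr⟩).apply_length

theorem Rep.holds_eq {c : Cfg K} {l : List Prog} {σ : PState} (h : Rep c l σ)
    (x : List Bool) {t : Test} (ht : t.RegsBelow K) :
    t.holds (readInput x c.input) c.top = t.eval x σ := by
  unfold Test.eval
  rw [h.input]
  cases t with
  | nonempty r => simp [Test.holds, h.top_eq ht]
  | topTrue r => simp [Test.holds, h.top_eq ht]
  | topFalse r => simp [Test.holds, h.top_eq ht]
  | _ => rfl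

/-- Several steps, during which no work head moves beyond cell `S`. -/
def Reaches (x : List Bool) (S : ℕ) (c c' : Cfg K) : Prop :=
  ∃ n, (Cfg.step x)^[n] c = c' ∧ ∀ m ≤ n, ∀ i, ((Cfg.step x)^[m] c).head i ≤ S

theorem Reaches.trans {x : List Bool} {S : ℕ} {c1 c2 c3 : Cfg K}
    (h1 : Reaches x S c1 c2) (h2 : Reaches x S c2 c3) : Reaches x S c1 c3 := by
  obtain ⟨n, rfl, hn⟩ := h1
  obtain ⟨m, rfl, hm⟩ := h2
  refine ⟨m + n, by rw [Function.iterate_add_apply], fun k hk i => ?_⟩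
  rcases le_total k n with h | h
  · exact hn k h i
  · obtain ⟨j, rfl⟩ := Nat.exists_eq_add_of_le' h
    rw [Function.iterate_add_apply]
    exact hm j (by omega) i

theorem Reaches.single {x : List Bool} {S : ℕ} {c : Cfg K}
    (h : ∀ i, c.head i ≤ S) (h' : ∀ i, (c.step x).head i ≤ S) : Reaches x S c (c.step x) := by
  refine ⟨1, rfl, fun m hm i => ?_⟩
  interval_cases m
  · exact h i
  · exact h' i

theorem Rep.step_eq {c : Cfg K} {l : List Prog} {σ : PState} (h : Rep c l σ) (x : List Bool)
    (hl : verdict l = none) : c.step x =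
    { control := next (readInput x c.input) c.top l
      input := min (moveHead (inputMove l) σ.head) (x.length + 1)
      tape := fun i => Function.update (c.tape i) (c.head i)
        (tapeAction i (c.tape i (c.head i)) l).1
      head := fun i => moveHead (tapeAction i (c.tape i (c.head i)) l).2 (c.head i) } := by
  unfold Cfg.step
  rw [h.control, hl, h.input]

/-- A step that leaves the work tapes unchanged. -/
theorem Rep.control_step {c : Cfg K} {l : List Prog} {σ : PState} (h : Rep c l σ)
    {x : List Bool} {S : ℕ} (hS : ∀ i : Fin K, (σ.regs i).length ≤ S) (hl : verdict l = none)
    (ha : ∀ i a, tapeAction i a l = (a, .stay)) :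
    Reaches x S c (c.step x) ∧ Rep (c.step x) (next (readInput x c.input) c.top l)
      ⟨σ.regs, min (moveHead (inputMove l) σ.head) (x.length + 1)⟩ := by
  have e := h.step_eq x hl
  simp only [ha, Function.update_eq_self] at e
  refine ⟨.single (fun i => by rw [h.head]; exact hS i)
    fun i => by rw [e]; exact (h.head i).trans_le (hS i), ?_⟩
  rw [e]
  exact ⟨rfl, rfl, h.head, h.tape⟩

/-- Induction on the derivation of the big-step semantics: termination is already contained in the
derivation. A head stands on the cell whose number is the length of its stack, so the bound on
pushes becomes a bound on the cells visited. -/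
theorem simulate {x : List Bool} {S : ℕ} {p : Prog} {σ σ' : PState} (h : Exec x S p σ σ')
    (hp : p.RegsBelow K) (k : List Prog) (c : Cfg K) (hc : Rep c (p :: k) σ)
    (hh : σ.head ≤ x.length + 1) (hS : ∀ i : Fin K, (σ.regs i).length ≤ S) :
    ∃ c', Reaches x S c c' ∧ Rep c' k σ' ∧ σ'.head ≤ x.length + 1 ∧
      ∀ i : Fin K, (σ'.regs i).length ≤ S := by
  induction h generalizing k c with
  | @push r b σ h =>
    have e := hc.step_eq x rfl
    simp only [tapeAction, Function.update_eq_self, next, inputMove, moveHead,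
      min_eq_left hh] at e
    -- A push takes two machine steps: first the head moves right and the scanned symbol is kept,
    -- then the bit is written.
    set c1 := c.step x
    have e1 : ∀ i : Fin K, c1.head i = if i = r then (σ.regs i).length + 1
        else (σ.regs i).length := by
      intro i
      rw [e]
      by_cases hi : (i : ℕ) = r <;> simp [hi, hc.head]
    have b1 : ∀ i, c1.head i ≤ S := by
      intro i
      rw [e1]
      split
      · rename_i hi; rw [hi]; omega
      · exact hS i
    have e' : c1.step x = ⟨k, σ.head, fun i => Function.update (c.tape i) (c1.head i)
        (if i = r then some b else c.tape i (c1.head i)), c1.head⟩ := by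
      rw [Cfg.step, e]
      simp [verdict, next, inputMove, moveHead, tapeAction, hh]
    refine ⟨c1.step x, .trans (.single (fun i => by rw [hc.head]; exact hS i) b1)
      (.single b1 fun i => by rw [e']; exact b1 i), ?_, hh, ?_⟩
    · rw [e']
      refine ⟨rfl, rfl, fun i => ?_, fun i => ?_⟩
      · by_cases hi : (i : ℕ) = r <;> simp [hi, e1]
      · simp only [e1]
        by_cases hi : (i : ℕ) = r
        · simp only [hi, if_true, Function.update_self]
          refine ⟨by simp, ?_⟩
          have := hc.tape i
          rw [hi] at this
          exact this.update (by omega) _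
        · simpa [hi] using hc.tape i
    · intro i
      by_cases hi : (i : ℕ) = r
      · simp only [hi, Function.update_self, List.length_cons]; omega
      · simp only [Function.update_of_ne hi]; exact hS i
  | @pop r σ =>
    have e := hc.step_eq x rfl
    simp only [tapeAction, Function.update_eq_self, next, inputMove, moveHead,
      min_eq_left hh] at e
    have e1 : ∀ i : Fin K, (c.step x).head i =
        (Function.update σ.regs r (σ.regs r).tail i).length := by
      intro i
      rw [e]
      by_cases hi : (i : ℕ) = r <;> simp [hi, hc.head]
    have e2 : ∀ i : Fin K, (Function.update σ.regs r (σ.regs r).tail i).length ≤ S := by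
      intro i
      by_cases hi : (i : ℕ) = r
      · have := hS i
        simp only [hi, Function.update_self, List.length_tail] at this ⊢; omega
      · simp only [Function.update_of_ne hi]; exact hS i
    refine ⟨_, .single (fun i => by rw [hc.head]; exact hS i) (fun i => by rw [e1]; exact e2 i),
      ⟨by rw [e], by rw [e], e1, fun i => ?_⟩, hh, e2⟩
    rw [e]
    by_cases hi : (i : ℕ) = r
    · have := (hc.tape i).tail
      simpa [hi] using this
    · simpa [hi] using hc.tape i
  | @left σ =>
    obtain ⟨h1, h2⟩ := hc.control_step (x := x) hS rfl (by simp [tapeAction])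
    exact ⟨_, h1, h2, min_le_right _ _, hS⟩
  | @right σ =>
    obtain ⟨h1, h2⟩ := hc.control_step (x := x) hS rfl (by simp [tapeAction])
    exact ⟨_, h1, h2, min_le_right _ _, hS⟩
  | @seq p q σ σ' σ'' _ _ ih1 ih2 =>
    obtain ⟨h1, h2⟩ := hc.control_step (x := x) hS rfl (by simp [tapeAction])
    simp only [next, inputMove, moveHead, min_eq_left hh] at h2
    obtain ⟨c1, r1, e1, hh1, hS1⟩ := ih1 hp.1 _ _ h2 hh hS
    obtain ⟨c2, r2, e2, hh2, hS2⟩ := ih2 hp.2 _ _ e1 hh1 hS1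
    exact ⟨c2, h1.trans (r1.trans r2), e2, hh2, hS2⟩
  | @iteT t p q σ σ' ht _ ih =>
    obtain ⟨h1, h2⟩ := hc.control_step (x := x) hS rfl (by simp [tapeAction])
    simp only [next, inputMove, moveHead, min_eq_left hh, hc.holds_eq x hp.1, ht, if_true] at h2
    obtain ⟨c1, r1, e1⟩ := ih hp.2.1 _ _ h2 hh hS
    exact ⟨c1, h1.trans r1, e1⟩
  | @iteF t p q σ σ' ht _ ih =>
    obtain ⟨h1, h2⟩ := hc.control_step (x := x) hS rfl (by simp [tapeAction])
    simp only [next, inputMove, moveHead, min_eq_left hh, hc.holds_eq x hp.1, ht] at h2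
    obtain ⟨c1, r1, e1⟩ := ih hp.2.2 _ _ h2 hh hS
    exact ⟨c1, h1.trans r1, e1⟩
  | @loopT t p σ σ' σ'' ht _ _ ih1 ih2 =>
    obtain ⟨h1, h2⟩ := hc.control_step (x := x) hS rfl (by simp [tapeAction])
    simp only [next, inputMove, moveHead, min_eq_left hh, hc.holds_eq x hp.1, ht, if_true] at h2
    obtain ⟨c1, r1, e1, hh1, hS1⟩ := ih1 hp.2 _ _ h2 hh hS
    obtain ⟨c2, r2, e2⟩ := ih2 hp _ _ e1 hh1 hS1
    exact ⟨c2, h1.trans (r1.trans r2), e2⟩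
  | @loopF t p σ ht =>
    obtain ⟨h1, h2⟩ := hc.control_step (x := x) hS rfl (by simp [tapeAction])
    simp only [next, inputMove, moveHead, min_eq_left hh, hc.holds_eq x hp.1, ht] at h2
    exact ⟨_, h1, h2, hh, hS⟩

/-- Run `P`, then accept if and only if register `0` is nonempty. -/
def decider (P : Prog) : Prog := .seq P (.ite (.nonempty 0) (.halt true) (.halt false))

/-- Each of the `K` heads stays on the cells `0, …, S`, whence the bound `K * (S + 1)`. -/
theorem decider_spec {P : Prog} {K : ℕ} (hP : P.RegsBelow K) (hK : 0 < K) {x : List Bool}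
    {S : ℕ} {σ : PState} (h : Exec x S P ⟨fun _ => [], 0⟩ σ) :
    (∃ n, (P.decider.toTM K).halt ((P.decider.toTM K).run x n).state =
      some (!(σ.regs 0).isEmpty)) ∧
    (P.decider.toTM K).RunsInSpace x ((K * (S + 1) : ℕ) : ℝ) := by
  set c0 : Cfg K := ⟨[P.decider], 0, fun _ _ => none, fun _ => 0⟩
  have h0 : Rep c0 [P.decider] ⟨fun _ => [], 0⟩ := ⟨rfl, rfl, fun _ => rfl, fun _ => rfl⟩
  obtain ⟨r1, e1⟩ := h0.control_step (x := x) (S := S) (fun i => Nat.zero_le _) rfl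
    (by simp [tapeAction, decider])
  obtain ⟨c2, r2, e2, hh2, hS2⟩ := simulate h hP _ _ e1 (Nat.zero_le _) (fun i => Nat.zero_le _)
  obtain ⟨r3, e3⟩ := e2.control_step (x := x) hS2 rfl (by simp [tapeAction])
  simp only [next, e2.holds_eq x (t := .nonempty 0) hK] at e3
  set c3 := c2.step x with hc3
  have hc3h : verdict c3.control = some (!(σ.regs 0).isEmpty) := by
    rw [e3.control]
    have h1 : ∀ b : Bool, verdict (if b = true then [halt true] else [halt false]) = some b := by
      intro b; cases b <;> rfl
    have h2 : ∀ s : List Bool, s.head?.isSome = !s.isEmpty := by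
      intro s; cases s <;> rfl
    rw [h1]
    exact congrArg some (h2 _)
  obtain ⟨n, hn, hnS⟩ := (r1.trans r2).trans r3
  have hfix : c3.step x = c3 := by
    rw [Cfg.step, hc3h]
  refine ⟨⟨n, ?_⟩, ?_⟩
  · have := ofConfig_run P.decider K x n
    rw [hn] at this
    have h' : (P.decider.toTM K).halt ((P.decider.toTM K).run x n).state =
      verdict (ofConfig ((P.decider.toTM K).run x n)).control := rfl
    rw [h', this, hc3h]
  -- The cells visited are collected over all times. After the halting step `n` the configuration is
  -- fixed, so the bound up to time `n` is enough.
  have hall : ∀ m i, ((Cfg.step x)^[m] c0).head i ≤ S := by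
    intro m i
    rcases le_total m n with hm | hm
    · exact hnS m hm i
    · obtain ⟨j, rfl⟩ := Nat.exists_eq_add_of_le' hm
      rw [Function.iterate_add_apply, hn, Function.iterate_fixed hfix]
      have := hnS n le_rfl i
      rwa [hn] at this
  have hsub : (P.decider.toTM K).visitedCells x ⊆
      (((Finset.univ : Finset (Fin K)) ×ˢ Finset.range (S + 1) : Finset (Fin K × ℕ)) :
        Set (Fin K × ℕ)) := by
    rintro ⟨i, p⟩ ⟨m, hm⟩
    have h1 := hall m i
    rw [← ofConfig_run] at h1
    have h2 : p ≤ S := le_of_eq_of_le hm.symm h1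
    have h3 : p < S + 1 := by omega
    exact Finset.mem_coe.2 (Finset.mem_product.2 ⟨Finset.mem_univ _, Finset.mem_range.2 h3⟩)
  refine ⟨(Finset.finite_toSet _).subset hsub, ?_⟩
  have h1 := Set.ncard_le_ncard hsub (Finset.finite_toSet _)
  have h2 : (((Finset.univ : Finset (Fin K)) ×ˢ Finset.range (S + 1) : Finset (Fin K × ℕ)) :
        Set (Fin K × ℕ)).ncard = K * (S + 1) := by
    rw [Set.ncard_coe_finset, Finset.card_product, Finset.card_univ, Fintype.card_fin,
      Finset.card_range]
  exact Nat.cast_le.2 (h1.trans h2.le)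

end Prog

/-! ### Basic programs -/

infixr:60 " ;; " => Prog.seq

namespace Prog

/-- Move the stack `i` onto the stack `j`, reversing it. -/
def mv (i j : ℕ) : Prog :=
  .loop (.nonempty i) (.ite (.topTrue i) (.pop i ;; .push j true) (.pop i ;; .push j false))

/-- Move the stack `i` onto the stacks `j` and `k`, reversing it. -/
def mvTwo (i j k : ℕ) : Prog :=
  .loop (.nonempty i) (.ite (.topTrue i) (.pop i ;; .push j true ;; .push k true)
    (.pop i ;; .push j false ;; .push k false))

/-- Empty the stack `i`. -/
def clear (i : ℕ) : Prog := .loop (.nonempty i) (.pop i)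

/-- Copy the stack `0` to the empty stack `K`. -/
def copy (K : ℕ) : Prog := mv 0 (K + 1) ;; mvTwo (K + 1) 0 K

/-- Move the stack `K` to the empty stack `0`. -/
def restore (K : ℕ) : Prog := mv K (K + 1) ;; mv (K + 1) 0

end Prog

open Prog Function

section
variable {x : List Bool} {S : ℕ}

theorem Exec.congr {p : Prog} {ρ ρ' ρ'' : ℕ → List Bool} {h h' : ℕ}
    (H : Exec x S p ⟨ρ, h⟩ ⟨ρ', h'⟩) (e : ρ' = ρ'') : Exec x S p ⟨ρ, h⟩ ⟨ρ'', h'⟩ := e ▸ H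

theorem eval_nonempty {ρ : ℕ → List Bool} {h r : ℕ} :
    (Test.nonempty r).eval x ⟨ρ, h⟩ = !(ρ r).isEmpty := by
  change (ρ r).head?.isSome = _
  cases ρ r <;> rfl

theorem eval_topTrue {ρ : ℕ → List Bool} {h r : ℕ} :
    (Test.topTrue r).eval x ⟨ρ, h⟩ = ((ρ r).head? == some true) := rfl

theorem exec_mv {i j h : ℕ} (hij : i ≠ j) {l : List Bool} {ρ : ℕ → List Bool} (hl : ρ i = l)
    (hS : l.length + (ρ j).length ≤ S) :
    Exec x S (mv i j) ⟨ρ, h⟩ ⟨update (update ρ i []) j (l.reverse ++ ρ j), h⟩ := by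
  induction l generalizing ρ with
  | nil =>
    refine Exec.congr (.loopF (by simp [eval_nonempty, hl])) ?_
    rw [← hl, update_eq_self, hl]
    simp
  | cons b l ih =>
    simp only [List.length_cons] at hS
    have ih' := @ih (update (update ρ i l) j (b :: ρ j)) (by simp [hij])
      (by simp; omega)
    refine .loopT (σ' := ⟨update (update ρ i l) j (b :: ρ j), h⟩) (by simp [eval_nonempty, hl])
      ?_ (ih'.congr ?_)
    · have hp : Exec x S (.pop i) ⟨ρ, h⟩ ⟨update ρ i l, h⟩ := by
        simpa [hl] using (Exec.pop (x := x) (S := S) (r := i) (σ := ⟨ρ, h⟩))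
      have hq : Exec x S (.push j b) ⟨update ρ i l, h⟩ ⟨update (update ρ i l) j (b :: ρ j), h⟩ := by
        simpa [hij.symm] using (Exec.push (x := x) (S := S) (r := j) (b := b)
          (σ := ⟨update ρ i l, h⟩) (by simp [hij.symm]; omega))
      cases b
      · exact .iteF (by simp [eval_topTrue, hl]) (.seq hp hq)
      · exact .iteT (by simp [eval_topTrue, hl]) (.seq hp hq)
    · ext1 r
      simp only [update_apply]
      split_ifs <;> simp_all

theorem exec_mvTwo {i j k h : ℕ} (hij : i ≠ j) (hik : i ≠ k) (hjk : j ≠ k) {l : List Bool}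
    {ρ : ℕ → List Bool} (hl : ρ i = l) (hS : l.length + (ρ j).length ≤ S)
    (hS' : l.length + (ρ k).length ≤ S) :
    Exec x S (mvTwo i j k) ⟨ρ, h⟩
      ⟨update (update (update ρ i []) j (l.reverse ++ ρ j)) k (l.reverse ++ ρ k), h⟩ := by
  induction l generalizing ρ with
  | nil =>
    refine Exec.congr (.loopF (by simp [eval_nonempty, hl])) ?_
    ext1 r
    simp only [update_apply]
    split_ifs <;> simp_all
  | cons b l ih =>
    simp only [List.length_cons] at hS hS'
    set ρ' := update (update (update ρ i l) j (b :: ρ j)) k (b :: ρ k) with hρ'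
    have ih' := @ih ρ' (by simp [hρ', hij, hik]) (by simp [hρ', hjk]; omega)
      (by simp [hρ']; omega)
    refine .loopT (σ' := ⟨ρ', h⟩) (by simp [eval_nonempty, hl]) ?_ (ih'.congr ?_)
    · have hp : Exec x S (.pop i) ⟨ρ, h⟩ ⟨update ρ i l, h⟩ := by
        simpa [hl] using (Exec.pop (x := x) (S := S) (r := i) (σ := ⟨ρ, h⟩))
      have hq : Exec x S (.push j b) ⟨update ρ i l, h⟩ ⟨update (update ρ i l) j (b :: ρ j), h⟩ := by
        simpa [hij.symm] using (Exec.push (x := x) (S := S) (r := j) (b := b)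
          (σ := ⟨update ρ i l, h⟩) (by simp [hij.symm]; omega))
      have hr : Exec x S (.push k b) ⟨update (update ρ i l) j (b :: ρ j), h⟩ ⟨ρ', h⟩ := by
        simpa [hik.symm, hjk.symm] using (Exec.push (x := x) (S := S) (r := k) (b := b)
          (σ := ⟨update (update ρ i l) j (b :: ρ j), h⟩) (by simp [hik.symm, hjk.symm]; omega))
      cases b
      · exact .iteF (by simp [eval_topTrue, hl]) (.seq hp (.seq hq hr))
      · exact .iteT (by simp [eval_topTrue, hl]) (.seq hp (.seq hq hr))
    · ext1 r
      simp only [hρ', update_apply]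
      split_ifs <;> simp_all

theorem exec_clear {i h : ℕ} {ρ : ℕ → List Bool} :
    Exec x S (clear i) ⟨ρ, h⟩ ⟨update ρ i [], h⟩ := by
  generalize hl : ρ i = l
  induction l generalizing ρ with
  | nil =>
    refine Exec.congr (.loopF (by simp [eval_nonempty, hl])) ?_
    simp [← hl, update_eq_self]
  | cons b l ih =>
    have hp : Exec x S (.pop i) ⟨ρ, h⟩ ⟨update ρ i l, h⟩ := by
      simpa [hl] using (Exec.pop (x := x) (S := S) (r := i) (σ := ⟨ρ, h⟩))
    refine .loopT (by simp [eval_nonempty, hl]) hp ((@ih (update ρ i l) (by simp)).congr ?_)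
    simp

theorem exec_copy {K h : ℕ} (hK : 0 < K) {ρ : ℕ → List Bool} (h1 : ρ K = [])
    (h2 : ρ (K + 1) = []) (hS : (ρ 0).length ≤ S) :
    Exec x S (copy K) ⟨ρ, h⟩ ⟨update ρ K (ρ 0), h⟩ := by
  refine .seq (exec_mv (by omega) rfl (by simpa [h2] using hS))
    ((exec_mvTwo (l := (ρ 0).reverse) (by omega) (by omega) (by omega) (by simp [h2]) ?_ ?_).congr
      ?_)
  · simpa using hS
  · have : K ≠ 0 := by omega
    simpa [this, h1] using hS
  · ext1 r
    simp only [update_apply]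
    split_ifs <;> grind

theorem exec_restore {K h : ℕ} (hK : 0 < K) {ρ : ℕ → List Bool} (h1 : ρ 0 = [])
    (h2 : ρ (K + 1) = []) (hS : (ρ K).length ≤ S) :
    Exec x S (restore K) ⟨ρ, h⟩ ⟨update (update ρ K []) 0 (ρ K), h⟩ := by
  refine .seq (exec_mv (by omega) rfl (by simpa [h2] using hS))
    ((exec_mv (l := (ρ K).reverse) (by omega) (by simp [h2]) ?_).congr ?_)
  · have : (0 : ℕ) ≠ K := by omega
    simpa [this, h1] using hS
  · ext1 r
    simp only [update_apply]
    split_ifs <;> grind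

theorem exec_pop {i h : ℕ} {ρ : ℕ → List Bool} :
    Exec x S (.pop i) ⟨ρ, h⟩ ⟨update ρ i (ρ i).tail, h⟩ := .pop

theorem exec_push {i h : ℕ} {b : Bool} {ρ : ℕ → List Bool} (hS : (ρ i).length < S) :
    Exec x S (.push i b) ⟨ρ, h⟩ ⟨update ρ i (b :: ρ i), h⟩ := .push hS

end

/-! ### Functions computable in linear space -/

/-- Types whose elements are coded by binary strings. Some elements, such as a handle on the input,
only make sense for a given input. -/
class Obj (α : Type) where
  enc : α → List Bool
  compat : List Bool → α → Prop

/-- Types whose elements make sense for every input. -/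
class Plain (α : Type) [Obj α] : Prop where
  compat : ∀ (x : List Bool) (a : α), Obj.compat x a

/-- The length of the code of an element. -/
def len {α : Type} [Obj α] (a : α) : ℕ := (Obj.enc a).length

instance : Obj ℕ := ⟨Nat.bits, fun _ _ => True⟩
instance : Plain ℕ := ⟨fun _ _ => trivial⟩
-- With the empty string for `false`, the test `nonempty 0` reads off a Boolean result.
instance : Obj Bool := ⟨fun b => if b then [true] else [], fun _ _ => True⟩
instance : Plain Bool := ⟨fun _ _ => trivial⟩

/-- A handle on the input. -/
structure Inp where
  word : List Bool

/-- A handle costs no space, because the input is consulted on its own tape and never copied.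
Compatibility ties the handle to the actual input. -/
instance : Obj Inp := ⟨fun _ => [], fun x a => a.word = x⟩

/-- Every bit preceded by a one. -/
def flagged (l : List Bool) : List Bool := l.flatMap fun d => [true, d]

@[simp] theorem length_flagged (l : List Bool) : (flagged l).length = 2 * l.length := by
  induction l with
  | nil => rfl
  | cons b l ih => simp only [flagged, List.flatMap_cons, List.length_append] at *; simp [ih]; omega

/-- A bit of the first component is announced by a one, so the first zero in flag position separates
the components. The second component is copied unchanged, hence in a tuple nested to the right every
component is lengthened only by a factor of at most two. -/
instance {α β : Type} [Obj α] [Obj β] : Obj (α × β) :=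
  ⟨fun p => flagged (Obj.enc p.1) ++ false :: Obj.enc p.2,
    fun x p => Obj.compat x p.1 ∧ Obj.compat x p.2⟩

instance {α β : Type} [Obj α] [Obj β] [Plain α] [Plain β] : Plain (α × β) :=
  ⟨fun x p => ⟨Plain.compat x p.1, Plain.compat x p.2⟩⟩

@[simp] theorem len_nat (n : ℕ) : len n = n.size := Nat.size_eq_bits_len n

@[simp] theorem len_pair {α β : Type} [Obj α] [Obj β] (a : α) (b : β) :
    len (a, b) = 2 * len a + len b + 1 := by
  simp [len, Obj.enc]; omega

theorem len_prod {α β : Type} [Obj α] [Obj β] (p : α × β) :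
    len p = 2 * len p.1 + len p.2 + 1 := len_pair p.1 p.2

theorem len_bool (b : Bool) : len b ≤ 1 := by
  cases b <;> simp [len, Obj.enc]

@[simp] theorem len_inp (i : Inp) : len i = 0 := rfl

/-- The program `P` replaces the contents `u` of register `0` by `v`, provided that the other
registers below `K` are empty, and restores all other registers. -/
def Runs (k : Bool) (K : ℕ) (P : Prog) (x : List Bool) (S : ℕ) (u v : List Bool) : Prop :=
  ∀ (ρ : ℕ → List Bool) (h : ℕ), ρ 0 = u → (∀ i, 0 < i → i < K → ρ i = []) →
    ∃ h', Exec x S P ⟨ρ, h⟩ ⟨update ρ 0 v, h'⟩ ∧ (k = true → h' = h)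

theorem Runs.mono {k : Bool} {K K' : ℕ} {P : Prog} {x : List Bool} {S S' : ℕ} {u v : List Bool}
    (H : Runs k K P x S u v) (hK : K ≤ K') (hS : S ≤ S') : Runs k K' P x S' u v := by
  intro ρ h h1 h2
  obtain ⟨h', h3, h4⟩ := H ρ h h1 fun i hi hi' => h2 i hi (by omega)
  exact ⟨h', h3.mono hS, h4⟩

theorem Runs.seq {k : Bool} {K : ℕ} {P Q : Prog} {x : List Bool} {S : ℕ} {u v w : List Bool}
    (H1 : Runs k K P x S u v) (H2 : Runs k K Q x S v w) : Runs k K (P ;; Q) x S u w := by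
  intro ρ h h1 h2
  obtain ⟨h', h3, h4⟩ := H1 ρ h h1 h2
  obtain ⟨h'', h5, h6⟩ := H2 (update ρ 0 v) h' (by simp) fun i hi hi' => by
    rw [update_of_ne (by omega)]; exact h2 i hi hi'
  exact ⟨h'', .seq h3 (h5.congr (by simp)), fun hk => by rw [h6 hk, h4 hk]⟩

/-- A result cannot be longer than the space it was produced in. Consequently functions in `LS`
increase lengths at most linearly, which is what composition needs. -/
theorem Runs.length_le {k : Bool} {K : ℕ} {P : Prog} {x : List Bool} {S : ℕ} {u v : List Bool}
    (H : Runs k K P x S u v) : v.length ≤ max u.length S := by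
  obtain ⟨h', h1, -⟩ := H (fun i => if i = 0 then u else []) 0 (by simp)
    (fun i hi _ => by simp; omega)
  simpa using h1.length_le 0

/-- Functions computable in linear space. If `k` is `true`, the input head is not moved. -/
@[fun_prop] def LS (k : Bool) {α β : Type} [Obj α] [Obj β] (f : α → β) : Prop :=
  ∃ (P : Prog) (K c : ℕ), 0 < K ∧ P.RegsBelow K ∧ ∀ (x : List Bool) (a : α), Obj.compat x a →
    Obj.compat x (f a) ∧ Runs k K P x (c * (len a + 1)) (Obj.enc a) (Obj.enc (f a))

section
variable {α β γ δ : Type} [Obj α] [Obj β] [Obj γ] [Obj δ] {k : Bool}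

theorem LS.len_le {f : α → β} (h : LS k f) :
    ∃ c, ∀ (x : List Bool) (a : α), Obj.compat x a → len (f a) ≤ c * (len a + 1) := by
  obtain ⟨P, K, c, -, -, H⟩ := h
  refine ⟨c + 1, fun x a ha => ((H x a ha).2.length_le).trans (max_le ?_ ?_)⟩
  · change len a ≤ _
    nlinarith
  · nlinarith

/-- A program that does nothing. -/
def Prog.skip : Prog := .ite (.nonempty 0) (.push 0 true ;; .pop 0) (.push 0 true ;; .pop 0)

theorem exec_skip {x : List Bool} {S : ℕ} {ρ : ℕ → List Bool} {h : ℕ} (hS : (ρ 0).length < S) :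
    Exec x S skip ⟨ρ, h⟩ ⟨ρ, h⟩ := by
  have : Exec x S (.push 0 true ;; .pop 0) ⟨ρ, h⟩ ⟨ρ, h⟩ :=
    (Exec.seq (exec_push hS) exec_pop).congr (by simp)
  by_cases hρ : (Test.nonempty 0).eval x ⟨ρ, h⟩ = true
  · exact .iteT hρ this
  · exact .iteF (by simpa using hρ) this

@[fun_prop] theorem LS.id : LS k (fun a : α => a) := by
  refine ⟨skip, 1, 1, by omega, by simp [skip, RegsBelow, Test.RegsBelow], fun x a ha =>
    ⟨ha, fun ρ h h1 _ => ⟨h, (exec_skip ?_).congr ?_, fun _ => rfl⟩⟩⟩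
  · rw [h1]; change len a < _; omega
  · rw [← h1]; simp

-- The intermediate result has linear length, so linear space in it is linear space in the argument.
@[fun_prop] theorem LS.comp {f : β → γ} {g : α → β} (hf : LS k f) (hg : LS k g) :
    LS k (fun a => f (g a)) := by
  obtain ⟨cg, hcg⟩ := hg.len_le
  obtain ⟨P, K, c, hK, hP, H⟩ := hg
  obtain ⟨P', K', c', hK', hP', H'⟩ := hf
  refine ⟨P ;; P', max K K', c + c' * (cg + 1), by omega,
    ⟨hP.mono (le_max_left _ _), hP'.mono (le_max_right _ _)⟩, fun x a ha => ?_⟩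
  obtain ⟨h1, h2⟩ := H x a ha
  obtain ⟨h3, h4⟩ := H' x _ h1
  refine ⟨h3, (h2.mono (le_max_left _ _) ?_).seq (h4.mono (le_max_right _ _) ?_)⟩
  · exact Nat.mul_le_mul_right _ (by omega)
  · have := hcg x a ha
    nlinarith [Nat.zero_le (c * (len a + 1)), Nat.mul_le_mul_left c' this]

/-- Push the bits of stack `i`, each preceded by a flag, onto stack `0`. -/
def Prog.flag (i : ℕ) : Prog := .loop (.nonempty i)
  (.ite (.topTrue i) (.pop i ;; .push 0 true ;; .push 0 true)
    (.pop i ;; .push 0 false ;; .push 0 true))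

theorem exec_flag {x : List Bool} {S : ℕ} {i h : ℕ} (hi : i ≠ 0) {l : List Bool}
    {ρ : ℕ → List Bool} (hl : ρ i = l) (hS : 2 * l.length + (ρ 0).length ≤ S) :
    Exec x S (flag i) ⟨ρ, h⟩ ⟨update (update ρ i []) 0 (flagged l.reverse ++ ρ 0), h⟩ := by
  induction l generalizing ρ with
  | nil =>
    refine Exec.congr (.loopF (by simp [eval_nonempty, hl])) ?_
    rw [← hl, update_eq_self, hl]
    simp [flagged]
  | cons b l ih =>
    simp only [List.length_cons] at hS
    set ρ' := update (update ρ i l) 0 (true :: b :: ρ 0) with hρ'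
    have ih' := @ih ρ' (by simp [hρ', hi]) (by simp [hρ']; omega)
    refine .loopT (σ' := ⟨ρ', h⟩) (by simp [eval_nonempty, hl]) ?_ (ih'.congr ?_)
    · have hp : Exec x S (.pop i) ⟨ρ, h⟩ ⟨update ρ i l, h⟩ := exec_pop.congr (by simp [hl])
      have hq : Exec x S (.push 0 b ;; .push 0 true) ⟨update ρ i l, h⟩ ⟨ρ', h⟩ :=
        .seq (exec_push (by simp [hi.symm]; omega))
          ((exec_push (by simp [hi.symm]; omega)).congr (by simp [hρ', hi.symm]))
      cases b
      · exact .iteF (by simp [eval_topTrue, hl]) (.seq hp hq)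
      · exact .iteT (by simp [eval_topTrue, hl]) (.seq hp hq)
    · ext1 r
      simp only [hρ', update_apply]
      split_ifs <;> simp_all [flagged]

theorem LS.exists_common {f : α → β} {g : α → γ} (hf : LS k f) (hg : LS k g) :
    ∃ (P Q : Prog) (K c : ℕ), 0 < K ∧ P.RegsBelow K ∧ Q.RegsBelow K ∧
      ∀ (x : List Bool) (a : α), Obj.compat x a → Obj.compat x (f a) ∧ Obj.compat x (g a) ∧
        len (f a) ≤ c * (len a + 1) ∧ len (g a) ≤ c * (len a + 1) ∧
        Runs k K P x (c * (len a + 1)) (Obj.enc a) (Obj.enc (f a)) ∧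
        Runs k K Q x (c * (len a + 1)) (Obj.enc a) (Obj.enc (g a)) := by
  obtain ⟨cf, hcf⟩ := hf.len_le
  obtain ⟨cg, hcg⟩ := hg.len_le
  obtain ⟨P, K, c, hK, hP, H⟩ := hf
  obtain ⟨P', K', c', hK', hP', H'⟩ := hg
  refine ⟨P, P', max K K', c + c' + cf + cg, by omega, hP.mono (le_max_left _ _),
    hP'.mono (le_max_right _ _), fun x a ha => ⟨(H x a ha).1, (H' x a ha).1,
      (hcf x a ha).trans ?_, (hcg x a ha).trans ?_, (H x a ha).2.mono (le_max_left _ _) ?_,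
      (H' x a ha).2.mono (le_max_right _ _) ?_⟩⟩ <;> apply Nat.mul_le_mul_right <;> omega

-- The argument is saved in register `K` while `f` is computed (register `K + 1` is scratch for
-- copying), and the reversed value of `f` is parked in register `K + 2` while `g` is computed.
-- Flagging the parked value onto the code of the second component produces the code of the pair.
@[fun_prop] theorem LS.pair {f : α → β} {g : α → γ} (hf : LS k f) (hg : LS k g) :
    LS k (fun a => (f a, g a)) := by
  obtain ⟨P, Q, K, c, hK, hP, hQ, H⟩ := hf.exists_common hg
  refine ⟨copy K ;; P ;; mv 0 (K + 2) ;; restore K ;; Q ;; .push 0 false ;; flag (K + 2), K + 3,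
    3 * c + 1, by omega, ?_, fun x a ha => ?_⟩
  · have h1 := hP.mono (show K ≤ K + 3 by omega)
    have h2 := hQ.mono (show K ≤ K + 3 by omega)
    simp [RegsBelow, Test.RegsBelow, copy, restore, mv, mvTwo, flag, h1, h2]
  · obtain ⟨hfa, hga, lf, lg, hP, hQ⟩ := H x a ha
    refine ⟨⟨hfa, hga⟩, ?_⟩
    set S := (3 * c + 1) * (len a + 1) with hS
    have b1 : c * (len a + 1) ≤ S := by nlinarith
    have b2 : len a ≤ S := by nlinarith
    have b3 : 2 * len (f a) + len (g a) + 1 ≤ S := by nlinarith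
    replace hP := hP.mono le_rfl b1
    replace hQ := hQ.mono le_rfl b1
    intro ρ h h1 h2
    have e1 : Exec x S (copy K) ⟨ρ, h⟩ ⟨update ρ K (Obj.enc a), h⟩ :=
      (exec_copy hK (h2 _ (by omega) (by omega)) (h2 _ (by omega) (by omega))
        (by rw [h1]; exact b2)).congr (by rw [h1])
    obtain ⟨h', e2, k2⟩ := hP (update ρ K (Obj.enc a)) h
      (by rw [update_of_ne (by omega)]; exact h1)
      (fun i hi hi' => by rw [update_of_ne (by omega)]; exact h2 i hi (by omega))
    have e3 : Exec x S (mv 0 (K + 2)) ⟨update (update ρ K (Obj.enc a)) 0 (Obj.enc (f a)), h'⟩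
        ⟨update (update (update ρ K (Obj.enc a)) 0 []) (K + 2) (Obj.enc (f a)).reverse, h'⟩ := by
      refine (exec_mv (by omega) rfl ?_).congr ?_
      · have : K + 2 ≠ K := by omega
        simp only [update_self, update_of_ne (show K + 2 ≠ 0 by omega), update_of_ne this,
          h2 (K + 2) (by omega) (by omega), List.length_nil]
        change len (f a) + 0 ≤ S
        omega
      · simp [h2 (K + 2) (by omega) (by omega)]
    have e4 : Exec x S (restore K)
        ⟨update (update (update ρ K (Obj.enc a)) 0 []) (K + 2) (Obj.enc (f a)).reverse, h'⟩
        ⟨update ρ (K + 2) (Obj.enc (f a)).reverse, h'⟩ := by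
      have hK0 : K ≠ 0 := by omega
      refine (exec_restore hK (by simp) ?_ ?_).congr ?_
      · simp [h2 (K + 1) (by omega) (by omega)]
      · simp only [update_of_ne (show K ≠ K + 2 by omega), update_of_ne hK0, update_self]
        exact b2
      · have := h2 K (by omega) (by omega)
        ext1 r
        simp only [update_apply]
        split_ifs <;> grind
    obtain ⟨h'', e5, k5⟩ := hQ (update ρ (K + 2) (Obj.enc (f a)).reverse) h'
      (by rw [update_of_ne (by omega)]; exact h1)
      (fun i hi hi' => by rw [update_of_ne (by omega)]; exact h2 i hi (by omega))
    refine ⟨h'', .seq e1 (.seq e2 (.seq e3 (.seq e4 (.seq e5 (.seq (exec_push ?_)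
      ((exec_flag (l := (Obj.enc (f a)).reverse) (by omega) ?_ ?_).congr ?_)))))),
      fun hk => by rw [k5 hk, k2 hk]⟩
    · simp only [update_self]
      change len (g a) < S
      omega
    · simp
    · simp only [update_self, List.length_reverse, List.length_cons]
      change 2 * len (f a) + (len (g a) + 1) ≤ S
      omega
    · have := h2 (K + 2) (by omega) (by omega)
      ext1 r
      simp only [update_apply, List.reverse_reverse]
      split_ifs <;> simp_all [Obj.enc]

/-- Move the flagged bits on top of stack `0` to stack `1`. -/
def Prog.unflag : Prog := .loop (.topTrue 0) (.pop 0 ;;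
  .ite (.topTrue 0) (.pop 0 ;; .push 1 true) (.pop 0 ;; .push 1 false))

theorem exec_unflag {x : List Bool} {S h : ℕ} {l m : List Bool}
    {ρ : ℕ → List Bool} (hl : ρ 0 = flagged l ++ false :: m) (hS : l.length + (ρ 1).length ≤ S) :
    Exec x S unflag ⟨ρ, h⟩ ⟨update (update ρ 0 (false :: m)) 1 (l.reverse ++ ρ 1), h⟩ := by
  induction l generalizing ρ with
  | nil =>
    refine Exec.congr (.loopF (by simp [eval_topTrue, hl, flagged])) ?_
    simp only [flagged, List.flatMap_nil, List.nil_append] at hl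
    simp [← hl]
  | cons b l ih =>
    simp only [List.length_cons] at hS
    have hl' : ρ 0 = true :: b :: (flagged l ++ false :: m) := by rw [hl]; simp [flagged]
    set ρ' := update (update ρ 0 (flagged l ++ false :: m)) 1 (b :: ρ 1) with hρ'
    have ih' := @ih ρ' (by simp [hρ']) (by simp [hρ']; omega)
    refine .loopT (σ' := ⟨ρ', h⟩) (by simp [eval_topTrue, hl']) (.seq exec_pop ?_) (ih'.congr ?_)
    · have hp : Exec x S (.pop 0) ⟨update ρ 0 (ρ 0).tail, h⟩
        ⟨update ρ 0 (flagged l ++ false :: m), h⟩ := exec_pop.congr (by simp [hl'])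
      have hq : Exec x S (.push 1 b) ⟨update ρ 0 (flagged l ++ false :: m), h⟩ ⟨ρ', h⟩ :=
        (exec_push (by simp; omega)).congr (by simp [hρ'])
      cases b
      · exact .iteF (by simp [eval_topTrue, hl']) (.seq hp hq)
      · exact .iteT (by simp [eval_topTrue, hl']) (.seq hp hq)
    · ext1 r
      simp only [hρ', update_apply]
      split_ifs <;> simp_all

theorem LS.fst' : LS k (fun p : α × β => p.1) := by
  refine ⟨unflag ;; clear 0 ;; mv 1 0, 2, 1, by omega, ?_, fun x a ha => ⟨ha.1,
    fun ρ h h1 h2 => ⟨h, .seq (exec_unflag h1 ?_) (.seq exec_clear ((exec_mv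
      (l := (Obj.enc a.1).reverse) (by omega) ?_ ?_).congr ?_)), fun _ => rfl⟩⟩⟩
  · simp [RegsBelow, Test.RegsBelow, mv, unflag, clear]
  · rw [h2 1 (by omega) (by omega)]
    have := len_prod a
    change len a.1 + 0 ≤ _
    omega
  · simp [h2 1 (by omega) (by omega)]
  · have := len_prod a
    simp only [update_self, List.length_reverse]
    change len a.1 + 0 ≤ _
    omega
  · have := h2 1 (by omega) (by omega)
    ext1 r
    simp only [update_apply]
    split_ifs <;> simp_all

theorem LS.snd' : LS k (fun p : α × β => p.2) := by
  refine ⟨unflag ;; clear 1 ;; .pop 0, 2, 1, by omega, ?_, fun x a ha => ⟨ha.2,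
    fun ρ h h1 h2 => ⟨h, .seq (exec_unflag h1 ?_) (.seq exec_clear (exec_pop.congr ?_)),
      fun _ => rfl⟩⟩⟩
  · simp [RegsBelow, Test.RegsBelow, unflag, clear]
  · rw [h2 1 (by omega) (by omega)]
    have := len_prod a
    change len a.1 + 0 ≤ _
    omega
  · have := h2 1 (by omega) (by omega)
    ext1 r
    simp only [update_apply]
    split_ifs <;> simp_all

/-- Push a list of bits onto stack `0`. -/
def Prog.pushAll : List Bool → Prog
  | [] => skip
  | b :: l => pushAll l ;; .push 0 b

theorem exec_pushAll {x : List Bool} {S h : ℕ} {l : List Bool} {ρ : ℕ → List Bool}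
    (hS : l.length + (ρ 0).length < S) :
    Exec x S (pushAll l) ⟨ρ, h⟩ ⟨update ρ 0 (l ++ ρ 0), h⟩ := by
  induction l with
  | nil => exact (exec_skip (by simpa using hS)).congr (by simp)
  | cons b l ih =>
    simp only [List.length_cons] at hS
    exact .seq (ih (by omega)) ((exec_push (by simp; omega)).congr (by simp))

theorem pushAll_regsBelow (l : List Bool) {K : ℕ} (hK : 0 < K) : (pushAll l).RegsBelow K := by
  induction l with
  | nil => simp [pushAll, skip, RegsBelow, Test.RegsBelow, hK]
  | cons b l ih => exact ⟨ih, hK⟩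

@[fun_prop] theorem LS.const [Plain β] (b : β) : LS k (fun _ : α => b) := by
  refine ⟨clear 0 ;; pushAll (Obj.enc b), 1, len b + 1, by omega,
    ⟨by simp [clear, RegsBelow, Test.RegsBelow], pushAll_regsBelow _ (by omega)⟩,
    fun x a ha => ⟨Plain.compat x b, fun ρ h h1 h2 => ⟨h, .seq exec_clear
      ((exec_pushAll ?_).congr (by simp)), fun _ => rfl⟩⟩⟩
  simp only [update_self, List.length_nil]
  change len b + 0 < _
  nlinarith

theorem LS.ite {c : α → Bool} {f g : α → β} (hc : LS k c) (hf : LS k f) (hg : LS k g) :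
    LS k (fun a => bif c a then f a else g a) := by
  obtain ⟨P, Q, K, C, hK, hP, hQ, H⟩ := hf.exists_common hg
  obtain ⟨P', K', C', hK', hP', H'⟩ := hc
  set L := max K K' with hL
  refine ⟨copy L ;; P' ;; .ite (.nonempty 0) (.pop 0 ;; restore L ;; P) (restore L ;; Q), L + 2,
    C + C' + 1, by omega, ?_, fun x a ha => ?_⟩
  · have h1 := hP.mono (show K ≤ L + 2 by omega)
    have h2 := hQ.mono (show K ≤ L + 2 by omega)
    have h3 := hP'.mono (show K' ≤ L + 2 by omega)
    simp [RegsBelow, Test.RegsBelow, copy, restore, mv, mvTwo, h1, h2, h3]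
  · obtain ⟨hfa, hga, lf, lg, hP, hQ⟩ := H x a ha
    obtain ⟨-, hC⟩ := H' x a ha
    have hL0 : L ≠ 0 := by omega
    refine ⟨by dsimp only; cases c a <;> assumption, fun ρ h h1 h2 => ?_⟩
    set S := (C + C' + 1) * (len a + 1) with hS
    have b1 : C * (len a + 1) ≤ S := by nlinarith
    have b1' : C' * (len a + 1) ≤ S := by nlinarith
    have b2 : len a ≤ S := by nlinarith
    have e1 : Exec x S (copy L) ⟨ρ, h⟩ ⟨update ρ L (Obj.enc a), h⟩ :=
      (exec_copy (by omega) (h2 _ (by omega) (by omega)) (h2 _ (by omega) (by omega))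
        (by rw [h1]; exact b2)).congr (by rw [h1])
    obtain ⟨h', e2, k2⟩ := (hC.mono (le_max_right K K') b1') (update ρ L (Obj.enc a)) h
      (by rw [update_of_ne (by omega)]; exact h1)
      (fun i hi hi' => by rw [update_of_ne (by omega)]; exact h2 i hi (by omega))
    have e3 : Exec x S (restore L) ⟨update (update ρ L (Obj.enc a)) 0 [], h'⟩ ⟨ρ, h'⟩ := by
      refine (exec_restore (by omega) (by simp) ?_ ?_).congr ?_
      · simp [h2 (L + 1) (by omega) (by omega)]
      · simp only [update_of_ne hL0, update_self]
        exact b2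
      · have := h2 L (by omega) (by omega)
        ext1 r
        simp only [update_apply]
        split_ifs <;> grind
    cases hca : c a with
    | true =>
      obtain ⟨h'', e4, k4⟩ := (hP.mono (le_max_left K K') b1) ρ h' h1
        (fun i hi hi' => h2 i hi (by omega))
      refine ⟨h'', .seq e1 (.seq e2 (.iteT (by simp [eval_nonempty, hca, Obj.enc])
        (.seq (exec_pop.congr ?_) (.seq e3 (e4.congr (by simp [hca])))))),
        fun hk => by rw [k4 hk, k2 hk]⟩
      simp [hca, Obj.enc]
    | false =>
      obtain ⟨h'', e4, k4⟩ := (hQ.mono (le_max_left K K') b1) ρ h' h1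
        (fun i hi hi' => h2 i hi (by omega))
      simp only [hca, Obj.enc] at e2
      exact ⟨h'', .seq e1 (.seq e2 (.iteF (by simp [eval_nonempty])
        (.seq e3 (e4.congr (by simp [hca]))))),
        fun hk => by rw [k4 hk, k2 hk]⟩

/-- The program of a `while` loop. -/
def Prog.while (K : ℕ) (C F : Prog) : Prog :=
  copy K ;; C ;; .loop (.nonempty 0) (.pop 0 ;; restore K ;; F ;; copy K ;; C) ;; restore K

/-- The test destroys its argument, so each round works on a copy and restores it afterwards. Only
the lengths of the values `u i` enter the space; the number `n` of rounds does not. -/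
theorem Runs.while {K S n : ℕ} {C F : Prog} {x : List Bool} (hK : 0 < K) (u : ℕ → List Bool)
    (hu : ∀ i ≤ n, (u i).length ≤ S)
    (hC : ∀ i ≤ n, Runs k K C x S (u i) (if i < n then [true] else []))
    (hF : ∀ i < n, Runs k K F x S (u i) (u (i + 1))) :
    Runs k (K + 2) (Prog.while K C F) x S (u 0) (u n) := by
  intro ρ h h1 h2
  have hK0 : K ≠ 0 := by omega
  have test : ∀ i ≤ n, ∀ h, ∃ h', Exec x S (copy K ;; C) ⟨update ρ 0 (u i), h⟩
      ⟨update (update ρ K (u i)) 0 (if i < n then [true] else []), h'⟩ ∧ (k = true → h' = h) := by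
    intro i hi h
    have e1 : Exec x S (copy K) ⟨update ρ 0 (u i), h⟩ ⟨update (update ρ 0 (u i)) K (u i), h⟩ :=
      (exec_copy hK (by simp [hK0, h2 K hK (by omega)]) (by simp [h2 (K + 1)])
        (by simpa using hu i hi)).congr (by simp)
    obtain ⟨h', e2, k2⟩ := hC i hi (update (update ρ 0 (u i)) K (u i)) h (by simp [hK0.symm])
      (fun j hj hj' => by simp [hj.ne', hj'.ne, h2 j hj (by omega)])
    refine ⟨h', .seq e1 (e2.congr ?_), k2⟩
    ext1 r
    simp only [update_apply]
    split_ifs <;> simp_all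
  have hres : ∀ i ≤ n, ∀ h, Exec x S (restore K) ⟨update (update ρ K (u i)) 0 [], h⟩
      ⟨update ρ 0 (u i), h⟩ := by
    intro i hi h
    refine (exec_restore hK (by simp) (by simp [h2 (K + 1)]) (by simpa [hK0] using hu i hi)).congr
      ?_
    have := h2 K (by omega) (by omega)
    ext1 r
    simp only [update_apply]
    split_ifs <;> simp_all
  have main : ∀ m ≤ n, ∀ h, ∃ h', Exec x S
      (.loop (.nonempty 0) (.pop 0 ;; restore K ;; F ;; copy K ;; C))
      ⟨update (update ρ K (u (n - m))) 0 (if n - m < n then [true] else []), h⟩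
      ⟨update (update ρ K (u n)) 0 [], h'⟩ ∧ (k = true → h' = h) := by
    intro m
    induction m with
    | zero =>
      intro _ h
      simp only [tsub_zero, lt_irrefl, if_false]
      exact ⟨h, .loopF (by simp [eval_nonempty]), fun _ => rfl⟩
    | succ m ih =>
      intro hm h
      rw [if_pos (by omega)]
      obtain ⟨h', e1, k1⟩ := hF (n - (m + 1)) (by omega) (update ρ 0 (u (n - (m + 1)))) h (by simp)
        (fun j hj hj' => by simp [hj.ne', h2 j hj (by omega)])
      rw [show n - (m + 1) + 1 = n - m by omega, update_idem] at e1
      obtain ⟨h'', e2, k2⟩ := test (n - m) (by omega) h'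
      obtain ⟨h''', e3, k3⟩ := ih (by omega) h''
      exact ⟨h''', .loopT (by simp [eval_nonempty]) (.seq (exec_pop.congr (by simp))
        (.seq (hres _ (by omega) h) (.seq e1 e2))) e3, fun hk => by rw [k3 hk, k2 hk, k1 hk]⟩
  obtain ⟨h', e1, k1⟩ := test 0 (by omega) h
  obtain ⟨h'', e2, k2⟩ := main n le_rfl h'
  rw [← h1, update_eq_self] at e1
  rw [Nat.sub_self, ← h1] at e2
  cases e1 with
  | seq e1 e1' =>
    exact ⟨h'', .seq e1 (.seq e1' (.seq e2 (hres n le_rfl h''))), fun hk => by rw [k2 hk, k1 hk]⟩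

theorem while_regsBelow {K : ℕ} {C F : Prog} (hC : C.RegsBelow K) (hF : F.RegsBelow K) :
    (Prog.while K C F).RegsBelow (K + 2) := by
  have h1 := hC.mono (show K ≤ K + 2 by omega)
  have h2 := hF.mono (show K ≤ K + 2 by omega)
  simp [Prog.while, RegsBelow, Test.RegsBelow, copy, restore, mv, mvTwo, h1, h2]

theorem compat_iterate {F : α → α} (hF : LS k F) {x : List Bool} {a : α} (ha : Obj.compat x a)
    (i : ℕ) : Obj.compat x (F^[i] a) := by
  induction i with
  | zero => exact ha
  | succ i ih =>
    rw [iterate_succ_apply']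
    obtain ⟨P, K, c, -, -, H⟩ := hF
    exact (H x _ ih).1

/-- Every intermediate value has to be linear in the original argument `a`; linearity of `F` alone
would compound from round to round. There is no bound on the number of rounds. -/
theorem LS.while {I : γ → α} {F : α → α} {C : α → Bool} (hI : LS k I) (hF : LS k F)
    (hC : LS k C) {c : ℕ} (n : γ → ℕ)
    (hn : ∀ x a, Obj.compat x a → C (F^[n a] (I a)) = false)
    (hn' : ∀ x a, Obj.compat x a → ∀ i < n a, C (F^[i] (I a)) = true)
    (hb : ∀ x a, Obj.compat x a → ∀ i ≤ n a, len (F^[i] (I a)) ≤ c * (len a + 1)) :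
    LS k (fun a => F^[n a] (I a)) := by
  have hF' := hF
  obtain ⟨P, Q, K, C, hK, hP, hQ, H⟩ := hF.exists_common hC
  obtain ⟨R, K', C', hK', hR, HI⟩ := hI
  refine ⟨R ;; Prog.while K Q P, max K' (K + 2), C' + C * (c + 1) + c, by omega,
    ⟨hR.mono (le_max_left _ _), (while_regsBelow hQ hP).mono (le_max_right _ _)⟩,
    fun x a ha => ⟨compat_iterate hF' (HI x a ha).1 _, ?_⟩⟩
  have hIa := (HI x a ha).1
  have hS : ∀ i ≤ n a, C * (len (F^[i] (I a)) + 1) ≤ (C' + C * (c + 1) + c) * (len a + 1) := by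
    intro i hi
    have := hb x a ha i hi
    nlinarith [Nat.zero_le (c * (len a + 1)), Nat.mul_le_mul_left C this,
      Nat.zero_le (C' * (len a + 1))]
  refine ((HI x a ha).2.mono (le_max_left _ _) (Nat.mul_le_mul_right _ (by omega))).seq
    ((Runs.while hK (fun i => Obj.enc (F^[i] (I a))) (fun i hi => ?_) (fun i hi => ?_)
    (fun i hi => ?_)).mono (le_max_right _ _) le_rfl)
  · exact (hb x a ha i hi).trans (Nat.mul_le_mul_right _ (by omega))
  · have := (H x _ (compat_iterate hF' hIa i)).2.2.2.2.2.mono le_rfl (hS i hi)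
    rcases hi.lt_or_eq with h | h
    · simpa [h, hn' x a ha i h, Obj.enc] using this
    · subst h
      simpa [hn x a ha, Obj.enc] using this
  · rw [iterate_succ_apply']
    exact (H x _ (compat_iterate hF' hIa i)).2.2.2.2.1.mono le_rfl (hS i hi.le)

end

open TuringMachine Prog Function

section
variable {α β γ δ : Type} [Obj α] [Obj β] [Obj γ] [Obj δ] {k : Bool}

@[fun_prop] theorem LS.fst {f : α → β × γ} (hf : LS k f) : LS k (fun a => (f a).1) :=
  LS.fst'.comp hf

@[fun_prop] theorem LS.snd {f : α → β × γ} (hf : LS k f) : LS k (fun a => (f a).2) :=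
  LS.snd'.comp hf

@[fun_prop] theorem LS.cond {c : α → Bool} {f g : α → β} (hc : LS k c) (hf : LS k f)
    (hg : LS k g) : LS k (fun a => bif c a then f a else g a) := hc.ite hf hg

/-! ### Arithmetic -/

/-- The successor of a number in binary. -/
def incList : List Bool → List Bool
  | [] => [true]
  | false :: l => true :: l
  | true :: l => false :: incList l

theorem bits_bit0 {n : ℕ} (h : n ≠ 0) : (2 * n).bits = false :: n.bits := by
  simpa [Nat.bit] using Nat.bit0_bits n h

theorem bits_bit1 (n : ℕ) : (2 * n + 1).bits = true :: n.bits := by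
  simp

theorem bits_succ (n : ℕ) : (n + 1).bits = incList n.bits := by
  induction n using Nat.strong_induction_on with
  | _ n ih =>
    rcases Nat.even_or_odd' n with ⟨m, rfl | rfl⟩
    · rcases Nat.eq_zero_or_pos m with rfl | hm
      · rfl
      · rw [bits_bit1, bits_bit0 (by omega), incList]
    · rw [show 2 * m + 1 + 1 = 2 * (m + 1) by ring, bits_bit0 (by omega), bits_bit1, incList,
        ih m (by omega)]

/-- The predecessor of a number in binary. -/
def decList : List Bool → List Bool
  | [] => []
  | [true] => []
  | true :: b :: l => false :: b :: l
  | false :: l => true :: decList l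

theorem bits_pred (n : ℕ) : (n - 1).bits = decList n.bits := by
  induction n using Nat.strong_induction_on with
  | _ n ih =>
    rcases Nat.even_or_odd' n with ⟨m, rfl | rfl⟩
    · rcases Nat.eq_zero_or_pos m with rfl | hm
      · rfl
      · rw [show 2 * m - 1 = 2 * (m - 1) + 1 by omega, bits_bit1, bits_bit0 (by omega), decList,
          ih m (by omega)]
    · rcases Nat.eq_zero_or_pos m with rfl | hm
      · rfl
      · rw [Nat.add_sub_cancel, bits_bit1, bits_bit0 (by omega)]
        have : m.bits ≠ [] := by
          intro h
          have := Nat.size_eq_bits_len m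
          rw [h] at this
          have := Nat.size_pos.2 hm
          simp_all
        rcases hb : m.bits with _ | ⟨b, l⟩
        · exact absurd hb this
        · rfl

/-- Digits are stored with the least significant one on top. The loop carries out the carry of an
increment (`b = true`) or the borrow of a decrement (`b = false`): it flips the initial block of
digits `b` and keeps the result on stack `1`. -/
theorem exec_flip {x : List Bool} {S h : ℕ} (b : Bool) (n : ℕ) {r : List Bool}
    {ρ : ℕ → List Bool} (hl : ρ 0 = List.replicate n b ++ r) (hr : r.head? ≠ some b)
    (hS : n + (ρ 1).length ≤ S) :
    Exec x S (.loop (bif b then .topTrue 0 else .topFalse 0) (.pop 0 ;; .push 1 (!b))) ⟨ρ, h⟩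
      ⟨update (update ρ 0 r) 1 (List.replicate n (!b) ++ ρ 1), h⟩ := by
  induction n generalizing ρ with
  | zero =>
    simp only [List.replicate_zero, List.nil_append] at hl
    refine Exec.congr (.loopF ?_) ?_
    · rw [← hl] at hr
      cases b <;> exact beq_eq_false_iff_ne.2 hr
    · simp [← hl]
  | succ n ih =>
    simp only [List.replicate_succ, List.cons_append] at hl
    set ρ' := update (update ρ 0 (List.replicate n b ++ r)) 1 ((!b) :: ρ 1) with hρ'
    have ih' := @ih ρ' (by simp [hρ']) (by simp [hρ']; omega)
    refine .loopT (σ' := ⟨ρ', h⟩) ?_ (.seq exec_pop ((exec_push ?_).congr ?_)) (ih'.congr ?_)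
    · have : (ρ 0).head? = some b := by rw [hl]; rfl
      cases b <;> exact beq_iff_eq.2 this
    · simp; omega
    · simp [hρ', hl]
    · have : List.replicate n (!b) ++ (!b) :: ρ 1 = (!b) :: (List.replicate n (!b) ++ ρ 1) := by
        rw [List.append_cons, ← List.replicate_succ', List.replicate_succ, List.cons_append]
      ext1 r
      simp only [hρ', update_apply]
      split_ifs <;> simp_all [List.replicate_succ]

theorem exists_replicate (b : Bool) (l : List Bool) :
    ∃ n r, l = List.replicate n b ++ r ∧ r.head? ≠ some b := by
  induction l with
  | nil => exact ⟨0, [], by simp⟩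
  | cons a l ih =>
    by_cases h : a = b
    · obtain ⟨n, r, e, hr⟩ := ih
      exact ⟨n + 1, r, by rw [e, h]; simp [List.replicate_succ], hr⟩
    · exact ⟨0, a :: l, by simp, by simpa using h⟩

theorem LS.succ' : LS k (fun n : ℕ => n + 1) := by
  refine ⟨.loop (.topTrue 0) (.pop 0 ;; .push 1 false) ;; .pop 0 ;; .push 0 true ;; mv 1 0, 2, 2,
    by omega, by simp [RegsBelow, Test.RegsBelow, mv], fun x n _ => ⟨trivial, fun ρ h h1 h2 => ?_⟩⟩
  obtain ⟨m, r, e, hr⟩ := exists_replicate true n.bits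
  have hone := h2 1 (by omega) (by omega)
  have hlen : m + r.length = len n := by
    have := congrArg List.length e
    simpa [len, Obj.enc] using this.symm
  rw [len_nat] at hlen
  refine ⟨h, .seq (exec_flip true m (h1.trans e) hr ?_) (.seq exec_pop (.seq (exec_push ?_)
    ((exec_mv (l := List.replicate m false) (by omega) ?_ ?_).congr ?_))), fun _ => rfl⟩
  · simp [hone]; omega
  · simp; omega
  · simp [hone]
  · simp; omega
  · have key : (n + 1).bits = List.replicate m false ++ true :: r.tail := by
      rw [bits_succ, e]
      clear * - hr
      induction m with
      | zero =>
        rcases r with _ | ⟨b, r⟩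
        · rfl
        · cases b <;> simp_all [incList]
      | succ m ih => simpa [List.replicate_succ, incList] using ih
    ext1 i
    simp only [update_apply, Obj.enc, key]
    split_ifs <;> simp_all

theorem LS.pred' : LS k (fun n : ℕ => n - 1) := by
  refine ⟨.loop (.topFalse 0) (.pop 0 ;; .push 1 true) ;; .pop 0 ;;
    .ite (.nonempty 0) (.push 0 false) skip ;; mv 1 0, 2, 2,
    by omega, by simp [RegsBelow, Test.RegsBelow, mv, skip], fun x n _ =>
      ⟨trivial, fun ρ h h1 h2 => ?_⟩⟩
  obtain ⟨m, r, e, hr⟩ := exists_replicate false n.bits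
  have hone := h2 1 (by omega) (by omega)
  have hlen : m + r.length = len n := by
    have := congrArg List.length e
    simpa [len, Obj.enc] using this.symm
  rw [len_nat] at hlen
  -- The one after the block of zeros becomes a zero. If it was the leading digit, this zero must
  -- disappear to keep the expansion canonical.
  set r' : List Bool := if r.tail = [] then [] else false :: r.tail with hr'
  have hlr : r'.length ≤ r.length := by
    rw [hr']
    rcases r with _ | ⟨b, r⟩
    · simp
    · split <;> simp
  have e1 : Exec x (2 * (len n + 1)) (.ite (.nonempty 0) (.push 0 false) skip)
      ⟨update (update ρ 0 r.tail) 1 (List.replicate m true), h⟩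
      ⟨update (update ρ 0 r') 1 (List.replicate m true), h⟩ := by
    by_cases hrt : r.tail = []
    · refine .iteF (by simp [eval_nonempty, hrt]) ((exec_skip ?_).congr ?_)
      · simp [hrt]
      · simp [hr', hrt]
    · refine .iteT (by simp [eval_nonempty, hrt]) ((exec_push ?_).congr ?_)
      · simp; omega
      · simp only [hr', hrt, if_false]
        ext1 i
        simp only [update_apply]
        split_ifs <;> simp_all
  refine ⟨h, .seq ((exec_flip false m (h1.trans e) hr ?_)) (.seq (exec_pop.congr ?_)
    (.seq e1 ((exec_mv (l := List.replicate m true) (by omega) ?_ ?_).congr ?_))), fun _ => rfl⟩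
  · simp [hone]; omega
  · ext1 i
    simp only [update_apply]
    split_ifs <;> simp_all
  · simp
  · simp; omega
  · have key : (n - 1).bits = List.replicate m true ++ r' := by
      -- A canonical expansion ends with a one, so it cannot consist of a nonempty block of zeros
      -- alone.
      have hmr : m = 0 ∨ r ≠ [] := by
        by_contra hcon
        push Not at hcon
        obtain ⟨hm, rfl⟩ := hcon
        obtain ⟨m, rfl⟩ := Nat.exists_eq_succ_of_ne_zero hm
        rcases Nat.eq_zero_or_pos n with rfl | hn
        · simp [List.replicate_succ] at e
        · have hg : n.bits.getLast? = some true := by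
            clear * - hn
            induction n using Nat.strong_induction_on with
            | _ n ih =>
              rcases Nat.even_or_odd' n with ⟨m, rfl | rfl⟩
              · rw [bits_bit0 (by omega), List.getLast?_cons, ih m (by omega) (by omega)]; rfl
              · rw [bits_bit1, List.getLast?_cons]
                rcases Nat.eq_zero_or_pos m with rfl | hm
                · rfl
                · rw [ih m (by omega) hm]; rfl
          rw [e] at hg
          simp [List.getLast?_replicate] at hg
      rw [bits_pred, e]
      clear * - hr hmr
      induction m with
      | zero =>
        rcases r with _ | ⟨b, _ | ⟨c, r⟩⟩
        · rfl
        · cases b <;> simp_all [decList, r']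
        · cases b <;> simp_all [decList, r']
      | succ m ih =>
        simp only [List.replicate_succ, List.cons_append, decList]
        rw [ih (.inr (by simpa using hmr))]
    ext1 i
    simp only [update_apply, Obj.enc, key]
    split_ifs <;> simp_all

theorem LS.neZero' : LS k (fun n : ℕ => n != 0) := by
  refine ⟨.ite (.nonempty 0) (clear 0 ;; .push 0 true) skip, 1, 1, by omega,
    by simp [RegsBelow, Test.RegsBelow, clear, skip], fun x n _ => ⟨trivial, fun ρ h h1 _ => ⟨h, ?_,
      fun _ => rfl⟩⟩⟩
  rcases Nat.eq_zero_or_pos n with rfl | hn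
  · refine .iteF (by simp [eval_nonempty, h1, Obj.enc])
      ((exec_skip (by simp [h1, Obj.enc])).congr ?_)
    simpa [Obj.enc] using h1
  · have : n.bits ≠ [] := by
      intro h
      have h' := Nat.size_eq_bits_len n
      rw [h] at h'
      have := Nat.size_pos.2 hn
      simp_all
    refine .iteT (by simp [eval_nonempty, h1, Obj.enc, this]) (.seq exec_clear
      ((exec_push (by simp)).congr ?_))
    have hn' : n ≠ 0 := by omega
    simp [Obj.enc, hn']

@[fun_prop] theorem LS.succ {f : α → ℕ} (hf : LS k f) : LS k (fun a => f a + 1) := LS.succ'.comp hf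

theorem LS.pred {f : α → ℕ} (hf : LS k f) : LS k (fun a => f a - 1) := LS.pred'.comp hf

theorem LS.neZero {f : α → ℕ} (hf : LS k f) : LS k (fun a => f a != 0) := LS.neZero'.comp hf

/-- Iteration with access to the counter. -/
def iter {β : Type} : ℕ → β → (ℕ → β → β) → β
  | 0, z, _ => z
  | n + 1, z, h => h n (iter n z h)

/-- The loop carries the parameter, an ascending counter for `h`, a descending counter for the test,
and the value. Two counters are used because the only test available so far is comparison with zero.
-/
theorem LS.iter {n : α → ℕ} {g : α → β} {h : α → ℕ → β → β} (hn : LS k n) (hg : LS k g)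
    (hh : LS k (fun p : α × ℕ × β => h p.1 p.2.1 p.2.2)) {c : ℕ}
    (hb : ∀ x a, Obj.compat x a → ∀ i ≤ n a, len (iter i (g a) (h a)) ≤ c * (len a + 1)) :
    LS k (fun a => iter (n a) (g a) (h a)) := by
  let F : α × ℕ × ℕ × β → α × ℕ × ℕ × β :=
    fun p => (p.1, p.2.1 + 1, p.2.2.1 - 1, h p.1 p.2.1 p.2.2.2)
  have hit : ∀ a i, F^[i] (a, 0, n a, g a) = (a, i, n a - i, ModelChecking.iter i (g a) (h a)) := by
    intro a i
    induction i with
    | zero => rfl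
    | succ i ih => rw [iterate_succ_apply', ih]; simp [F, ModelChecking.iter, Nat.sub_sub]
  have hF : LS k F := by
    have h1 : LS k (fun p : α × ℕ × ℕ × β => h p.1 p.2.1 p.2.2.2) :=
      hh.comp (g := fun p : α × ℕ × ℕ × β => (p.1, p.2.1, p.2.2.2)) (by fun_prop)
    have h2 : LS k (fun p : α × ℕ × ℕ × β => p.2.2.1 - 1) := LS.pred (by fun_prop)
    fun_prop
  have hI : LS k (fun a => (a, 0, n a, g a)) := by fun_prop
  have hC : LS k (fun p : α × ℕ × ℕ × β => p.2.2.1 != 0) := LS.neZero (by fun_prop)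
  obtain ⟨cn, hcn⟩ := hn.len_le
  have main := LS.while (c := 4 * cn + c + 5) hI hF hC n (fun x a _ => by simp [hit])
    (fun x a _ i hi => by simp [hit]; omega) (fun x a ha i hi => by
      have h1 := hb x a ha i hi
      have h2 := hcn x a ha
      have h3 : i.size ≤ (n a).size := Nat.size_le_size hi
      have h4 : (n a - i).size ≤ (n a).size := Nat.size_le_size (Nat.sub_le _ _)
      simp only [hit, len_pair, len_nat] at h1 h2 ⊢
      nlinarith)
  have := main.snd.snd.snd
  simpa [hit] using this

end

open TuringMachine Prog Function

section
variable {α β γ δ : Type} [Obj α] [Obj β] [Obj γ] [Obj δ] {k : Bool}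

/-! ### Arithmetic and comparison by counting -/

theorem size_add_le (a b : ℕ) : (a + b).size ≤ a.size + b.size + 1 := by
  rw [Nat.size_le]
  have h1 := Nat.lt_size_self a
  have h2 := Nat.lt_size_self b
  have h3 : 2 ^ a.size ≤ 2 ^ (a.size + b.size) := Nat.pow_le_pow_right (by omega) (by omega)
  have h4 : 2 ^ b.size ≤ 2 ^ (a.size + b.size) := Nat.pow_le_pow_right (by omega) (by omega)
  rw [pow_succ]
  omega

theorem size_mul_le (a b : ℕ) : (a * b).size ≤ a.size + b.size := by
  rcases Nat.eq_zero_or_pos b with rfl | hb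
  · simp
  rw [Nat.size_le, pow_add]
  exact Nat.mul_lt_mul_of_lt_of_le (Nat.lt_size_self a) (Nat.lt_size_self b).le (by positivity)

-- Adding by repeated increments takes exponentially many steps in the length of the numbers, but no
-- more space than the numbers themselves. Subtraction and multiplication are treated in the same
-- way.
@[fun_prop] theorem LS.add {f g : α → ℕ} (hf : LS k f) (hg : LS k g) :
    LS k (fun a => f a + g a) := by
  have e : ∀ i m : ℕ, ModelChecking.iter i m (fun _ s => s + 1) = m + i := by
    intro i m
    induction i with
    | zero => rfl
    | succ i ih => simp [ModelChecking.iter, ih]; ring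
  obtain ⟨cf, hcf⟩ := hf.len_le
  obtain ⟨cg, hcg⟩ := hg.len_le
  have := LS.iter (h := fun _ _ s => s + 1) (c := cf + cg + 1) hg hf (by fun_prop)
    (fun x a ha i hi => by
      have h1 := hcf x a ha
      have h2 := hcg x a ha
      have h3 := size_add_le (f a) i
      have h4 : i.size ≤ (g a).size := Nat.size_le_size hi
      simp only [e, len_nat] at *
      nlinarith)
  simpa only [e] using this

@[fun_prop] theorem LS.sub {f g : α → ℕ} (hf : LS k f) (hg : LS k g) :
    LS k (fun a => f a - g a) := by
  have e : ∀ i m : ℕ, ModelChecking.iter i m (fun _ s => s - 1) = m - i := by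
    intro i m
    induction i with
    | zero => rfl
    | succ i ih => simp [ModelChecking.iter, ih]; omega
  obtain ⟨cf, hcf⟩ := hf.len_le
  have := LS.iter (h := fun _ _ s => s - 1) (c := cf) hg hf (LS.pred (by fun_prop))
    (fun x a ha i hi => by
      have h1 := hcf x a ha
      have h4 : (f a - i).size ≤ (f a).size := Nat.size_le_size (Nat.sub_le _ _)
      simp only [e, len_nat] at *
      omega)
  simpa only [e] using this

@[fun_prop] theorem LS.mul {f g : α → ℕ} (hf : LS k f) (hg : LS k g) :
    LS k (fun a => f a * g a) := by
  have e : ∀ i m : ℕ, ModelChecking.iter i 0 (fun _ s => s + m) = m * i := by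
    intro i m
    induction i with
    | zero => rfl
    | succ i ih => simp [ModelChecking.iter, ih]; ring
  obtain ⟨cf, hcf⟩ := hf.len_le
  obtain ⟨cg, hcg⟩ := hg.len_le
  have := LS.iter (g := fun _ => 0) (h := fun a _ s => s + f a) (c := cf + cg) hg (by fun_prop)
    (by fun_prop)
    (fun x a ha i hi => by
      have h1 := hcf x a ha
      have h2 := hcg x a ha
      have h3 := size_mul_le (f a) i
      have h4 : i.size ≤ (g a).size := Nat.size_le_size hi
      simp only [e, len_nat] at *
      nlinarith)
  simpa only [e] using this

@[fun_prop] theorem LS.not {f : α → Bool} (hf : LS k f) : LS k (fun a => !f a) := by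
  have : LS k (fun a => bif f a then false else true) := by fun_prop
  convert this using 2 with a
  cases f a <;> rfl

@[fun_prop] theorem LS.and {f g : α → Bool} (hf : LS k f) (hg : LS k g) :
    LS k (fun a => f a && g a) := by
  have : LS k (fun a => bif f a then g a else false) := by fun_prop
  convert this using 2 with a
  cases f a <;> rfl

@[fun_prop] theorem LS.or {f g : α → Bool} (hf : LS k f) (hg : LS k g) :
    LS k (fun a => f a || g a) := by
  have : LS k (fun a => bif f a then true else g a) := by fun_prop
  convert this using 2 with a
  cases f a <;> rfl

/-- Boolean comparison of numbers. -/
def nle (a b : ℕ) : Bool := decide (a ≤ b)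

/-- Boolean strict comparison of numbers. -/
def nlt (a b : ℕ) : Bool := decide (a < b)

/-- Boolean equality of numbers. -/
def neq (a b : ℕ) : Bool := decide (a = b)

@[simp] theorem nle_iff {a b : ℕ} : nle a b = true ↔ a ≤ b := by simp [nle]
@[simp] theorem nlt_iff {a b : ℕ} : nlt a b = true ↔ a < b := by simp [nlt]
@[simp] theorem neq_iff {a b : ℕ} : neq a b = true ↔ a = b := by simp [neq]

@[fun_prop] theorem LS.nle {f g : α → ℕ} (hf : LS k f) (hg : LS k g) :
    LS k (fun a => nle (f a) (g a)) := by
  have : LS k (fun a => !(f a - g a != 0)) := (LS.neZero (hf.sub hg)).not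
  convert this using 2 with a
  rw [Bool.eq_iff_iff]
  simp
  omega

@[fun_prop] theorem LS.nlt {f g : α → ℕ} (hf : LS k f) (hg : LS k g) :
    LS k (fun a => nlt (f a) (g a)) := by
  have : LS k (fun a => ModelChecking.nle (f a + 1) (g a)) := by fun_prop
  exact this

@[fun_prop] theorem LS.neq {f g : α → ℕ} (hf : LS k f) (hg : LS k g) :
    LS k (fun a => neq (f a) (g a)) := by
  have : LS k (fun a => ModelChecking.nle (f a) (g a) && ModelChecking.nle (g a) (f a)) := by
    fun_prop
  convert this using 2 with a
  rw [Bool.eq_iff_iff]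
  simp
  omega

/-! ### Bounded quantification, counting and minimization -/

/-- Bounded existential quantification. -/
def bex (n : ℕ) (f : ℕ → Bool) : Bool := iter n false fun i s => s || f i

/-- Bounded universal quantification. -/
def ball (n : ℕ) (f : ℕ → Bool) : Bool := iter n true fun i s => s && f i

/-- Bounded counting. -/
def bcount (n : ℕ) (f : ℕ → Bool) : ℕ := iter n 0 fun i s => bif f i then s + 1 else s

/-- Bounded minimization, with value `n` if there is no witness below `n`. -/
def bmin (n : ℕ) (f : ℕ → Bool) : ℕ := bcount n fun i => ball (i + 1) fun j => !f j

@[simp] theorem bex_iff {n : ℕ} {f : ℕ → Bool} : bex n f = true ↔ ∃ i < n, f i = true := by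
  unfold bex
  induction n with
  | zero => simp [iter]
  | succ n ih => simp only [iter, Bool.or_eq_true, ih, Nat.exists_lt_succ_right]

@[simp] theorem ball_iff {n : ℕ} {f : ℕ → Bool} : ball n f = true ↔ ∀ i < n, f i = true := by
  unfold ball
  induction n with
  | zero => simp [iter]
  | succ n ih => simp only [iter, Bool.and_eq_true, ih, Nat.forall_lt_succ_right]

theorem bcount_eq (n : ℕ) (f : ℕ → Bool) :
    bcount n f = ((Finset.range n).filter fun i => f i = true).card := by
  induction n with
  | zero => rfl
  | succ n ih =>
    have : bcount (n + 1) f = bif f n then bcount n f + 1 else bcount n f := rfl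
    rw [this, Finset.range_add_one, Finset.filter_insert, ih]
    cases h : f n
    · simp
    · simp

theorem bcount_le (n : ℕ) (f : ℕ → Bool) : bcount n f ≤ n := by
  rw [bcount_eq]
  exact (Finset.card_filter_le _ _).trans (by simp)

theorem bcount_of_iff {n m : ℕ} {f : ℕ → Bool} (hm : m ≤ n) (h : ∀ i < n, f i = true ↔ i < m) :
    bcount n f = m := by
  rw [bcount_eq]
  have : (Finset.range n).filter (fun i => f i = true) = Finset.range m := by
    ext i
    simp only [Finset.mem_filter, Finset.mem_range]
    constructor
    · rintro ⟨h1, h2⟩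
      exact (h i h1).1 h2
    · intro h1
      exact ⟨by omega, (h i (by omega)).2 h1⟩
  rw [this, Finset.card_range]

theorem bmin_eq {n m : ℕ} {f : ℕ → Bool} (hm : m < n) (h : f m = true)
    (h' : ∀ i < m, f i = false) : bmin n f = m := by
  refine bcount_of_iff hm.le fun i _ => ?_
  simp only [ball_iff, Bool.not_eq_true']
  constructor
  · intro hi
    by_contra hcon
    have := hi m (by omega)
    simp_all
  · intro hi j hj
    exact h' j (by omega)

theorem bmin_eq_self {n : ℕ} {f : ℕ → Bool} (h : ∀ i < n, f i = false) : bmin n f = n := by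
  refine bcount_of_iff le_rfl fun i hi => ?_
  simp only [ball_iff, Bool.not_eq_true', hi, iff_true]
  exact fun j hj => h j (by omega)

theorem bmin_le (n : ℕ) (f : ℕ → Bool) : bmin n f ≤ n := bcount_le _ _

theorem bmin_spec {n : ℕ} {f : ℕ → Bool} (h : bmin n f < n) : f (bmin n f) = true := by
  by_cases hex : ∃ i < n, f i = true
  · classical
    obtain ⟨h1, h2⟩ := Nat.find_spec hex
    have : bmin n f = Nat.find hex := bmin_eq h1 h2 fun i hi => by
      have := Nat.find_min hex hi
      simp only [not_and, Bool.not_eq_true] at this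
      exact this (by omega)
    rwa [this]
  · push Not at hex
    have : bmin n f = n := bmin_eq_self fun i hi => by simpa using hex i hi
    omega

theorem bmin_min {n : ℕ} {f : ℕ → Bool} {i : ℕ} (h : i < bmin n f) : f i = false := by
  have hle := bmin_le n f
  by_contra hcon
  have hex : ∃ i < n, f i = true := ⟨i, by omega, by simpa using hcon⟩
  classical
  obtain ⟨h1, h2⟩ := Nat.find_spec hex
  have : bmin n f = Nat.find hex := bmin_eq h1 h2 fun i hi => by
    have := Nat.find_min hex hi
    simp only [not_and, Bool.not_eq_true] at this
    exact this (by omega)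
  have h3 := Nat.find_min' hex (m := i) ⟨by omega, by simpa using hcon⟩
  omega

@[fun_prop] theorem LS.bex {n : α → ℕ} {f : α → ℕ → Bool} (hn : LS k n)
    (hf : LS k (fun p : α × ℕ => f p.1 p.2)) : LS k (fun a => bex (n a) (fun i => f a i)) := by
  refine LS.iter (c := 1) hn (by fun_prop) ?_ (fun x a _ i _ => (len_bool _).trans (by omega))
  have := hf.comp (g := fun p : α × ℕ × Bool => (p.1, p.2.1)) (by fun_prop)
  fun_prop

@[fun_prop] theorem LS.ball {n : α → ℕ} {f : α → ℕ → Bool} (hn : LS k n)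
    (hf : LS k (fun p : α × ℕ => f p.1 p.2)) : LS k (fun a => ball (n a) (fun i => f a i)) := by
  refine LS.iter (c := 1) hn (by fun_prop) ?_ (fun x a _ i _ => (len_bool _).trans (by omega))
  have := hf.comp (g := fun p : α × ℕ × Bool => (p.1, p.2.1)) (by fun_prop)
  fun_prop

@[fun_prop] theorem LS.bcount {n : α → ℕ} {f : α → ℕ → Bool} (hn : LS k n)
    (hf : LS k (fun p : α × ℕ => f p.1 p.2)) : LS k (fun a => bcount (n a) (fun i => f a i)) := by
  obtain ⟨c, hc⟩ := hn.len_le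
  refine LS.iter (c := c) hn (by fun_prop) ?_ (fun x a ha i hi => ?_)
  · have := hf.comp (g := fun p : α × ℕ × ℕ => (p.1, p.2.1)) (by fun_prop)
    fun_prop
  · refine le_trans ?_ (hc x a ha)
    rw [len_nat, len_nat]
    exact Nat.size_le_size ((bcount_le i (f a)).trans hi)

@[fun_prop] theorem LS.bmin {n : α → ℕ} {f : α → ℕ → Bool} (hn : LS k n)
    (hf : LS k (fun p : α × ℕ => f p.1 p.2)) : LS k (fun a => bmin (n a) (fun i => f a i)) := by
  unfold ModelChecking.bmin
  refine LS.bcount hn (LS.ball (by fun_prop) (LS.not ?_))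
  exact hf.comp (g := fun p : (α × ℕ) × ℕ => (p.1.1, p.2)) (by fun_prop)

/-! ### Division, powers and binary length -/

@[fun_prop] theorem LS.div {f g : α → ℕ} (hf : LS k f) (hg : LS k g) :
    LS k (fun a => f a / g a) := by
  have : LS k (fun a => bif ModelChecking.neq (g a) 0 then 0 else
      ModelChecking.bcount (f a) fun q => ModelChecking.nle ((q + 1) * g a) (f a)) := by
    fun_prop
  convert this using 2 with a
  by_cases h : g a = 0
  · simp [h, ModelChecking.neq]
  · have h1 : ModelChecking.neq (g a) 0 = false := by simp [ModelChecking.neq, h]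
    rw [h1, cond_false]
    refine (bcount_of_iff (Nat.div_le_self _ _) fun i _ => ?_).symm
    rw [nle_iff, ← Nat.le_div_iff_mul_le (by omega)]
    omega

@[fun_prop] theorem LS.mod {f g : α → ℕ} (hf : LS k f) (hg : LS k g) :
    LS k (fun a => f a % g a) := by
  have : LS k (fun a => f a - g a * (f a / g a)) := by fun_prop
  convert this using 2 with a
  exact Nat.mod_eq_sub _ _

/-- Iterated division. -/
def idiv (b a i : ℕ) : ℕ := iter i a fun _ s => s / b

theorem idiv_eq (b a i : ℕ) : idiv b a i = a / b ^ i := by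
  unfold idiv
  induction i with
  | zero => simp [iter]
  | succ i ih => rw [iter, ih, Nat.div_div_eq_div_mul, pow_succ]

@[fun_prop] theorem LS.idiv {f g h : α → ℕ} (hf : LS k f) (hg : LS k g) (hh : LS k h) :
    LS k (fun a => idiv (f a) (g a) (h a)) := by
  obtain ⟨c, hc⟩ := hg.len_le
  refine LS.iter (h := fun a _ s => s / f a) (c := c) hh hg (by fun_prop) (fun x a ha i _ => ?_)
  have h1 := idiv_eq (f a) (g a) i
  rw [ModelChecking.idiv] at h1
  rw [h1]
  refine le_trans ?_ (hc x a ha)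
  rw [len_nat, len_nat]
  exact Nat.size_le_size (Nat.div_le_self _ _)

/-- The minimum of `m + 1` and `b ^ i`. -/
def tpow (m b i : ℕ) : ℕ := iter i 1 fun _ s => bif nle (s * b) m then s * b else m + 1

theorem tpow_le (m b i : ℕ) : tpow m b i ≤ m + 1 := by
  unfold tpow
  cases i with
  | zero => simp [iter]
  | succ i =>
    rw [iter, Bool.cond_eq_ite]
    split
    · rename_i h
      simp only [nle_iff] at h
      omega
    · omega

/-- A power may be far too long to be stored, and truncation still decides whether it is at most
`m`: since `b` is positive, the powers never fall back below a bound that they have exceeded. -/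
theorem tpow_le_iff {m b : ℕ} (hb : 0 < b) (i : ℕ) :
    (tpow m b i ≤ m ↔ b ^ i ≤ m) ∧ (tpow m b i ≤ m → tpow m b i = b ^ i) := by
  induction i with
  | zero => simp [tpow, iter]
  | succ i ih =>
    have e : tpow m b (i + 1) = bif nle (tpow m b i * b) m then tpow m b i * b else m + 1 := rfl
    have hle := tpow_le m b i
    rw [e, pow_succ]
    by_cases h : tpow m b i ≤ m
    · rw [← ih.2 h]
      by_cases h' : tpow m b i * b ≤ m
      · simp [h', nle]
      · simp [h', nle]
    · have h1 : tpow m b i = m + 1 := by omega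
      have h2 : ¬ b ^ i ≤ m := fun hc => h (ih.1.2 hc)
      have h3 : ¬ (m + 1) * b ≤ m := by nlinarith
      have h4 : ¬ b ^ i * b ≤ m := by nlinarith
      simp [h1, nle, h3, h4]

@[fun_prop] theorem LS.tpow {f g h : α → ℕ} (hf : LS k f) (hg : LS k g) (hh : LS k h) :
    LS k (fun a => tpow (f a) (g a) (h a)) := by
  obtain ⟨c, hc⟩ := hf.len_le
  refine LS.iter (h := fun a _ s => bif ModelChecking.nle (s * g a) (f a) then s * g a else f a + 1)
    (c := c + 2) hh (by fun_prop) (by fun_prop) (fun x a ha i _ => ?_)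
  have h1 := tpow_le (f a) (g a) i
  rw [ModelChecking.tpow] at h1
  have h2 := Nat.size_le_size h1
  have h3 := size_add_le (f a) 1
  have h4 := hc x a ha
  rw [len_nat] at *
  have : Nat.size 1 = 1 := by simp
  nlinarith

/-- Powers with constant exponent. -/
theorem LS.pow_const {f : α → ℕ} (hf : LS k f) (n : ℕ) : LS k (fun a => f a ^ n) := by
  induction n with
  | zero => simp only [pow_zero]; fun_prop
  | succ n ih => simp only [pow_succ]; fun_prop

@[fun_prop] theorem LS.size {f : α → ℕ} (hf : LS k f) : LS k (fun a => (f a).size) := by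
  have : LS k (fun a => ModelChecking.bcount (f a) fun i =>
      !ModelChecking.neq (ModelChecking.idiv 2 (f a) i) 0) := by fun_prop
  convert this using 2 with a
  refine (bcount_of_iff ?_ fun i _ => ?_).symm
  · rw [Nat.size_le]
    exact Nat.lt_two_pow_self
  · simp only [Bool.not_eq_true', ← Bool.not_eq_true, neq_iff, idiv_eq]
    rw [Nat.lt_size, Nat.div_eq_zero_iff]
    have : 0 < 2 ^ i := by positivity
    omega

/-! ### Passes over the input -/

theorem exec_rewind {x : List Bool} {S h : ℕ} {ρ : ℕ → List Bool} :
    Exec x S (.loop .notLeft .left) ⟨ρ, h⟩ ⟨ρ, 0⟩ := by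
  induction h using Nat.strong_induction_on with
  | _ h ih =>
    rcases h with _ | h
    · exact .loopF rfl
    · refine .loopT ?_ .left (ih _ ?_)
      · change (match readInput x (h + 1) with
          | .leftEnd => false
          | _ => true) = true
        rw [readInput]
        rcases x[h]? with _ | b <;> rfl
      · simp

/-- A left-to-right pass over the input. -/
theorem LS.foldInput [Plain α] {I : γ → α} {F : Bool × α → α} (hI : LS false I)
    (hF : LS true F) {c : ℕ}
    (hb : ∀ (y : List Bool) (a : γ), len (y.foldl (fun s b => F (b, s)) (I a)) ≤ c * (len a + 1)) :
    LS false (fun p : Inp × γ => p.1.word.foldl (fun s b => F (b, s)) (I p.2)) := by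
  obtain ⟨Q, K', c', hK', hQ, H'⟩ := hI.comp (LS.snd' (k := false) (α := Inp) (β := γ))
  obtain ⟨P, K, C, hK, hP, H⟩ := hF
  refine ⟨Q ;; .loop .notLeft .left ;; .right ;; .loop .notRight
    (.ite .bitTrue (.push 0 false ;; .push 0 true ;; .push 0 true) (.push 0 false) ;; P ;; .right),
    max K K', c' + (C + 1) * (c + 4), by omega, ⟨hQ.mono (le_max_right _ _),
      ⟨trivial, trivial⟩, trivial, trivial, ⟨trivial, ?_, ?_⟩, hP.mono (le_max_left _ _), trivial⟩,
    fun x p hp => ⟨Plain.compat _ _, ?_⟩⟩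
  · simp [RegsBelow]; omega
  · simp [RegsBelow]; omega
  obtain ⟨⟨y⟩, a⟩ := p
  obtain rfl : y = x := hp.1
  refine ((H' y _ hp).2.mono (le_max_right _ _) (Nat.mul_le_mul_right _ (by omega))).seq ?_
  intro ρ h h1 h2
  simp only [len_pair, len_inp] at h1 ⊢
  set S := (c' + (C + 1) * (c + 4)) * (2 * 0 + len a + 1 + 1) with hS
  set s : ℕ → α := fun i => (y.take i).foldl (fun s b => F (b, s)) (I a) with hs
  have hsl : ∀ i, len (s i) ≤ c * (len a + 1) := fun i => hb _ _
  have main : ∀ m ≤ y.length, Exec y S (.loop .notRight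
      (.ite .bitTrue (.push 0 false ;; .push 0 true ;; .push 0 true) (.push 0 false) ;;
        P ;; .right))
      ⟨update ρ 0 (Obj.enc (s (y.length - m))), y.length - m + 1⟩
      ⟨update ρ 0 (Obj.enc (s y.length)), y.length + 1⟩ := by
    intro m
    induction m with
    | zero =>
      intro _
      refine .loopF ?_
      change (match readInput y (y.length + 1) with
          | .rightEnd => false
          | _ => true) = false
      simp [readInput]
    | succ m ih =>
      intro hm
      obtain ⟨i, hi⟩ : ∃ i, y.length - (m + 1) = i := ⟨_, rfl⟩
      have hi' : y.length - m = i + 1 := by omega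
      have hil : i < y.length := by omega
      specialize ih (by omega)
      rw [hi'] at ih
      rw [hi]
      have hread : readInput y (i + 1) = .bit y[i] := by simp [readInput, hil]
      have hss : s (i + 1) = F (y[i], s i) := by
        simp only [hs]
        rw [List.take_add_one, List.foldl_append]
        simp [hil]
      have hlp : len (y[i], s i) ≤ c * (len a + 1) + 3 := by
        have := hsl i
        have := len_bool y[i]
        rw [len_pair]; omega
      have hlS : C * (len (y[i], s i) + 1) ≤ S := by
        rw [hS]
        have h1 : C * (len (y[i], s i) + 1) ≤ C * ((c + 4) * (len a + 2)) := by
          apply Nat.mul_le_mul_left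
          nlinarith
        refine h1.trans ?_
        rw [← mul_assoc]
        apply Nat.mul_le_mul
        · nlinarith
        · omega
      have hlS' : len (s i) + 3 ≤ S := by
        have h1 : len (s i) + 3 ≤ 1 * ((c + 4) * (len a + 2)) := by
          have := hsl i
          nlinarith
        refine h1.trans ?_
        rw [hS, ← mul_assoc]
        apply Nat.mul_le_mul
        · nlinarith
        · omega
      -- These pushes put the scanned bit in front of the state as first component of a pair: `true`
      -- has the one-bit code `[true]`, flagged to two ones, and `false` has the empty code; in both
      -- cases the separator `false` is pushed first.
      have e1 : Exec y S
          (.ite .bitTrue (.push 0 false ;; .push 0 true ;; .push 0 true) (.push 0 false))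
          ⟨update ρ 0 (Obj.enc (s i)), i + 1⟩ ⟨update ρ 0 (Obj.enc (y[i], s i)), i + 1⟩ := by
        have hl0 : (Obj.enc (s i)).length + 3 ≤ S := hlS'
        have hev : Test.bitTrue.eval y ⟨update ρ 0 (Obj.enc (s i)), i + 1⟩ = y[i] := by
          change (match readInput y (i + 1) with
            | .bit b => b
            | _ => false) = _
          rw [hread]
        cases hy : y[i] with
        | true =>
          refine .iteT (by rw [hev, hy]) (.seq (exec_push ?_) (.seq (exec_push ?_)
            ((exec_push ?_).congr ?_)))
          · simp; omega
          · simp; omega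
          · simp; omega
          · simp [Obj.enc, flagged]
        | false =>
          refine .iteF (by rw [hev, hy]) ((exec_push ?_).congr ?_)
          · simp; omega
          · simp [Obj.enc, flagged]
      -- Here it matters that `F` is computed without moving the input head: the pass continues at
      -- the next cell.
      obtain ⟨h', e2, k2⟩ := ((H y (y[i], s i) (Plain.compat _ _)).2.mono (le_max_left K K') hlS)
        (update ρ 0 (Obj.enc (y[i], s i))) (i + 1) (by simp)
        (fun j hj hj' => by rw [update_of_ne (by omega)]; exact h2 j hj hj')
      rw [k2 rfl, ← hss, update_idem] at e2
      have e3 : Exec y S .right ⟨update ρ 0 (Obj.enc (s (i + 1))), i + 1⟩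
          ⟨update ρ 0 (Obj.enc (s (i + 1))), i + 1 + 1⟩ := by
        have := Exec.right (x := y) (S := S) (σ := ⟨update ρ 0 (Obj.enc (s (i + 1))), i + 1⟩)
        rwa [min_eq_left (by simp; omega)] at this
      refine .loopT ?_ (.seq e1 (.seq e2 e3)) ih
      change (match readInput y (i + 1) with
          | .rightEnd => false
          | _ => true) = true
      rw [hread]
  have e2 : Exec y S .right ⟨ρ, 0⟩ ⟨ρ, 1⟩ := by
    have := Exec.right (x := y) (S := S) (σ := ⟨ρ, 0⟩)
    rwa [min_eq_left (by simp)] at this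
  have e3 := main y.length le_rfl
  simp only [Nat.sub_self, zero_add] at e3
  have hs0 : s 0 = I a := by simp [hs]
  rw [hs0, ← h1, update_eq_self] at e3
  have hsn : s y.length = y.foldl (fun s b => F (b, s)) (I a) := by simp [hs]
  rw [hsn] at e3
  exact ⟨_, .seq exec_rewind (.seq e2 e3), by simp⟩

end

/-! ### Reading the input letter by letter -/

/-- The value of the block of bits of a letter, plus one. -/
def Letter.code : Letter → ℕ
  | .zero => 1
  | .one => 2
  | .var => 3
  | .con => 4
  | .rel => 5
  | .equal => 6
  | .neg => 7
  | .and => 8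
  | .or => 9
  | .ex => 10
  | .all => 11
  | .univ => 12
  | .tup => 13
  | .elt => 14
  | .sep => 15

/-- Collect bits into blocks of four, starting from `acc = 1`, and apply `g` to every block. -/
def blockStep {σ : Type} (g : ℕ × σ → σ) (p : Bool × ℕ × σ) : ℕ × σ :=
  bif nlt (2 * p.2.1 + bif p.1 then 1 else 0) 16 then (2 * p.2.1 + bif p.1 then 1 else 0, p.2.2)
  else (1, g (2 * p.2.1 + (bif p.1 then 1 else 0) - 15, p.2.2))

theorem ls_blockStep {σ : Type} [Obj σ] {g : ℕ × σ → σ} (hg : LS true g) :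
    LS true (blockStep g) := by
  unfold blockStep
  fun_prop

/-- The accumulator starts with a leading one, so a block of four bits with value `v` brings it to
`16 + v`, and the letter is passed on as `v + 1`. In this way `0` stays free to mean that there is
no letter. -/
theorem foldl_blockStep {σ : Type} (g : ℕ × σ → σ) (w : List Letter) (s : σ) (y : List Bool) :
    (toBinary w ++ y).foldl (fun s b => blockStep g (b, s)) (1, s) =
      y.foldl (fun s b => blockStep g (b, s)) (1, w.foldl (fun s l => g (l.code, s)) s) := by
  induction w generalizing s with
  | nil => rfl
  | cons l w ih =>
    rw [List.foldl_cons, ← ih]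
    simp only [toBinary, List.flatMap_cons, List.append_assoc]
    rw [List.foldl_append]
    congr 1
    cases l <;> simp [Letter.toBits, blockStep, nlt, Letter.code]

/-- The bound has to hold for every binary string, including strings that encode nothing, so the
invariant `P` must be preserved for every `c`. The accumulator stays below `16` and contributes a
constant. -/
theorem len_blockStep {σ : Type} [Obj σ] {g : ℕ × σ → σ} {B : ℕ} (P : σ → Prop)
    (hP : ∀ c s, P s → P (g (c, s))) (hB : ∀ s, P s → len s ≤ B) (y : List Bool) (s : σ)
    (hs : P s) : len (y.foldl (fun s b => blockStep g (b, s)) (1, s)) ≤ B + 11 := by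
  have key : ∀ (n : ℕ) (s : σ), n < 16 → P s →
      (y.foldl (fun s b => blockStep g (b, s)) (n, s)).1 < 16 ∧
        P (y.foldl (fun s b => blockStep g (b, s)) (n, s)).2 := by
    induction y with
    | nil => exact fun n s hn hs => ⟨hn, hs⟩
    | cons b y ih =>
      intro n s hn hs
      rw [List.foldl_cons]
      unfold blockStep
      by_cases h : 2 * n + (bif b then 1 else 0) < 16
      · simp only [nlt, h, decide_true, cond_true]
        exact ih _ _ h hs
      · simp only [nlt, h, decide_false, cond_false]
        exact ih _ _ (by omega) (hP _ _ hs)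
  obtain ⟨h1, h2⟩ := key 1 s (by omega) hs
  rw [len_prod, len_nat]
  have h3 : Nat.size (y.foldl (fun s b => blockStep g (b, s)) (1, s)).1 ≤ 4 := by
    rw [Nat.size_le]; omega
  have := hB _ h2
  omega

/-- The block of four ones is the only one that is not a letter, so reading in blocks succeeds,
meets this block, or ends inside a block. -/
theorem exists_toBinary (x : List Bool) : (∃ w, x = toBinary w) ∨
    (∃ w y, x = toBinary w ++ ([true, true, true, true] ++ y)) ∨
    ∃ w r, x = toBinary w ++ r ∧ r ≠ [] ∧ r.length < 4 := by
  induction hn : x.length using Nat.strong_induction_on generalizing x with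
  | _ n ih =>
    subst hn
    rcases x with _ | ⟨b1, _ | ⟨b2, _ | ⟨b3, _ | ⟨b4, x⟩⟩⟩⟩
    · exact .inl ⟨[], rfl⟩
    · exact .inr (.inr ⟨[], _, rfl, by simp, by simp⟩)
    · exact .inr (.inr ⟨[], _, rfl, by simp, by simp⟩)
    · exact .inr (.inr ⟨[], _, rfl, by simp, by simp⟩)
    · have hl : (∃ l : Letter, [b1, b2, b3, b4] = l.toBits) ∨
          [b1, b2, b3, b4] = [true, true, true, true] := by
        cases b1 <;> cases b2 <;> cases b3 <;> cases b4
        exacts [.inl ⟨.zero, rfl⟩, .inl ⟨.one, rfl⟩, .inl ⟨.var, rfl⟩, .inl ⟨.con, rfl⟩,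
          .inl ⟨.rel, rfl⟩, .inl ⟨.equal, rfl⟩, .inl ⟨.neg, rfl⟩, .inl ⟨.and, rfl⟩,
          .inl ⟨.or, rfl⟩, .inl ⟨.ex, rfl⟩, .inl ⟨.all, rfl⟩, .inl ⟨.univ, rfl⟩,
          .inl ⟨.tup, rfl⟩, .inl ⟨.elt, rfl⟩, .inl ⟨.sep, rfl⟩, .inr rfl]
      rcases hl with ⟨l, hl⟩ | hl
      · have e : ∀ z, b1 :: b2 :: b3 :: b4 :: z = l.toBits ++ z := fun z => by rw [← hl]; rfl
        rcases ih x.length (by simp; omega) x rfl with ⟨w, rfl⟩ | ⟨w, y, rfl⟩ | ⟨w, r, rfl, h⟩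
        · exact .inl ⟨l :: w, by rw [e]; rfl⟩
        · exact .inr (.inl ⟨l :: w, y, by rw [e]; simp [toBinary]⟩)
        · exact .inr (.inr ⟨l :: w, r, by rw [e]; simp [toBinary], h⟩)
      · refine .inr (.inl ⟨[], x, ?_⟩)
        rw [← hl]; rfl

/-! ### The format of the input -/

/-- A token: a letter that is not a digit, followed by digits. -/
abbrev Tok := Letter × List Bool

/-- The letter of a digit. -/
def digit (b : Bool) : Letter := if b then .one else .zero

/-- The word of a list of tokens. -/
def render (T : List Tok) : List Letter := T.flatMap fun t => t.1 :: t.2.map digit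

/-- The letters that start a token. -/
def Letter.IsHead : Letter → Prop
  | .zero => False
  | .one => False
  | .sep => False
  | _ => True

/-- A token whose digits are the binary expansion of a number. -/
def numTok (p : Letter × ℕ) : Tok := (p.1, p.2.bits)

/-- A token that describes an arity. -/
def arityTok (r : ℕ) : Tok := (.rel, List.replicate r true)

/-- The word that consists of the three given sections. -/
def sections (T0 T1 T2 : List Tok) : List Letter :=
  render T0 ++ .sep :: (render T1 ++ .sep :: render T2)

/-- The transitions of the automaton that checks the format of the input; its states are pairs of
a phase (`0`, `1` or `2` for the sections, `3` for rejection) and the kind of the last letter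
(`0` for none, `2` for a zero, `1` otherwise). -/
def formatStep (p : ℕ × ℕ × ℕ) : ℕ × ℕ :=
  bif nle 3 p.2.1 || nle 16 p.1 then (3, 0)
  else bif neq p.2.1 2 then
    bif neq p.1 5 then (2, 1)
    else bif neq p.1 2 && !neq p.2.2 0 then (2, 1) else (3, 0)
  else bif nle p.1 2 then
    bif neq p.2.2 0 then (3, 0) else bif neq p.1 1 then (p.2.1, 2) else (p.2.1, 1)
  else bif neq p.2.2 2 then (3, 0)
  else bif neq p.1 15 then (p.2.1 + 1, 0)
  else (p.2.1, 1)

/-- The check of the format of the input. -/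
def format (x : Inp) : Bool :=
  let s := x.word.foldl (fun s b => blockStep formatStep (b, s)) (1, 0, 0)
  neq s.1 1 && neq s.2.1 2

theorem formatStep_bounds (c : ℕ) (s : ℕ × ℕ) (hs : s.1 ≤ 3 ∧ s.2 ≤ 2) :
    (formatStep (c, s)).1 ≤ 3 ∧ (formatStep (c, s)).2 ≤ 2 := by
  obtain ⟨a, b⟩ := s
  simp only [formatStep, Bool.cond_eq_ite, Bool.or_eq_true, nle_iff, neq_iff] at *
  split_ifs <;> simp <;> omega

@[fun_prop] theorem ls_format {α : Type} [Obj α] {f : α → Inp} (hf : LS false f) :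
    LS false (fun a => format (f a)) := by
  have h1 : LS true formatStep := by unfold formatStep; fun_prop
  have h2 := LS.foldInput (γ := ℕ) (I := fun _ => (1, 0, 0)) (c := 20) (by fun_prop)
    (ls_blockStep h1) (fun y a => (len_blockStep (B := 9) (fun s : ℕ × ℕ => s.1 ≤ 3 ∧ s.2 ≤ 2)
      formatStep_bounds (fun s hs => by
        have : s.1.size ≤ 2 := by rw [Nat.size_le]; omega
        have : s.2.size ≤ 2 := by rw [Nat.size_le]; omega
        rw [len_prod, len_nat, len_nat]
        omega) y (0, 0) (by simp)).trans (by nlinarith))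
  have h3 := h2.comp (g := fun a => (f a, 0)) (by fun_prop)
  unfold format
  fun_prop

theorem format_bad (w : List Letter) (n : ℕ) :
    (w.foldl (fun s l => formatStep (l.code, s)) (3, n)).1 = 3 := by
  induction w generalizing n with
  | nil => rfl
  | cons l w ih =>
    rw [List.foldl_cons]
    exact ih _

theorem exists_arities {la : ℕ} (w : List Letter)
    (h : (w.foldl (fun s l => formatStep (l.code, s)) (2, la)).1 = 2) :
    ∃ (r : ℕ) (T : List ℕ), w = List.replicate r .one ++ render (T.map arityTok) ∧
      (la = 0 → r = 0) := by
  induction w generalizing la with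
  | nil => exact ⟨0, [], rfl, fun _ => rfl⟩
  | cons l w ih =>
    rw [List.foldl_cons] at h
    have hbad : ∀ {s}, s = (3, 0) →
        (w.foldl (fun s l => formatStep (l.code, s)) s).1 = 2 → False := by
      rintro s rfl h
      rw [format_bad] at h
      omega
    cases l
    case rel =>
      obtain ⟨r, T, rfl, -⟩ := ih (la := 1) h
      exact ⟨0, r :: T, by simp [render, arityTok, digit], fun _ => rfl⟩
    case one =>
      rcases Nat.eq_zero_or_pos la with rfl | hla
      · exact (hbad rfl h).elim
      · have e : formatStep (Letter.one.code, (2, la)) = (2, 1) := by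
          have : la ≠ 0 := by omega
          simp [formatStep, Letter.code, nle, neq, this]
        rw [e] at h
        obtain ⟨r, T, rfl, -⟩ := ih h
        exact ⟨r + 1, T, by simp [List.replicate_succ], fun h => by omega⟩
    all_goals exact (hbad rfl h).elim

/-- The least significant digit comes first, so an expansion is canonical exactly if it does not end
with a zero. -/
theorem exists_bits (l : List Bool) (h : l = [] ∨ l.getLast? = some true) :
    ∃ n : ℕ, l = n.bits := by
  induction l with
  | nil => exact ⟨0, rfl⟩
  | cons b l ih =>
    have h' : l = [] ∨ l.getLast? = some true := by grind
    obtain ⟨n, rfl⟩ := ih h'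
    cases b
    · refine ⟨2 * n, (bits_bit0 ?_).symm⟩
      rintro rfl
      simp at h
    · exact ⟨2 * n + 1, (bits_bit1 n).symm⟩

theorem formatStep_head {ph la : ℕ} (hph : ph < 2) {l : Letter} (hl : l.IsHead) :
    formatStep (l.code, (ph, la)) = if la = 2 then (3, 0) else (ph, 1) := by
  have h1 : ¬ 3 ≤ ph := by omega
  have h2 : ph ≠ 2 := by omega
  by_cases hla : la = 2 <;> cases l <;>
    first
    | exact hl.elim
    | simp [formatStep, Letter.code, nle, neq, h1, h2, hla]

theorem formatStep_sep {ph la : ℕ} (hph : ph < 2) :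
    formatStep (Letter.sep.code, (ph, la)) = if la = 2 then (3, 0) else (ph + 1, 0) := by
  have h1 : ¬ 3 ≤ ph := by omega
  have h2 : ph ≠ 2 := by omega
  by_cases hla : la = 2 <;> simp [formatStep, Letter.code, nle, neq, h1, h2, hla]

/-- The induction runs from the front of the word, so it has to carry digits `d` that belong to a
token whose letter has been consumed already. The last clause says that this token has no leading
zeros, its previous digit being recorded in `la`. -/
theorem exists_section {ph la : ℕ} (hph : ph < 2) (w : List Letter)
    (h : (w.foldl (fun s l => formatStep (l.code, s)) (ph, la)).1 = 2) :
    ∃ (d : List Bool) (T : List (Letter × ℕ)) (v : List Letter),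
      w = d.map digit ++ (render (T.map numTok) ++ .sep :: v) ∧
      (∀ t ∈ T, t.1.IsHead) ∧ (v.foldl (fun s l => formatStep (l.code, s)) (ph + 1, 0)).1 = 2 ∧
      (la = 0 → d = []) ∧ (d = [] ∧ la ≠ 2 ∨ d.getLast? = some true) := by
  induction w generalizing la with
  | nil => simp at h; omega
  | cons l w ih =>
    rw [List.foldl_cons] at h
    have hbad : ∀ {s}, s = (3, 0) →
        (w.foldl (fun s l => formatStep (l.code, s)) s).1 = 2 → False := by
      rintro s rfl h
      rw [format_bad] at h
      omega
    have hdig : ∀ b : Bool, formatStep ((digit b).code, (ph, la)) =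
        if la = 0 then (3, 0) else (ph, if b then 1 else 2) := by
      intro b
      cases b <;> by_cases hla : la = 0 <;>
        simp [formatStep, digit, Letter.code, nle, neq, hla, show ¬ 3 ≤ ph by omega,
          show ph ≠ 2 by omega]
    have hd : ∀ b : Bool, l = digit b → ∃ (d : List Bool) (T : List (Letter × ℕ)) (v : List Letter),
        l :: w = d.map digit ++
        (render (T.map numTok) ++ .sep :: v) ∧ (∀ t ∈ T, t.1.IsHead) ∧
        (v.foldl (fun s l => formatStep (l.code, s)) (ph + 1, 0)).1 = 2 ∧
        (la = 0 → d = []) ∧ (d = [] ∧ la ≠ 2 ∨ d.getLast? = some true) := by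
      rintro b rfl
      rw [hdig] at h
      by_cases hla : la = 0
      · grind
      · rw [if_neg hla] at h
        obtain ⟨d, T, v, rfl, h1, h2, h3, h4⟩ := ih h
        refine ⟨b :: d, T, v, by simp, h1, h2, fun h => absurd h hla, .inr ?_⟩
        rcases h4 with ⟨rfl, h4⟩ | h4
        · cases b <;> simp_all
        · rw [List.getLast?_cons, h4]; rfl
    have hhead : l.IsHead → ∃ (d : List Bool) (T : List (Letter × ℕ)) (v : List Letter),
        l :: w = d.map digit ++
        (render (T.map numTok) ++ .sep :: v) ∧ (∀ t ∈ T, t.1.IsHead) ∧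
        (v.foldl (fun s l => formatStep (l.code, s)) (ph + 1, 0)).1 = 2 ∧
        (la = 0 → d = []) ∧ (d = [] ∧ la ≠ 2 ∨ d.getLast? = some true) := by
      intro hl
      rw [formatStep_head hph hl] at h
      by_cases hla : la = 2
      · grind
      · rw [if_neg hla] at h
        obtain ⟨d, T, v, rfl, h1, h2, h3, h4⟩ := ih h
        obtain ⟨n, rfl⟩ := exists_bits d (h4.imp (fun h => h.1) id)
        exact ⟨[], (l, n) :: T, v, by simp [render, numTok],
          by simpa using ⟨hl, fun a b h => h1 (a, b) h⟩, h2,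
          fun _ => rfl, .inl ⟨rfl, hla⟩⟩
    cases l
    case zero => exact hd false rfl
    case one => exact hd true rfl
    case sep =>
      rw [formatStep_sep hph] at h
      by_cases hla : la = 2
      · rw [if_pos hla] at h
        exact (hbad rfl h).elim
      · rw [if_neg hla] at h
        exact ⟨[], [], w, by simp [render], by simp, h, fun _ => rfl, .inl ⟨rfl, hla⟩⟩
    all_goals exact hhead trivial

theorem exists_sections_of_format {x : Inp} (h : format x = true) :
    ∃ (T0 T1 : List (Letter × ℕ)) (ar : List ℕ), (∀ t ∈ T0, t.1.IsHead) ∧ (∀ t ∈ T1, t.1.IsHead) ∧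
      x.word = toBinary (sections (T0.map numTok) (T1.map numTok) (ar.map arityTok)) := by
  obtain ⟨x⟩ := x
  simp only [format, Bool.and_eq_true, neq_iff] at h
  have hbad : ∀ (y : List Bool) (n : ℕ × ℕ), n.1 < 16 →
      (y.foldl (fun s b => blockStep formatStep (b, s)) (n.1, 3, n.2)).2.1 = 3 := by
    intro y
    induction y with
    | nil => exact fun _ _ => rfl
    | cons b y ih =>
      rintro ⟨n, m⟩ hn
      rw [List.foldl_cons]
      by_cases h : 2 * n + (bif b then 1 else 0) < 16
      · have e : blockStep formatStep (b, n, 3, m) = (2 * n + (bif b then 1 else 0), 3, m) := by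
          simp [blockStep, nlt, h]
        rw [e]
        exact ih (_, m) h
      · have e : blockStep formatStep (b, n, 3, m) = (1, 3, 0) := by
          simp [blockStep, nlt, h, formatStep, nle]
        rw [e]
        exact ih (1, 0) (by omega)
  rcases exists_toBinary x with ⟨w, rfl⟩ | ⟨w, y, rfl⟩ | ⟨w, r, rfl, hr, hr'⟩
  · have e := foldl_blockStep formatStep w (0, 0) []
    rw [List.append_nil] at e
    rw [e] at h
    obtain ⟨d, T0, v, rfl, h1, h2, h3, -⟩ := exists_section (by omega) w h.2
    obtain rfl := h3 rfl
    obtain ⟨d, T1, v, rfl, h4, h5, h6, -⟩ := exists_section (by omega) v h2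
    obtain rfl := h6 rfl
    obtain ⟨r, ar, rfl, hr⟩ := exists_arities v h5
    obtain rfl := hr rfl
    exact ⟨T0, T1, ar, h1, h4, rfl⟩
  -- The block that is not a letter has the code `16`, which sends the automaton to the rejecting
  -- phase `3`, and this phase is never left.
  · rw [foldl_blockStep, List.foldl_append] at h
    obtain ⟨m, hm⟩ : ∃ m, [true, true, true, true].foldl (fun s b => blockStep formatStep (b, s))
        (1, w.foldl (fun s l => formatStep (l.code, s)) (0, 0)) = (1, 3, m) := by
      generalize w.foldl (fun s l => formatStep (l.code, s)) (0, 0) = s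
      exact ⟨0, by simp [blockStep, nlt, formatStep, nle]⟩
    rw [hm] at h
    have := hbad y (1, m) (by omega)
    simp only at this
    omega
  -- An incomplete block leaves the accumulator different from `1`.
  · rw [foldl_blockStep] at h
    generalize w.foldl (fun s l => formatStep (l.code, s)) (0, 0) = s at h
    exfalso
    rcases r with _ | ⟨b1, _ | ⟨b2, _ | ⟨b3, _ | ⟨b4, r⟩⟩⟩⟩
    · exact hr rfl
    · revert h; cases b1 <;> simp [blockStep, nlt]
    · revert h; cases b1 <;> cases b2 <;> simp [blockStep, nlt]
    · revert h; cases b1 <;> cases b2 <;> cases b3 <;> simp [blockStep, nlt]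
    · simp at hr'; omega

theorem foldl_formatStep_digits {ph : ℕ} (hph : ph < 2) (d : List Bool) (la : ℕ)
    (hla : la ≠ 0) (hd : d = [] ∨ d.getLast? = some true) (hla' : d = [] → la = 1) :
    (d.map digit).foldl (fun s l => formatStep (l.code, s)) (ph, la) = (ph, 1) := by
  induction d generalizing la with
  | nil => simp [hla' rfl]
  | cons b d ih =>
    rw [List.map_cons, List.foldl_cons]
    have e : formatStep ((digit b).code, (ph, la)) = (ph, if b then 1 else 2) := by
      cases b <;> simp [formatStep, digit, Letter.code, nle, neq, hla, show ¬ 3 ≤ ph by omega,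
          show ph ≠ 2 by omega]
    rw [e]
    refine ih _ (by cases b <;> simp) ?_ ?_
    · rcases d with _ | ⟨c, d⟩
      · exact .inl rfl
      · right; simpa [List.getLast?_cons_cons] using hd
    · rintro rfl
      cases b <;> simp_all

theorem getLast?_bits {n : ℕ} : n.bits = [] ∨ n.bits.getLast? = some true := by
  induction n using Nat.strong_induction_on with
  | _ n ih =>
    rcases Nat.even_or_odd' n with ⟨m, rfl | rfl⟩
    · rcases Nat.eq_zero_or_pos m with rfl | hm
      · exact .inl rfl
      · right
        rw [bits_bit0 (by omega), List.getLast?_cons]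
        rcases ih m (by omega) with h | h
        · have := Nat.size_eq_bits_len m
          rw [h] at this
          have := Nat.size_pos.2 hm
          simp_all
        · rw [h]; rfl
    · right
      rw [bits_bit1, List.getLast?_cons]
      rcases Nat.eq_zero_or_pos m with rfl | hm
      · rfl
      · rcases ih m (by omega) with h | h
        · rw [h]; rfl
        · rw [h]; rfl

theorem foldl_formatStep_section {ph la : ℕ} (hph : ph < 2) (hla : la ≠ 2)
    (T : List (Letter × ℕ)) (hT : ∀ t ∈ T, t.1.IsHead) :
    (render (T.map numTok) ++ [Letter.sep]).foldl (fun s l => formatStep (l.code, s)) (ph, la) =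
      (ph + 1, 0) := by
  induction T generalizing la with
  | nil =>
    simp [render, formatStep_sep hph, hla]
  | cons t T ih =>
    obtain ⟨l, n⟩ := t
    have hl : l.IsHead := hT (l, n) (by simp)
    have e : formatStep (l.code, (ph, la)) = (ph, 1) := by
      rw [formatStep_head hph hl, if_neg hla]
    simp only [render, numTok, List.map_cons, List.flatMap_cons, List.cons_append,
      List.append_assoc, List.foldl_cons, e, List.foldl_append]
    rw [foldl_formatStep_digits hph _ 1 (by omega) getLast?_bits (fun _ => rfl)]
    have := ih (la := 1) (by omega) fun t ht => hT t (by simp [ht])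
    rwa [List.foldl_append] at this

theorem format_of_sections {T0 T1 : List (Letter × ℕ)} {ar : List ℕ}
    (h0 : ∀ t ∈ T0, t.1.IsHead) (h1 : ∀ t ∈ T1, t.1.IsHead) :
    format ⟨toBinary (sections (T0.map numTok) (T1.map numTok) (ar.map arityTok))⟩ = true := by
  have e := foldl_blockStep formatStep
    (sections (T0.map numTok) (T1.map numTok) (ar.map arityTok)) (0, 0) []
  rw [List.append_nil] at e
  simp only [format, e, List.foldl_nil, Bool.and_eq_true, neq_iff, true_and]
  have h2 : sections (T0.map numTok) (T1.map numTok) (ar.map arityTok) =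
      (render (T0.map numTok) ++ [.sep]) ++ ((render (T1.map numTok) ++ [.sep]) ++
        render (ar.map arityTok)) := by simp [sections]
  rw [h2, List.foldl_append, foldl_formatStep_section (by omega) (by omega) _ h0,
    List.foldl_append, foldl_formatStep_section (by omega) (by omega) _ h1]
  clear h2 e
  have key : ∀ la, ((render (ar.map arityTok)).foldl (fun s l => formatStep (l.code, s))
      (2, la)).1 = 2 := by
    induction ar with
    | nil => exact fun _ => rfl
    | cons r ar ih =>
      intro la
      have hr : ∀ n, (List.replicate n Letter.one).foldl (fun s l => formatStep (l.code, s))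
          (2, 1) = (2, 1) := by
        intro n
        induction n with
        | zero => rfl
        | succ n ih => rw [List.replicate_succ, List.foldl_cons]; exact ih
      simp only [render, List.map_cons, arityTok, List.flatMap_cons, List.map_replicate, digit,
        if_true, List.cons_append, List.foldl_cons, List.foldl_append]
      have e : formatStep (Letter.rel.code, (2, la)) = (2, 1) := rfl
      rw [e, hr]
      exact ih _
  exact key _

/-! ### Random access to the tokens -/

/-- The letter of token `j`, if `i = 0`, and its `i`-th digit, if `i > 0`. -/
def tokenGet (T : List Tok) (j i : ℕ) : ℕ :=
  match T[j]? with
  | none => 0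
  | some t => if i = 0 then t.1.code else
    match t.2[i - 1]? with
    | none => 0
    | some b => (digit b).code

/-- The transitions of the search for a letter; the state consists of the number of sections, tokens
and digits to be skipped and of the successor of the result. -/
def getStep (p : ℕ × ℕ × ℕ × ℕ × ℕ) : ℕ × ℕ × ℕ × ℕ :=
  bif !neq p.2.2.2.2 0 then p.2
  else bif !neq p.2.1 0 then
    bif neq p.1 15 then (p.2.1 - 1, p.2.2) else p.2
  else bif !neq p.2.2.1 0 then
    bif nle p.1 2 then p.2
    else bif nle 15 p.1 then (0, 0, 0, 1)
    else bif neq p.2.2.1 1 && neq p.2.2.2.1 0 then (0, 0, 0, p.1 + 1)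
    else (0, p.2.2.1 - 1, p.2.2.2.1, 0)
  else bif nle p.1 2 then
    bif neq p.2.2.2.1 1 then (0, 0, 0, p.1 + 1) else (0, 0, p.2.2.2.1 - 1, 0)
  else (0, 0, 0, 1)

/-- The code of letter `i` of token `j` of section `s` of the input. -/
def get (x : Inp) (s j i : ℕ) : ℕ :=
  (x.word.foldl (fun s b => blockStep getStep (b, s)) (1, s, j + 1, i, 0)).2.2.2.2 - 1

theorem getStep_bounds {s j i : ℕ} (c : ℕ) (p : ℕ × ℕ × ℕ × ℕ)
    (h : p.1 ≤ s ∧ p.2.1 ≤ j ∧ p.2.2.1 ≤ i ∧ p.2.2.2 ≤ 15) :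
    (getStep (c, p)).1 ≤ s ∧ (getStep (c, p)).2.1 ≤ j ∧ (getStep (c, p)).2.2.1 ≤ i ∧
      (getStep (c, p)).2.2.2 ≤ 15 := by
  obtain ⟨a, b, d, e⟩ := p
  simp only [getStep, Bool.cond_eq_ite, Bool.and_eq_true, Bool.not_eq_true', nle_iff, neq_iff] at *
  split_ifs <;> simp <;> omega

@[fun_prop] theorem ls_get {α : Type} [Obj α] {f : α → Inp} {s j i : α → ℕ} (hf : LS false f)
    (hs : LS false s) (hj : LS false j) (hi : LS false i) :
    LS false (fun a => get (f a) (s a) (j a) (i a)) := by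
  have h1 : LS true getStep := by unfold getStep; fun_prop
  have h2 := LS.foldInput (γ := ℕ × ℕ × ℕ)
    (I := fun a => (1, a.1, a.2.1 + 1, a.2.2, 0)) (c := 40) (by fun_prop)
    (ls_blockStep h1) (fun y a => (len_blockStep
      (B := 2 * a.1.size + 2 * (a.2.1 + 1).size + 2 * a.2.2.size + 10)
      (fun p : ℕ × ℕ × ℕ × ℕ => p.1 ≤ a.1 ∧ p.2.1 ≤ a.2.1 + 1 ∧ p.2.2.1 ≤ a.2.2 ∧ p.2.2.2 ≤ 15)
      getStep_bounds (fun p hp => by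
        have h1 := Nat.size_le_size hp.1
        have h2 := Nat.size_le_size hp.2.1
        have h3 := Nat.size_le_size hp.2.2.1
        have : p.2.2.2.size ≤ 4 := by rw [Nat.size_le]; omega
        simp only [len_prod, len_nat]
        omega) y (a.1, a.2.1 + 1, a.2.2, 0) (by simp)).trans (by
          have := size_add_le a.2.1 1
          have h1 : Nat.size 1 = 1 := by simp
          simp only [len_prod, len_nat]
          omega))
  have h3 := h2.comp (g := fun a => (f a, s a, j a, i a)) (by fun_prop)
  unfold get
  fun_prop

theorem foldl_getStep_done (w : List Letter) (s j i r : ℕ) :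
    w.foldl (fun s l => getStep (l.code, s)) (s, j, i, r + 1) = (s, j, i, r + 1) := by
  induction w with
  | nil => rfl
  | cons l w ih => rw [List.foldl_cons]; exact ih

theorem foldl_getStep_skip {T : List Tok} (hT : ∀ t ∈ T, t.1.IsHead) (w : List Letter)
    (s j i : ℕ) : (render T ++ Letter.sep :: w).foldl (fun s l => getStep (l.code, s))
      (s + 1, j, i, 0) = w.foldl (fun s l => getStep (l.code, s)) (s, j, i, 0) := by
  have key : ∀ v : List Letter, (∀ l ∈ v, l.code ≠ 15) →
      v.foldl (fun s l => getStep (l.code, s)) (s + 1, j, i, 0) = (s + 1, j, i, 0) := by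
    intro v hv
    induction v with
    | nil => rfl
    | cons l v ih =>
      have e : getStep (l.code, s + 1, j, i, 0) = (s + 1, j, i, 0) := by
        simp [getStep, neq, hv l (by simp)]
      rw [List.foldl_cons, e]
      exact ih fun l hl => hv l (by simp [hl])
  rw [List.foldl_append, key, List.foldl_cons]
  · congr 1
  · intro l hl
    simp only [render, List.mem_flatMap, List.mem_cons, List.mem_map] at hl
    obtain ⟨t, ht, rfl | ⟨b, -, rfl⟩⟩ := hl
    · have := hT t ht
      cases h : t.1 <;> simp_all [Letter.IsHead, Letter.code]
    · cases b <;> simp [digit, Letter.code]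

/-- The result is stored increased by one, so that `0` means that the search goes on. A letter that
is not a digit ends the token and stores `1`, that is, the result `0`; the end of the word leaves
`0`, and truncated subtraction gives the result `0` again. -/
theorem foldl_getStep_digits (d : List Bool) (w : List Letter) (i : ℕ)
    (hw : w = [] ∨ ∃ l v, w = l :: v ∧ 2 < l.code) :
    ((d.map digit ++ w).foldl (fun s l => getStep (l.code, s)) (0, 0, i + 1, 0)).2.2.2 - 1 =
      match d[i]? with
      | none => 0
      | some b => (digit b).code := by
  induction d generalizing i with
  | nil =>
    rcases hw with rfl | ⟨l, v, rfl, hl⟩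
    · simp
    · have e : getStep (l.code, 0, 0, i + 1, 0) = (0, 0, 0, 1) := by
        simp [getStep, neq, nle, show ¬ l.code ≤ 2 by omega]
      simp only [List.map_nil, List.nil_append, List.foldl_cons, e, foldl_getStep_done]
      simp
  | cons b d ih =>
    have hb : (digit b).code ≤ 2 := by cases b <;> simp [digit, Letter.code]
    rcases i with _ | i
    · have e : getStep ((digit b).code, 0, 0, 0 + 1, 0) = (0, 0, 0, (digit b).code + 1) := by
        simp [getStep, neq, nle, hb]
      simp only [List.map_cons, List.cons_append, List.foldl_cons, e, foldl_getStep_done]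
      simp
    · have e : getStep ((digit b).code, 0, 0, i + 1 + 1, 0) = (0, 0, i + 1, 0) := by
        simp [getStep, neq, nle, hb]
      simp only [List.map_cons, List.cons_append, List.foldl_cons, e]
      rw [ih]
      simp

theorem Letter.IsHead.code_bounds {l : Letter} (h : l.IsHead) : 2 < l.code ∧ l.code < 15 := by
  cases l <;> first | exact h.elim | simp [Letter.code]

theorem foldl_getStep_section {T : List Tok} (hT : ∀ t ∈ T, t.1.IsHead) {w : List Letter}
    (hw : w = [] ∨ ∃ v, w = .sep :: v) (j i : ℕ) :
    ((render T ++ w).foldl (fun s l => getStep (l.code, s)) (0, j + 1, i, 0)).2.2.2 - 1 =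
      tokenGet T j i := by
  induction T generalizing j with
  | nil =>
    rcases hw with rfl | ⟨v, rfl⟩
    · simp [render, tokenGet]
    · have e : getStep (Letter.sep.code, 0, j + 1, i, 0) = (0, 0, 0, 1) := by
        simp [getStep, neq, nle, Letter.code]
      simp only [render, List.flatMap_nil, List.nil_append, List.foldl_cons, e,
        foldl_getStep_done]
      simp [tokenGet]
  | cons t T ih =>
    obtain ⟨l, d⟩ := t
    have hT' : ∀ t ∈ T, t.1.IsHead := fun t ht => hT t (by simp [ht])
    have hl : 2 < l.code ∧ l.code < 15 := (hT (l, d) (by simp)).code_bounds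
    have hskip : ∀ j i : ℕ, (d.map digit).foldl (fun s l => getStep (l.code, s))
        (0, j + 1, i, 0) = (0, j + 1, i, 0) := by
      intro j i
      induction d with
      | nil => rfl
      | cons b d ih' =>
        have e : getStep ((digit b).code, 0, j + 1, i, 0) = (0, j + 1, i, 0) := by
          cases b <;> simp [getStep, neq, nle, digit, Letter.code]
        rw [List.map_cons, List.foldl_cons, e]
        exact ih' (fun t ht => by
          rcases List.mem_cons.1 ht with rfl | ht
          · exact hT (l, b :: d) (by simp)
          · exact hT' t ht)
    have er : render ((l, d) :: T) ++ w = l :: (d.map digit ++ (render T ++ w)) := by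
      simp [render]
    rw [er, List.foldl_cons]
    rcases j with _ | j
    · rcases i with _ | i
      · have e : getStep (l.code, 0, 0 + 1, 0, 0) = (0, 0, 0, l.code + 1) := by
          simp [getStep, neq, nle, show ¬ l.code ≤ 2 by omega, show ¬ 15 ≤ l.code by omega]
        rw [e, foldl_getStep_done]
        simp [tokenGet]
      · have e : getStep (l.code, 0, 0 + 1, i + 1, 0) = (0, 0, i + 1, 0) := by
          simp [getStep, neq, nle, show ¬ l.code ≤ 2 by omega, show ¬ 15 ≤ l.code by omega]
        rw [e, foldl_getStep_digits]
        · simp [tokenGet]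
        · rcases T with _ | ⟨⟨l', d'⟩, T⟩
          · rcases hw with rfl | ⟨v, rfl⟩
            · exact .inl rfl
            · exact .inr ⟨_, _, rfl, by simp [Letter.code]⟩
          · exact .inr ⟨l', _, rfl, (hT' (l', d') (by simp)).code_bounds.1⟩
    · have e : getStep (l.code, 0, j + 1 + 1, i, 0) = (0, j + 1, i, 0) := by
        simp [getStep, neq, nle, show ¬ l.code ≤ 2 by omega, show ¬ 15 ≤ l.code by omega]
      rw [e, List.foldl_append, hskip, ih hT']
      simp [tokenGet]

theorem get_sections {T0 T1 T2 : List Tok} (h0 : ∀ t ∈ T0, t.1.IsHead)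
    (h1 : ∀ t ∈ T1, t.1.IsHead) (h2 : ∀ t ∈ T2, t.1.IsHead) {x : Inp}
    (hx : x.word = toBinary (sections T0 T1 T2)) (j i : ℕ) :
    get x 0 j i = tokenGet T0 j i ∧ get x 1 j i = tokenGet T1 j i ∧
      get x 2 j i = tokenGet T2 j i := by
  have key : ∀ s, get x s j i = ((sections T0 T1 T2).foldl
      (fun s l => getStep (l.code, s)) (s, j + 1, i, 0)).2.2.2 - 1 := by
    intro s
    have e := foldl_blockStep getStep (sections T0 T1 T2) (s, j + 1, i, 0) []
    rw [List.append_nil] at e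
    rw [get, hx, e]
    rfl
  refine ⟨?_, ?_, ?_⟩
  · rw [key, sections, foldl_getStep_section h0 (.inr ⟨_, rfl⟩)]
  · rw [key, sections, foldl_getStep_skip h0, foldl_getStep_section h1 (.inr ⟨_, rfl⟩)]
  · rw [key, sections, foldl_getStep_skip h0, foldl_getStep_skip h1]
    have := foldl_getStep_section h2 (.inl rfl) j i
    rwa [List.append_nil] at this

/-! ### Numbers of tokens -/

/-- The code of the `k`-th binary digit of `n`, and `0` if there is none. -/
def bitCode (n k : ℕ) : ℕ := bif nlt k n.size then idiv 2 n k % 2 + 1 else 0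

/-- The number written in token `j` of section `s`, cut off at `N + 1`. -/
def num (x : Inp) (N s j : ℕ) : ℕ :=
  bmin (N + 1) fun n => ball (N + 1) fun k => neq (get x s j (k + 1)) (bitCode n k)

section

variable {α : Type} [Obj α] {x : α → Inp} {N s j u z : α → ℕ}

@[fun_prop] theorem ls_bitCode (hs : LS false s) (hj : LS false j) :
    LS false (fun a => bitCode (s a) (j a)) := by
  unfold bitCode; fun_prop

@[fun_prop] theorem ls_num (hx : LS false x) (hN : LS false N) (hs : LS false s)
    (hj : LS false j) : LS false (fun a => num (x a) (N a) (s a) (j a)) := by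
  unfold num; fun_prop

end

theorem bits_getElem? (n k : ℕ) :
    n.bits[k]? = if k < n.size then some (decide (n / 2 ^ k % 2 = 1)) else none := by
  induction n using Nat.strong_induction_on generalizing k with
  | _ n ih =>
    rw [← Nat.size_eq_bits_len]
    rcases Nat.even_or_odd' n with ⟨m, rfl | rfl⟩
    · rcases Nat.eq_zero_or_pos m with rfl | hm
      · simp
      · rw [bits_bit0 (by omega)]
        rcases k with _ | k
        · simp
        · rw [List.getElem?_cons_succ, ih m (by omega), ← Nat.size_eq_bits_len, pow_succ',
            ← Nat.div_div_eq_div_mul]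
          simp
    · rw [bits_bit1]
      rcases k with _ | k
      · simp
      · rcases Nat.eq_zero_or_pos m with rfl | hm
        · simp
        · rw [List.getElem?_cons_succ, ih m (by omega), ← Nat.size_eq_bits_len, pow_succ',
            ← Nat.div_div_eq_div_mul, show (2 * m + 1) / 2 = m by omega]
          simp

theorem bitCode_eq (n k : ℕ) : bitCode n k = match n.bits[k]? with
    | none => 0
    | some b => (digit b).code := by
  rw [bits_getElem?, bitCode, idiv_eq]
  by_cases h : k < n.size
  · have : n / 2 ^ k % 2 = 0 ∨ n / 2 ^ k % 2 = 1 := by omega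
    rcases this with h' | h' <;> simp [nlt, h, h', digit, Letter.code]
  · simp [nlt, h]

/-- `bitCode` also shows where an expansion ends: it vanishes at the length of `n`, which is at most
`K`. So the lengths agree, and a bound on the length of `n` alone suffices. -/
theorem bitCode_injective {n m K : ℕ} (hn : n.size ≤ K)
    (h : ∀ k ≤ K, bitCode n k = bitCode m k) : n = m := by
  have hz : ∀ {n k}, bitCode n k = 0 ↔ n.size ≤ k := by
    intro n k
    by_cases h : k < n.size <;> simp [bitCode, nlt, h]; omega
  have hs : n.size = m.size := by grind
  have hb : n.bits = m.bits := by
    apply List.ext_getElem?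
    intro k
    rw [bits_getElem?, bits_getElem?, ← hs]
    by_cases hk : k < n.size
    · have := h k (by omega)
      simp only [bitCode, nlt, ← hs, hk, decide_true, cond_true, idiv_eq] at this
      grind
    · simp [hk]
  have := congrArg (fun l : List Bool => l.foldr Nat.bit 0) hb
  have key : ∀ n : ℕ, n.bits.foldr Nat.bit 0 = n := by
    intro n
    induction n using Nat.strong_induction_on with
    | _ n ih =>
      rcases Nat.even_or_odd' n with ⟨m, rfl | rfl⟩
      · rcases Nat.eq_zero_or_pos m with rfl | hm
        · rfl
        · rw [bits_bit0 (by omega), List.foldr_cons, ih m (by omega)]; rfl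
      · rw [bits_bit1, List.foldr_cons, ih m (by omega)]; rfl
  simpa [key] using this

theorem tokenGet_zero (T : List Tok) (j : ℕ) :
    tokenGet T j 0 = (T[j]?).elim 0 fun t => t.1.code := by
  cases h : T[j]? <;> simp [tokenGet, h]

theorem tokenGet_succ {T : List (Letter × ℕ)} {j : ℕ} {t : Letter × ℕ} (h : T[j]? = some t)
    (i : ℕ) : tokenGet (T.map numTok) j (i + 1) = bitCode t.2 i := by
  simp only [tokenGet, List.getElem?_map, h, bitCode_eq]
  simp [numTok]

/-- A candidate `n ≤ N` has at most `N` digits, so comparing the first `N + 1` digits, absent ones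
included, identifies it. A larger number matches no candidate and yields `N + 1`. -/
theorem num_eq {x : Inp} {s : ℕ} {T : List (Letter × ℕ)}
    (hg : ∀ j i, get x s j i = tokenGet (T.map numTok) j i) (N : ℕ) {j : ℕ} {t : Letter × ℕ}
    (h : T[j]? = some t) : num x N s j = min t.2 (N + 1) := by
  have hsz : ∀ n ≤ N, n.size ≤ N := fun n hn =>
    (Nat.size_le.2 Nat.lt_two_pow_self).trans hn
  have key : ∀ n < N + 1, (ball (N + 1) fun k => neq (get x s j (k + 1)) (bitCode n k)) = true →
      t.2 = n := by
    intro n hn h'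
    rw [ball_iff] at h'
    refine (bitCode_injective (hsz n (by omega)) fun k hk => ?_).symm
    have := h' k (by omega)
    rw [neq_iff, hg, tokenGet_succ h] at this
    exact this.symm
  by_cases hN : t.2 ≤ N
  · rw [min_eq_left (by omega)]
    apply bmin_eq (by omega)
    · rw [ball_iff]
      intro k _
      rw [neq_iff, hg, tokenGet_succ h]
    · intro n hn
      by_contra h'
      have := key n (by omega) (by simpa using h')
      omega
  · rw [min_eq_right (by omega)]
    apply bmin_eq_self
    grind

/-! ### Formulas as lists of tokens -/

/-- The code of the letter of token `j`, and `0` if there is none. -/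
def kindAt (T : List (Letter × ℕ)) (j : ℕ) : ℕ := (T[j]?).elim 0 fun t => t.1.code

/-- The number of token `j`. -/
def indexAt (T : List (Letter × ℕ)) (j : ℕ) : ℕ := (T[j]?).elim 0 fun t => t.2

/-- The token of a term. -/
def Term.tok {τ : Vocabulary} : Term τ → Letter × ℕ
  | .var x => (.var, x)
  | .const c => (.con, c)

/-- The tokens of a formula. -/
def Formula.toks {τ : Vocabulary} : Formula τ → List (Letter × ℕ)
  | .equal t u => [(.equal, 0), t.tok, u.tok]
  | .rel i ts => (.rel, i) :: List.ofFn fun j => (ts j).tok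
  | .neg φ => (.neg, 0) :: φ.toks
  | .and φ ψ => (.and, 0) :: (φ.toks ++ ψ.toks)
  | .or φ ψ => (.or, 0) :: (φ.toks ++ ψ.toks)
  | .ex x φ => (.ex, x) :: φ.toks
  | .all x φ => (.all, x) :: φ.toks

theorem render_tok {τ : Vocabulary} (t : Term τ) : render [numTok t.tok] = t.write := by
  cases t <;> simp [render, numTok, Term.tok, Term.write, writeNat, digit]

theorem render_append (T T' : List Tok) : render (T ++ T') = render T ++ render T' := by
  simp [render]

theorem render_cons (l : Letter) (n : ℕ) (T : List Tok) :
    render (numTok (l, n) :: T) = l :: (writeNat n ++ render T) := by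
  simp [render, numTok, writeNat, digit]

theorem render_toks {τ : Vocabulary} (φ : Formula τ) : render (φ.toks.map numTok) = φ.write := by
  have h0 : writeNat 0 = [] := by simp [writeNat]
  induction φ with
  | equal t u =>
    have h1 := render_tok t
    have h2 := render_tok u
    simp only [Formula.toks, List.map_cons, List.map_nil, render_cons, Formula.write, h0]
    rw [← h1, ← h2, ← render_append]
    rfl
  | rel i ts =>
    simp only [Formula.toks, List.map_cons, render_cons, Formula.write]
    congr 2
    rw [List.map_ofFn, List.ofFn_eq_map]
    induction List.finRange (τ.arity i) with
    | nil => rfl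
    | cons j l ih =>
      rw [List.map_cons, List.flatMap_cons, ← ih, ← render_tok, ← render_append]
      rfl
  | neg φ ih => simp [Formula.toks, Formula.write, render_cons, h0, ih]
  | and φ ψ ih1 ih2 =>
    simp [Formula.toks, Formula.write, render_cons, h0, render_append, ih1, ih2]
  | or φ ψ ih1 ih2 =>
    simp [Formula.toks, Formula.write, render_cons, h0, render_append, ih1, ih2]
  | ex y φ ih => simp [Formula.toks, Formula.write, render_cons, ih]
  | all y φ ih => simp [Formula.toks, Formula.write, render_cons, ih]

/-- The number of tokens of a formula. -/
def Formula.len {τ : Vocabulary} (φ : Formula τ) : ℕ := φ.toks.length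

section

variable {τ : Vocabulary} (φ ψ : Formula τ) (y : ℕ)

@[simp] theorem len_equal (t u : Term τ) : (Formula.equal t u).len = 3 := rfl
@[simp] theorem len_rel (i : Fin τ.numRels) (ts) : (Formula.rel i ts).len = τ.arity i + 1 := by
  simp [Formula.len, Formula.toks]
@[simp] theorem len_neg : (Formula.neg φ).len = φ.len + 1 := by simp [Formula.len, Formula.toks]
@[simp] theorem len_and : (Formula.and φ ψ).len = φ.len + ψ.len + 1 := by
  simp [Formula.len, Formula.toks]
@[simp] theorem len_or : (Formula.or φ ψ).len = φ.len + ψ.len + 1 := by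
  simp [Formula.len, Formula.toks]
@[simp] theorem len_ex : (Formula.ex y φ).len = φ.len + 1 := by simp [Formula.len, Formula.toks]
@[simp] theorem len_all : (Formula.all y φ).len = φ.len + 1 := by simp [Formula.len, Formula.toks]

theorem Formula.len_pos : 0 < φ.len := by cases φ <;> simp

end

/-- The code of the first letter of a formula. -/
def Formula.kind {τ : Vocabulary} : Formula τ → ℕ
  | .equal _ _ => 6
  | .rel _ _ => 5
  | .neg _ => 7
  | .and _ _ => 8
  | .or _ _ => 9
  | .ex _ _ => 10
  | .all _ _ => 11

theorem Formula.kind_bounds {τ : Vocabulary} (φ : Formula τ) : 5 ≤ φ.kind ∧ φ.kind ≤ 11 := by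
  cases φ <;> simp [Formula.kind]

/-- The subformula `φ` occurs in the list of tokens at position `u`. -/
def Occ {τ : Vocabulary} (T : List (Letter × ℕ)) (u : ℕ) (φ : Formula τ) : Prop :=
  φ.toks <+: T.drop u ∧ kindAt T (u + φ.len) ≠ 3 ∧ kindAt T (u + φ.len) ≠ 4

section

variable {τ : Vocabulary} {T : List (Letter × ℕ)} {u : ℕ} {φ ψ : Formula τ} {y : ℕ}

theorem Occ.getElem? (h : Occ T u φ) {i : ℕ} (hi : i < φ.len) : T[u + i]? = φ.toks[i]? := by
  obtain ⟨⟨R, hR⟩, -⟩ := h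
  rw [← List.getElem?_drop, ← hR, List.getElem?_append_left hi]

theorem Occ.le_length (h : Occ T u φ) : u + φ.len ≤ T.length := by
  have h1 := h.getElem? (i := φ.len - 1) (by have := φ.len_pos; omega)
  have hp := φ.len_pos
  rw [List.getElem?_eq_getElem (l := φ.toks) (by unfold Formula.len at *; omega)] at h1
  grind

theorem Occ.kindAt (h : Occ T u φ) : kindAt T u = φ.kind := by
  have h1 := h.getElem? (i := 0) φ.len_pos
  rw [Nat.add_zero] at h1
  rw [ModelChecking.kindAt, h1]
  cases φ <;> simp [Formula.toks, Formula.kind, Letter.code]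

/-- After a subformula there comes either whatever follows the whole formula or the first token of
another formula, and neither is a term. This preserves the condition that the terms of an atomic
formula end where the formula ends. -/
theorem Occ.of_prefix (h : Occ T u φ) {k : ℕ} (P R : List (Letter × ℕ))
    (e : φ.toks = P ++ (ψ.toks ++ R)) (hP : P.length = k) (hR : R = [] ∨ ∃ χ : Formula τ, ∃ R',
      R = χ.toks ++ R') : Occ T (u + k) ψ := by
  obtain ⟨⟨Q, hQ⟩, h1⟩ := h
  have hd : T.drop (u + k) = ψ.toks ++ (R ++ Q) := by
    rw [← List.drop_drop, ← hQ, e, ← hP]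
    simp
  refine ⟨⟨R ++ Q, hd.symm⟩, ?_⟩
  rcases hR with rfl | ⟨χ, R', rfl⟩
  · have : φ.len = k + ψ.len := by simp [Formula.len, e, hP]
    grind
  · have h2 : T[u + k + ψ.len]? = χ.toks[0]? := by
      rw [← List.getElem?_drop, hd, Formula.len, List.getElem?_append_right le_rfl, Nat.sub_self,
        List.append_assoc, List.getElem?_append_left χ.len_pos]
    rw [ModelChecking.kindAt, h2]
    cases χ <;> simp [Formula.toks, Letter.code]

end

/-! ### Immediate subformulas and unique readability -/

/-- `Child u φ c ψ`: if `φ` occurs at `u`, then the immediate subformula `ψ` occurs at `c`. -/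
inductive Child {τ : Vocabulary} : ℕ → Formula τ → ℕ → Formula τ → Prop
  | neg (u φ) : Child u (.neg φ) (u + 1) φ
  | andLeft (u φ ψ) : Child u (.and φ ψ) (u + 1) φ
  | andRight (u φ ψ) : Child u (.and φ ψ) (u + 1 + φ.len) ψ
  | orLeft (u φ ψ) : Child u (.or φ ψ) (u + 1) φ
  | orRight (u φ ψ) : Child u (.or φ ψ) (u + 1 + φ.len) ψ
  | ex (u y φ) : Child u (.ex y φ) (u + 1) φ
  | all (u y φ) : Child u (.all y φ) (u + 1) φ

section

variable {τ : Vocabulary} {T : List (Letter × ℕ)} {u c : ℕ} {φ ψ : Formula τ}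

/-- The immediate subformulas of the different kinds of formulas. -/
theorem child_cases_iff : Child u φ c ψ ↔ match φ with
    | .equal .. | .rel .. => False
    | .neg χ | .ex _ χ | .all _ χ => c = u + 1 ∧ ψ = χ
    | .and χ χ' | .or χ χ' => c = u + 1 ∧ ψ = χ ∨ c = u + 1 + χ.len ∧ ψ = χ' := by
  refine ⟨fun h => by cases h <;> simp, fun h => ?_⟩
  cases φ <;> simp only at h
  on_goal 2 => rcases h with h | h
  on_goal 4 => rcases h with h | h
  all_goals obtain ⟨rfl, rfl⟩ := h; constructor

theorem Child.occ (h : Child u φ c ψ) (hu : Occ T u φ) : Occ T c ψ := by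
  cases h with
  | neg => exact hu.of_prefix [(.neg, 0)] [] (by simp [Formula.toks]) rfl (.inl rfl)
  | andLeft φ ψ =>
    exact hu.of_prefix [(.and, 0)] ψ.toks (by simp [Formula.toks]) rfl (.inr ⟨ψ, [], by simp⟩)
  | andRight φ ψ =>
    rw [add_assoc]
    exact hu.of_prefix ((.and, 0) :: φ.toks) [] (by simp [Formula.toks])
      (by simp [Formula.len]; omega) (.inl rfl)
  | orLeft φ ψ =>
    exact hu.of_prefix [(.or, 0)] ψ.toks (by simp [Formula.toks]) rfl (.inr ⟨ψ, [], by simp⟩)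
  | orRight φ ψ =>
    rw [add_assoc]
    exact hu.of_prefix ((.or, 0) :: φ.toks) [] (by simp [Formula.toks])
      (by simp [Formula.len]; omega) (.inl rfl)
  | ex y => exact hu.of_prefix [(.ex, y)] [] (by simp [Formula.toks]) rfl (.inl rfl)
  | all y => exact hu.of_prefix [(.all, y)] [] (by simp [Formula.toks]) rfl (.inl rfl)

theorem Child.lt (h : Child u φ c ψ) : u < c := by cases h <;> omega

theorem Child.le (h : Child u φ c ψ) : c + ψ.len ≤ u + φ.len := by cases h <;> simp <;> omega

theorem Child.nodes_lt (h : Child u φ c ψ) : ψ.nodes < φ.nodes := by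
  cases h <;> simp [Formula.nodes] <;> omega

/-- Every proper position inside a formula that is not atomic lies in an immediate subformula. -/
theorem exists_child (hk : 7 ≤ φ.kind) {z : ℕ} (h1 : u < z) (h2 : z < u + φ.len) :
    ∃ c ψ, Child u φ c ψ ∧ c ≤ z ∧ z < c + ψ.len := by
  cases φ <;> simp [Formula.kind, child_cases_iff, or_and_right, exists_or] at * <;> omega

theorem Term.tok_code (t : Term τ) : t.tok.1.code = 3 ∨ t.tok.1.code = 4 := by
  cases t <;> simp [Term.tok, Letter.code]

/-- Below the first token of an atomic formula there are only terms. -/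
theorem Occ.kindAt_of_atomic (hu : Occ T u φ) (hk : φ.kind < 7) {z : ℕ} (h1 : u < z)
    (h2 : z < u + φ.len) : ModelChecking.kindAt T z = 3 ∨ ModelChecking.kindAt T z = 4 := by
  obtain ⟨i, rfl⟩ := Nat.exists_eq_add_of_lt h1
  have h := hu.getElem? (i := i + 1) (by omega)
  rw [show u + i + 1 = u + (i + 1) by omega, ModelChecking.kindAt, h]
  cases φ with
  | equal t s =>
    simp only [len_equal] at h2
    have : i = 0 ∨ i = 1 := by omega
    rcases this with rfl | rfl
    · simpa [Formula.toks] using t.tok_code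
    · simpa [Formula.toks] using s.tok_code
  | rel k ts =>
    simp only [len_rel] at h2
    have hi : i < τ.arity k := by omega
    simpa [Formula.toks, List.getElem?_ofFn, hi] using (ts ⟨i, hi⟩).tok_code
  | neg | and | or | ex | all => simp [Formula.kind] at hk

/-- Every node inside an occurrence of a formula is an occurrence of a formula. -/
theorem Occ.exists_occ (hu : Occ T u φ) {z : ℕ} (h1 : u ≤ z) (h2 : z < u + φ.len)
    (hz : 5 ≤ ModelChecking.kindAt T z) :
    ∃ ψ : Formula τ, Occ T z ψ ∧ z + ψ.len ≤ u + φ.len := by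
  induction hn : φ.nodes using Nat.strong_induction_on generalizing u φ with
  | _ n ih =>
    rcases Nat.eq_or_lt_of_le h1 with rfl | h1
    · exact ⟨φ, hu, le_rfl⟩
    by_cases hk : 7 ≤ φ.kind
    · obtain ⟨c, ψ, hc, h3, h4⟩ := exists_child hk h1 h2
      obtain ⟨χ, h5, h6⟩ := ih _ (hn ▸ hc.nodes_lt) (hc.occ hu) h3 h4 rfl
      exact ⟨χ, h5, h6.trans hc.le⟩
    · have := hu.kindAt_of_atomic (by omega) h1 h2
      omega

theorem Term.tok_injective {t t' : Term τ} (h : t.tok = t'.tok) : t = t' := by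
  cases t <;> cases t' <;> simp_all [Term.tok, Fin.ext_iff]

/-- Unique readability of Polish notation: the first token determines the kind of the formula, for
an atom also the relation symbol and with it the number of terms, and then the immediate subformulas
are determined one after the other. -/
theorem Occ.unique {φ' : Formula τ} (hu : Occ T u φ) (hu' : Occ T u φ') : φ = φ' := by
  induction hn : φ.nodes using Nat.strong_induction_on generalizing u φ φ' with
  | _ n ih =>
    subst hn
    have hk := hu.kindAt.symm.trans hu'.kindAt
    have e : ∀ i < φ.len, i < φ'.len → φ.toks[i]? = φ'.toks[i]? := fun i h h' =>
      (hu.getElem? h).symm.trans (hu'.getElem? h')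
    have h0 := e 0 φ.len_pos φ'.len_pos
    have H : ∀ {c ψ ψ'}, Child u φ c ψ → Child u φ' c ψ' → ψ = ψ' := fun h h' =>
      ih _ h.nodes_lt (h.occ hu) (h'.occ hu') rfl
    cases φ <;> cases φ' <;> simp [Formula.kind] at hk <;> simp [Formula.toks] at h0
    · have h1 := e 1 (by simp) (by simp)
      have h2 := e 2 (by simp) (by simp)
      simp only [Formula.toks, List.getElem?_cons_succ, List.getElem?_cons_zero,
        Option.some.injEq] at h1 h2
      rw [Term.tok_injective h1, Term.tok_injective h2]
    · obtain rfl := Fin.ext h0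
      congr 1
      funext j
      exact Term.tok_injective (by simpa [Formula.toks] using e (j + 1) (by simp) (by simp))
    · rw [H (.neg _ _) (.neg _ _)]
    · obtain rfl := H (.andLeft _ _ _) (.andLeft _ _ _)
      rw [H (.andRight _ _ _) (.andRight _ _ _)]
    · obtain rfl := H (.orLeft _ _ _) (.orLeft _ _ _)
      rw [H (.orRight _ _ _) (.orRight _ _ _)]
    · rw [h0, H (.ex _ _ _) (.ex _ _ _)]
    · rw [h0, H (.all _ _ _) (.all _ _ _)]

/-- Occurrences of formulas are nested or disjoint. -/
theorem Occ.nested {r : ℕ} {χ : Formula τ} (hu : Occ T u φ) (hr : Occ T r χ) (h1 : u ≤ r)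
    (h2 : r < u + φ.len) : r + χ.len ≤ u + φ.len := by
  obtain ⟨ψ, h3, h4⟩ := hu.exists_occ h1 h2 (by rw [hr.kindAt]; exact χ.kind_bounds.1)
  rwa [hr.unique h3]

/-- A node between a formula and an immediate subformula ends before the latter. -/
theorem Child.ends_before (h : Child u φ c ψ) (hu : Occ T u φ) {r : ℕ} {χ : Formula τ}
    (hr : Occ T r χ) (h1 : u < r) (h2 : r < c) : r + χ.len ≤ c := by
  cases h with
  | andRight a b => exact ((Child.andLeft _ _ _).occ hu).nested hr (by omega) (by omega)
  | orRight a b => exact ((Child.orLeft _ _ _).occ hu).nested hr (by omega) (by omega)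
  | neg | andLeft | orLeft | ex | all => omega

/-! ### Counting tokens -/

@[simp] theorem Letter.code_var : Letter.var.code = 3 := rfl
@[simp] theorem Letter.code_con : Letter.con.code = 4 := rfl
@[simp] theorem Letter.code_rel : Letter.rel.code = 5 := rfl
@[simp] theorem Letter.code_equal : Letter.equal.code = 6 := rfl
@[simp] theorem Letter.code_neg : Letter.neg.code = 7 := rfl
@[simp] theorem Letter.code_and : Letter.and.code = 8 := rfl
@[simp] theorem Letter.code_or : Letter.or.code = 9 := rfl
@[simp] theorem Letter.code_ex : Letter.ex.code = 10 := rfl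
@[simp] theorem Letter.code_all : Letter.all.code = 11 := rfl
@[simp] theorem Letter.code_univ : Letter.univ.code = 12 := rfl
@[simp] theorem Letter.code_tup : Letter.tup.code = 13 := rfl
@[simp] theorem Letter.code_elt : Letter.elt.code = 14 := rfl

/-- A tree in which all inner nodes have one or two children has one leaf more than it has binary
nodes. This locates the end of a subformula by counting, without a stack. -/
theorem toks_count (φ : Formula τ) :
    (φ.toks.countP fun t => t.1.code == 5 || t.1.code == 6) =
        (φ.toks.countP fun t => t.1.code == 8 || t.1.code == 9) + 1 ∧
      (φ.toks.countP fun t => decide (5 ≤ t.1.code)) = φ.nodes := by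
  induction φ with
  | equal t s =>
    rcases t.tok_code with h | h <;> rcases s.tok_code with h' | h' <;>
      simp [Formula.toks, h, h', Formula.nodes]
  | rel i ts =>
    have h : ∀ p : Letter × ℕ → Bool, (∀ t : Term τ, p t.tok = false) →
        (List.ofFn fun j => (ts j).tok).countP p = 0 := by grind
    simp only [Formula.toks, List.countP_cons, Formula.nodes]
    rw [h, h, h]
    · simp
    all_goals intro t; rcases t.tok_code with h | h <;> simp [h]
  | neg φ ih | ex y φ ih | all y φ ih =>
    simp only [Formula.toks, List.countP_cons, Formula.nodes, ih]
    simp [add_comm]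
  | and φ ψ ih1 ih2 | or φ ψ ih1 ih2 =>
    simp only [Formula.toks, List.countP_cons, List.countP_append, Formula.nodes, ih1, ih2]
    simp
    omega

/-- Before the end of a formula the atoms do not yet outnumber the binary connectives, except within
the terms of the last atom. For a binary formula, its own connective compensates the surplus of the
completed left part. -/
theorem toks_take_count (φ : Formula τ) {m : ℕ} (h0 : 0 < m) (hm : m < φ.len) :
    ((φ.toks.take m).countP fun t => t.1.code == 5 || t.1.code == 6) ≤
        (φ.toks.take m).countP (fun t => t.1.code == 8 || t.1.code == 9) ∨
      ModelChecking.kindAt φ.toks m = 3 ∨ ModelChecking.kindAt φ.toks m = 4 := by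
  induction φ generalizing m with
  | equal t s =>
    right
    have : m = 1 ∨ m = 2 := by simp at hm; omega
    rcases this with rfl | rfl
    · simpa [ModelChecking.kindAt, Formula.toks] using t.tok_code
    · simpa [ModelChecking.kindAt, Formula.toks] using s.tok_code
  | rel i ts =>
    right
    obtain ⟨k, rfl⟩ := Nat.exists_eq_add_of_lt h0
    have hk : k < τ.arity i := by simp at hm; omega
    simpa [ModelChecking.kindAt, Formula.toks, List.getElem?_ofFn, hk] using (ts ⟨k, hk⟩).tok_code
  | neg φ ih | ex y φ ih | all y φ ih =>
    obtain ⟨k, rfl⟩ := Nat.exists_eq_add_of_lt h0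
    rcases Nat.eq_zero_or_pos k with rfl | hk
    · left; simp [Formula.toks]
    · rcases ih hk (by simp at hm; omega) with h | h
      · left
        simpa [Formula.toks] using h
      · right
        simpa [Formula.toks, ModelChecking.kindAt] using h
  | and φ ψ ih1 ih2 | or φ ψ ih1 ih2 =>
    obtain ⟨k, rfl⟩ := Nat.exists_eq_add_of_lt h0
    rw [Nat.zero_add] at *
    have hc := (toks_count φ).1
    simp only [Formula.toks, List.take_succ_cons, List.take_append, List.countP_cons,
      List.countP_append, ModelChecking.kindAt, List.getElem?_cons_succ]
    rcases lt_trichotomy k φ.len with h | h | h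
    · rw [show k - φ.toks.length = 0 by unfold Formula.len at h; omega, List.take_zero,
        List.getElem?_append_left h]
      rcases Nat.eq_zero_or_pos k with rfl | hk
      · left; simp
      · rcases ih1 hk h with h | h
        · left; simp; omega
        · exact .inr h
    · left
      rw [show k - φ.toks.length = 0 by unfold Formula.len at h; omega, List.take_zero,
        List.take_of_length_le (by unfold Formula.len at h; omega), hc]
      simp
    · rw [List.take_of_length_le (by unfold Formula.len at h; omega), hc,
        List.getElem?_append_right (by unfold Formula.len at h; omega)]
      rcases ih2 (m := k - φ.len) (by omega) (by simp at hm; omega) with h | h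
      · left
        unfold Formula.len at h
        simp; omega
      · exact .inr h

end

/-! ### Functions on the tokens of the formula -/

/-- The code of the first letter of token `j` of the formula. -/
def kd (x : Inp) (j : ℕ) : ℕ := get x 0 j 0

def isTerm (x : Inp) (j : ℕ) : Bool := neq (kd x j) 3 || neq (kd x j) 4

def isAtom (x : Inp) (j : ℕ) : Bool := neq (kd x j) 5 || neq (kd x j) 6

def isBin (x : Inp) (j : ℕ) : Bool := neq (kd x j) 8 || neq (kd x j) 9

def isQuant (x : Inp) (j : ℕ) : Bool := neq (kd x j) 10 || neq (kd x j) 11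

/-- The end of the subformula at position `u`. -/
def fend (x : Inp) (N u : ℕ) : ℕ :=
  bmin (N + 1) fun e => nlt u e && !isTerm x e &&
    nlt (bcount e fun i => nle u i && isBin x i) (bcount e fun i => nle u i && isAtom x i)

/-- Position `z` lies in the subformula at position `u`. -/
def inside (x : Inp) (N u z : ℕ) : Bool := nle u z && nlt z (fend x N u)

/-- The number of nodes of the subformula at position `u`. -/
def nodeCount (x : Inp) (N u : ℕ) : ℕ := bcount (fend x N u) fun i => nle u i && nle 5 (kd x i)

/-- The least position of a token with the same number as token `z`. -/
def cid (x : Inp) (N z : ℕ) : ℕ :=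
  bmin z fun y => ball (N + 1) fun i => neq (get x 0 y (i + 1)) (get x 0 z (i + 1))

/-- Token `z` is a free occurrence of a variable in the subformula at position `u`. -/
def freeOcc (x : Inp) (N u z : ℕ) : Bool :=
  neq (kd x z) 3 && inside x N u z &&
    ball z fun r => !(nle u r && isQuant x r && nlt z (fend x N r) && neq (cid x N r) (cid x N z))

/-- The position of the variable at `z` among the free variables of the subformula at `u`. -/
def varRank (x : Inp) (N u z : ℕ) : ℕ :=
  bcount (cid x N z) fun i => bex N fun y => freeOcc x N u y && neq (cid x N y) i

/-- The number of free variables of the subformula at `u`. -/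
def freeCount (x : Inp) (N u : ℕ) : ℕ :=
  bcount N fun i => bex N fun y => freeOcc x N u y && neq (cid x N y) i

/-- The number of variables. -/
def varCount (x : Inp) (N : ℕ) : ℕ :=
  bcount N fun i => bex N fun y => (neq (kd x y) 3 || isQuant x y) && neq (cid x N y) i

/-- The value of the variable at `z` in the assignment to the free variables of the subformula at
`u` with code `α`, in a universe with `n` elements. -/
def codeVal (x : Inp) (N n u α z : ℕ) : ℕ := idiv n α (varRank x N u z) % n

/-- The parity of the number of negations above position `u`. -/
def negParity (x : Inp) (N u : ℕ) : ℕ :=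
  bcount u (fun r => neq (kd x r) 7 && nlt u (fend x N r)) % 2

/-- The subformula at `u` is quantifier-free. -/
def quantFree (x : Inp) (N u : ℕ) : Bool := ball N fun r => !(inside x N u r && isQuant x r)

/-- The quantifier at `r` is not existential if `o` is true, and not universal if `o` is false. -/
def mismatch (x : Inp) (o : Bool) (r : ℕ) : Bool := bif o then neq (kd x r) 11 else neq (kd x r) 10

/-- The subformula at `u` belongs to `Σ_t` if `o` is true, and to `Π_t` if `o` is false. -/
def inLevel (x : Inp) (N : ℕ) : Bool → ℕ → ℕ → Bool
  | _, 0, u => quantFree x N u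
  | o, t + 1, u => ball N fun r => !inside x N u r ||
      ((!neq (kd x r) 7 || quantFree x N r) && (!mismatch x o r || inLevel x N (!o) t r))

section

variable {α : Type} [Obj α] {x : α → Inp} {N n u z a j : α → ℕ} {o : α → Bool}

@[fun_prop] theorem ls_kd (hx : LS false x) (hj : LS false j) :
    LS false (fun a => kd (x a) (j a)) := by unfold kd; fun_prop

@[fun_prop] theorem ls_isTerm (hx : LS false x) (hj : LS false j) :
    LS false (fun a => isTerm (x a) (j a)) := by unfold isTerm; fun_prop

@[fun_prop] theorem ls_isAtom (hx : LS false x) (hj : LS false j) :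
    LS false (fun a => isAtom (x a) (j a)) := by unfold isAtom; fun_prop

@[fun_prop] theorem ls_isBin (hx : LS false x) (hj : LS false j) :
    LS false (fun a => isBin (x a) (j a)) := by unfold isBin; fun_prop

@[fun_prop] theorem ls_isQuant (hx : LS false x) (hj : LS false j) :
    LS false (fun a => isQuant (x a) (j a)) := by unfold isQuant; fun_prop

@[fun_prop] theorem ls_mismatch (hx : LS false x) (ho : LS false o) (hj : LS false j) :
    LS false (fun a => mismatch (x a) (o a) (j a)) := by unfold mismatch; fun_prop

@[fun_prop] theorem ls_fend (hx : LS false x) (hN : LS false N) (hu : LS false u) :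
    LS false (fun a => fend (x a) (N a) (u a)) := by unfold fend; fun_prop

@[fun_prop] theorem ls_inside (hx : LS false x) (hN : LS false N) (hu : LS false u)
    (hz : LS false z) : LS false (fun a => inside (x a) (N a) (u a) (z a)) := by
  unfold inside; fun_prop

@[fun_prop] theorem ls_nodeCount (hx : LS false x) (hN : LS false N) (hu : LS false u) :
    LS false (fun a => nodeCount (x a) (N a) (u a)) := by unfold nodeCount; fun_prop

@[fun_prop] theorem ls_cid (hx : LS false x) (hN : LS false N) (hu : LS false u) :
    LS false (fun a => cid (x a) (N a) (u a)) := by unfold cid; fun_prop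

@[fun_prop] theorem ls_freeOcc (hx : LS false x) (hN : LS false N) (hu : LS false u)
    (hz : LS false z) : LS false (fun a => freeOcc (x a) (N a) (u a) (z a)) := by
  unfold freeOcc; fun_prop

@[fun_prop] theorem ls_varRank (hx : LS false x) (hN : LS false N) (hu : LS false u)
    (hz : LS false z) : LS false (fun a => varRank (x a) (N a) (u a) (z a)) := by
  unfold varRank; fun_prop

@[fun_prop] theorem ls_freeCount (hx : LS false x) (hN : LS false N) (hu : LS false u) :
    LS false (fun a => freeCount (x a) (N a) (u a)) := by unfold freeCount; fun_prop

@[fun_prop] theorem ls_varCount (hx : LS false x) (hN : LS false N) :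
    LS false (fun a => varCount (x a) (N a)) := by unfold varCount; fun_prop

@[fun_prop] theorem ls_codeVal (hx : LS false x) (hN : LS false N) (hn : LS false n)
    (hu : LS false u) (ha : LS false a) (hz : LS false z) :
    LS false (fun i => codeVal (x i) (N i) (n i) (u i) (a i) (z i)) := by
  unfold codeVal; fun_prop

@[fun_prop] theorem ls_negParity (hx : LS false x) (hN : LS false N) (hu : LS false u) :
    LS false (fun a => negParity (x a) (N a) (u a)) := by unfold negParity; fun_prop

@[fun_prop] theorem ls_quantFree (hx : LS false x) (hN : LS false N) (hu : LS false u) :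
    LS false (fun a => quantFree (x a) (N a) (u a)) := by unfold quantFree; fun_prop

/-- The level `t` is a constant of the machine, so the recursion is unfolded into the program. -/
theorem ls_inLevel (t : ℕ) : LS false (fun p : Inp × ℕ × Bool × ℕ =>
    inLevel p.1 p.2.1 p.2.2.1 t p.2.2.2) := by
  induction t with
  | zero => simp only [inLevel]; fun_prop
  | succ t ih =>
    simp only [inLevel]
    have := ih.comp (g := fun q : (Inp × ℕ × Bool × ℕ) × ℕ =>
      (q.1.1, q.1.2.1, !q.1.2.2.1, q.2)) (by fun_prop)
    fun_prop

end

/-- The tokens of the formula are `T`, and `N` bounds their number and their lengths. -/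
structure Reads (x : Inp) (N : ℕ) (T : List (Letter × ℕ)) : Prop where
  get_eq : ∀ j i, get x 0 j i = tokenGet (T.map numTok) j i
  length_le : T.length ≤ N
  size_le : ∀ t ∈ T, t.2.size ≤ N

section

variable {τ : Vocabulary} {x : Inp} {N : ℕ} {T : List (Letter × ℕ)} {u c z : ℕ}
  {φ ψ : Formula τ}

theorem kindAt_of_le (h : T.length ≤ z) : kindAt T z = 0 := by
  simp [kindAt, List.getElem?_eq_none h]

theorem lt_of_kindAt (h : kindAt T z ≠ 0) : z < T.length := by
  by_contra h'
  exact h (kindAt_of_le (by omega))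

theorem Reads.kd_eq (h : Reads x N T) (j : ℕ) : kd x j = kindAt T j := by
  rw [kd, h.get_eq, tokenGet_zero, kindAt]
  cases e : T[j]? <;> simp [e, numTok]

theorem Reads.bcount_eq_countP (h : Reads x N T) {f : ℕ → Bool} {p : ℕ → Bool}
    (hf : ∀ i, f i = p (kd x i)) (hp : p 0 = false) (u m : ℕ) :
    bcount (u + m) (fun i => nle u i && f i) =
      ((T.drop u).take m).countP fun t => p t.1.code := by
  induction m with
  | zero =>
    rw [bcount_eq, List.take_zero, List.countP_nil, Finset.card_eq_zero,
      Finset.filter_eq_empty_iff]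
    intro i hi
    simp at hi ⊢
    omega
  | succ m ih =>
    rw [List.take_add_one, List.countP_append, ← ih, bcount_eq, bcount_eq, ← add_assoc,
      Finset.range_add_one, Finset.filter_insert, List.getElem?_drop]
    have hk := h.kd_eq (u + m)
    rw [hf, hk, kindAt]
    cases e : T[u + m]? with
    | none => simp [hp]
    | some t => cases hpt : p t.1.code <;> simp [nle, hpt]

/-- By the counting lemmas, the end is the first position after `u` that does not hold a term and
before which the atoms outnumber the binary connectives. The search up to `N + 1` reaches the end of
the list. -/
theorem Reads.fend_eq (h : Reads x N T) (hu : Occ T u φ) : fend x N u = u + φ.len := by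
  have hlen := hu.le_length
  have hN := h.length_le
  have hA : ∀ m, bcount (u + m) (fun i => nle u i && isAtom x i) =
      ((T.drop u).take m).countP fun t => t.1.code == 5 || t.1.code == 6 := fun m =>
    h.bcount_eq_countP (p := fun c => c == 5 || c == 6)
      (fun i => by simp [isAtom, neq, beq_eq_decide]) rfl u m
  have hB : ∀ m, bcount (u + m) (fun i => nle u i && isBin x i) =
      ((T.drop u).take m).countP fun t => t.1.code == 8 || t.1.code == 9 := fun m =>
    h.bcount_eq_countP (p := fun c => c == 8 || c == 9)
      (fun i => by simp [isBin, neq, beq_eq_decide]) rfl u m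
  have ht : ∀ m ≤ φ.len, (T.drop u).take m = φ.toks.take m := by
    intro m hm
    obtain ⟨⟨R, hR⟩, -⟩ := hu
    rw [← hR, List.take_append_of_le_length hm]
  refine bmin_eq (by omega) ?_ fun e he => ?_
  · rw [hA, hB, ht _ le_rfl]
    have e : φ.toks.take φ.len = φ.toks := List.take_length
    rw [e]
    have h1 := (toks_count φ).1
    have h2 := φ.len_pos
    have h3 := hu.2
    simp only [Bool.and_eq_true, nlt_iff, Bool.not_eq_true', isTerm, Bool.or_eq_false_iff,
      h.kd_eq, neq, decide_eq_false_iff_not]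
    exact ⟨⟨by omega, h3⟩, by omega⟩
  · by_contra hcon
    simp only [Bool.not_eq_false, Bool.and_eq_true, nlt_iff, Bool.not_eq_true', isTerm,
      Bool.or_eq_false_iff, h.kd_eq, neq, decide_eq_false_iff_not] at hcon
    obtain ⟨⟨h1, h2⟩, h3⟩ := hcon
    obtain ⟨m, rfl⟩ := Nat.exists_eq_add_of_lt h1
    rw [add_assoc, hA, hB, ht _ (by omega)] at h3
    have h4 : kindAt φ.toks (m + 1) = kindAt T (u + m + 1) := by
      rw [kindAt, kindAt, add_assoc, hu.getElem? (by omega)]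
    rcases toks_take_count φ (m := m + 1) (by omega) (by omega) with h5 | h5
    · omega
    · rw [h4] at h5; omega

theorem Reads.inside_iff (h : Reads x N T) (hu : Occ T u φ) :
    inside x N u z = true ↔ u ≤ z ∧ z < u + φ.len := by
  simp [inside, h.fend_eq hu]

theorem Reads.nodeCount_eq (h : Reads x N T) (hu : Occ T u φ) : nodeCount x N u = φ.nodes := by
  rw [nodeCount, h.fend_eq hu, h.bcount_eq_countP (p := fun c => decide (5 ≤ c))
    (fun i => by simp [nle]) rfl]
  obtain ⟨⟨R, hR⟩, -⟩ := hu
  rw [← hR, Formula.len, List.take_left]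
  exact (toks_count φ).2

theorem indexAt_eq {t : Letter × ℕ} (h : T[z]? = some t) : indexAt T z = t.2 := by
  simp [indexAt, h]

theorem Reads.same_iff (h : Reads x N T) {y : ℕ} (hy : y < T.length) (hz : z < T.length) :
    (ball (N + 1) fun i => neq (get x 0 y (i + 1)) (get x 0 z (i + 1))) = true ↔
      indexAt T y = indexAt T z := by
  have hy' := List.getElem?_eq_getElem hy
  have hz' := List.getElem?_eq_getElem hz
  simp only [ball_iff, neq_iff, h.get_eq, tokenGet_succ hy', tokenGet_succ hz', indexAt_eq hy',
    indexAt_eq hz']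
  constructor
  · intro h'
    exact bitCode_injective (h.size_le _ (List.getElem_mem hy)) fun k hk => h' k (by omega)
  · intro h' i _
    rw [h']

theorem cid_le (x : Inp) (N z : ℕ) : cid x N z ≤ z := bmin_le _ _

theorem Reads.indexAt_cid (h : Reads x N T) (hz : z < T.length) :
    indexAt T (cid x N z) = indexAt T z := by
  rcases Nat.eq_or_lt_of_le (cid_le x N z) with e | hlt
  · rw [e]
  · exact (h.same_iff (by omega) hz).1 (bmin_spec hlt)

/-- The index of a variable may have about $|\varphi|$ digits and is too long to be stored.
Variables are therefore named by the first position whose token has the same number; the kind of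
that token does not matter. -/
theorem Reads.cid_eq_iff (h : Reads x N T) {y : ℕ} (hy : y < T.length) (hz : z < T.length) :
    cid x N y = cid x N z ↔ indexAt T y = indexAt T z := by
  constructor
  · intro e
    rw [← h.indexAt_cid hy, e, h.indexAt_cid hz]
  · have key : ∀ {y z}, y < T.length → z < T.length → indexAt T y = indexAt T z →
        cid x N y ≤ cid x N z := by
      intro y z hy hz e
      by_contra! hlt
      have h1 := cid_le x N y
      have := bmin_min (show cid x N z < bmin y _ from hlt)
      rw [← Bool.not_eq_true, h.same_iff (by omega) hy, h.indexAt_cid hz] at this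
      exact this e.symm
    grind

/-- Counting numbers of tokens amounts to counting the values of `cid`. -/
theorem Reads.bcount_cid (h : Reads x N T) {p : ℕ → Bool} {S : Finset ℕ}
    (hp : ∀ z, p z = true → z < T.length)
    (hS : ∀ X, X ∈ S ↔ ∃ z, p z = true ∧ indexAt T z = X) :
    bcount N (fun i => bex N fun y => p y && neq (cid x N y) i) = S.card := by
  rw [bcount_eq]
  have hN := h.length_le
  refine Finset.card_bij (fun i _ => indexAt T i) ?_ ?_ ?_
  · intro i hi
    simp only [Finset.mem_filter, bex_iff, Bool.and_eq_true, neq_iff] at hi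
    obtain ⟨-, y, -, hy, rfl⟩ := hi
    rw [h.indexAt_cid (hp y hy)]
    exact (hS _).2 ⟨y, hy, rfl⟩
  · intro i hi i' hi' e
    simp only [Finset.mem_filter, bex_iff, Bool.and_eq_true, neq_iff] at hi hi'
    obtain ⟨-, y, -, hy, rfl⟩ := hi
    obtain ⟨-, y', -, hy', rfl⟩ := hi'
    rw [h.indexAt_cid (hp y hy), h.indexAt_cid (hp y' hy')] at e
    exact (h.cid_eq_iff (hp y hy) (hp y' hy')).2 e
  · intro X hX
    obtain ⟨z, hz, rfl⟩ := (hS X).1 hX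
    have := hp z hz
    have := cid_le x N z
    refine ⟨cid x N z, ?_, h.indexAt_cid (hp z hz)⟩
    simp only [Finset.mem_filter, Finset.mem_range, bex_iff, Bool.and_eq_true, neq_iff]
    exact ⟨by omega, z, by omega, hz, rfl⟩

/-! ### Free variables -/

/-- The variable that is quantified by the first token of a formula. -/
def Formula.boundVar : Formula τ → Option ℕ
  | .ex y _ => some y
  | .all y _ => some y
  | _ => none

theorem mem_freeVars_iff (hk : 7 ≤ φ.kind) (u X : ℕ) : X ∈ φ.freeVars ↔
    (∃ c ψ, Child u φ c ψ ∧ X ∈ ψ.freeVars) ∧ φ.boundVar ≠ some X := by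
  cases φ <;> simp [Formula.kind, child_cases_iff, Formula.boundVar, Formula.freeVars] at * <;>
    grind

theorem Occ.boundVar_eq (hu : Occ T u φ) :
    φ.boundVar = if φ.kind = 10 ∨ φ.kind = 11 then some (indexAt T u) else none := by
  have h := hu.getElem? (i := 0) φ.len_pos
  rw [Nat.add_zero] at h
  rw [indexAt, h]
  cases φ <;> simp [Formula.boundVar, Formula.kind, Formula.toks]

theorem Reads.freeOcc_lt (h : Reads x N T) (hz : freeOcc x N u z = true) : z < T.length := by
  simp only [freeOcc, Bool.and_eq_true, neq_iff, h.kd_eq] at hz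
  exact lt_of_kindAt (by omega)

theorem Reads.freeOcc_inside (h : Reads x N T) (hu : Occ T u φ) (hz : freeOcc x N u z = true) :
    kindAt T z = 3 ∧ u ≤ z ∧ z < u + φ.len := by
  simp only [freeOcc, Bool.and_eq_true, neq_iff, h.kd_eq, h.inside_iff hu] at hz
  exact hz.1

/-- Free occurrences in a formula are free occurrences in immediate subformulas. -/
theorem Reads.freeOcc_child (h : Reads x N T) (hu : Occ T u φ) (hc : Child u φ c ψ)
    (h1 : c ≤ z) (h2 : z < c + ψ.len) : freeOcc x N u z = true ↔
      freeOcc x N c z = true ∧ φ.boundVar ≠ some (indexAt T z) := by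
  have hle := hc.le
  have hlt := hc.lt
  have hT := hu.le_length
  simp only [freeOcc, Bool.and_eq_true, h.inside_iff hu, h.inside_iff (hc.occ hu), ball_iff,
    Bool.not_eq_true', Bool.and_eq_false_iff, nle, nlt, neq, decide_eq_false_iff_not,
    decide_eq_true_iff]
  rw [hu.boundVar_eq]
  constructor
  · rintro ⟨⟨hk, -⟩, h3⟩
    refine ⟨⟨⟨hk, h1, h2⟩, fun r hr => ?_⟩, ?_⟩
    · grind
    · split_ifs with hq
      · rw [Ne, Option.some.injEq, ← h.cid_eq_iff (by omega) (by omega)]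
        rcases h3 u (by omega) with ((h' | h') | h') | h'
        · omega
        · simp only [isQuant, h.kd_eq, hu.kindAt, neq, Bool.or_eq_false_iff,
            decide_eq_false_iff_not] at h'
          omega
        · rw [h.fend_eq hu] at h'; omega
        · exact h'
      · simp
  · rintro ⟨⟨⟨hk, -⟩, h3⟩, hb⟩
    refine ⟨⟨hk, by omega, by omega⟩, fun r hr => ?_⟩
    by_cases hrc : c ≤ r
    · grind
    · by_cases hq : isQuant x r = true
      · have hkr : kindAt T r = 10 ∨ kindAt T r = 11 := by
          simpa [isQuant, h.kd_eq] using hq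
        rcases lt_trichotomy r u with hru | rfl | hru
        · exact .inl (.inl (.inl (by omega)))
        · right
          rw [hu.kindAt] at hkr
          rw [if_pos hkr, Ne, Option.some.injEq, ← h.cid_eq_iff (by omega) (by omega)] at hb
          exact hb
        -- A quantifier strictly between `u` and `c` belongs to the other immediate subformula, so
        -- its scope ends before `c`.
        · obtain ⟨χ, hχ, -⟩ := hu.exists_occ hru.le (by omega) (by omega)
          have := hc.ends_before hu hχ hru (by omega)
          left; right
          rw [h.fend_eq hχ]
          omega
      grind

theorem Reads.freeOcc_atomic (h : Reads x N T) (hu : Occ T u φ) (hk : φ.kind < 7) :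
    freeOcc x N u z = true ↔ kindAt T z = 3 ∧ u ≤ z ∧ z < u + φ.len := by
  refine ⟨h.freeOcc_inside hu, fun ⟨h1, h2, h3⟩ => ?_⟩
  simp only [freeOcc, Bool.and_eq_true, neq_iff, h.kd_eq, h.inside_iff hu, ball_iff,
    Bool.not_eq_true', Bool.and_eq_false_iff]
  refine ⟨⟨h1, h2, h3⟩, fun r hr => ?_⟩
  by_cases hru : u ≤ r
  · left; left; right
    have : kindAt T r < 7 := by
      rcases Nat.eq_or_lt_of_le hru with rfl | hru
      · rw [hu.kindAt]; exact hk
      · have := hu.kindAt_of_atomic hk hru (by omega)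
        omega
    simp only [isQuant, h.kd_eq, neq, Bool.or_eq_false_iff, decide_eq_false_iff_not]
    omega
  · left; left; left
    simp [nle]; omega

theorem Term.mem_vars_iff (t : Term τ) (X : ℕ) : X ∈ t.vars ↔ t.tok = (.var, X) := by
  cases t <;> simp [Term.vars, Term.tok, eq_comm]

theorem mem_vars_atomic (hu : Occ T u φ) (hk : φ.kind < 7) (X : ℕ) :
    (X ∈ φ.freeVars ↔ ∃ z, u < z ∧ z < u + φ.len ∧ T[z]? = some (.var, X)) ∧
      φ.vars = φ.freeVars := by
  cases φ with
  | equal t s =>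
    refine ⟨?_, rfl⟩
    have e1 := hu.getElem? (i := 1) (by simp)
    have e2 := hu.getElem? (i := 2) (by simp)
    simp only [Formula.toks, List.getElem?_cons_succ, List.getElem?_cons_zero] at e1 e2
    simp only [Formula.freeVars, Finset.mem_union, Term.mem_vars_iff, len_equal]
    constructor <;> grind
  | rel i ts =>
    refine ⟨?_, rfl⟩
    have e : ∀ j : Fin (τ.arity i), T[u + (j + 1)]? = some (ts j).tok := by
      intro j
      rw [hu.getElem? (i := j + 1) (by simp)]
      simp [Formula.toks]
    simp only [Formula.freeVars, Finset.mem_biUnion, Finset.mem_univ, true_and,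
      Term.mem_vars_iff, len_rel]
    constructor
    · grind
    · rintro ⟨z, h1, h2, h3⟩
      obtain ⟨j, rfl⟩ := Nat.exists_eq_add_of_lt h1
      refine ⟨⟨j, by omega⟩, ?_⟩
      grind
  | neg | and | or | ex | all => simp [Formula.kind] at hk

theorem getElem?_of_kindAt_var (h : kindAt T z = 3) : T[z]? = some (.var, indexAt T z) := by
  unfold kindAt at h
  unfold indexAt
  cases e : T[z]? with
  | none => simp [e] at h
  | some t =>
    obtain ⟨l, n⟩ := t
    cases l <;> simp_all [Letter.code]

/-- The free occurrences are the occurrences of the free variables. -/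
theorem Reads.mem_freeVars (h : Reads x N T) (hu : Occ T u φ) (X : ℕ) :
    X ∈ φ.freeVars ↔ ∃ z, freeOcc x N u z = true ∧ indexAt T z = X := by
  induction hn : φ.nodes using Nat.strong_induction_on generalizing u φ with
  | _ n ih =>
    by_cases hk : 7 ≤ φ.kind
    · rw [mem_freeVars_iff hk u]
      constructor
      · rintro ⟨⟨c, ψ, hc, hX⟩, hb⟩
        obtain ⟨z, hz, rfl⟩ := (ih _ (hn ▸ hc.nodes_lt) (hc.occ hu) rfl).1 hX
        obtain ⟨-, h1, h2⟩ := h.freeOcc_inside (hc.occ hu) hz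
        exact ⟨z, (h.freeOcc_child hu hc h1 h2).2 ⟨hz, hb⟩, rfl⟩
      · rintro ⟨z, hz, rfl⟩
        obtain ⟨h0, h1, h2⟩ := h.freeOcc_inside hu hz
        have : z ≠ u := by
          rintro rfl
          rw [hu.kindAt] at h0
          omega
        obtain ⟨c, ψ, hc, h3, h4⟩ := exists_child hk (show u < z by omega) h2
        obtain ⟨h5, h6⟩ := (h.freeOcc_child hu hc h3 h4).1 hz
        exact ⟨⟨c, ψ, hc, (ih _ (hn ▸ hc.nodes_lt) (hc.occ hu) rfl).2 ⟨z, h5, rfl⟩⟩, h6⟩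
    · rw [(mem_vars_atomic hu (by omega) X).1]
      constructor
      · rintro ⟨z, h1, h2, h3⟩
        exact ⟨z, (h.freeOcc_atomic hu (by omega)).2 ⟨by simp [kindAt, h3], by omega, h2⟩,
          by simp [indexAt, h3]⟩
      · rintro ⟨z, hz, rfl⟩
        obtain ⟨h1, h2, h3⟩ := (h.freeOcc_atomic hu (by omega)).1 hz
        have : z ≠ u := by
          rintro rfl
          have := φ.kind_bounds
          rw [hu.kindAt] at h1
          omega
        exact ⟨z, by omega, h3, getElem?_of_kindAt_var h1⟩

theorem Reads.freeCount_eq (h : Reads x N T) (hu : Occ T u φ) :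
    freeCount x N u = φ.freeVars.card :=
  h.bcount_cid (fun _ => h.freeOcc_lt) (h.mem_freeVars hu)

theorem mem_vars_iff_child (hk : 7 ≤ φ.kind) (u X : ℕ) : X ∈ φ.vars ↔
    (∃ c ψ, Child u φ c ψ ∧ X ∈ ψ.vars) ∨ φ.boundVar = some X := by
  cases φ <;> simp [Formula.kind, child_cases_iff, Formula.boundVar, Formula.vars] at * <;> grind

theorem mem_vars_iff_kindAt (hu : Occ T u φ) (X : ℕ) : X ∈ φ.vars ↔ ∃ z, u ≤ z ∧ z < u + φ.len ∧
    (kindAt T z = 3 ∨ kindAt T z = 10 ∨ kindAt T z = 11) ∧ indexAt T z = X := by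
  induction hn : φ.nodes using Nat.strong_induction_on generalizing u φ with
  | _ n ih =>
    have hb := hu.boundVar_eq
    by_cases hk : 7 ≤ φ.kind
    · rw [mem_vars_iff_child hk u]
      constructor
      · rintro (⟨c, ψ, hc, hX⟩ | h)
        · obtain ⟨z, h1, h2, h3⟩ := (ih _ (hn ▸ hc.nodes_lt) (hc.occ hu) rfl).1 hX
          have := hc.le
          have := hc.lt
          exact ⟨z, by omega, by omega, h3⟩
        · rw [h] at hb
          split_ifs at hb with hq
          have := φ.len_pos
          exact ⟨u, le_rfl, by omega, by rw [hu.kindAt]; omega, (Option.some.inj hb).symm⟩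
      · rintro ⟨z, h1, h2, h3, rfl⟩
        rcases Nat.eq_or_lt_of_le h1 with rfl | h1
        · right
          rw [hb, if_pos]
          rw [hu.kindAt] at h3
          omega
        · obtain ⟨c, ψ, hc, h4, h5⟩ := exists_child hk h1 h2
          exact .inl ⟨c, ψ, hc, (ih _ (hn ▸ hc.nodes_lt) (hc.occ hu) rfl).2
            ⟨z, h4, h5, h3, rfl⟩⟩
    · obtain ⟨e1, e2⟩ := mem_vars_atomic hu (by omega) X
      rw [e2, e1]
      constructor
      · rintro ⟨z, h1, h2, h3⟩
        exact ⟨z, by omega, h2, by simp [kindAt, h3], by simp [indexAt, h3]⟩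
      · rintro ⟨z, h1, h2, h3, rfl⟩
        have hkk := φ.kind_bounds
        rcases Nat.eq_or_lt_of_le h1 with rfl | h1
        · rw [hu.kindAt] at h3
          omega
        · have := hu.kindAt_of_atomic (by omega) h1 h2
          exact ⟨z, h1, h2, getElem?_of_kindAt_var (by omega)⟩

theorem Reads.varCount_eq (h : Reads x N T) (h0 : Occ T 0 φ) (hT : T.length = φ.len) :
    varCount x N = φ.vars.card := by
  refine h.bcount_cid (fun z hz => ?_) (fun X => ?_)
  · simp only [isQuant, Bool.or_eq_true, neq_iff, h.kd_eq] at hz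
    exact lt_of_kindAt (by omega)
  · rw [mem_vars_iff_kindAt h0]
    simp only [isQuant, Bool.or_eq_true, neq_iff, h.kd_eq]
    constructor
    · grind
    · rintro ⟨z, h1, h2⟩
      have := lt_of_kindAt (T := T) (z := z) (by omega)
      grind

end

section

variable {τ : Vocabulary} {x : Inp} {N : ℕ} {T : List (Letter × ℕ)} {u c z : ℕ}
  {φ φ0 ψ : Formula τ}

/-! ### Codes of assignments -/

theorem exists_digits {M : ℕ} {d : ℕ → ℕ} (hd : ∀ i, d i < M) (n : ℕ) :
    ∃ q < M ^ n, ∀ i < n, q / M ^ i % M = d i := by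
  induction n generalizing d with
  | zero => exact ⟨0, by simp, by simp⟩
  | succ n ih =>
    obtain ⟨q, hq, h⟩ := ih (d := fun i => d (i + 1)) fun i => hd _
    have h0 := hd 0
    refine ⟨d 0 + M * q, ?_, fun i hi => ?_⟩
    · rw [pow_succ']
      calc d 0 + M * q < M * (q + 1) := by rw [mul_add]; omega
        _ ≤ M * M ^ n := Nat.mul_le_mul_left _ hq
    · rcases i with _ | i
      · simp [Nat.mod_eq_of_lt h0]
      · rw [pow_succ', ← Nat.div_div_eq_div_mul, Nat.add_mul_div_left _ _ (by omega),
          Nat.div_eq_of_lt h0, Nat.zero_add]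
        exact h i (by omega)

/-- The rank counts the names of free variables below a given name, so it increases strictly with
the name. Hence different free variables occupy different digits of the code of an assignment. -/
theorem Reads.varRank_lt (h : Reads x N T) (hz : freeOcc x N u z = true) {y : ℕ}
    (hlt : cid x N z < cid x N y) :
    varRank x N u z < varRank x N u y := by
  have hN := h.length_le
  have hzT := h.freeOcc_lt hz
  have := cid_le x N z
  rw [varRank, varRank, bcount_eq, bcount_eq]
  apply Finset.card_lt_card
  refine ⟨fun i hi => ?_, fun hsub => ?_⟩
  · grind
  · have : cid x N z ∈ (Finset.range (cid x N z)).filter fun i =>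
        (bex N fun y => freeOcc x N u y && neq (cid x N y) i) = true := by
      apply hsub
      simp only [Finset.mem_filter, Finset.mem_range, bex_iff, Bool.and_eq_true, neq_iff]
      exact ⟨hlt, z, by omega, hz, rfl⟩
    simp at this

theorem Reads.varRank_lt_freeCount (h : Reads x N T) (hz : freeOcc x N u z = true) :
    varRank x N u z < freeCount x N u := by
  have hN := h.length_le
  have hzT := h.freeOcc_lt hz
  have := cid_le x N z
  rw [varRank, freeCount, bcount_eq, bcount_eq]
  apply Finset.card_lt_card
  refine ⟨fun i hi => ?_, fun hsub => ?_⟩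
  · grind
  · have : cid x N z ∈ (Finset.range (cid x N z)).filter fun i =>
        (bex N fun y => freeOcc x N u y && neq (cid x N y) i) = true := by
      apply hsub
      simp only [Finset.mem_filter, Finset.mem_range, bex_iff, Bool.and_eq_true, neq_iff]
      exact ⟨by omega, z, by omega, hz, rfl⟩
    simp at this

/-- Every assignment has a code. -/
theorem Reads.exists_code (h : Reads x N T) {n : ℕ} (u : ℕ) (w : ℕ → Fin n) :
    ∃ α < n ^ freeCount x N u, ∀ z, freeOcc x N u z = true →
      codeVal x N n u α z = w (indexAt T z) := by
  classical
  obtain ⟨q, hq, hd⟩ := exists_digits (M := n) (d := fun i =>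
    if hi : ∃ z, freeOcc x N u z = true ∧ varRank x N u z = i then w (indexAt T hi.choose)
    -- A digit that belongs to no free variable is arbitrary; it only has to be less than `n`.
    else w 0) (fun i => by split_ifs <;> exact Fin.is_lt _) (freeCount x N u)
  refine ⟨q, hq, fun z hz => ?_⟩
  have hex : ∃ y, freeOcc x N u y = true ∧ varRank x N u y = varRank x N u z := ⟨z, hz, rfl⟩
  rw [codeVal, idiv_eq, hd _ (h.varRank_lt_freeCount hz), dif_pos hex]
  obtain ⟨h1, h2⟩ := hex.choose_spec
  congr 2
  rw [← h.cid_eq_iff (h.freeOcc_lt h1) (h.freeOcc_lt hz)]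
  rcases lt_trichotomy (cid x N hex.choose) (cid x N z) with hlt | he | hlt
  · have := h.varRank_lt h1 hlt
    omega
  · exact he
  · have := h.varRank_lt hz hlt
    omega

open Classical in
/-- The assignment with code `α` to the free variables of the subformula at `u`. -/
noncomputable def codeAsg (x : Inp) (N : ℕ) (T : List (Letter × ℕ)) {n : ℕ} (hn : 0 < n)
    (u α : ℕ) (X : ℕ) : Fin n :=
  if hX : ∃ z, freeOcc x N u z = true ∧ indexAt T z = X then
    ⟨codeVal x N n u α hX.choose, Nat.mod_lt _ hn⟩
  else ⟨0, hn⟩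

theorem Reads.codeAsg_index (h : Reads x N T) {n : ℕ} (hn : 0 < n) {α : ℕ}
    (hz : freeOcc x N u z = true) :
    (codeAsg x N T hn u α (indexAt T z) : ℕ) = codeVal x N n u α z := by
  have hex : ∃ y, freeOcc x N u y = true ∧ indexAt T y = indexAt T z := ⟨z, hz, rfl⟩
  obtain ⟨h1, h2⟩ := hex.choose_spec
  rw [codeAsg, dif_pos hex]
  have : cid x N hex.choose = cid x N z :=
    (h.cid_eq_iff (h.freeOcc_lt h1) (h.freeOcc_lt hz)).2 h2
  simp only [codeVal, varRank, this]

/-! ### Negations and levels -/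

theorem occ_root (hT : T = φ0.toks) : Occ T 0 φ0 := by
  subst hT
  refine ⟨by simp, ?_⟩
  have : kindAt φ0.toks (0 + φ0.len) = 0 := kindAt_of_le (by simp [Formula.len])
  rw [this]
  omega

theorem exists_occ_of_kindAt (hT : T = φ0.toks) (hz : 5 ≤ kindAt T z) :
    ∃ ψ : Formula τ, Occ T z ψ := by
  have := lt_of_kindAt (T := T) (z := z) (by omega)
  obtain ⟨ψ, h, -⟩ := (occ_root hT).exists_occ (Nat.zero_le z)
    (by rw [hT] at this; simpa [Formula.len] using this) hz
  exact ⟨ψ, h⟩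

/-- The negations above `c` are those above `u` and possibly the one at `u`: a node strictly between
`u` and `c` ends before `c` and so does not contain it. -/
theorem Reads.negParity_child (h : Reads x N T) (hT : T = φ0.toks) (hu : Occ T u φ)
    (hc : Child u φ c ψ) :
    negParity x N c = (negParity x N u + if φ.kind = 7 then 1 else 0) % 2 := by
  have hlt := hc.lt
  have hle := hc.le
  have hpos := ψ.len_pos
  have key : ((Finset.range c).filter fun r =>
      (neq (kd x r) 7 && nlt c (fend x N r)) = true) =
      ((Finset.range u).filter fun r => (neq (kd x r) 7 && nlt u (fend x N r)) = true) ∪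
        if φ.kind = 7 then {u} else ∅ := by
    ext r
    simp only [Finset.mem_filter, Finset.mem_range, Finset.mem_union, Bool.and_eq_true, neq_iff,
      nlt_iff, h.kd_eq]
    constructor
    · rintro ⟨h1, h2, h3⟩
      obtain ⟨χ, hχ⟩ := exists_occ_of_kindAt (τ := τ) hT (z := r) (by omega)
      rw [h.fend_eq hχ] at h3 ⊢
      rcases lt_trichotomy r u with hr | rfl | hr
      · exact .inl ⟨hr, h2, by omega⟩
      · right
        rw [hu.kindAt] at h2
        simp [h2]
      · have := hc.ends_before hu hχ hr h1
        omega
    · rintro (⟨h1, h2, h3⟩ | h1)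
      · obtain ⟨χ, hχ⟩ := exists_occ_of_kindAt (τ := τ) hT (z := r) (by omega)
        rw [h.fend_eq hχ] at h3 ⊢
        have := hχ.nested hu h1.le h3
        exact ⟨by omega, h2, by omega⟩
      · split_ifs at h1 with hk
        · obtain rfl := Finset.mem_singleton.1 h1
          refine ⟨hlt, by rw [hu.kindAt, hk], ?_⟩
          rw [h.fend_eq hu]
          omega
        · simp at h1
  rw [negParity, negParity, bcount_eq, bcount_eq, key]
  split_ifs with hk
  · grind
  · simp

theorem negParity_zero (x : Inp) (N : ℕ) : negParity x N 0 = 0 := by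
  simp [negParity, bcount, iter]

theorem Reads.quantFree_iff (h : Reads x N T) (hu : Occ T u φ) :
    quantFree x N u = true ↔ ∀ r, u ≤ r → r < u + φ.len → kindAt T r ≠ 10 ∧ kindAt T r ≠ 11 := by
  have hN := h.length_le
  have hlen := hu.le_length
  simp only [quantFree, ball_iff, Bool.not_eq_true', Bool.and_eq_false_imp, h.inside_iff hu,
    isQuant, h.kd_eq, Bool.or_eq_false_iff, neq, decide_eq_false_iff_not]
  grind

theorem Reads.quantFree_iff_quantifierFree (h : Reads x N T) (hu : Occ T u φ) :
    quantFree x N u = true ↔ φ.QuantifierFree := by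
  rw [h.quantFree_iff hu]
  induction hn : φ.nodes using Nat.strong_induction_on generalizing u φ with
  | _ n ih =>
    subst hn
    by_cases hk : 7 ≤ φ.kind
    · have H : (∀ r, u ≤ r → r < u + φ.len → kindAt T r ≠ 10 ∧ kindAt T r ≠ 11) ↔
          (φ.kind ≠ 10 ∧ φ.kind ≠ 11) ∧ ∀ c ψ, Child u φ c ψ → ψ.QuantifierFree := by
        constructor
        · intro H
          refine ⟨by rw [← hu.kindAt]; exact H u le_rfl (by have := φ.len_pos; omega),
            fun c ψ hc => (ih _ hc.nodes_lt (hc.occ hu) rfl).1 fun r h1 h2 =>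
              H r (by have := hc.lt; omega) (by have := hc.le; omega)⟩
        · rintro ⟨H1, H2⟩ r h1 h2
          rcases Nat.eq_or_lt_of_le h1 with rfl | h1
          · rwa [hu.kindAt]
          · obtain ⟨c, ψ, hc, h3, h4⟩ := exists_child hk h1 h2
            exact (ih _ hc.nodes_lt (hc.occ hu) rfl).2 (H2 c ψ hc) r h3 h4
      rw [H]
      clear ih H
      cases φ <;> simp_all [Formula.kind, child_cases_iff, Formula.QuantifierFree, or_imp,
        forall_and]
    · have : φ.QuantifierFree := by cases φ <;> simp_all [Formula.kind, Formula.QuantifierFree]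
      refine iff_of_true (fun r h1 h2 => ?_) this
      rcases Nat.eq_or_lt_of_le h1 with rfl | h1
      · rw [hu.kindAt]; omega
      · have := hu.kindAt_of_atomic (by omega) h1 h2
        omega

/-- The polarity that corresponds to a Boolean. -/
def toPolarity : Bool → Polarity
  | true => .sigma
  | false => .pi

theorem toPolarity_not (o : Bool) : toPolarity (!o) = (toPolarity o).dual := by
  cases o <;> rfl

theorem Reads.inLevel_succ_iff (h : Reads x N T) (hu : Occ T u φ) (o : Bool) (t : ℕ) :
    inLevel x N o (t + 1) u = true ↔ ∀ r, u ≤ r → r < u + φ.len →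
      (kindAt T r = 7 → quantFree x N r = true) ∧
        (mismatch x o r = true → inLevel x N (!o) t r = true) := by
  have hN := h.length_le
  have hlen := hu.le_length
  simp only [inLevel, ball_iff, Bool.or_eq_true, Bool.not_eq_true', ← Bool.not_eq_true,
    h.inside_iff hu, Bool.and_eq_true, neq_iff, h.kd_eq, ← imp_iff_not_or]
  grind

theorem Reads.inLevel_sub (h : Reads x N T) (hu : Occ T u φ) {o : Bool} {t : ℕ}
    (H : inLevel x N o t u = true) (hc : Occ T c ψ) (h1 : u ≤ c) (h2 : c < u + φ.len) :
    inLevel x N o t c = true := by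
  have hle := hu.nested hc h1 h2
  cases t with
  | zero =>
    simp only [inLevel] at H ⊢
    rw [h.quantFree_iff hu] at H
    rw [h.quantFree_iff hc]
    exact fun r h3 h4 => H r (by omega) (by omega)
  | succ t =>
    rw [h.inLevel_succ_iff hu] at H
    rw [h.inLevel_succ_iff hc]
    grind

theorem mismatch_kindAt (h : Reads x N T) {o : Bool} {r : ℕ} (H : mismatch x o r = true) :
    kindAt T r = 10 ∨ kindAt T r = 11 := by
  cases o <;> simp_all [mismatch, h.kd_eq]

theorem Reads.inLevel_mono (h : Reads x N T) (hu : Occ T u φ) {o : Bool} {t : ℕ}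
    (H : inLevel x N (!o) t u = true) : inLevel x N o (t + 1) u = true := by
  rw [h.inLevel_succ_iff hu]
  intro r h1 h2
  refine ⟨fun hk => ?_, fun hm => ?_⟩
  · obtain ⟨χ, hχ, hle⟩ := hu.exists_occ h1 h2 (by omega)
    cases t with
    | zero =>
      simp only [inLevel] at H
      rw [h.quantFree_iff hu] at H
      rw [h.quantFree_iff hχ]
      grind
    | succ t =>
      rw [h.inLevel_succ_iff hu] at H
      exact (H r h1 h2).1 hk
  · obtain ⟨χ, hχ, hle⟩ := hu.exists_occ h1 h2 (by
      have := mismatch_kindAt h hm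
      omega)
    exact h.inLevel_sub hu H hχ h1 h2

theorem inLevel_of_quantifierFree (h : φ.QuantifierFree) (p : Polarity) (t : ℕ) :
    InLevel p t φ := by
  induction t generalizing p with
  | zero => exact .base h
  | succ t ih => exact .incl (ih _)

/-- The inductive definition becomes a condition on all nodes inside the formula at once: negations
are applied to quantifier-free formulas only, and every quantifier of the wrong kind starts a
formula of the dual class one level lower. The recursion depth is then `t` and not the height of the
formula. -/
theorem Reads.inLevel_iff (h : Reads x N T) (hu : Occ T u φ) (o : Bool) (t : ℕ) :
    inLevel x N o t u = true ↔ InLevel (toPolarity o) t φ := by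
  constructor
  · intro H
    induction t generalizing o u φ with
    | zero =>
      simp only [inLevel, h.quantFree_iff_quantifierFree hu] at H
      exact .base H
    | succ t ih =>
      induction hn : φ.nodes using Nat.strong_induction_on generalizing u φ with
      | _ n ih' =>
        subst hn
        have hr := (h.inLevel_succ_iff hu o t).1 H u le_rfl (by have := φ.len_pos; omega)
        have H' : ∀ {c ψ}, Child u φ c ψ → InLevel (toPolarity o) (t + 1) ψ := fun {c ψ} hc =>
          ih' _ hc.nodes_lt (hc.occ hu) (h.inLevel_sub hu H (hc.occ hu) hc.lt.le
            (by have := hc.le; have := ψ.len_pos; omega)) rfl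
        have hm := fun hm => InLevel.incl (toPolarity_not o ▸ ih hu _ (hr.2 hm))
        cases φ with
        | equal | rel => exact inLevel_of_quantifierFree (by simp [Formula.QuantifierFree]) _ _
        | neg φ =>
          exact inLevel_of_quantifierFree
            ((h.quantFree_iff_quantifierFree hu).1 (hr.1 hu.kindAt)) _ _
        | and φ ψ => exact .and (H' (.andLeft _ _ _)) (H' (.andRight _ _ _))
        | or φ ψ => exact .or (H' (.orLeft _ _ _)) (H' (.orRight _ _ _))
        | ex y φ =>
          cases o
          · exact hm (by simp [mismatch, h.kd_eq, hu.kindAt, Formula.kind])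
          · exact .ex (H' (.ex _ _ _))
        | all y φ =>
          cases o
          · exact .all (H' (.all _ _ _))
          · exact hm (by simp [mismatch, h.kd_eq, hu.kindAt, Formula.kind])
  · intro H
    have step : ∀ {u o t} {φ : Formula τ}, Occ T u φ → 8 ≤ φ.kind → mismatch x o u = false →
        (∀ c ψ, Child u φ c ψ → inLevel x N o (t + 1) c = true) →
        inLevel x N o (t + 1) u = true := by
      intro u o t φ hu hk hm H
      rw [h.inLevel_succ_iff hu]
      intro r h1 h2
      rcases Nat.eq_or_lt_of_le h1 with rfl | h1
      · rw [hu.kindAt, hm]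
        exact ⟨by omega, by simp⟩
      · obtain ⟨c, χ, hc, h3, h4⟩ := exists_child (by omega) h1 h2
        exact (h.inLevel_succ_iff (hc.occ hu) o t).1 (H c χ hc) r h3 h4
    generalize hp : toPolarity o = p at H
    induction H generalizing u o with
    | base hq => simpa only [inLevel, h.quantFree_iff_quantifierFree hu] using hq
    | incl _ ih => exact h.inLevel_mono hu (ih hu _ (by rw [toPolarity_not, hp]))
    | and _ _ ih1 ih2 | or _ _ ih1 ih2 =>
      refine step hu (by simp [Formula.kind])
        (by cases o <;> simp [mismatch, h.kd_eq, hu.kindAt, Formula.kind, neq]) fun c ψ hc => ?_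
      have := hc.occ hu
      cases hc
      exacts [ih1 this _ hp, ih2 this _ hp]
    | ex _ ih | all _ ih =>
      refine step hu (by simp [Formula.kind]) ?_ fun c ψ hc => ?_
      · cases o <;> simp_all [toPolarity, mismatch, h.kd_eq, hu.kindAt, Formula.kind, neq]
      · have := hc.occ hu
        cases hc
        exact ih this _ hp

/-- In a formula of `Σ_t` no quantifier occurs below a negation. -/
theorem Reads.negParity_quantifier (h : Reads x N T) (hT : T = φ0.toks) {o : Bool} {t : ℕ}
    (H : inLevel x N o t 0 = true) {r : ℕ} (hr : kindAt T r = 10 ∨ kindAt T r = 11) :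
    negParity x N r = 0 := by
  have h0 := occ_root hT
  have hlen : φ0.len = T.length := by rw [hT]; rfl
  have hrT := lt_of_kindAt (T := T) (z := r) (by omega)
  rw [negParity, bcount_eq, Finset.card_eq_zero.2]
  rw [Finset.filter_eq_empty_iff]
  intro s hs
  rw [Bool.and_eq_true, neq_iff, nlt_iff, h.kd_eq]
  rintro ⟨h1, h2⟩
  rw [Finset.mem_range] at hs
  obtain ⟨χ, hχ⟩ := exists_occ_of_kindAt (τ := τ) hT (z := s) (by omega)
  rw [h.fend_eq hχ] at h2
  have hq : quantFree x N s = true := by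
    cases t with
    | zero => exact h.inLevel_sub h0 H hχ (by omega) (by omega)
    | succ t => exact ((h.inLevel_succ_iff h0 o t).1 H s (by omega) (by omega)).1 h1
  have := (h.quantFree_iff hχ).1 hq r (by omega) h2
  omega

end

/-! ### Evaluation of formulas with a hole -/

/-- The assertion that `φ`, which occurs at position `u`, has the truth value `sg` under `w`, where
the corresponding assertion about the subformula at position `v` is replaced by `E`. -/
def Formula.Ev {τ : Vocabulary} (A : FinStructure τ) (v : ℕ) (E : (ℕ → Fin A.card) → Prop) :
    Formula τ → Bool → ℕ → (ℕ → Fin A.card) → Prop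
  | .equal t s, sg, u, w => if u = v then E w else (t.value A w = s.value A w ↔ sg = true)
  | .rel i ts, sg, u, w => if u = v then E w else
      ((fun j => (ts j).value A w) ∈ A.rel i ↔ sg = true)
  | .neg φ, sg, u, w => if u = v then E w else φ.Ev A v E (!sg) (u + 1) w
  | .and φ ψ, sg, u, w => if u = v then E w else
      if sg = true then φ.Ev A v E sg (u + 1) w ∧ ψ.Ev A v E sg (u + 1 + φ.len) w
      else φ.Ev A v E sg (u + 1) w ∨ ψ.Ev A v E sg (u + 1 + φ.len) w
  | .or φ ψ, sg, u, w => if u = v then E w else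
      if sg = true then φ.Ev A v E sg (u + 1) w ∨ ψ.Ev A v E sg (u + 1 + φ.len) w
      else φ.Ev A v E sg (u + 1) w ∧ ψ.Ev A v E sg (u + 1 + φ.len) w
  | .ex y φ, sg, u, w => if u = v then E w else
      if sg = true then ∃ a, φ.Ev A v E sg (u + 1) (Function.update w y a)
      else ∀ a, φ.Ev A v E sg (u + 1) (Function.update w y a)
  | .all y φ, sg, u, w => if u = v then E w else
      if sg = true then ∀ a, φ.Ev A v E sg (u + 1) (Function.update w y a)
      else ∃ a, φ.Ev A v E sg (u + 1) (Function.update w y a)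

/-- The assertion that a conjunction is true or that a disjunction is false. -/
def Formula.Conj {τ : Vocabulary} (φ : Formula τ) (sg : Bool) : Prop :=
  (φ.kind = 8 ∧ sg = true) ∨ (φ.kind = 9 ∧ sg = false)

/-- The assertion that an existential formula is false or that a universal formula is true. -/
def Formula.Mis {τ : Vocabulary} (φ : Formula τ) (sg : Bool) : Prop :=
  (φ.kind = 10 ∧ sg = false) ∨ (φ.kind = 11 ∧ sg = true)

/-- The truth value of immediate subformulas that corresponds to the truth value of a formula. -/
def Formula.childSign {τ : Vocabulary} (φ : Formula τ) (sg : Bool) : Bool :=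
  if φ.kind = 7 then !sg else sg

/-- The assignments `w` and `w'` agree except possibly at `o`. -/
def AgreeOff {α : Type} (o : Option ℕ) (w w' : ℕ → α) : Prop := ∀ X, o ≠ some X → w' X = w X

theorem agreeOff_none {α : Type} {w w' : ℕ → α} : AgreeOff none w w' ↔ w' = w :=
  ⟨fun h => funext fun X => h X (by simp), fun h _ _ => by rw [h]⟩

theorem agreeOff_some {α : Type} {y : ℕ} {w w' : ℕ → α} :
    AgreeOff (some y) w w' ↔ ∃ a, w' = Function.update w y a := by
  constructor
  · intro h
    refine ⟨w' y, funext fun X => ?_⟩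
    by_cases hX : X = y
    · subst hX; simp
    · rw [Function.update_of_ne hX]
      exact h X (by simpa [eq_comm] using hX)
  · rintro ⟨a, rfl⟩ X hX
    grind

section

variable {τ : Vocabulary} {A : FinStructure τ} {T : List (Letter × ℕ)} {u v v' c : ℕ}
  {φ ψ : Formula τ} {sg : Bool} {E E' : (ℕ → Fin A.card) → Prop} {w w' : ℕ → Fin A.card}

theorem ev_self : φ.Ev A v E sg v w ↔ E w := by cases φ <;> simp [Formula.Ev]

/-- All formulas that are not atomic are treated uniformly: either all or some immediate subformulas
have to be considered, under all or some assignments that differ at most at the bound variable. A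
negation has one immediate subformula and no bound variable, and is counted among the existential
cases of `ev_exists`. -/
theorem ev_univ (hk : 7 ≤ φ.kind) (huv : u ≠ v) (hU : φ.Conj sg ∨ φ.Mis sg) :
    φ.Ev A v E sg u w ↔ ∀ c ψ, Child u φ c ψ → ∀ w', AgreeOff φ.boundVar w w' →
      ψ.Ev A v E (φ.childSign sg) c w' := by
  cases sg <;> cases φ <;> simp_all [Formula.kind, child_cases_iff, Formula.boundVar, Formula.Ev,
    Formula.Conj, Formula.Mis, Formula.childSign, agreeOff_none, agreeOff_some] <;> grind

theorem ev_exists (hk : 7 ≤ φ.kind) (huv : u ≠ v) (hU : ¬ (φ.Conj sg ∨ φ.Mis sg)) :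
    φ.Ev A v E sg u w ↔ ∃ c ψ, Child u φ c ψ ∧ ∃ w', AgreeOff φ.boundVar w w' ∧
      ψ.Ev A v E (φ.childSign sg) c w' := by
  cases sg <;> cases φ <;> simp_all [Formula.kind, child_cases_iff, Formula.boundVar, Formula.Ev,
    Formula.Conj, Formula.Mis, Formula.childSign, agreeOff_none, agreeOff_some] <;> grind

theorem ev_congr (hk : 7 ≤ φ.kind) (huv : u ≠ v) (huv' : u ≠ v')
    (H : ∀ c ψ, Child u φ c ψ → ∀ w, ψ.Ev A v E (φ.childSign sg) c w ↔
      ψ.Ev A v' E' (φ.childSign sg) c w) :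
    φ.Ev A v E sg u w ↔ φ.Ev A v' E' sg u w := by
  by_cases hU : φ.Conj sg ∨ φ.Mis sg
  · rw [ev_univ hk huv hU, ev_univ hk huv' hU]
    grind
  · rw [ev_exists hk huv hU, ev_exists hk huv' hU]
    grind

theorem ev_mono (hE : ∀ w, E w → E' w) (h : φ.Ev A v E sg u w) : φ.Ev A v E' sg u w := by
  induction hn : φ.nodes using Nat.strong_induction_on generalizing u φ sg w with
  | _ n ih =>
    by_cases huv : u = v
    · subst huv
      rw [ev_self] at h ⊢
      exact hE w h
    by_cases hk : 7 ≤ φ.kind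
    · by_cases hU : φ.Conj sg ∨ φ.Mis sg
      · rw [ev_univ hk huv hU] at h ⊢
        exact fun c ψ hc w hw => ih _ (hn ▸ hc.nodes_lt) (h c ψ hc w hw) rfl
      · rw [ev_exists hk huv hU] at h ⊢
        obtain ⟨c, ψ, hc, w, hw, h⟩ := h
        exact ⟨c, ψ, hc, w, hw, ih _ (hn ▸ hc.nodes_lt) h rfl⟩
    · cases φ <;> simp_all [Formula.Ev, Formula.kind]

/-- A hole outside the formula is irrelevant. -/
theorem ev_iff_realize (h : v < u ∨ u + φ.len ≤ v) :
    φ.Ev A v E sg u w ↔ (φ.Realize A w ↔ sg = true) := by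
  have huv : u ≠ v := by have := φ.len_pos; omega
  induction φ generalizing u sg w <;> simp at h <;>
    simp only [Formula.Ev, huv, if_false, Formula.Realize] <;> grind [Formula.len_pos]

/-- The truth of `E` depends only on the free variables of the subformula at `v`. -/
def LocalAt (T : List (Letter × ℕ)) (v : ℕ) (E : (ℕ → Fin A.card) → Prop) : Prop :=
  ∀ ψ : Formula τ, Occ T v ψ → ∀ w w' : ℕ → Fin A.card, (∀ X ∈ ψ.freeVars, w' X = w X) → E w → E w'

theorem Term.value_congr (t : Term τ) (h : ∀ X ∈ t.vars, w' X = w X) :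
    t.value A w' = t.value A w := by
  cases t with
  | var X => exact h X (by simp [Term.vars])
  | const c => rfl

/-- An evaluation with a hole depends only on the free variables if the filling does. This justifies
storing assignments by codes that record the values of the free variables only. -/
theorem ev_local (hE : LocalAt T v E) (hu : Occ T u φ) (hw : ∀ X ∈ φ.freeVars, w' X = w X)
    (h : φ.Ev A v E sg u w) : φ.Ev A v E sg u w' := by
  classical
  induction hn : φ.nodes using Nat.strong_induction_on generalizing u φ sg w w' with
  | _ n ih =>
    by_cases huv : u = v
    · subst huv
      rw [ev_self] at h ⊢
      exact hE φ hu w w' hw h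
    by_cases hk : 7 ≤ φ.kind
    · have key : ∀ {w w' : ℕ → Fin A.card}, (∀ X ∈ φ.freeVars, w' X = w X) → ∀ w1,
          AgreeOff φ.boundVar w w1 → ∃ w1', AgreeOff φ.boundVar w' w1' ∧
            ∀ c ψ, Child u φ c ψ → ∀ X ∈ ψ.freeVars, w1' X = w1 X := by
        intro w w' hw w1 hw1
        refine ⟨fun X => if φ.boundVar = some X then w1 X else w' X, fun X hX => if_neg hX,
          fun c ψ hc X hX => ?_⟩
        by_cases hb : φ.boundVar = some X
        · simp [hb]
        · simp only [hb, if_false]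
          rw [hw X ((mem_freeVars_iff hk u X).2 ⟨⟨c, ψ, hc, hX⟩, hb⟩), hw1 X hb]
      by_cases hU : φ.Conj sg ∨ φ.Mis sg
      · rw [ev_univ hk huv hU] at h ⊢
        intro c ψ hc w1' hw1'
        obtain ⟨w1, h1, h2⟩ := key (fun X hX => (hw X hX).symm) w1' hw1'
        exact ih _ (hn ▸ hc.nodes_lt) (hc.occ hu) (fun X hX => (h2 c ψ hc X hX).symm)
          (h c ψ hc w1 h1) rfl
      · rw [ev_exists hk huv hU] at h ⊢
        obtain ⟨c, ψ, hc, w1, hw1, h⟩ := h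
        obtain ⟨w1', h1, h2⟩ := key hw w1 hw1
        exact ⟨c, ψ, hc, w1', h1, ih _ (hn ▸ hc.nodes_lt) (hc.occ hu) (h2 c ψ hc) h rfl⟩
    · cases φ with
      | equal t s =>
        simp only [Formula.Ev, huv, if_false] at h ⊢
        rwa [t.value_congr fun X hX => hw X (Finset.mem_union_left _ hX),
          s.value_congr fun X hX => hw X (Finset.mem_union_right _ hX)]
      | rel i ts =>
        simp only [Formula.Ev, huv, if_false] at h ⊢
        have : (fun j => (ts j).value A w') = fun j => (ts j).value A w :=
          funext fun j => (ts j).value_congr fun X hX =>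
            hw X (Finset.mem_biUnion.2 ⟨j, Finset.mem_univ _, hX⟩)
        rwa [this]
      | neg | and | or | ex | all => simp [Formula.kind] at hk

theorem realize_congr (hT : T = φ.toks) (hw : ∀ X ∈ φ.freeVars, w' X = w X)
    (h : φ.Realize A w) : φ.Realize A w' := by
  have := ev_local (A := A) (v := φ.len) (E := fun _ => True) (sg := true)
    (fun _ _ _ _ _ _ => trivial) (occ_root hT) hw ((ev_iff_realize (by omega)).2 (by simpa using h))
  simpa using (ev_iff_realize (by omega)).1 this

/-! ### Filling a hole -/

/-- Disjointness of a formula from the immediate subformulas that do not contain it. -/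
theorem Child.disjoint {d : ℕ} {χ : Formula τ} (h : Child u φ d χ) (hu : Occ T u φ)
    (hc : Occ T c ψ) (h1 : u < c) (h2 : ¬ (d ≤ c ∧ c < d + χ.len)) {z : ℕ} (h3 : c ≤ z)
    (h4 : z < c + ψ.len) : z < d ∨ d + χ.len ≤ z := by
  by_cases h5 : c < d
  · have := h.ends_before hu hc h1 h5
    omega
  · omega

theorem Child.unique {d d' : ℕ} {χ χ' : Formula τ} (hu : Occ T u φ) (h : Child u φ d χ)
    (h' : Child u φ d' χ') {z : ℕ} (h1 : d ≤ z) (h2 : z < d + χ.len) (h3 : d' ≤ z)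
    (h4 : z < d' + χ'.len) : d = d' ∧ χ = χ' := by
  have : d = d' := by
    rcases lt_trichotomy d d' with hlt | he | hlt
    · have := h'.ends_before hu (h.occ hu) h.lt hlt
      omega
    · exact he
    · have := h.ends_before hu (h'.occ hu) h'.lt hlt
      omega
  subst this
  exact ⟨rfl, (h.occ hu).unique (h'.occ hu)⟩

theorem Occ.kind_of_inside (hu : Occ T u φ) (hc : Occ T c ψ) (h1 : u < c) (h2 : c < u + φ.len) :
    7 ≤ φ.kind := by
  by_contra hk
  have := hu.kindAt_of_atomic (by omega) h1 h2
  have := ψ.kind_bounds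
  rw [hc.kindAt] at *
  omega

/-- A function that assigns to every position a sign, in accordance with the negations. -/
def SignOk (τ : Vocabulary) (T : List (Letter × ℕ)) (σ : ℕ → Bool) : Prop :=
  ∀ (u : ℕ) (φ : Formula τ) (c : ℕ) (ψ : Formula τ), Occ T u φ → Child u φ c ψ →
    σ c = φ.childSign (σ u)

variable {σ : ℕ → Bool}

/-- A hole may be filled by evaluating an intermediate formula. -/
theorem ev_comp (hσ : SignOk τ T σ) (hu : Occ T u φ) (hc : Occ T c ψ) (h1 : u ≤ c)
    (h2 : c < u + φ.len) (hv : (v < u ∨ u + φ.len ≤ v) ∨ (c ≤ v ∧ v < c + ψ.len)) :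
    φ.Ev A v E (σ u) u w ↔ φ.Ev A c (fun w' => ψ.Ev A v E (σ c) c w') (σ u) u w := by
  induction hn : φ.nodes using Nat.strong_induction_on generalizing u φ w with
  | _ n ih =>
    rcases Nat.eq_or_lt_of_le h1 with rfl | h1
    · rw [ev_self, hu.unique hc]
    · have hk := hu.kind_of_inside hc h1 h2
      have hle := hu.nested hc h1.le h2
      have hpos := φ.len_pos
      refine ev_congr hk (by omega) (by omega) fun d χ hd w => ?_
      rw [← hσ _ _ _ _ hu hd]
      have hdle := hd.le
      have hdlt := hd.lt
      by_cases hcd : d ≤ c ∧ c < d + χ.len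
      · exact ih _ (hn ▸ hd.nodes_lt) (hd.occ hu) hcd.1 hcd.2 (by omega) rfl
      · rw [ev_iff_realize, ev_iff_realize]
        · grind
        · rcases hv with hv | hv
          · omega
          · exact hd.disjoint hu hc h1 hcd hv.1 hv.2

/-- If no mismatched quantifier lies above the hole, then one assignment at the hole suffices. -/
theorem ev_linear (hσ : SignOk τ T σ) (hu : Occ T u φ) (hc : Occ T c ψ) (h1 : u ≤ c)
    (h2 : c < u + φ.len)
    (hp : ∀ (r : ℕ) (χ : Formula τ), Occ T r χ → u ≤ r → r < c → c < r + χ.len → ¬ χ.Mis (σ r))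
    (h : φ.Ev A c E (σ u) u w) : φ.Ev A c (fun _ => False) (σ u) u w ∨
      ∃ w0, E w0 ∧ φ.Ev A c (fun w' => ∀ X ∈ ψ.freeVars, w' X = w0 X) (σ u) u w := by
  induction hn : φ.nodes using Nat.strong_induction_on generalizing u φ w with
  | _ n ih =>
    rcases Nat.eq_or_lt_of_le h1 with rfl | h1
    · rw [ev_self] at h
      exact .inr ⟨w, h, ev_self.2 fun _ _ => rfl⟩
    have hk := hu.kind_of_inside hc h1 h2
    have hne : u ≠ c := by omega
    have hm := hp u φ hu le_rfl h1 h2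
    have hout : ∀ {d χ}, Child u φ d χ → ¬ (d ≤ c ∧ c < d + χ.len) →
        ∀ {E E' : (ℕ → Fin A.card) → Prop} {sg : Bool} {w}, χ.Ev A c E sg d w →
          χ.Ev A c E' sg d w := by
      intro d χ hd hcd E E' sg w H
      have := hd.disjoint hu hc h1 hcd le_rfl (by have := ψ.len_pos; omega)
      rw [ev_iff_realize this] at H ⊢
      exact H
    have hin : ∀ {d χ w}, Child u φ d χ → d ≤ c ∧ c < d + χ.len →
        χ.Ev A c E (φ.childSign (σ u)) d w →
        χ.Ev A c (fun _ => False) (φ.childSign (σ u)) d w ∨ ∃ w0, E w0 ∧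
          χ.Ev A c (fun w' => ∀ X ∈ ψ.freeVars, w' X = w0 X) (φ.childSign (σ u)) d w := by
      intro d χ w hd hcd H
      rw [← hσ _ _ _ _ hu hd] at H ⊢
      exact ih _ (hn ▸ hd.nodes_lt) (hd.occ hu) hcd.1 hcd.2
        (fun r χ hr h1 => hp r χ hr (by have := hd.lt; omega)) H rfl
    -- All parts of a conjunction have to be verified, but under the same assignment, and only one
    -- of them contains the hole; the others do not change when its filling is changed. So the
    -- assignment found in that part serves for the whole.
    by_cases hU : φ.Conj (σ u)
    · have hb : φ.boundVar = none := by
        cases φ <;> simp_all [Formula.Conj, Formula.kind, Formula.boundVar]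
      obtain ⟨d, χ, hd, hcd⟩ := exists_child hk h1 h2
      have key : ∀ {E'}, χ.Ev A c E' (φ.childSign (σ u)) d w → φ.Ev A c E' (σ u) u w := by
        intro E' H
        rw [ev_univ hk hne (.inl hU), hb] at h ⊢
        intro d' χ' hd' w' hw'
        by_cases hcd' : d' ≤ c ∧ c < d' + χ'.len
        · obtain ⟨rfl, rfl⟩ := Child.unique hu hd hd' hcd.1 hcd.2 hcd'.1 hcd'.2
          rwa [agreeOff_none.1 hw']
        · exact hout hd' hcd' (h d' χ' hd' w' hw')
      have H := (ev_univ hk hne (.inl hU)).1 h d χ hd w fun _ _ => rfl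
      rcases hin hd hcd H with H | ⟨w0, h3, H⟩
      · exact .inl (key H)
      · exact .inr ⟨w0, h3, key H⟩
    -- In all remaining cases one immediate subformula and one assignment are chosen. Universal
    -- quantifiers, the only nodes at which the hole could be reached under several assignments, are
    -- excluded by `hm`.
    · have hU' : ¬ (φ.Conj (σ u) ∨ φ.Mis (σ u)) := by tauto
      rw [ev_exists hk hne hU'] at h
      simp only [ev_exists hk hne hU']
      grind

end

/-! ### Structures as lists of tokens -/

/-- The tokens of a tuple. -/
def tupleToks (t : List ℕ) : List (Letter × ℕ) := (.tup, 0) :: t.map fun a => (.elt, a)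

/-- The tokens of a sequence of relations. -/
def blockToks (B : List (List (List ℕ))) : List (Letter × ℕ) :=
  B.flatMap fun b => (.rel, 0) :: b.flatMap tupleToks

/-- The tokens of a structure with `n` elements, constants `cs` and relations `B`. -/
def structToks (n : ℕ) (cs : List ℕ) (B : List (List (List ℕ))) : List (Letter × ℕ) :=
  (.univ, n) :: (cs.map (fun c => (.con, c)) ++ blockToks B)

namespace FinStructure

variable {τ : Vocabulary} (A : FinStructure τ)

/-- The values of the constants. -/
def consts : List ℕ := List.ofFn fun c => (A.const c : ℕ)

/-- The lists of the tuples of the relations. -/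
def blocks : List (List (List ℕ)) := List.ofFn fun i =>
  ((allTuples A.card (τ.arity i)).filter fun t => decide (t ∈ A.rel i)).map fun t =>
    List.ofFn fun j => (t j : ℕ)

/-- The tokens of a structure. -/
def toks : List (Letter × ℕ) := structToks A.card A.consts A.blocks

end FinStructure

theorem render_flatMap {α : Type} (l : List α) (f : α → List (Letter × ℕ)) :
    render ((l.flatMap f).map numTok) = l.flatMap fun a => render ((f a).map numTok) := by
  induction l with
  | nil => rfl
  | cons a l ih => simp [render_append, ih]

theorem render_map {α : Type} (l : List α) (f : α → Letter × ℕ) :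
    render ((l.map f).map numTok) = l.flatMap fun a => (f a).1 :: writeNat (f a).2 := by
  induction l with
  | nil => rfl
  | cons a l ih =>
    rw [List.map_cons, List.map_cons, List.flatMap_cons, ← ih]
    exact render_cons (f a).1 (f a).2 _

theorem write_eq_render {τ : Vocabulary} (A : FinStructure τ) :
    A.write = render (A.toks.map numTok) ++ .sep :: render ((List.ofFn τ.arity).map arityTok) := by
  have h0 : writeNat 0 = [] := by simp [writeNat]
  have h1 : render ((List.ofFn τ.arity).map arityTok) =
      (List.finRange τ.numRels).flatMap fun i => .rel :: List.replicate (τ.arity i) .one := by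
    rw [List.ofFn_eq_map, render, List.map_map, List.flatMap_map]
    simp [arityTok, digit]
  rw [h1]
  simp only [FinStructure.write, FinStructure.toks, structToks, FinStructure.consts,
    FinStructure.blocks, blockToks, List.map_cons, render_cons, List.map_append, render_append,
    render_flatMap, render_map, List.ofFn_eq_map, List.flatMap_map, h0, List.nil_append]
  simp only [List.cons_append, List.append_assoc, List.map_map, tupleToks]
  congr 3
  congr 1
  apply List.flatMap_congr
  intro i _
  congr 1
  rw [List.flatMap_congr]
  intro t _
  rw [List.map_cons, render_cons, h0, List.nil_append, render_map]
  rfl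

theorem encodePair_eq {τ : Vocabulary} (φ : Formula τ) (A : FinStructure τ) :
    encodePair φ A = toBinary (sections (φ.toks.map numTok) (A.toks.map numTok)
      ((List.ofFn τ.arity).map arityTok)) := by
  rw [encodePair, sections, render_toks, write_eq_render]

/-- The three sections of the input. -/
structure Sections (x : Inp) (T0 T1 : List (Letter × ℕ)) (ar : List ℕ) : Prop where
  formula : ∀ j i, get x 0 j i = tokenGet (T0.map numTok) j i
  struct : ∀ j i, get x 1 j i = tokenGet (T1.map numTok) j i
  arities : ∀ j i, get x 2 j i = tokenGet (ar.map arityTok) j i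

/-! ### Functions on the tokens of the structure -/

/-- The code of the first letter of token `j` of the structure. -/
def kds (x : Inp) (j : ℕ) : ℕ := get x 1 j 0

/-- The number of relations that begin before token `q` of the structure. -/
def relCount (x : Inp) (q : ℕ) : ℕ := bcount q fun i => neq (kds x i) 5

/-- The relation symbol `i` has arity `m`. -/
def arityIs (x : Inp) (i m : ℕ) : Bool := !neq (get x 2 i m) 0 && neq (get x 2 i (m + 1)) 0

/-- The length of the tuple at position `q`. -/
def tupLen (x : Inp) (N q : ℕ) : ℕ := bmin (N + 1) fun m => !neq (kds x (q + 1 + m)) 14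

/-- Lexicographic comparison of the `m`-tuples with first elements at `p` and `q`. -/
def lexLt (x : Inp) (N m p q : ℕ) : Bool :=
  bex m fun k => nlt (num x N 1 (p + k)) (num x N 1 (q + k)) &&
    ball k fun l => neq (num x N 1 (p + l)) (num x N 1 (q + l))

/-- A token with code `b` may follow a token with code `a` in a structure. -/
def follows (a b : ℕ) : Bool :=
  neq b 0 || neq b 5 || (neq b 4 && (neq a 12 || neq a 4)) ||
    (neq b 13 && (neq a 5 || neq a 13 || neq a 14)) || (neq b 14 && (neq a 13 || neq a 14))

/-- The second and the third section of the input describe a structure. -/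
def validStruct (x : Inp) (N : ℕ) : Bool :=
  neq (kds x 0) 12 && nle 1 (num x N 1 0) &&
  (ball N fun j => follows (kds x j) (kds x (j + 1))) &&
  (ball N fun j => !(neq (kds x j) 5 || neq (kds x j) 13) || neq (get x 1 j 1) 0) &&
  (ball N fun j => !(neq (kds x j) 4 || neq (kds x j) 14) || nlt (num x N 1 j) (num x N 1 0)) &&
  (neq (get x 2 (relCount x N) 0) 0 &&
    (neq (relCount x N) 0 || !neq (get x 2 (relCount x N - 1) 0) 0)) &&
  ball N fun q => !neq (kds x q) 13 || (arityIs x (relCount x q - 1) (tupLen x N q) &&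
    (!neq (kds x (q + 1 + tupLen x N q)) 13 ||
      lexLt x N (tupLen x N q) (q + 1) (q + 2 + tupLen x N q)))

section

variable {α : Type} [Obj α] {x : α → Inp} {N i j m p q : α → ℕ}

@[fun_prop] theorem ls_kds (hx : LS false x) (hj : LS false j) :
    LS false (fun a => kds (x a) (j a)) := by unfold kds; fun_prop

@[fun_prop] theorem ls_relCount (hx : LS false x) (hj : LS false j) :
    LS false (fun a => relCount (x a) (j a)) := by unfold relCount; fun_prop

@[fun_prop] theorem ls_arityIs (hx : LS false x) (hi : LS false i) (hm : LS false m) :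
    LS false (fun a => arityIs (x a) (i a) (m a)) := by unfold arityIs; fun_prop

@[fun_prop] theorem ls_tupLen (hx : LS false x) (hN : LS false N) (hj : LS false j) :
    LS false (fun a => tupLen (x a) (N a) (j a)) := by unfold tupLen; fun_prop

@[fun_prop] theorem ls_lexLt (hx : LS false x) (hN : LS false N) (hm : LS false m)
    (hp : LS false p) (hq : LS false q) :
    LS false (fun a => lexLt (x a) (N a) (m a) (p a) (q a)) := by unfold lexLt; fun_prop

@[fun_prop] theorem ls_follows (hp : LS false p) (hq : LS false q) :
    LS false (fun a => follows (p a) (q a)) := by unfold follows; fun_prop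

@[fun_prop] theorem ls_validStruct (hx : LS false x) (hN : LS false N) :
    LS false (fun a => validStruct (x a) (N a)) := by unfold validStruct; fun_prop

end

theorem bcount_eq_countP {T : List (Letter × ℕ)} {f p : ℕ → Bool}
    (hf : ∀ i, f i = p (kindAt T i)) (hp : p 0 = false) (m : ℕ) :
    bcount m f = (T.take m).countP fun t => p t.1.code := by
  induction m with
  | zero => rfl
  | succ m ih =>
    rw [List.take_add_one, List.countP_append, ← ih]
    have e : bcount (m + 1) f = bif f m then bcount m f + 1 else bcount m f := rfl
    rw [e, hf, kindAt]
    grind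

section

variable {x : Inp} {N : ℕ} {T0 T1 : List (Letter × ℕ)} {ar : List ℕ}

theorem Sections.kds_eq (h : Sections x T0 T1 ar) (j : ℕ) : kds x j = kindAt T1 j := by
  rw [kds, h.struct, tokenGet_zero, kindAt]
  cases e : T1[j]? <;> simp [e, numTok]

theorem Sections.relCount_eq (h : Sections x T0 T1 ar) (q : ℕ) :
    relCount x q = (T1.take q).countP fun t => decide (t.1.code = 5) :=
  bcount_eq_countP (p := fun c => decide (c = 5)) (fun i => by simp [neq, h.kds_eq]) rfl q

theorem tokenGet_arity (ar : List ℕ) (i m : ℕ) : tokenGet (ar.map arityTok) i m =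
    (ar[i]?).elim 0 fun r => if m = 0 then 5 else if m ≤ r then 2 else 0 := by
  cases e : ar[i]? with
  | none => simp [tokenGet, e]
  | some r =>
    rcases m with _ | m
    · simp [tokenGet, e, arityTok]
    · by_cases hm : m < r
      · simp [tokenGet, e, arityTok, hm, digit, Letter.code]
      · simp [tokenGet, e, arityTok, hm]

theorem Sections.arityIs_iff (h : Sections x T0 T1 ar) {i m : ℕ} :
    arityIs x i m = true ↔ ar[i]? = some m := by
  simp only [arityIs, h.arities, tokenGet_arity, Bool.and_eq_true, Bool.not_eq_true', neq,
    decide_eq_false_iff_not, decide_eq_true_iff]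
  cases e : ar[i]? with
  | none => simp
  | some r =>
    grind

/-- The tokens of the last section are consecutive, so a missing token at `n` and a present one at
`n - 1` determine their number. -/
theorem Sections.length_arities_iff (h : Sections x T0 T1 ar) {n : ℕ} :
    (neq (get x 2 n 0) 0 && (neq n 0 || !neq (get x 2 (n - 1) 0) 0)) = true ↔
      ar.length = n := by
  simp only [h.arities, tokenGet_arity, Bool.and_eq_true, Bool.or_eq_true, Bool.not_eq_true', neq,
    decide_eq_false_iff_not, decide_eq_true_iff, if_true]
  grind

/-- The conditions on the data of an encoded structure. -/
structure GoodBlocks (n : ℕ) (cs : List ℕ) (B : List (List (List ℕ))) (ar : List ℕ) : Prop where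
  pos : 1 ≤ n
  consts : ∀ c ∈ cs, c < n
  length : ar.length = B.length
  entries : ∀ b ∈ B, ∀ t ∈ b, ∀ a ∈ t, a < n
  arity : ∀ (i : ℕ) (b : List (List ℕ)), B[i]? = some b → ∀ t ∈ b, ar[i]? = some t.length
  chain : ∀ b ∈ B, b.IsChain (· < ·)

/-- The list is parsed from its end. The parts `e` and `tt` collect elements whose tuple and tuples
whose relation have not been opened yet; a constant can only stand in front of them if both are
empty. -/
theorem exists_blocks {T : List (Letter × ℕ)}
    (h1 : ∀ t ∈ T, t.1.code = 4 ∨ t.1.code = 5 ∨ t.1.code = 13 ∨ t.1.code = 14)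
    (h2 : ∀ t ∈ T, t.1.code = 5 ∨ t.1.code = 13 → t.2 = 0)
    (h3 : ∀ j, follows (kindAt T j) (kindAt T (j + 1)) = true) :
    ∃ (cs e : List ℕ) (tt : List (List ℕ)) (B : List (List (List ℕ))),
      T = cs.map (fun c => (.con, c)) ++ (e.map (fun a => (.elt, a)) ++
        (tt.flatMap tupleToks ++ blockToks B)) ∧ (cs ≠ [] → e = [] ∧ tt = []) := by
  induction T with
  | nil => exact ⟨[], [], [], [], rfl, by simp⟩
  | cons t T ih =>
    obtain ⟨cs, e, tt, B, rfl, hcs⟩ := ih (fun t ht => h1 t (by simp [ht]))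
      (fun t ht => h2 t (by simp [ht])) (fun j => by simpa [kindAt] using h3 (j + 1))
    obtain ⟨l, n⟩ := t
    have hl := h1 (l, n) (by simp)
    have hn := h2 (l, n) (by simp)
    have h : ∀ k, kindAt (cs.map (fun c => (Letter.con, c)) ++ (e.map (fun a => (Letter.elt, a)) ++
        (tt.flatMap tupleToks ++ blockToks B))) 0 = k → follows l.code k = true := by
      rintro k rfl
      simpa [kindAt] using h3 0
    simp only [follows, neq, Bool.or_eq_true, Bool.and_eq_true, decide_eq_true_iff] at h
    have hcon : l.code ≠ 4 → cs = [] := by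
      intro hl'
      rcases cs with _ | ⟨c, cs⟩
      · rfl
      · have := h 4 (by simp [kindAt])
        simp only at hl
        omega
    have helt : l.code = 4 ∨ l.code = 5 → e = [] := by
      intro hl'
      rcases e with _ | ⟨a, e⟩
      · rfl
      · rcases cs with _ | ⟨c, cs⟩
        · have := h 14 (by simp [kindAt])
          omega
        · exact (hcs (by simp)).1
    have htup : l.code = 4 → tt = [] := by
      intro hl'
      have he := helt (.inl hl')
      rcases tt with _ | ⟨a, tt⟩
      · rfl
      · rcases cs with _ | ⟨c, cs⟩
        · subst he
          have := h 13 (by simp [kindAt, tupleToks])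
          omega
        · exact (hcs (by simp)).2
    have hl' : l = .con ∨ l = .rel ∨ l = .tup ∨ l = .elt := by
      cases l <;> simp [Letter.code] at hl ⊢
    rcases hl' with rfl | rfl | rfl | rfl
    · obtain rfl := helt (.inl rfl)
      obtain rfl := htup rfl
      exact ⟨n :: cs, [], [], B, by simp, by simp⟩
    · obtain rfl := helt (.inr rfl)
      obtain rfl := hcon (by simp)
      obtain rfl := hn (.inl rfl)
      exact ⟨[], [], [], tt :: B, by simp [blockToks], by simp⟩
    · obtain rfl := hcon (by simp)
      obtain rfl := hn (.inr rfl)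
      exact ⟨[], [], e :: tt, B, by simp [tupleToks], by simp⟩
    · obtain rfl := hcon (by simp)
      exact ⟨[], n :: e, tt, B, by simp, by simp⟩

theorem Sections.exists_structToks (h : Sections x T0 T1 ar) (hN : T1.length ≤ N)
    (hv : validStruct x N = true) : ∃ n cs B, T1 = structToks n cs B := by
  simp only [validStruct, Bool.and_eq_true, ball_iff] at hv
  obtain ⟨⟨⟨⟨⟨⟨h1, -⟩, h2⟩, h3⟩, -⟩, -⟩, -⟩ := hv
  rw [neq_iff, h.kds_eq] at h1
  rcases T1 with _ | ⟨⟨l, n⟩, T⟩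
  · simp [kindAt] at h1
  have hl : l = .univ := by
    simp only [kindAt, List.getElem?_cons_zero, Option.elim_some] at h1
    cases l <;> simp [Letter.code] at h1
    rfl
  subst hl
  have h2' : ∀ j, follows (kindAt ((.univ, n) :: T) j) (kindAt ((.univ, n) :: T) (j + 1)) =
      true := by
    intro j
    rcases lt_or_ge j N with hj | hj
    · rw [← h.kds_eq, ← h.kds_eq]; exact h2 j hj
    · rw [kindAt_of_le (z := j + 1) (by omega)]
      simp [follows, neq]
  obtain ⟨cs, e, tt, B, rfl, hcs⟩ := exists_blocks (T := T) (fun t ht => by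
      obtain ⟨j, hj, rfl⟩ := List.mem_iff_getElem.1 ht
      have := h2' j
      have e : kindAt ((Letter.univ, n) :: T) (j + 1) = T[j].1.code := by
        simp [kindAt, List.getElem?_eq_getElem hj]
      rw [e] at this
      simp only [follows, neq, Bool.or_eq_true, Bool.and_eq_true, decide_eq_true_iff] at this
      have : T[j].1.code ≠ 0 := by cases T[j].1 <;> simp [Letter.code]
      omega)
    (fun t ht hk => by
      obtain ⟨j, hj, rfl⟩ := List.mem_iff_getElem.1 ht
      have := h3 (j + 1) (by simp at hN; omega)
      have e : ((Letter.univ, n) :: T)[j + 1]? = some T[j] := by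
        simp [List.getElem?_eq_getElem hj]
      have e' : kindAt ((Letter.univ, n) :: T) (j + 1) = T[j].1.code := by simp [kindAt, e]
      rw [h.kds_eq, e', h.struct, tokenGet_succ e] at this
      simp only [neq, Bool.or_eq_true, Bool.not_eq_true', Bool.or_eq_false_iff,
        decide_eq_false_iff_not, decide_eq_true_iff, bitCode, nlt, Bool.cond_eq_ite] at this
      rcases this with this | this
      · omega
      · split_ifs at this with h0
        by_contra hne
        exact h0 (Nat.size_pos.2 (by omega)))
    (fun j => by simpa [kindAt] using h2' (j + 1))
  have h0 := h2' 0
  have : e = [] ∧ tt = [] := by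
    rcases cs with _ | ⟨c, cs⟩
    · rcases e with _ | ⟨a, e⟩
      · rcases tt with _ | ⟨a, tt⟩
        · exact ⟨rfl, rfl⟩
        · simp [kindAt, follows, neq, tupleToks] at h0
      · simp [kindAt, follows, neq] at h0
    · exact hcs (by simp)
  obtain ⟨rfl, rfl⟩ := this
  exact ⟨n, cs, B, by simp [structToks]⟩

end

/-! ### Tuples of the encoded structure and the validity test -/

section

variable {x : Inp} {N n : ℕ} {T0 T1 : List (Letter × ℕ)} {ar cs : List ℕ}
  {B B1 B2 : List (List (List ℕ))} {b1 b2 : List (List ℕ)} {t : List ℕ}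

theorem exists_split_of_kindAt_tuples {b : List (List ℕ)} {q : ℕ}
    (h : kindAt (b.flatMap tupleToks) q = 13) :
    ∃ b1 t b2, b = b1 ++ t :: b2 ∧ q = (b1.flatMap tupleToks).length := by
  induction b generalizing q with
  | nil => simp [kindAt] at h
  | cons t b ih =>
    rcases q with _ | q
    · exact ⟨[], t, b, rfl, rfl⟩
    · rcases lt_or_ge q t.length with hq | hq
      · exfalso
        simp only [kindAt, List.flatMap_cons, tupleToks, List.cons_append,
          List.getElem?_cons_succ] at h
        rw [List.getElem?_append_left (by simpa using hq), List.getElem?_map,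
          List.getElem?_eq_getElem hq] at h
        simp at h
      · have : kindAt (b.flatMap tupleToks) (q - t.length) = 13 := by
          simp only [kindAt, List.flatMap_cons, tupleToks, List.cons_append,
            List.getElem?_cons_succ] at h ⊢
          rwa [List.getElem?_append_right (by simpa using hq), List.length_map] at h
        obtain ⟨b1, t', b2, rfl, hq'⟩ := ih this
        exact ⟨t :: b1, t', b2, rfl, by simp [tupleToks, ← hq']; omega⟩

theorem exists_split_of_kindAt_blocks {q : ℕ} (h : kindAt (blockToks B) q = 13) :
    ∃ B1 b1 t b2 B2, B = B1 ++ (b1 ++ t :: b2) :: B2 ∧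
      q = (blockToks B1 ++ (.rel, 0) :: b1.flatMap tupleToks).length := by
  induction B generalizing q with
  | nil => simp [kindAt, blockToks] at h
  | cons b B ih =>
    have e : blockToks (b :: B) = (.rel, 0) :: (b.flatMap tupleToks ++ blockToks B) := by
      simp [blockToks]
    rw [e] at h
    rcases q with _ | q
    · simp [kindAt] at h
    · rcases lt_or_ge q (b.flatMap tupleToks).length with hq | hq
      · have : kindAt (b.flatMap tupleToks) q = 13 := by
          simp only [kindAt, List.getElem?_cons_succ] at h ⊢
          rwa [List.getElem?_append_left hq] at h
        obtain ⟨b1, t, b2, rfl, rfl⟩ := exists_split_of_kindAt_tuples this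
        exact ⟨[], b1, t, b2, B, rfl, by simp [blockToks]⟩
      · have : kindAt (blockToks B) (q - (b.flatMap tupleToks).length) = 13 := by
          simp only [kindAt, List.getElem?_cons_succ] at h ⊢
          rwa [List.getElem?_append_right hq] at h
        obtain ⟨B1, b1, t, b2, B2, rfl, hq'⟩ := ih this
        refine ⟨b :: B1, b1, t, b2, B2, rfl, ?_⟩
        simp only [blockToks, List.flatMap_cons, List.length_append, List.length_cons] at hq' ⊢
        omega

/-- The tokens before a tuple. -/
def tuplePrefix (n : ℕ) (cs : List ℕ) (B1 : List (List (List ℕ))) (b1 : List (List ℕ)) :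
    List (Letter × ℕ) :=
  structToks n cs B1 ++ (.rel, 0) :: b1.flatMap tupleToks

theorem exists_split_of_kindAt {q : ℕ} (h : kindAt (structToks n cs B) q = 13) :
    ∃ B1 b1 t b2 B2, B = B1 ++ (b1 ++ t :: b2) :: B2 ∧
      q = (tuplePrefix n cs B1 b1).length := by
  rcases q with _ | q
  · simp [kindAt, structToks] at h
  rcases lt_or_ge q cs.length with hq | hq
  · exfalso
    simp only [kindAt, structToks, List.getElem?_cons_succ] at h
    rw [List.getElem?_append_left (by simpa using hq), List.getElem?_map,
      List.getElem?_eq_getElem hq] at h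
    simp at h
  · have : kindAt (blockToks B) (q - cs.length) = 13 := by
      simp only [kindAt, structToks, List.getElem?_cons_succ] at h ⊢
      rwa [List.getElem?_append_right (by simpa using hq), List.length_map] at h
    obtain ⟨B1, b1, t, b2, B2, rfl, hq'⟩ := exists_split_of_kindAt_blocks this
    refine ⟨B1, b1, t, b2, B2, rfl, ?_⟩
    simp only [List.length_append, List.length_cons, tuplePrefix, structToks,
      List.length_map] at hq' ⊢
    omega

theorem structToks_split : structToks n cs (B1 ++ (b1 ++ t :: b2) :: B2) =
    tuplePrefix n cs B1 b1 ++ (.tup, 0) :: (t.map (fun a => (.elt, a)) ++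
      (b2.flatMap tupleToks ++ blockToks B2)) := by
  simp [structToks, tuplePrefix, blockToks, tupleToks]

theorem countP_tuples (b : List (List ℕ)) :
    (b.flatMap tupleToks).countP (fun t => decide (t.1.code = 5)) = 0 := by
  rw [List.countP_eq_zero]
  intro a ha
  simp only [List.mem_flatMap, tupleToks, List.mem_cons, List.mem_map] at ha
  obtain ⟨t, -, rfl | ⟨c, -, rfl⟩⟩ := ha <;> simp

theorem countP_structToks :
    (structToks n cs B).countP (fun t => decide (t.1.code = 5)) = B.length := by
  have h1 : (cs.map fun c => (Letter.con, c)).countP (fun t => decide (t.1.code = 5)) = 0 := by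
    rw [List.countP_eq_zero]
    intro a ha
    obtain ⟨c, -, rfl⟩ := List.mem_map.1 ha
    simp
  have h2 : (blockToks B).countP (fun t => decide (t.1.code = 5)) = B.length := by
    induction B with
    | nil => rfl
    | cons b B ih =>
      have e : blockToks (b :: B) = (.rel, 0) :: (b.flatMap tupleToks ++ blockToks B) := by
        simp [blockToks]
      rw [e, List.countP_cons, List.countP_append, countP_tuples, ih]
      simp
  rw [structToks, List.countP_cons, List.countP_append, h1, h2]
  simp

/-- The data at the position of a tuple. -/
theorem Sections.at_tuple
    (h : Sections x T0 (structToks n cs (B1 ++ (b1 ++ t :: b2) :: B2)) ar)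
    (hN : (structToks n cs (B1 ++ (b1 ++ t :: b2) :: B2)).length ≤ N) :
    kds x (tuplePrefix n cs B1 b1).length = 13 ∧
    (tuplePrefix n cs B1 b1).length < N ∧
    relCount x (tuplePrefix n cs B1 b1).length = B1.length + 1 ∧
    (∀ (k : ℕ) (hk : k < t.length), num x N 1 ((tuplePrefix n cs B1 b1).length + 1 + k) =
      min t[k] (N + 1)) ∧
    tupLen x N (tuplePrefix n cs B1 b1).length = t.length ∧
    (kds x ((tuplePrefix n cs B1 b1).length + 1 + t.length) = 13 ↔ b2 ≠ []) := by
  have hs := structToks_split (n := n) (cs := cs) (B1 := B1) (b1 := b1) (t := t) (b2 := b2)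
    (B2 := B2)
  rw [hs] at h hN
  set P := tuplePrefix n cs B1 b1 with hP
  have hget : ∀ i, (P ++ (Letter.tup, 0) :: (t.map (fun a => (Letter.elt, a)) ++
      (b2.flatMap tupleToks ++ blockToks B2)))[P.length + 1 + i]? =
      (t.map (fun a => (Letter.elt, a)) ++ (b2.flatMap tupleToks ++ blockToks B2))[i]? := by grind
  have hk : ∀ k (hk : k < t.length), (P ++ (Letter.tup, 0) :: (t.map (fun a => (Letter.elt, a)) ++
      (b2.flatMap tupleToks ++ blockToks B2)))[P.length + 1 + k]? = some (.elt, t[k]) := by grind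
  have hend : kds x (P.length + 1 + t.length) =
      kindAt (b2.flatMap tupleToks ++ blockToks B2) 0 := by
    rw [h.kds_eq, kindAt, hget, List.getElem?_append_right (by simp), List.length_map,
      Nat.sub_self]
    rfl
  have hend' : kindAt (b2.flatMap tupleToks ++ blockToks B2) 0 = 13 ∧ b2 ≠ [] ∨
      (kindAt (b2.flatMap tupleToks ++ blockToks B2) 0 = 5 ∨
        kindAt (b2.flatMap tupleToks ++ blockToks B2) 0 = 0) ∧ b2 = [] := by
    rcases b2 with _ | ⟨t', b2⟩
    · rcases B2 with _ | ⟨b, B2⟩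
      · simp [kindAt, blockToks]
      · simp [kindAt, blockToks]
    · simp [kindAt, tupleToks]
  simp only [List.length_append, List.length_cons, List.length_map] at hN
  refine ⟨?_, by omega, ?_, fun k hk' => num_eq h.struct N (hk k hk'), ?_, ?_⟩
  · rw [h.kds_eq, kindAt, List.getElem?_append_right le_rfl]
    simp
  · rw [h.relCount_eq, List.take_left, hP, tuplePrefix, List.countP_append, countP_structToks,
      List.countP_cons, countP_tuples]
    simp
  · refine bmin_eq (by omega) ?_ fun m hm => ?_
    · rw [hend]
      simp only [Bool.not_eq_true', neq, decide_eq_false_iff_not]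
      omega
    · rw [h.kds_eq, kindAt, hk m hm]
      simp [neq]
  grind

theorem follows_five (a : ℕ) : follows a 5 = true := by simp [follows, neq]

theorem isChain_blockToks {R : Letter × ℕ → Letter × ℕ → Prop}
    (hR : ∀ a b : Letter × ℕ, follows a.1.code b.1.code = true → R a b) (B) :
    (blockToks B).IsChain R ∧ ∀ y ∈ (blockToks B).head?, y.1 = .rel := by
  have htup : ∀ (b : List (List ℕ)) (a : Letter × ℕ),
      a.1.code = 5 ∨ a.1.code = 13 ∨ a.1.code = 14 → (a :: b.flatMap tupleToks).IsChain R := by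
    intro b
    induction b with
    | nil => intro a _; simp
    | cons t b ih =>
      intro a ha
      have helt : ∀ (t : List ℕ) (a : Letter × ℕ), a.1.code = 13 ∨ a.1.code = 14 →
          (a :: (t.map (fun c => (Letter.elt, c)) ++ b.flatMap tupleToks)).IsChain R := by
        intro t
        induction t with
        | nil => exact fun a ha => ih a (.inr ha)
        | cons c t ih' =>
          intro a ha
          refine List.IsChain.cons_cons (hR _ _ ?_) (ih' (.elt, c) (by simp))
          rcases ha with ha | ha <;> simp [follows, neq, ha]
      refine List.IsChain.cons_cons (hR _ _ ?_) (helt t (.tup, 0) (by simp))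
      rcases ha with ha | ha | ha <;> simp [follows, neq, ha]
  induction B with
  | nil => simp [blockToks]
  | cons b B ih =>
    have e : blockToks (b :: B) = ((.rel, 0) :: b.flatMap tupleToks) ++ blockToks B := by
      simp [blockToks]
    rw [e]
    refine ⟨List.isChain_append.2 ⟨htup b _ (by simp), ih.1, fun a _ y hy => hR _ _ ?_⟩, by simp⟩
    rw [ih.2 y hy]
    exact follows_five _

theorem isChain_structToks {R : Letter × ℕ → Letter × ℕ → Prop}
    (hR : ∀ a b : Letter × ℕ, follows a.1.code b.1.code = true → R a b) :
    (structToks n cs B).IsChain R := by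
  have hcon : ∀ (cs : List ℕ) (a : Letter × ℕ), a.1.code = 12 ∨ a.1.code = 4 →
      (a :: (cs.map fun c => (Letter.con, c))).IsChain R := by
    intro cs
    induction cs with
    | nil => intro a _; simp
    | cons c cs ih =>
      intro a ha
      refine List.IsChain.cons_cons (hR _ _ ?_) (ih (.con, c) (by simp))
      rcases ha with ha | ha <;> simp [follows, neq, ha]
  obtain ⟨h1, h2⟩ := isChain_blockToks hR B
  rw [structToks, ← List.cons_append]
  refine List.isChain_append.2 ⟨hcon cs _ (by simp), h1, fun a _ y hy => hR _ _ ?_⟩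
  rw [h2 y hy]
  exact follows_five _

theorem follows_structToks (j : ℕ) :
    follows (kindAt (structToks n cs B) j) (kindAt (structToks n cs B) (j + 1)) = true := by
  have := isChain_structToks (n := n) (cs := cs) (B := B)
    (R := fun a b => follows a.1.code b.1.code = true) (fun _ _ h => h)
  rcases lt_or_ge (j + 1) (structToks n cs B).length with hj | hj
  · rw [kindAt, kindAt, List.getElem?_eq_getElem hj, List.getElem?_eq_getElem (by omega)]
    exact List.isChain_iff_getElem.1 this j hj
  · rw [kindAt_of_le hj]
    simp [follows, neq]

theorem lexLt_iff {t t' : List ℕ} {p q : ℕ}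
    (hl : t.length = t'.length) (ht : ∀ a ∈ t, a ≤ N) (ht' : ∀ a ∈ t', a ≤ N)
    (hp : ∀ (k : ℕ) (hk : k < t.length), num x N 1 (p + k) = min t[k] (N + 1))
    (hq : ∀ (k : ℕ) (hk : k < t'.length), num x N 1 (q + k) = min t'[k] (N + 1)) :
    lexLt x N t.length p q = true ↔ t < t' := by
  have hp' : ∀ (k : ℕ) (hk : k < t.length), num x N 1 (p + k) = t[k] := fun k hk => by
    rw [hp k hk]; have := ht _ (List.getElem_mem hk); omega
  have hq' : ∀ (k : ℕ) (hk : k < t'.length), num x N 1 (q + k) = t'[k] := fun k hk => by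
    rw [hq k hk]; have := ht' _ (List.getElem_mem hk); omega
  simp only [lexLt, bex_iff, Bool.and_eq_true, nlt_iff, ball_iff, neq_iff]
  rw [List.lt_iff_exists]
  constructor <;> grind

/-- Since `n ≤ N`, cutting numbers off at `N + 1` affects neither the test whether an entry is less
than `n` nor the lexicographic comparison of valid tuples. For a list that already has the right
shape, the test then checks the conditions of `GoodBlocks` one by one. -/
theorem Sections.validStruct_iff (h : Sections x T0 (structToks n cs B) ar)
    (hN : (structToks n cs B).length ≤ N) (hn : n ≤ N) :
    validStruct x N = true ↔ GoodBlocks n cs B ar := by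
  have hcard : num x N 1 0 = n := by
    rw [num_eq h.struct N (t := (.univ, n)) rfl]
    exact min_eq_left (by omega)
  have htok : ∀ p : Letter × ℕ → Prop, (∀ j < N, ∀ t, (structToks n cs B)[j]? = some t → p t) ↔
      ∀ t ∈ structToks n cs B, p t := by
    intro p
    constructor
    · intro H t ht
      obtain ⟨j, hj, rfl⟩ := List.mem_iff_getElem.1 ht
      exact H j (by omega) _ (List.getElem?_eq_getElem hj)
    grind
  have hnum : (∀ j < N, (!(neq (kds x j) 4 || neq (kds x j) 14) ||
      nlt (num x N 1 j) (num x N 1 0)) = true) ↔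
      ∀ t ∈ structToks n cs B, t.1.code = 4 ∨ t.1.code = 14 → t.2 < n := by
    rw [← htok, hcard]
    refine forall₂_congr fun j hj => ?_
    rw [h.kds_eq, kindAt]
    cases e : (structToks n cs B)[j]? with
    | none => simp [neq]
    | some t =>
      rw [num_eq h.struct N e]
      have hmin : min t.2 (N + 1) < n ↔ t.2 < n := by omega
      by_cases h4 : t.1.code = 4 <;> by_cases h14 : t.1.code = 14 <;>
        simp [neq, h4, h14, hmin]
  have hmem : (∀ t ∈ structToks n cs B, t.1.code = 4 ∨ t.1.code = 14 → t.2 < n) ↔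
      (∀ c ∈ cs, c < n) ∧ ∀ b ∈ B, ∀ t ∈ b, ∀ a ∈ t, a < n := by
    constructor
    · intro H
      refine ⟨fun c hc => H (.con, c) ?_ (by simp), fun b hb t ht a ha => H (.elt, a) ?_ (by simp)⟩
      · simp [structToks, hc]
      · simp only [structToks, blockToks, tupleToks, List.mem_cons, List.mem_append,
          List.mem_flatMap, List.mem_map]
        grind
    · rintro ⟨H1, H2⟩ t ht hk
      simp only [structToks, blockToks, tupleToks, List.mem_cons, List.mem_append,
          List.mem_flatMap, List.mem_map] at ht
      rcases ht with rfl | ⟨c, hc, rfl⟩ | ⟨b, hb, rfl | ⟨t, ht, rfl | ⟨a, ha, rfl⟩⟩⟩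
      · simp at hk
      · exact H1 c hc
      · simp at hk
      · simp at hk
      · exact H2 b hb t ht a ha
  have hrel : relCount x N = B.length := by
    rw [h.relCount_eq, List.take_of_length_le hN, countP_structToks]
  have hzero : ∀ j < N, (!(neq (kds x j) 5 || neq (kds x j) 13) || neq (get x 1 j 1) 0) = true := by
    intro j _
    rw [h.kds_eq, kindAt]
    cases e : (structToks n cs B)[j]? with
    | none => simp [neq]
    | some t =>
      rw [h.struct, tokenGet_succ e]
      have ht := List.mem_of_getElem? e
      simp only [structToks, blockToks, tupleToks, List.mem_cons, List.mem_append,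
          List.mem_flatMap, List.mem_map] at ht
      rcases ht with rfl | ⟨c, hc, rfl⟩ | ⟨b, hb, rfl | ⟨t, ht, rfl | ⟨a, ha, rfl⟩⟩⟩ <;>
        simp [neq, bitCode, nlt]
  have h0 : kds x 0 = 12 := by rw [h.kds_eq]; simp [kindAt, structToks]
  have htup : (∀ b ∈ B, ∀ t ∈ b, ∀ a ∈ t, a < n) → ((∀ q < N, (!neq (kds x q) 13 ||
      (arityIs x (relCount x q - 1) (tupLen x N q) &&
        (!neq (kds x (q + 1 + tupLen x N q)) 13 ||
          lexLt x N (tupLen x N q) (q + 1) (q + 2 + tupLen x N q)))) = true) ↔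
      (∀ (i : ℕ) (b : List (List ℕ)), B[i]? = some b → ∀ t ∈ b, ar[i]? = some t.length) ∧
        ∀ b ∈ B, b.IsChain (· < ·)) := by
    intro hent
    have key : (∀ q < N, (!neq (kds x q) 13 || (arityIs x (relCount x q - 1) (tupLen x N q) &&
        (!neq (kds x (q + 1 + tupLen x N q)) 13 ||
          lexLt x N (tupLen x N q) (q + 1) (q + 2 + tupLen x N q)))) = true) ↔
        ∀ B1 b1 t b2 B2, B = B1 ++ (b1 ++ t :: b2) :: B2 → ar[B1.length]? = some t.length ∧
          (b2 ≠ [] → lexLt x N t.length ((tuplePrefix n cs B1 b1).length + 1)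
            ((tuplePrefix n cs B1 b1).length + 2 + t.length) = true) := by
      constructor
      · rintro H B1 b1 t b2 B2 rfl
        obtain ⟨a1, a2, a3, -, a5, a6⟩ := h.at_tuple hN
        have := H _ a2
        rw [a1, a3, a5] at this
        simp only [neq, decide_true, Bool.not_true, Bool.false_or, Bool.and_eq_true,
          Nat.add_sub_cancel, h.arityIs_iff, Bool.or_eq_true, Bool.not_eq_true',
          decide_eq_false_iff_not, a6] at this
        exact ⟨this.1, fun hb => this.2.resolve_left (by simpa using hb)⟩
      · intro H q _
        by_cases hk : kds x q = 13
        · rw [h.kds_eq] at hk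
          obtain ⟨B1, b1, t, b2, B2, rfl, rfl⟩ := exists_split_of_kindAt hk
          obtain ⟨a1, a2, a3, -, a5, a6⟩ := h.at_tuple hN
          obtain ⟨h1, h2⟩ := H _ _ _ _ _ rfl
          rw [a1, a3, a5]
          simp only [neq, decide_true, Bool.not_true, Bool.false_or, Bool.and_eq_true,
            Nat.add_sub_cancel, h.arityIs_iff, Bool.or_eq_true, Bool.not_eq_true',
            decide_eq_false_iff_not, a6]
          exact ⟨h1, by tauto⟩
        · simp [neq, hk]
    rw [key]
    -- Adjacent tuples of a block are compared in place: the entries of the successor start after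
    -- the entries of `t` and the opening token of `t'`.
    have hlex : ∀ B1 b1 t t' b2 B2, B = B1 ++ (b1 ++ t :: t' :: b2) :: B2 →
        t.length = t'.length →
        (lexLt x N t.length ((tuplePrefix n cs B1 b1).length + 1)
            ((tuplePrefix n cs B1 b1).length + 2 + t.length) = true ↔ t < t') := by
      rintro B1 b1 t t' b2 B2 rfl hl
      have a4 := (h.at_tuple hN).2.2.2.1
      have e : b1 ++ t :: t' :: b2 = (b1 ++ [t]) ++ t' :: b2 := by simp
      have h' := h
      have hN' := hN
      rw [e] at h' hN'
      have a4' := (h'.at_tuple hN').2.2.2.1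
      refine lexLt_iff hl
        (fun a ha => (hent (b1 ++ t :: t' :: b2) (by simp) t (by simp) a ha).le.trans hn)
        (fun a ha => (hent (b1 ++ t :: t' :: b2) (by simp) t' (by simp) a ha).le.trans hn) a4 ?_
      have e' : (tuplePrefix n cs B1 (b1 ++ [t])).length + 1 =
          (tuplePrefix n cs B1 b1).length + 2 + t.length := by
        simp [tuplePrefix, tupleToks]; omega
      rwa [e'] at a4'
    constructor
    · intro H
      have har : ∀ (i : ℕ) (b : List (List ℕ)), B[i]? = some b → ∀ t ∈ b,
          ar[i]? = some t.length := by
        intro i b hb t ht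
        obtain ⟨hi, rfl⟩ := List.getElem?_eq_some_iff.1 hb
        obtain ⟨b1, b2, hb'⟩ := List.append_of_mem ht
        have e : B = B.take i ++ B[i] :: B.drop (i + 1) := by simp
        grind
      refine ⟨har, fun b hb => ?_⟩
      rw [List.isChain_iff_forall_rel_of_append_cons_cons]
      rintro t t' b1 b2 rfl
      obtain ⟨B1, B2, rfl⟩ := List.append_of_mem hb
      have hl : t.length = t'.length := by
        have h1 := har B1.length (b1 ++ t :: t' :: b2) (by simp) t (by simp)
        have h2 := har B1.length (b1 ++ t :: t' :: b2) (by simp) t' (by simp)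
        exact Option.some.inj (h1.symm.trans h2)
      exact (hlex _ _ _ _ _ _ rfl hl).1 ((H B1 b1 t (t' :: b2) B2 rfl).2 (by simp))
    · rintro ⟨H1, H2⟩ B1 b1 t b2 B2 rfl
      refine ⟨H1 B1.length (b1 ++ t :: b2) (by simp) t (by simp), fun hb => ?_⟩
      rcases b2 with _ | ⟨t', b2⟩
      · exact absurd rfl hb
      have hl : t.length = t'.length := by
        have h1 := H1 B1.length (b1 ++ t :: t' :: b2) (by simp) t (by simp)
        have h2 := H1 B1.length (b1 ++ t :: t' :: b2) (by simp) t' (by simp)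
        exact Option.some.inj (h1.symm.trans h2)
      refine (hlex _ _ _ _ _ _ rfl hl).2 ?_
      exact List.isChain_iff_forall_rel_of_append_cons_cons.1
        (H2 (b1 ++ t :: t' :: b2) (by simp)) rfl
  have hfol : ∀ j < N, follows (kds x j) (kds x (j + 1)) = true := fun j _ => by
    rw [h.kds_eq, h.kds_eq]; exact follows_structToks j
  have hlen := h.length_arities_iff (n := B.length)
  rw [Bool.and_eq_true] at hlen
  simp only [validStruct, Bool.and_eq_true, ball_iff]
  constructor
  · rintro ⟨⟨⟨⟨⟨⟨-, h1⟩, -⟩, -⟩, h2⟩, h3⟩, h4⟩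
    have h2' := (hnum.trans hmem).1 h2
    obtain ⟨h5, h6⟩ := (htup h2'.2).1 h4
    rw [nle_iff, hcard] at h1
    rw [hrel] at h3
    exact ⟨h1, h2'.1, hlen.1 h3, h2'.2, h5, h6⟩
  · rintro ⟨h1, h2, h3, h4, h5, h6⟩
    refine ⟨⟨⟨⟨⟨⟨by simp [neq, h0], by rwa [nle_iff, hcard]⟩, hfol⟩, hzero⟩,
      (hnum.trans hmem).2 ⟨h2, h4⟩⟩, ?_⟩, (htup h4).2 ⟨h5, h6⟩⟩
    rw [hrel]
    exact hlen.2 h3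

end

/-! ### Encoded structures -/

theorem mem_allTuples {n r : ℕ} (t : Fin r → Fin n) : t ∈ allTuples n r := by
  induction r with
  | zero => simp only [allTuples, List.mem_singleton]; exact Subsingleton.elim _ _
  | succ r ih =>
    simp only [allTuples, List.mem_flatMap, List.mem_map, List.mem_finRange, true_and]
    exact ⟨t 0, Fin.tail t, ih _, Fin.cons_self_tail t⟩

/-- The enumeration is strictly increasing, so the prescribed order of the tuples of a relation can
be recognized by comparing neighbours. -/
theorem pairwise_allTuples (n r : ℕ) : (allTuples n r).Pairwise fun t t' =>
    (List.ofFn fun j => (t j : ℕ)) < List.ofFn fun j => (t' j : ℕ) := by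
  induction r with
  | zero => simp [allTuples]
  | succ r ih =>
    rw [allTuples, List.pairwise_flatMap]
    refine ⟨fun a _ => ?_, (List.pairwise_lt_finRange n).imp fun {a a'} haa t ht t' ht' => ?_⟩
    · rw [List.pairwise_map]
      refine ih.imp fun {t t'} h => ?_
      rw [List.ofFn_succ, List.ofFn_succ, List.cons_lt_cons_iff]
      exact .inr ⟨by simp, by simpa using h⟩
    · obtain ⟨s, -, rfl⟩ := List.mem_map.1 ht
      obtain ⟨s', -, rfl⟩ := List.mem_map.1 ht'
      rw [List.ofFn_succ, List.ofFn_succ, List.cons_lt_cons_iff]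
      exact .inl (by simpa using haa)

/-- Both lists are strictly increasing and have the same members, and a strictly increasing list is
determined by its members. -/
theorem filter_allTuples_eq {n r : ℕ} {b : List (List ℕ)} (hb : b.IsChain (· < ·))
    (hr : ∀ t ∈ b, t.length = r) (hn : ∀ t ∈ b, ∀ a ∈ t, a < n)
    (p : (Fin r → Fin n) → Bool) (hp : ∀ t, p t = true ↔ (List.ofFn fun j => (t j : ℕ)) ∈ b) :
    ((allTuples n r).filter p).map (fun t => List.ofFn fun j => (t j : ℕ)) = b := by
  have h1 : (((allTuples n r).filter p).map
      (fun t => List.ofFn fun j => (t j : ℕ))).Pairwise (· < ·) := by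
    rw [List.pairwise_map]
    exact (pairwise_allTuples n r).filter _
  have h2 : b.Pairwise (· < ·) := List.isChain_iff_pairwise.1 hb
  refine List.Perm.eq_of_pairwise (fun a b _ _ h h' => absurd h' (lt_asymm h)) h1 h2 ?_
  rw [List.perm_ext_iff_of_nodup (h1.imp fun h => h.ne) (h2.imp fun h => h.ne)]
  intro l
  simp only [List.mem_map, List.mem_filter, hp]
  constructor
  · rintro ⟨t, ⟨-, ht⟩, rfl⟩
    exact ht
  · intro hl
    have hlr := hr l hl
    subst hlr
    have e : (List.ofFn fun j : Fin l.length =>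
        ((⟨l[j], hn l hl _ (List.getElem_mem _)⟩ : Fin n) : ℕ)) = l := by simp
    exact ⟨fun j => ⟨l[j], hn l hl _ (List.getElem_mem _)⟩, ⟨mem_allTuples _, by rwa [e]⟩, e⟩

/-- Each relation is read off as the set of tuples in its block. By `filter_allTuples_eq`, writing
this structure gives back the same tokens, so nothing but genuine encodings passes the test. -/
theorem GoodBlocks.exists_structure {n : ℕ} {cs : List ℕ} {B : List (List (List ℕ))} {ar : List ℕ}
    (h : GoodBlocks n cs B ar) : ∃ (τ : Vocabulary) (A : FinStructure τ),
      structToks n cs B = A.toks ∧ List.ofFn τ.arity = ar := by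
  classical
  have hi : ∀ i : Fin ar.length, (i : ℕ) < B.length := fun i => by
    have := h.length; omega
  refine ⟨⟨cs.length, ar.length, fun i => ar[i]⟩, ⟨n, h.pos, fun c => ⟨cs[c], h.consts _
    (List.getElem_mem _)⟩, fun i => Finset.univ.filter fun t : Fin ar[i] → Fin n =>
      (List.ofFn fun j => (t j : ℕ)) ∈ B[i]'(hi i)⟩, ?_, by simp⟩
  simp only [FinStructure.toks]
  congr 1
  · simp [FinStructure.consts]
  · refine List.ext_getElem (by simp [FinStructure.blocks, h.length]) fun i h1 h2 => ?_
    simp only [FinStructure.blocks, List.getElem_ofFn]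
    have hlt : i < ar.length := by have := h.length; omega
    refine (filter_allTuples_eq (h.chain _ (List.getElem_mem h1)) (fun t ht => ?_)
      (h.entries _ (List.getElem_mem h1)) _ fun t => by simp).symm
    have := h.arity i _ (List.getElem?_eq_getElem h1) t ht
    grind

theorem FinStructure.mem_blocks {τ : Vocabulary} (A : FinStructure τ) {i : ℕ}
    {b : List (List ℕ)} (hb : A.blocks[i]? = some b) :
    ∃ hi : i < τ.numRels, ∀ l, l ∈ b ↔ ∃ t ∈ A.rel ⟨i, hi⟩, (List.ofFn fun j => (t j : ℕ)) = l := by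
  obtain ⟨h, rfl⟩ := List.getElem?_eq_some_iff.1 hb
  have hi : i < τ.numRels := by simpa [FinStructure.blocks] using h
  refine ⟨hi, fun l => ?_⟩
  simp [FinStructure.blocks, mem_allTuples]

theorem FinStructure.goodBlocks {τ : Vocabulary} (A : FinStructure τ) :
    GoodBlocks A.card A.consts A.blocks (List.ofFn τ.arity) where
  pos := A.card_pos
  consts c hc := by
    obtain ⟨i, rfl⟩ := List.mem_ofFn.1 hc
    exact (A.const i).2
  length := by simp [FinStructure.blocks]
  entries b hb t ht a ha := by
    obtain ⟨i, hi, rfl⟩ := List.mem_iff_getElem.1 hb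
    obtain ⟨hi', H⟩ := A.mem_blocks (List.getElem?_eq_getElem hi)
    grind
  arity i b hb t ht := by
    obtain ⟨hi', H⟩ := A.mem_blocks hb
    grind
  chain b hb := by
    obtain ⟨i, rfl⟩ := List.mem_ofFn.1 hb
    rw [List.isChain_iff_pairwise, List.pairwise_map]
    exact (pairwise_allTuples _ _).filter _

/-! ### Evaluation of atomic formulas -/

/-- The value of the term at `z` in the assignment with code `α` to the free variables of the
subformula at `u`. -/
def termVal (x : Inp) (N n u α z : ℕ) : ℕ :=
  bif neq (kd x z) 3 then codeVal x N n u α z else num x N 1 (num x N 0 z + 1)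

/-- The truth value of the atomic formula at `u` in the assignment with code `α`. -/
def atomVal (x : Inp) (N n u α : ℕ) : Bool :=
  bif neq (kd x u) 6 then neq (termVal x N n u α (u + 1)) (termVal x N n u α (u + 2))
  else bex N fun q => neq (kds x q) 13 && neq (relCount x q) (num x N 0 u + 1) &&
    ball (fend x N u - (u + 1)) fun k =>
      neq (num x N 1 (q + 1 + k)) (termVal x N n u α (u + 1 + k))

section

variable {α : Type} [Obj α] {x : α → Inp} {N n u a z : α → ℕ}

@[fun_prop] theorem ls_termVal (hx : LS false x) (hN : LS false N) (hn : LS false n)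
    (hu : LS false u) (ha : LS false a) (hz : LS false z) :
    LS false (fun i => termVal (x i) (N i) (n i) (u i) (a i) (z i)) := by
  unfold termVal; fun_prop

@[fun_prop] theorem ls_atomVal (hx : LS false x) (hN : LS false N) (hn : LS false n)
    (hu : LS false u) (ha : LS false a) :
    LS false (fun i => atomVal (x i) (N i) (n i) (u i) (a i)) := by
  unfold atomVal; fun_prop

end

/-- The input encodes `φ` and `A`, and `N` is large enough to read it. -/
structure Setup {τ : Vocabulary} (x : Inp) (N : ℕ) (φ : Formula τ) (A : FinStructure τ) :
    Prop where
  sections : Sections x φ.toks A.toks (List.ofFn τ.arity)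
  reads : Reads x N φ.toks
  length_le : A.toks.length ≤ N
  card_le : A.card ≤ N

section

variable {τ : Vocabulary} {x : Inp} {N u z α : ℕ} {φ φ0 : Formula τ} {A : FinStructure τ}

/-- Every constant has a token in the structure, so its index is small and reading it is not
affected by the cut-off at `N + 1`. The same holds for relation symbols. -/
theorem Setup.const_lt (h : Setup x N φ0 A) (c : Fin τ.numConsts) : (c : ℕ) + 1 < N := by
  have := h.length_le
  simp [FinStructure.toks, structToks, FinStructure.consts] at this
  omega

theorem Setup.rel_lt (h : Setup x N φ0 A) (i : Fin τ.numRels) : (i : ℕ) < N := by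
  have h1 := h.length_le
  have h2 : A.blocks.length ≤ (blockToks A.blocks).length := by
    generalize A.blocks = B
    induction B with
    | nil => simp
    | cons b B ih => simp only [blockToks, List.flatMap_cons, List.length_append,
        List.length_cons] at ih ⊢; omega
  have h3 : A.blocks.length = τ.numRels := by simp [FinStructure.blocks]
  simp [FinStructure.toks, structToks] at h1
  omega

theorem Setup.num_const (h : Setup x N φ0 A) (c : Fin τ.numConsts) :
    num x N 1 (c + 1) = A.const c := by
  have : A.toks[(c : ℕ) + 1]? = some (.con, (A.const c : ℕ)) := by
    simp only [FinStructure.toks, structToks, List.getElem?_cons_succ]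
    rw [List.getElem?_append_left (by simp [FinStructure.consts])]
    simp [FinStructure.consts]
  rw [num_eq h.sections.struct N this]
  have h1 := (A.const c).2
  have h2 := h.card_le
  exact min_eq_left (by simp only; omega)

theorem Setup.termVal_eq (h : Setup x N φ0 A) (hu : Occ φ0.toks u φ) (hk : φ.kind < 7)
    (h1 : u ≤ z) (h2 : z < u + φ.len) (t : Term τ) (ht : φ0.toks[z]? = some t.tok) :
    termVal x N A.card u α z = t.value A (codeAsg x N φ0.toks A.card_pos u α) := by
  cases t with
  | var X =>
    have h3 : kindAt φ0.toks z = 3 := by simp [kindAt, ht, Term.tok]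
    have h4 : indexAt φ0.toks z = X := by simp [indexAt, ht, Term.tok]
    have h5 := h.reads.codeAsg_index A.card_pos (α := α)
      ((h.reads.freeOcc_atomic hu hk).2 ⟨h3, h1, h2⟩)
    rw [h4] at h5
    simp [termVal, h.reads.kd_eq, h3, neq, Term.value, h5]
  | const c =>
    have h3 : kindAt φ0.toks z = 4 := by simp [kindAt, ht, Term.tok]
    have h4 := num_eq h.reads.get_eq N ht
    have h5 := h.const_lt c
    rw [Term.tok, min_eq_left (by simp only; omega)] at h4
    simp [termVal, h.reads.kd_eq, h3, neq, Term.value, h4, h.num_const]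

/-- A relational atom is evaluated by searching the structure for a tuple that is preceded by
exactly `i + 1` relation markers, hence lies in block `i`, and whose entries are the values of the
terms. Only positions and single entries are stored, never a tuple. -/
theorem Setup.atomVal_iff (h : Setup x N φ0 A) (hu : Occ φ0.toks u φ) (hk : φ.kind < 7) :
    atomVal x N A.card u α = true ↔
      φ.Realize A (codeAsg x N φ0.toks A.card_pos u α) := by
  cases φ with
  | equal t s =>
    have e1 := hu.getElem? (i := 1) (by simp)
    have e2 := hu.getElem? (i := 2) (by simp)
    simp only [Formula.toks, List.getElem?_cons_succ, List.getElem?_cons_zero] at e1 e2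
    have h1 := h.termVal_eq (α := α) hu hk (by omega) (by simp) t e1
    have h2 := h.termVal_eq (α := α) hu hk (by omega) (by simp) s e2
    simp only [atomVal, h.reads.kd_eq, hu.kindAt, Formula.kind, h1, h2, Formula.Realize, neq,
      decide_true, cond_true, decide_eq_true_iff, Fin.ext_iff]
  | rel i ts =>
    have e0 := hu.getElem? (i := 0) (by simp)
    rw [Nat.add_zero] at e0
    have hnum := num_eq h.reads.get_eq N e0
    have hi := h.rel_lt i
    simp only at hnum
    rw [min_eq_left (by omega)] at hnum
    have hterm : ∀ (k : ℕ) (hk' : k < τ.arity i), termVal x N A.card u α (u + 1 + k) =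
        (ts ⟨k, hk'⟩).value A (codeAsg x N φ0.toks A.card_pos u α) := by
      intro k hk'
      refine h.termVal_eq hu hk (by omega) (by simp; omega) _ ?_
      rw [add_assoc, add_comm 1 k, hu.getElem? (by simp; omega)]
      simp [Formula.toks, hk']
    have hsec := h.sections
    have hlen := h.length_le
    have hcard := h.card_le
    simp only [FinStructure.toks] at hsec hlen
    simp only [atomVal, h.reads.kd_eq, hu.kindAt, Formula.kind, neq, h.reads.fend_eq hu, len_rel,
      hnum, Formula.Realize]
    simp only [show u + (τ.arity i + 1) - (u + 1) = τ.arity i by omega]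
    simp only [show decide (5 = 6) = false from rfl, cond_false, bex_iff, Bool.and_eq_true,
      decide_eq_true_iff, ball_iff]
    have hval : ∀ {b : List (List ℕ)} {i : ℕ}, A.blocks[i]? = some b → ∀ t ∈ b, ∀ a ∈ t, a ≤ N := by
      intro b i hb t ht a ha
      have := A.goodBlocks.entries b (List.mem_of_getElem? hb) t ht a ha
      omega
    constructor
    · rintro ⟨q, -, ⟨h1, h2⟩, h3⟩
      rw [hsec.kds_eq] at h1
      obtain ⟨B1, b1, t, b2, B2, hB, rfl⟩ := exists_split_of_kindAt h1
      rw [hB] at hsec hlen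
      obtain ⟨-, -, a3, a4, -, -⟩ := hsec.at_tuple hlen
      have hBi : A.blocks[(i : ℕ)]? = some (b1 ++ t :: b2) := by grind
      obtain ⟨hi', H⟩ := A.mem_blocks hBi
      obtain ⟨t', ht', rfl⟩ := (H t).1 (by simp)
      convert ht' using 1
      funext j
      apply Fin.ext
      rw [← hterm j j.2, ← h3 j j.2, a4 j (by simp)]
      grind
    · intro hmem
      have hlt : (i : ℕ) < A.blocks.length := by simp [FinStructure.blocks]
      obtain ⟨hi', H⟩ := A.mem_blocks (List.getElem?_eq_getElem hlt)
      have ht := (H _).2 ⟨_, hmem, rfl⟩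
      obtain ⟨b1, b2, hb⟩ := List.append_of_mem ht
      have hB : A.blocks = A.blocks.take i ++ A.blocks[(i : ℕ)] :: A.blocks.drop (i + 1) := by simp
      have hv := hval (List.getElem?_eq_getElem hlt) _ ht
      rw [hb] at hB
      rw [hB] at hsec hlen
      obtain ⟨a1, a2, a3, a4, -, -⟩ := hsec.at_tuple hlen
      refine ⟨_, a2, ⟨a1, ?_⟩, fun k hk' => ?_⟩
      · rw [a3, List.length_take, min_eq_left hlt.le]
      · rw [a4 k (by simpa using hk'), hterm k hk']
        simp only [List.getElem_ofFn]
        refine min_eq_left ?_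
        grind
  | neg | and | or | ex | all => simp [Formula.kind] at hk

end

/-! ### Claims about subformulas -/

def isNode (x : Inp) (j : ℕ) : Bool := nle 5 (kd x j) && nle (kd x j) 11

/-- Whether claims of level `j` assert the formula, for formulas in `Σ_t`. -/
def orient (t j : ℕ) : Bool := neq ((t + j) % 2) 0

/-- The truth value of the subformula at `u` that corresponds to the truth value `o` of the
sentence. -/
def sgn (x : Inp) (N : ℕ) (o : Bool) (u : ℕ) : Bool :=
  bif o then neq (negParity x N u) 0 else neq (negParity x N u) 1

/-- The number of nodes of the subformula at `u` outside the subformula at `v`. -/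
def weight (x : Inp) (N u v : ℕ) : ℕ :=
  bif inside x N u v then nodeCount x N u - nodeCount x N v else nodeCount x N u

/-- The measure that decreases when claims of level `j` are split. -/
def rank (x : Inp) (N t j u v : ℕ) : ℕ :=
  j * (2 * (nodeCount x N 0).size + 4) + bif mismatch x (orient t j) u then 1 else
    2 + 2 * (weight x N u v).size + bif inside x N u v then 1 else 0

/-- There is no mismatched quantifier between `u` and `c`. -/
def pathOk (x : Inp) (N : ℕ) (o : Bool) (u c : ℕ) : Bool :=
  ball c fun r => !(nle u r && nlt c (fend x N r) && mismatch x o r)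

/-- The assignments with codes `α` and `γ` agree on the common free variables. -/
def consistent (x : Inp) (N n u α c γ : ℕ) : Bool :=
  ball N fun z => !(freeOcc x N u z && freeOcc x N c z) ||
    neq (codeVal x N n u α z) (codeVal x N n c γ z)

/-- The subformula at `d` with the code `δ` is an immediate subformula of that at `c` with a code
that is compatible with `γ`. -/
def childMove (x : Inp) (N n c γ d δ : ℕ) : Bool :=
  (neq d (c + 1) || isBin x c && neq d (fend x N (c + 1))) && consistent x N n c γ d δ

/-- All immediate subformulas have to be considered. -/
def conjunctive (x : Inp) (N : ℕ) (o : Bool) (c : ℕ) : Bool :=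
  bif sgn x N o c then neq (kd x c) 8 else neq (kd x c) 9

/-- The position `c` may be used to split a claim about `u` with a hole at `v`. -/
def focus (x : Inp) (N t j u v c : ℕ) : Bool :=
  isNode x c && inside x N u c && !neq c v && (!inside x N u v || inside x N c v) &&
    pathOk x N (orient t j) u c && nlt (rank x N t j u c) (rank x N t j u v)

/-- The claim about `u` with a hole at `v` is reduced to the claim that the formula at `u` holds
with a hole at `c`, filled according to `γ`. -/
def simpleSplit (x : Inp) (N n t j u v c γ : ℕ) : Bool :=
  focus x N t j u v c && (neq γ 0 ||
    isAtom x c && !(xor (atomVal x N n c (γ - 1)) (sgn x N (orient t j) c)))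

/-- Besides, there are claims about `c` or about immediate subformulas `d` and `e`. -/
def fullSplit (x : Inp) (N n t j u v c γ d δ e ε : ℕ) : Bool :=
  focus x N t j u v c && nlt 0 γ && nlt (rank x N t j d v) (rank x N t j u v) &&
    nlt (rank x N t j e v) (rank x N t j u v) &&
    bif mismatch x (orient t j) c then neq d c && neq δ (γ - 1) && neq e c && neq ε (γ - 1)
    else nle 7 (kd x c) && childMove x N n c (γ - 1) d δ && childMove x N n c (γ - 1) e ε &&
      !(conjunctive x N (orient t j) c && neq d e)

section

variable {α : Type} [Obj α] {x : α → Inp} {N n t j u v c g d δ e ε : α → ℕ} {o : α → Bool}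

@[fun_prop] theorem ls_isNode (hx : LS false x) (hj : LS false j) :
    LS false (fun a => isNode (x a) (j a)) := by unfold isNode; fun_prop

@[fun_prop] theorem ls_orient (ht : LS false t) (hj : LS false j) :
    LS false (fun a => orient (t a) (j a)) := by unfold orient; fun_prop

@[fun_prop] theorem ls_sgn (hx : LS false x) (hN : LS false N) (ho : LS false o)
    (hu : LS false u) : LS false (fun a => sgn (x a) (N a) (o a) (u a)) := by
  unfold sgn; fun_prop

@[fun_prop] theorem ls_weight (hx : LS false x) (hN : LS false N) (hu : LS false u)
    (hv : LS false v) : LS false (fun a => weight (x a) (N a) (u a) (v a)) := by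
  unfold weight; fun_prop

@[fun_prop] theorem ls_rank (hx : LS false x) (hN : LS false N) (ht : LS false t)
    (hj : LS false j) (hu : LS false u) (hv : LS false v) :
    LS false (fun a => rank (x a) (N a) (t a) (j a) (u a) (v a)) := by unfold rank; fun_prop

@[fun_prop] theorem ls_pathOk (hx : LS false x) (hN : LS false N) (ho : LS false o)
    (hu : LS false u) (hc : LS false c) :
    LS false (fun a => pathOk (x a) (N a) (o a) (u a) (c a)) := by unfold pathOk; fun_prop

@[fun_prop] theorem ls_consistent (hx : LS false x) (hN : LS false N) (hn : LS false n)
    (hu : LS false u) (hg : LS false g) (hd : LS false d) (hδ : LS false δ) :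
    LS false (fun a => consistent (x a) (N a) (n a) (u a) (g a) (d a) (δ a)) := by
  unfold consistent; fun_prop

@[fun_prop] theorem ls_childMove (hx : LS false x) (hN : LS false N) (hn : LS false n)
    (hu : LS false u) (hg : LS false g) (hd : LS false d) (hδ : LS false δ) :
    LS false (fun a => childMove (x a) (N a) (n a) (u a) (g a) (d a) (δ a)) := by
  unfold childMove; fun_prop

@[fun_prop] theorem ls_conjunctive (hx : LS false x) (hN : LS false N) (ho : LS false o)
    (hc : LS false c) : LS false (fun a => conjunctive (x a) (N a) (o a) (c a)) := by
  unfold conjunctive; fun_prop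

@[fun_prop] theorem ls_focus (hx : LS false x) (hN : LS false N) (ht : LS false t)
    (hj : LS false j) (hu : LS false u) (hv : LS false v) (hc : LS false c) :
    LS false (fun a => focus (x a) (N a) (t a) (j a) (u a) (v a) (c a)) := by
  unfold focus; fun_prop

@[fun_prop] theorem ls_simpleSplit (hx : LS false x) (hN : LS false N) (hn : LS false n)
    (ht : LS false t) (hj : LS false j) (hu : LS false u) (hv : LS false v) (hc : LS false c)
    (hg : LS false g) : LS false (fun a =>
      simpleSplit (x a) (N a) (n a) (t a) (j a) (u a) (v a) (c a) (g a)) := by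
  unfold simpleSplit
  simp only [show ∀ a b : Bool, xor a b = bif a then !b else b by decide]
  fun_prop

@[fun_prop] theorem ls_fullSplit (hx : LS false x) (hN : LS false N) (hn : LS false n)
    (ht : LS false t) (hj : LS false j) (hu : LS false u) (hv : LS false v) (hc : LS false c)
    (hg : LS false g) (hd : LS false d) (hδ : LS false δ) (he : LS false e) (hε : LS false ε) :
    LS false (fun a => fullSplit (x a) (N a) (n a) (t a) (j a) (u a) (v a) (c a) (g a) (d a) (δ a)
      (e a) (ε a)) := by
  unfold fullSplit; fun_prop

end

/-- The filling of the hole at `v` according to `β`: either `False`, or the requirement that the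
free variables have the values given by the code `β - 1`. -/
def holeProp {τ : Vocabulary} (x : Inp) (N : ℕ) (φ0 : Formula τ) (A : FinStructure τ) (v β : ℕ)
    (w : ℕ → Fin A.card) : Prop :=
  0 < β ∧ ∀ z, freeOcc x N v z = true →
    (w (indexAt φ0.toks z) : ℕ) = codeVal x N A.card v (β - 1) z

/-- The truth of a claim. -/
def ClaimTrue {τ : Vocabulary} (x : Inp) (N t : ℕ) (φ0 : Formula τ) (A : FinStructure τ)
    (j u α v β : ℕ) : Prop :=
  ∀ φ : Formula τ, Occ φ0.toks u φ → φ.Ev A v (holeProp x N φ0 A v β) (sgn x N (orient t j) u) u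
    (codeAsg x N φ0.toks A.card_pos u α)

/-- The properties of the claims that arise. -/
structure ClaimOk {τ : Vocabulary} (x : Inp) (N t : ℕ) (φ0 : Formula τ) (j u v : ℕ) : Prop where
  occ : ∃ φ : Formula τ, Occ φ0.toks u φ
  level : inLevel x N (orient t j) j u = true
  hole : inside x N u v = true → isNode x v = true ∧ pathOk x N (orient t j) u v = true

/-- The input encodes `φ0` and `A`, where `φ0` is in `Σ_t`. -/
structure Game {τ : Vocabulary} (x : Inp) (N t : ℕ) (φ0 : Formula τ) (A : FinStructure τ) : Prop
    extends Setup x N φ0 A where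
  level : inLevel x N true t 0 = true

section

variable {τ : Vocabulary} {x : Inp} {N t j u v c d e α β γ δ ε : ℕ} {o : Bool}
  {φ ψ χ φ0 : Formula τ} {A : FinStructure τ}

theorem ev_atomic {E : (ℕ → Fin A.card) → Prop} {sg : Bool} {w : ℕ → Fin A.card}
    (hk : φ.kind < 7) (huv : u ≠ v) : φ.Ev A v E sg u w ↔ (φ.Realize A w ↔ sg = true) := by
  cases φ <;> simp_all [Formula.Ev, Formula.Realize, Formula.kind]

theorem Occ.nodes_le {T : List (Letter × ℕ)} (hu : Occ T u φ) (hc : Occ T c ψ) (h1 : u ≤ c)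
    (h2 : c < u + φ.len) : ψ.nodes ≤ φ.nodes ∧ (u < c → ψ.nodes < φ.nodes) := by
  induction hn : φ.nodes using Nat.strong_induction_on generalizing u φ with
  | _ n ih =>
    subst hn
    rcases Nat.eq_or_lt_of_le h1 with rfl | h1
    · rw [hu.unique hc]; simp
    · obtain ⟨d, χ, hd, h3, h4⟩ := exists_child (hu.kind_of_inside hc h1 h2) h1 h2
      have := (ih _ hd.nodes_lt (hd.occ hu) h3 h4 rfl).1
      have := hd.nodes_lt
      omega

/-- The position `c` lies in an immediate subformula other than `χ`, which is disjoint from it, and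
the first node of `φ` belongs to neither. -/
theorem Child.nodes_add_lt {T : List (Letter × ℕ)} (hd : Child u φ d χ) (hu : Occ T u φ)
    (hc : Occ T c ψ) (h1 : u < c) (h2 : c < u + φ.len) (h3 : ¬ (d ≤ c ∧ c < d + χ.len)) :
    χ.nodes + ψ.nodes < φ.nodes := by
  obtain ⟨d', χ', hd', h4, h5⟩ := exists_child (hu.kind_of_inside hc h1 h2) h1 h2
  have h6 := ((hd'.occ hu).nodes_le hc h4 h5).1
  have : χ.nodes + χ'.nodes < φ.nodes := by
    cases hd <;> cases hd' <;> (simp only [Formula.nodes]; omega)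
  omega

theorem isNode_iff_occ (h : Reads x N φ0.toks) :
    isNode x u = true ↔ ∃ φ : Formula τ, Occ φ0.toks u φ := by
  simp only [isNode, Bool.and_eq_true, nle_iff, h.kd_eq]
  constructor
  · exact fun H => exists_occ_of_kindAt rfl H.1
  · rintro ⟨φ, hφ⟩
    rw [hφ.kindAt]
    exact φ.kind_bounds

theorem sgn_not (x : Inp) (N : ℕ) (o : Bool) (u : ℕ) : sgn x N (!o) u = !sgn x N o u := by
  have : negParity x N u < 2 := Nat.mod_lt _ (by norm_num)
  cases o <;> simp only [sgn, neq, cond_true, cond_false, Bool.not_true, Bool.not_false] <;>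
    rcases (by omega : negParity x N u = 0 ∨ negParity x N u = 1) with h | h <;> simp [h]

theorem orient_self (t : ℕ) : orient t t = true := by simp [orient]; omega

theorem orient_succ (t j : ℕ) : orient t (j + 1) = !orient t j := by
  simp only [orient, neq]
  grind

theorem Setup.signOk (h : Setup x N φ0 A) (o : Bool) : SignOk τ φ0.toks (sgn x N o) := by
  intro u φ c ψ hu hc
  have e := h.reads.negParity_child rfl hu hc
  have : negParity x N u < 2 := Nat.mod_lt _ (by norm_num)
  simp only [sgn, e, Formula.childSign, neq]
  rcases (by omega : negParity x N u = 0 ∨ negParity x N u = 1) with h | h <;> rw [h] <;>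
    by_cases h7 : φ.kind = 7 <;> cases o <;> simp [h7]

/-- In a formula of `Σ_t` no quantifier is below a negation, so the sign at a quantifier is `o`
itself. Whether it is universal for the claiming player can then be read from its letter. -/
theorem Game.mis_iff (h : Game x N t φ0 A) (hu : Occ φ0.toks u φ) (o : Bool) :
    φ.Mis (sgn x N o u) ↔ mismatch x o u = true := by
  have hk := hu.kindAt
  by_cases hq : kindAt φ0.toks u = 10 ∨ kindAt φ0.toks u = 11
  · have e := h.reads.negParity_quantifier rfl h.level hq
    cases o <;> simp [mismatch, Formula.Mis, sgn, e, neq, h.reads.kd_eq, hk]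
  · cases o <;> simp [mismatch, Formula.Mis, h.reads.kd_eq] <;> omega

theorem Setup.localAt_holeProp (h : Setup x N φ0 A) (v β : ℕ) :
    LocalAt φ0.toks v (holeProp x N φ0 A v β) := by
  intro ψ hψ w w' hw H
  refine ⟨H.1, fun z hz => ?_⟩
  rw [hw _ ((h.reads.mem_freeVars hψ _).2 ⟨z, hz, rfl⟩)]
  exact H.2 z hz

theorem claimTrue_iff (hu : Occ φ0.toks u φ) : ClaimTrue x N t φ0 A j u α v β ↔
    φ.Ev A v (holeProp x N φ0 A v β) (sgn x N (orient t j) u) u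
      (codeAsg x N φ0.toks A.card_pos u α) :=
  ⟨fun H => H φ hu, fun H _ hφ' => hu.unique hφ' ▸ H⟩

theorem Setup.codeAsg_eq (h : Setup x N φ0 A) (hu : Occ φ0.toks u φ) {w : ℕ → Fin A.card}
    (H : ∀ z, freeOcc x N u z = true → (w (indexAt φ0.toks z) : ℕ) = codeVal x N A.card u α z) :
    ∀ X ∈ φ.freeVars, codeAsg x N φ0.toks A.card_pos u α X = w X := by
  intro X hX
  obtain ⟨z, hz, rfl⟩ := (h.reads.mem_freeVars hu X).1 hX
  exact Fin.ext ((h.reads.codeAsg_index A.card_pos hz).trans (H z hz).symm)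

theorem ClaimOk.sub (hX : ClaimOk x N t φ0 j u v) (h : Setup x N φ0 A) (hu : Occ φ0.toks u φ)
    (hc : Occ φ0.toks c ψ) (h1 : u ≤ c) (h2 : c < u + φ.len) : ClaimOk x N t φ0 j c v where
  occ := ⟨ψ, hc⟩
  level := h.reads.inLevel_sub hu hX.level hc h1 h2
  hole hv := by
    have hle := hu.nested hc h1 h2
    rw [h.reads.inside_iff hc] at hv
    obtain ⟨h3, h4⟩ := hX.hole ((h.reads.inside_iff hu).2 (by omega))
    refine ⟨h3, ?_⟩
    simp only [pathOk, ball_iff, Bool.not_eq_true', Bool.and_eq_false_imp, nle_iff, nlt_iff,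
      Bool.and_eq_true] at h4 ⊢
    grind

/-- A claim about a mismatched quantifier is the negation of a claim of lower level. -/
theorem Game.claimTrue_pred (h : Game x N t φ0 A) (hX : ClaimOk x N t φ0 j u v) (huv : u ≠ v)
    (hm : mismatch x (orient t j) u = true) : ∃ i, j = i + 1 ∧ ClaimOk x N t φ0 i u v ∧
      (ClaimTrue x N t φ0 A j u α v β ↔ ¬ ClaimTrue x N t φ0 A i u α v β) := by
  obtain ⟨φ, hu⟩ := hX.occ
  have hpos := φ.len_pos
  have hlev := hX.level
  have hq := mismatch_kindAt h.reads hm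
  -- The path from `u` to a hole inside contains `u` itself, and it is required to be free of
  -- mismatched quantifiers.
  have hout : ¬ inside x N u v = true := by
    intro hv
    have := (hX.hole hv).2
    rw [h.reads.inside_iff hu] at hv
    simp only [pathOk, ball_iff, Bool.not_eq_true', Bool.and_eq_false_imp, nle_iff, nlt_iff,
      Bool.and_eq_true] at this
    have := this u (by omega) ⟨le_rfl, by rw [h.reads.fend_eq hu]; omega⟩
    simp [hm] at this
  cases j with
  | zero =>
    rw [inLevel, h.reads.quantFree_iff hu] at hlev
    have := hlev u le_rfl (by omega)
    omega
  | succ i =>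
    rw [h.reads.inLevel_succ_iff hu] at hlev
    have hl := (hlev u le_rfl (by omega)).2 hm
    rw [orient_succ, Bool.not_not] at hl
    refine ⟨i, rfl, ⟨⟨φ, hu⟩, hl, fun hv => absurd hv hout⟩, ?_⟩
    rw [h.reads.inside_iff hu] at hout
    -- The hole being outside, both claims are plain statements on the truth of the same formula,
    -- and the orientations of consecutive levels are opposite.
    rw [claimTrue_iff hu, claimTrue_iff hu, ev_iff_realize (by omega), ev_iff_realize (by omega),
      orient_succ, sgn_not]
    cases sgn x N (orient t i) u <;> simp

/-- A claim with the hole at the top compares two codes. -/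
theorem Game.claimTrue_hole (h : Game x N t φ0 A) (hu : Occ φ0.toks u φ) :
    ClaimTrue x N t φ0 A j u α u β ↔
      0 < β ∧ consistent x N A.card u α u (β - 1) = true := by
  rw [claimTrue_iff hu, ev_self, holeProp]
  refine and_congr_right fun _ => ?_
  simp only [consistent, ball_iff, Bool.or_eq_true, Bool.not_eq_true', Bool.and_self, neq_iff]
  constructor
  · intro H z _
    by_cases hz : freeOcc x N u z = true
    · exact .inr ((h.reads.codeAsg_index A.card_pos hz).symm.trans (H z hz))
    · exact .inl (by simpa using hz)
  · intro H z hz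
    have hN := h.reads.length_le
    rcases H z (by have := h.reads.freeOcc_lt hz; omega) with h' | h'
    · rw [hz] at h'; cases h'
    · exact (h.reads.codeAsg_index A.card_pos hz).trans h'

end

/-! ### Splitting claims -/

section

variable {τ : Vocabulary} {x : Inp} {N t j u v c d e α β γ δ ε : ℕ} {o : Bool}
  {φ ψ χ φ0 : Formula τ} {A : FinStructure τ}

theorem Setup.focus_iff (h : Setup x N φ0 A) (hu : Occ φ0.toks u φ) :
    focus x N t j u v c = true ↔ (∃ ψ : Formula τ, Occ φ0.toks c ψ) ∧ (u ≤ c ∧ c < u + φ.len) ∧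
      c ≠ v ∧ (inside x N u v = true → inside x N c v = true) ∧
      pathOk x N (orient t j) u c = true ∧ rank x N t j u c < rank x N t j u v := by
  simp only [focus, Bool.and_eq_true, Bool.or_eq_true, Bool.not_eq_true', isNode_iff_occ h.reads,
    h.reads.inside_iff hu (z := c), neq, decide_eq_false_iff_not, nlt_iff, and_assoc]
  cases inside x N u v <;> simp

theorem pathOk_iff (h : Reads x N φ0.toks) : pathOk x N o u c = true ↔
    ∀ (r : ℕ) (χ : Formula τ), Occ φ0.toks r χ → u ≤ r → r < c → c < r + χ.len →
      ¬ mismatch x o r = true := by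
  simp only [pathOk, ball_iff, Bool.not_eq_true', Bool.and_eq_false_imp, nle_iff, nlt_iff,
    Bool.and_eq_true, Bool.not_eq_true]
  constructor
  · exact fun H r χ hr h1 h2 h3 => H r h2 ⟨h1, by rwa [h.fend_eq hr]⟩
  · intro H r h2 ⟨h1, h3⟩
    by_contra hm
    rw [Bool.not_eq_false] at hm
    obtain ⟨χ, hχ⟩ := exists_occ_of_kindAt (T := φ0.toks) (φ0 := φ0) (z := r) rfl
      (by have := mismatch_kindAt h hm; omega)
    rw [h.fend_eq hχ] at h3
    grind

theorem Setup.ev_comp_hole (h : Setup x N φ0 A) (hu : Occ φ0.toks u φ) (hc : Occ φ0.toks c ψ)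
    (h1 : u ≤ c) (h2 : c < u + φ.len) (hv : inside x N u v = true → inside x N c v = true)
    {E : (ℕ → Fin A.card) → Prop} {w : ℕ → Fin A.card} :
    φ.Ev A v E (sgn x N o u) u w ↔
      φ.Ev A c (fun w' => ψ.Ev A v E (sgn x N o c) c w') (sgn x N o u) u w := by
  refine ev_comp (h.signOk o) hu hc h1 h2 ?_
  rw [h.reads.inside_iff hu, h.reads.inside_iff hc] at hv
  omega

/-- The code `γ - 1` fixes the free variables at `c`, so every assignment that satisfies the filling
makes the formula at `c` behave as in the claim about it. Monotonicity in the filling and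
`ev_comp_hole` transfer this to `u`. For `γ = 0` the filling is false and nothing is needed at `c`.
-/
theorem Game.claimTrue_of_focus (h : Game x N t φ0 A) (hu : Occ φ0.toks u φ)
    (hc : Occ φ0.toks c ψ) (h1 : u ≤ c) (h2 : c < u + φ.len)
    (hv : inside x N u v = true → inside x N c v = true)
    (hX : ClaimTrue x N t φ0 A j u α c γ)
    (hψ : 0 < γ → ClaimTrue x N t φ0 A j c (γ - 1) v β) : ClaimTrue x N t φ0 A j u α v β := by
  rw [claimTrue_iff hu] at hX ⊢
  rw [h.ev_comp_hole hu hc h1 h2 hv]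
  refine ev_mono (fun w hw => ?_) hX
  exact ev_local (h.localAt_holeProp v β) hc
    (fun X hX => (h.codeAsg_eq hc hw.2 X hX).symm) ((claimTrue_iff hc).1 (hψ hw.1))

theorem Setup.child_iff (h : Setup x N φ0 A) (hc : Occ φ0.toks c ψ) (hk : 7 ≤ ψ.kind) :
    (neq d (c + 1) || isBin x c && neq d (fend x N (c + 1))) = true ↔
      ∃ χ, Child c ψ d χ := by
  have hf : ∀ {χ}, Child c ψ (c + 1) χ → fend x N (c + 1) = c + 1 + χ.len := fun H =>
    h.reads.fend_eq (H.occ hc)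
  simp only [Bool.or_eq_true, neq_iff, Bool.and_eq_true, isBin, h.reads.kd_eq, hc.kindAt]
  cases ψ <;> simp_all [Formula.kind, child_cases_iff] <;> grind

theorem Setup.conjunctive_iff (h : Setup x N φ0 A) (hc : Occ φ0.toks c ψ) :
    conjunctive x N o c = true ↔ ψ.Conj (sgn x N o c) := by
  rw [conjunctive, h.reads.kd_eq, hc.kindAt, Formula.Conj]
  cases sgn x N o c <;> simp

theorem Formula.Conj.boundVar {sg : Bool} (h : φ.Conj sg) : φ.boundVar = none := by
  cases φ <;> simp_all [Formula.Conj, Formula.kind, Formula.boundVar]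

/-- The codes of a formula and of its immediate subformula are merged: the value of the bound
variable is taken from the latter, all other values from the former. Consistency ensures that the
merged assignment has the right values at the free variables of `χ`. -/
theorem Game.exists_agreeOff (h : Game x N t φ0 A) (hc : Occ φ0.toks c ψ) (hd : Child c ψ d χ)
    (hcon : consistent x N A.card c γ d δ = true)
    (H : ClaimTrue x N t φ0 A j d δ v β) :
    ∃ w', AgreeOff ψ.boundVar (codeAsg x N φ0.toks A.card_pos c γ) w' ∧
      χ.Ev A v (holeProp x N φ0 A v β) (ψ.childSign (sgn x N (orient t j) c)) d w' := by
  classical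
  have hdo := hd.occ hc
  rw [claimTrue_iff hdo, h.signOk (orient t j) _ _ _ _ hc hd] at H
  refine ⟨fun X => if ψ.boundVar = some X then codeAsg x N φ0.toks A.card_pos d δ X else
    codeAsg x N φ0.toks A.card_pos c γ X, fun X hX => if_neg hX,
    ev_local (h.localAt_holeProp v β) hdo (fun X hX => ?_) H⟩
  by_cases hb : ψ.boundVar = some X
  · simp [hb]
  simp only [hb, if_false]
  obtain ⟨z, hz, rfl⟩ := (h.reads.mem_freeVars hdo X).1 hX
  have hz' := h.reads.freeOcc_inside hdo hz
  have hzc := (h.reads.freeOcc_child hc hd hz'.2.1 hz'.2.2).2 ⟨hz, hb⟩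
  have hN := h.reads.length_le
  have hlt := h.reads.freeOcc_lt hz
  simp only [consistent, ball_iff, Bool.or_eq_true, Bool.not_eq_true', neq_iff] at hcon
  rcases hcon z (by omega) with h' | h'
  · simp [hz, hzc] at h'
  · exact Fin.ext (by rw [h.reads.codeAsg_index A.card_pos hz,
      h.reads.codeAsg_index A.card_pos hzc, h'])

/-- A formula has at most two immediate subformulas. So two different ones exhaust a conjunction,
while in the remaining cases a single one is a witness. -/
theorem Game.claimTrue_of_children (h : Game x N t φ0 A) (hc : Occ φ0.toks c ψ) (hcv : c ≠ v)
    (hk : 7 ≤ ψ.kind) (hm : ¬ mismatch x (orient t j) c = true)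
    (hd : childMove x N A.card c γ d δ = true) (he : childMove x N A.card c γ e ε = true)
    (hde : conjunctive x N (orient t j) c = true → d ≠ e)
    (Hd : ClaimTrue x N t φ0 A j d δ v β) (He : ClaimTrue x N t φ0 A j e ε v β) :
    ClaimTrue x N t φ0 A j c γ v β := by
  rw [childMove, Bool.and_eq_true] at hd he
  obtain ⟨χ, hχ⟩ := (h.child_iff hc hk).1 hd.1
  obtain ⟨χ', hχ'⟩ := (h.child_iff hc hk).1 he.1
  obtain ⟨w, hw, Hw⟩ := h.exists_agreeOff hc hχ hd.2 Hd
  obtain ⟨w', hw', Hw'⟩ := h.exists_agreeOff hc hχ' he.2 He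
  rw [claimTrue_iff hc]
  rw [← h.mis_iff hc] at hm
  by_cases hU : ψ.Conj (sgn x N (orient t j) c)
  · have hb := hU.boundVar
    rw [hb, agreeOff_none] at hw hw'
    subst hw hw'
    have hde := hde ((h.conjunctive_iff hc).2 hU)
    rw [ev_univ hk hcv (.inl hU), hb]
    intro f ξ hf w hw
    rw [agreeOff_none.1 hw]
    have hf' := (h.child_iff hc hk).2 ⟨ξ, hf⟩
    simp only [Bool.or_eq_true, neq_iff, Bool.and_eq_true] at hf' hd he
    rcases (by omega : f = d ∨ f = e) with rfl | rfl
    · rwa [(hf.occ hc).unique (hχ.occ hc)]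
    · rwa [(hf.occ hc).unique (hχ'.occ hc)]
  · rw [ev_exists hk hcv (by tauto)]
    exact ⟨d, χ, hχ, w, hw, Hw⟩

/-- The claims that result from a split imply the claim that is split. -/
theorem Game.claimTrue_of_simpleSplit (h : Game x N t φ0 A) (hX : ClaimOk x N t φ0 j u v)
    (hs : simpleSplit x N A.card t j u v c γ = true) : ClaimOk x N t φ0 j u c ∧
      (ClaimTrue x N t φ0 A j u α c γ → ClaimTrue x N t φ0 A j u α v β) ∧
      rank x N t j u c < rank x N t j u v := by
  obtain ⟨φ, hu⟩ := hX.occ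
  rw [simpleSplit, Bool.and_eq_true, h.focus_iff hu] at hs
  obtain ⟨⟨⟨ψ, hc⟩, ⟨h1, h2⟩, h3, h4, h5, h6⟩, hs⟩ := hs
  refine ⟨⟨⟨φ, hu⟩, hX.level, fun _ => ⟨(isNode_iff_occ h.reads).2 ⟨ψ, hc⟩, h5⟩⟩, fun H =>
    h.claimTrue_of_focus hu hc h1 h2 h4 H fun hγ => ?_, h6⟩
  simp only [Bool.or_eq_true, neq_iff, hγ.ne', false_or, Bool.and_eq_true, isAtom, h.reads.kd_eq,
    hc.kindAt] at hs
  have hk : ψ.kind < 7 := by omega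
  rw [claimTrue_iff hc, ev_atomic hk h3, ← h.atomVal_iff hc hk]
  grind

theorem Game.claimTrue_of_fullSplit (h : Game x N t φ0 A) (hX : ClaimOk x N t φ0 j u v)
    (hs : fullSplit x N A.card t j u v c γ d δ e ε = true) : ClaimOk x N t φ0 j u c ∧
      ClaimOk x N t φ0 j d v ∧ ClaimOk x N t φ0 j e v ∧
      (ClaimTrue x N t φ0 A j u α c γ → ClaimTrue x N t φ0 A j d δ v β →
        ClaimTrue x N t φ0 A j e ε v β → ClaimTrue x N t φ0 A j u α v β) ∧
      rank x N t j u c < rank x N t j u v ∧ rank x N t j d v < rank x N t j u v ∧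
      rank x N t j e v < rank x N t j u v := by
  obtain ⟨φ, hu⟩ := hX.occ
  rw [fullSplit, Bool.and_eq_true, Bool.and_eq_true, Bool.and_eq_true, Bool.and_eq_true,
    h.focus_iff hu] at hs
  obtain ⟨⟨⟨⟨⟨⟨ψ, hc⟩, ⟨h1, h2⟩, h3, h4, h5, h6⟩, hγ⟩, hrd⟩, hre⟩, hs⟩ := hs
  have hcX := hX.sub h.toSetup hu hc h1 h2
  refine ⟨⟨⟨φ, hu⟩, hX.level, fun _ => ⟨(isNode_iff_occ h.reads).2 ⟨ψ, hc⟩, h5⟩⟩, ?_⟩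
  cases hm : mismatch x (orient t j) c with
  | true =>
    simp only [hm, cond_true, Bool.and_eq_true, neq_iff] at hs
    obtain ⟨⟨⟨rfl, rfl⟩, rfl⟩, rfl⟩ := hs
    exact ⟨hcX, hcX, fun H1 H2 _ => h.claimTrue_of_focus hu hc h1 h2 h4 H1 fun _ => H2, h6,
      by simpa using hrd, by simpa using hre⟩
  | false =>
    simp only [hm, cond_false, Bool.and_eq_true, nle_iff, h.reads.kd_eq, hc.kindAt,
      Bool.not_eq_true', Bool.and_eq_false_imp, neq, decide_eq_false_iff_not] at hs
    obtain ⟨⟨⟨hk, hd⟩, he⟩, hde⟩ := hs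
    have key : ∀ {d δ}, childMove x N A.card c (γ - 1) d δ = true → ClaimOk x N t φ0 j d v := by
      intro d δ hd
      rw [childMove, Bool.and_eq_true] at hd
      obtain ⟨χ, hχ⟩ := (h.child_iff hc hk).1 hd.1
      have := hχ.le
      have := χ.len_pos
      exact hcX.sub h.toSetup hc (hχ.occ hc) hχ.lt.le (by omega)
    exact ⟨key hd, key he, fun H1 H2 H3 => h.claimTrue_of_focus hu hc h1 h2 h4 H1 fun _ =>
      h.claimTrue_of_children hc h3 hk (by simp [hm]) hd he hde H2 H3, h6,
      by simpa using hrd, by simpa using hre⟩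

end

/-! ### Balanced choice of the splitting node -/

section

variable {τ : Vocabulary} {x : Inp} {N M t j u v c d α β γ : ℕ}
  {φ ψ χ φ0 : Formula τ} {A : FinStructure τ}

/-- This is the balancing step. Let $2^s$ be the greatest power of two that is at most the weight of
the claim. Among the nodes whose removal leaves fewer than $2^s$ nodes of the formula at `u` (and
which lie above the hole, if it is inside, and are reached without mismatched quantifiers) take one
with the fewest nodes. The outer part is then light. An immediate subformula of `c` either fails the
condition, and then it is light after removal of the hole, or it does not contain a hole that lies
below `c`; in the latter case its weight need not be halved, but the summand of `rank` that records
a hole inside drops. If `c` itself is mismatched, its rank is the least possible one at this level.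
-/
theorem Game.exists_focus (h : Game x N t φ0 A) (hX : ClaimOk x N t φ0 j u v)
    (hu : Occ φ0.toks u φ) (huv : u ≠ v) (hm : ¬ mismatch x (orient t j) u = true) :
    ∃ (c : ℕ) (ψ : Formula τ), Occ φ0.toks c ψ ∧ focus x N t j u v c = true ∧
      (mismatch x (orient t j) c = true → rank x N t j c v < rank x N t j u v) ∧
      (¬ mismatch x (orient t j) c = true →
        ∀ d χ, Child c ψ d χ → rank x N t j d v < rank x N t j u v) := by
  classical
  have hpos := φ.len_pos
  have hnp : ∀ φ : Formula τ, 0 < φ.nodes := fun φ => by cases φ <;> simp [Formula.nodes]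
  have hv : inside x N u v = true → ∃ ξ : Formula τ, Occ φ0.toks v ξ ∧ ξ.nodes < φ.nodes := by
    intro hv
    obtain ⟨ξ, hξ⟩ := (isNode_iff_occ h.reads).1 (hX.hole hv).1
    rw [h.reads.inside_iff hu] at hv
    exact ⟨ξ, hξ, (hu.nodes_le hξ hv.1 hv.2).2 (by omega)⟩
  have hK : 0 < weight x N u v := by
    rw [weight, h.reads.nodeCount_eq hu]
    cases hin : inside x N u v with
    | true =>
      obtain ⟨ξ, hξ, hlt⟩ := hv hin
      rw [h.reads.nodeCount_eq hξ, cond_true]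
      omega
    | false => exact hnp φ
  -- The binary length of the weight is what `rank` counts, twice; a weight below `2 ^ s` therefore
  -- lowers the rank by at least `2`, enough to absorb the summand for the hole.
  obtain ⟨s, hs⟩ : ∃ s, (weight x N u v).size = s + 1 :=
    ⟨_, (Nat.succ_pred_eq_of_pos (Nat.size_pos.2 hK)).symm⟩
  have hs1 : 2 ^ s ≤ weight x N u v := Nat.lt_size.1 (by omega)
  have hs2 : weight x N u v < 2 ^ s + 2 ^ s := by
    have := Nat.lt_size_self (weight x N u v)
    rw [hs, pow_succ] at this
    omega
  have hrank : rank x N t j u v = j * (2 * (nodeCount x N 0).size + 4) + (2 + 2 * (s + 1) +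
      bif inside x N u v then 1 else 0) := by simp [rank, hm, hs]
  have hsmall : ∀ {c d}, weight x N c d < 2 ^ s → rank x N t j c d < rank x N t j u v := by
    intro c d hlt
    rw [hrank, rank]
    have := Nat.size_le.2 hlt
    grind
  let P : ℕ → Formula τ → Prop := fun c ψ => Occ φ0.toks c ψ ∧ u ≤ c ∧ c < u + φ.len ∧ c ≠ v ∧
    (inside x N u v = true → inside x N c v = true) ∧ pathOk x N (orient t j) u c = true ∧
    φ.nodes < ψ.nodes + 2 ^ s
  have hex : ∃ m c ψ, P c ψ ∧ ψ.nodes = m := by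
    -- The formula at `u` itself qualifies: removing it leaves no nodes.
    refine ⟨_, u, φ, ⟨hu, le_rfl, by omega, huv, id, (pathOk_iff h.reads).2 ?_, ?_⟩, rfl⟩
    · intro r χ hr h1 h2; omega
    · have := Nat.two_pow_pos s; omega
  obtain ⟨c, ψ, ⟨hc, h1, h2, h3, h4, h5, h6⟩, hmin⟩ := Nat.find_spec hex
  have hcle := hu.nested hc h1 h2
  have hnle := (hu.nodes_le hc h1 h2).1
  refine ⟨c, ψ, hc, (h.focus_iff hu).2 ⟨⟨ψ, hc⟩, ⟨h1, h2⟩, h3, h4, h5, hsmall ?_⟩, ?_, ?_⟩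
  · rw [weight, (h.reads.inside_iff hu).2 ⟨h1, h2⟩, h.reads.nodeCount_eq hu,
      h.reads.nodeCount_eq hc, cond_true]
    omega
  · intro hmc
    rw [hrank, rank, hmc]
    simp only [cond_true]
    omega
  · intro hmc d χ hd
    have hdlt := hd.lt
    have hdle := hd.le
    have hdpos := χ.len_pos
    have hdo := hd.occ hc
    -- By minimality of `c`, an immediate subformula that is still admissible must be too small, so
    -- at least `2 ^ s` nodes of the formula at `u` lie outside of it.
    have hlight : d ≠ v → (inside x N u v = true → inside x N d v = true) →
        χ.nodes + 2 ^ s ≤ φ.nodes := by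
      intro h7 h8
      by_contra hcon
      refine Nat.find_min hex (m := χ.nodes) (hmin ▸ hd.nodes_lt) ⟨d, χ, ⟨hdo, by omega, by omega,
        h7, h8, (pathOk_iff h.reads).2 fun r ξ hr h9 h10 h11 => ?_, by omega⟩, rfl⟩
      rcases lt_trichotomy r c with hlt | rfl | hlt
      · exact (pathOk_iff h.reads).1 h5 r ξ hr h9 hlt (by omega)
      · exact hmc
      · have := hd.ends_before hc hr hlt h10
        omega
    have hw : ∀ b, inside x N d v = b → weight x N d v =
        bif b then χ.nodes - nodeCount x N v else χ.nodes := by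
      rintro b rfl
      rw [weight, h.reads.nodeCount_eq hdo]
    have hw' : ∀ b, inside x N u v = b → weight x N u v =
        bif b then φ.nodes - nodeCount x N v else φ.nodes := by
      rintro b rfl
      rw [weight, h.reads.nodeCount_eq hu]
    cases hin : inside x N u v with
    | false =>
      have hout : ¬ (u ≤ v ∧ v < u + φ.len) := by
        rw [← h.reads.inside_iff hu, hin]; simp
      have hind : inside x N d v = false := by
        rw [← Bool.not_eq_true, h.reads.inside_iff hdo]
        omega
      have := hlight (by omega) (by simp [hin])
      rw [hw' _ hin, cond_false] at hs2
      refine hsmall ?_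
      rw [hw _ hind, cond_false]
      omega
    | true =>
      obtain ⟨ξ, hξ, hlt⟩ := hv hin
      rw [hw' _ hin, cond_true, h.reads.nodeCount_eq hξ] at hs1 hs2
      have hcv := (h.reads.inside_iff hc).1 (h4 hin)
      cases hind : inside x N d v with
      | true =>
        refine hsmall ?_
        rw [hw _ hind, cond_true, h.reads.nodeCount_eq hξ]
        have := Nat.two_pow_pos s
        by_cases hdv : d = v
        · subst hdv
          rw [hdo.unique hξ]
          omega
        grind
      -- The hole is below `c` but not below `d`. The nodes of the formula at `d` are among those
      -- counted by the old weight, so the binary length does not increase, and the summand for a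
      -- hole inside changes from `1` to `0`.
      | false =>
        have := hd.nodes_add_lt hc hξ (by omega) hcv.2 (by
          rw [← h.reads.inside_iff hdo, hind]; simp)
        have h7 : (weight x N d v).size ≤ s + 1 := by
          rw [← hs]
          refine Nat.size_le_size ?_
          rw [hw _ hind, hw' _ hin, cond_false, cond_true, h.reads.nodeCount_eq hξ]
          omega
        rw [hrank, rank, hin, hind]
        cases mismatch x (orient t j) d <;> simp only [cond_true, cond_false] <;> omega

/-- Codes of the assignments to the free variables of subformulas are less than `M`. -/
def CodesBelow {τ : Vocabulary} (x : Inp) (N M : ℕ) (φ0 : Formula τ) (A : FinStructure τ) : Prop :=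
  ∀ (c : ℕ) (ψ : Formula τ), Occ φ0.toks c ψ → A.card ^ freeCount x N c < M

/-- An assignment found semantically is replaced by its code. The strict bound `γ + 1 < M` leaves
room for the shift by one in the filling of holes, where `0` stands for falsity. -/
theorem Game.exists_claimTrue (h : Game x N t φ0 A) (hM : CodesBelow x N M φ0 A)
    (hc : Occ φ0.toks c ψ) {w : ℕ → Fin A.card}
    (H : ψ.Ev A v (holeProp x N φ0 A v β) (sgn x N (orient t j) c) c w) :
    ∃ γ, γ + 1 < M ∧ (∀ z, freeOcc x N c z = true →
      codeVal x N A.card c γ z = w (indexAt φ0.toks z)) ∧ ClaimTrue x N t φ0 A j c γ v β := by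
  obtain ⟨γ, hγ, hw⟩ := h.reads.exists_code c w
  have := hM c ψ hc
  exact ⟨γ, by omega, hw, (claimTrue_iff hc).2 (ev_local (h.localAt_holeProp v β) hc
    (h.codeAsg_eq hc fun z hz => (hw z hz).symm) H)⟩

/-- For a conjunction both immediate subformulas are claimed. In all other cases the same witness is
used twice, so that every full split has the same shape. -/
theorem Game.exists_children (h : Game x N t φ0 A) (hM : CodesBelow x N M φ0 A)
    (hc : Occ φ0.toks c ψ) (hcv : c ≠ v) (hk : 7 ≤ ψ.kind)
    (hm : ¬ mismatch x (orient t j) c = true) (H : ClaimTrue x N t φ0 A j c γ v β) :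
    ∃ d δ e ε χ χ', Child c ψ d χ ∧ Child c ψ e χ' ∧ δ < M ∧ ε < M ∧
      childMove x N A.card c γ d δ = true ∧ childMove x N A.card c γ e ε = true ∧
      (conjunctive x N (orient t j) c = true → d ≠ e) ∧
      ClaimTrue x N t φ0 A j d δ v β ∧ ClaimTrue x N t φ0 A j e ε v β := by
  rw [claimTrue_iff hc] at H
  rw [← h.mis_iff hc] at hm
  have key : ∀ {d χ w}, Child c ψ d χ →
      AgreeOff ψ.boundVar (codeAsg x N φ0.toks A.card_pos c γ) w →
      χ.Ev A v (holeProp x N φ0 A v β) (ψ.childSign (sgn x N (orient t j) c)) d w →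
      ∃ δ, δ < M ∧ childMove x N A.card c γ d δ = true ∧ ClaimTrue x N t φ0 A j d δ v β := by
    intro d χ w hd hw H
    have hdo := hd.occ hc
    rw [← h.signOk (orient t j) _ _ _ _ hc hd] at H
    obtain ⟨δ, h1, h2, h3⟩ := h.exists_claimTrue hM hdo H
    refine ⟨δ, by omega, ?_, h3⟩
    rw [childMove, Bool.and_eq_true, h.child_iff hc hk]
    refine ⟨⟨χ, hd⟩, ?_⟩
    simp only [consistent, ball_iff, Bool.or_eq_true, Bool.not_eq_true', neq_iff]
    intro z _
    by_cases hz : freeOcc x N d z = true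
    · by_cases hz' : freeOcc x N c z = true
      · right
        have hi := h.reads.freeOcc_inside hdo hz
        have := ((h.reads.freeOcc_child hc hd hi.2.1 hi.2.2).1 hz').2
        rw [h2 z hz, hw _ this, h.reads.codeAsg_index A.card_pos hz']
      · left; simp [hz']
    · left; simp [hz]
  by_cases hU : ψ.Conj (sgn x N (orient t j) c)
  · rw [ev_univ hk hcv (.inl hU)] at H
    obtain ⟨d, e, χ, χ', hd, he, hne⟩ : ∃ d e χ χ', Child c ψ d χ ∧ Child c ψ e χ' ∧ d ≠ e := by
      cases ψ with
      | and φ ψ => exact ⟨_, _, _, _, .andLeft _ _ _, .andRight _ _ _, by have := φ.len_pos; omega⟩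
      | or φ ψ => exact ⟨_, _, _, _, .orLeft _ _ _, .orRight _ _ _, by have := φ.len_pos; omega⟩
      | equal | rel | neg | ex | all => simp [Formula.Conj, Formula.kind] at hU
    obtain ⟨δ, d1, d2, d3⟩ := key hd (fun _ _ => rfl) (H d χ hd _ fun _ _ => rfl)
    obtain ⟨ε, e1, e2, e3⟩ := key he (fun _ _ => rfl) (H e χ' he _ fun _ _ => rfl)
    exact ⟨d, δ, e, ε, χ, χ', hd, he, d1, e1, d2, e2, fun _ => hne, d3, e3⟩
  · rw [ev_exists hk hcv (by tauto)] at H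
    obtain ⟨d, χ, hd, w, hw, H⟩ := H
    obtain ⟨δ, d1, d2, d3⟩ := key hd hw H
    exact ⟨d, δ, d, δ, χ, χ, hd, hd, d1, d1, d2, d2,
      fun h' => absurd ((h.conjunctive_iff hc).1 h') hU, d3, d3⟩

/-- A true claim can be split into true claims. -/
theorem Game.exists_split (h : Game x N t φ0 A) (hM : CodesBelow x N M φ0 A)
    (hL : φ0.len < M) (hX : ClaimOk x N t φ0 j u v) (huv : u ≠ v)
    (hm : ¬ mismatch x (orient t j) u = true) (H : ClaimTrue x N t φ0 A j u α v β) :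
    (∃ c γ, c < M ∧ γ < M ∧ simpleSplit x N A.card t j u v c γ = true ∧
      ClaimTrue x N t φ0 A j u α c γ) ∨
    ∃ c γ d δ e ε, c < M ∧ γ < M ∧ d < M ∧ δ < M ∧ e < M ∧ ε < M ∧
      fullSplit x N A.card t j u v c γ d δ e ε = true ∧ ClaimTrue x N t φ0 A j u α c γ ∧
      ClaimTrue x N t φ0 A j d δ v β ∧ ClaimTrue x N t φ0 A j e ε v β := by
  obtain ⟨φ, hu⟩ := hX.occ
  have hltM : ∀ {c} {ψ : Formula τ}, Occ φ0.toks c ψ → c < M := by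
    intro c ψ hc
    have := hc.le_length
    have := ψ.len_pos
    simp only [Formula.len] at *
    omega
  obtain ⟨c, ψ, hc, hf, hr, hr'⟩ := h.exists_focus hX hu huv hm
  obtain ⟨-, ⟨h1, h2⟩, h3, h4, h5, h6⟩ := (h.focus_iff hu).1 hf
  have hcM := hltM hc
  rw [claimTrue_iff hu, h.ev_comp_hole hu hc h1 h2 h4] at H
  rcases ev_linear (h.signOk (orient t j)) hu hc h1 h2 (fun r χ hr a1 a2 a3 => by
    rw [h.mis_iff hr]
    exact (pathOk_iff h.reads).1 h5 r χ hr a1 a2 a3) H with H | ⟨w0, hw0, H⟩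
  -- The evaluation does not need the subformula at `c`: fill the hole with falsity.
  · refine .inl ⟨c, 0, hcM, by omega, by simp [simpleSplit, hf], ?_⟩
    rw [claimTrue_iff hu]
    exact ev_mono (fun _ hw => hw.elim) H
  obtain ⟨γ, g1, g2, g3⟩ := h.exists_claimTrue hM hc hw0
  have hX1 : ClaimTrue x N t φ0 A j u α c (γ + 1) := by
    rw [claimTrue_iff hu]
    refine ev_mono (fun w hw => ⟨by omega, fun z hz => ?_⟩) H
    rw [hw _ ((h.reads.mem_freeVars hc _).2 ⟨z, hz, rfl⟩), Nat.add_sub_cancel, g2 z hz]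
  by_cases hmc : mismatch x (orient t j) c = true
  · refine .inr ⟨c, γ + 1, c, γ, c, γ, hcM, g1, hcM, by omega, hcM, by omega, ?_, hX1, g3, g3⟩
    simp [fullSplit, hf, hr hmc, hmc]
  by_cases hk : 7 ≤ ψ.kind
  · obtain ⟨d, δ, e, ε, χ, χ', hd, he, b1, b2, b3, b4, b5, b6, b7⟩ :=
      h.exists_children hM hc h3 hk hmc g3
    refine .inr ⟨c, γ + 1, d, δ, e, ε, hcM, g1, hltM (hd.occ hc), b1, hltM (he.occ hc), b2, ?_,
      hX1, b6, b7⟩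
    rw [Bool.not_eq_true] at hmc
    simp only [fullSplit, hf, hmc,
      nlt_iff.2 (Nat.succ_pos γ), nlt_iff.2 (hr' (by simp [hmc]) d χ hd),
      nlt_iff.2 (hr' (by simp [hmc]) e χ' he), h.reads.kd_eq, hc.kindAt, nle_iff.2 hk,
      Nat.add_sub_cancel, b3, b4, cond_false, Bool.and_self, Bool.true_and, Bool.not_eq_true',
      Bool.and_eq_false_imp, neq, decide_eq_false_iff_not]
    exact b5
  -- An atomic formula is checked at once, and only the claim about the outer part remains.
  · refine .inl ⟨c, γ + 1, hcM, g1, ?_, hX1⟩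
    rw [claimTrue_iff hc, ev_atomic (by omega) h3, ← h.atomVal_iff hc (by omega)] at g3
    have := ψ.kind_bounds
    have ha : isAtom x c = true := by
      simp only [isAtom, h.reads.kd_eq, hc.kindAt, Bool.or_eq_true, neq_iff]
      omega
    simp only [simpleSplit, hf, ha, Nat.add_sub_cancel, Bool.true_and, Bool.or_eq_true]
    grind

end

/-! ### The game -/

/-- The digit with number `i` of `p` in base `M`. -/
def dig (M p i : ℕ) : ℕ := idiv M p i % M

/-- The moves. A position is a claim, or a split of a claim, or it is lost. A player wins
immediately with a true claim about the hole; a claim about a mismatched quantifier is passed to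
the opponent as a claim of lower level; other claims are split. The opponent challenges one of the
claims that result from the split. -/
def move (x : Inp) (N n t : ℕ) (P Q : ℕ → ℕ) : Bool :=
  bif neq (P 0) 0 then
    bif neq (P 2) (P 4) then
      neq (Q 0) 3 && nlt 0 (P 5) && consistent x N n (P 2) (P 3) (P 2) (P 5 - 1)
    else neq (Q 2) (P 2) && neq (Q 3) (P 3) && neq (Q 4) (P 4) && neq (Q 5) (P 5) &&
      bif mismatch x (orient t (P 1)) (P 2) then neq (Q 0) 0 && neq (Q 1) (P 1 - 1)
      else neq (Q 1) (P 1) &&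
        (neq (Q 0) 1 && simpleSplit x N n t (P 1) (P 2) (P 4) (Q 6) (Q 7) ||
          neq (Q 0) 2 && fullSplit x N n t (P 1) (P 2) (P 4) (Q 6) (Q 7) (Q 8) (Q 9) (Q 10) (Q 11))
  else nle (P 0) 2 && neq (Q 0) 0 && neq (Q 1) (P 1) &&
    (neq (Q 2) (P 2) && neq (Q 3) (P 3) && neq (Q 4) (P 6) && neq (Q 5) (P 7) ||
      neq (P 0) 2 && neq (Q 4) (P 4) && neq (Q 5) (P 5) &&
        (neq (Q 2) (P 8) && neq (Q 3) (P 9) || neq (Q 2) (P 10) && neq (Q 3) (P 11)))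

/-- The player to move wins from `p` within `d` moves. -/
def win (B : ℕ) (mv : ℕ → ℕ → Bool) : ℕ → ℕ → Bool
  | 0, _ => false
  | d + 1, p => bex B fun q => mv p q && !win B mv d q

section

variable {α : Type} [Obj α] {x : α → Inp} {N n t M p q i : α → ℕ}

@[fun_prop] theorem ls_dig (hM : LS false M) (hp : LS false p) (hi : LS false i) :
    LS false (fun a => dig (M a) (p a) (i a)) := by unfold dig; fun_prop

@[fun_prop] theorem ls_move (hx : LS false x) (hN : LS false N) (hn : LS false n)
    (ht : LS false t) (hM : LS false M) (hp : LS false p) (hq : LS false q) :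
    LS false (fun a => move (x a) (N a) (n a) (t a) (dig (M a) (p a)) (dig (M a) (q a))) := by
  unfold move; fun_prop

end

theorem exists_dig {M : ℕ} (hM : 0 < M) (l : List ℕ) (hl : ∀ a ∈ l, a < M) :
    ∃ q < M ^ 12, ∀ i < 12, dig M q i = l.getD i 0 := by
  obtain ⟨q, hq, H⟩ := exists_digits (M := M) (d := fun i => l.getD i 0) (fun i => by
    rw [List.getD_eq_getElem?_getD]
    cases e : l[i]? with
    | none => exact hM
    | some a => exact hl a (List.mem_of_getElem? e)) 12
  exact ⟨q, hq, fun i hi => by rw [dig, idiv_eq, H i hi]⟩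

/-- The player to move wins. -/
def PosTrue {τ : Vocabulary} (x : Inp) (N t : ℕ) (φ0 : Formula τ) (A : FinStructure τ)
    (P : ℕ → ℕ) : Prop :=
  match P 0 with
  | 0 => ClaimTrue x N t φ0 A (P 1) (P 2) (P 3) (P 4) (P 5)
  | 1 => ¬ ClaimTrue x N t φ0 A (P 1) (P 2) (P 3) (P 6) (P 7)
  | 2 => ¬ (ClaimTrue x N t φ0 A (P 1) (P 2) (P 3) (P 6) (P 7) ∧
      ClaimTrue x N t φ0 A (P 1) (P 8) (P 9) (P 4) (P 5) ∧
      ClaimTrue x N t φ0 A (P 1) (P 10) (P 11) (P 4) (P 5))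
  | _ => False

/-- The claims of a position arise and the game ends after at most `r` moves. -/
def PosOk {τ : Vocabulary} (x : Inp) (N t : ℕ) (φ0 : Formula τ) (P : ℕ → ℕ) (r : ℕ) : Prop :=
  match P 0 with
  | 0 => ClaimOk x N t φ0 (P 1) (P 2) (P 4) ∧ 2 * rank x N t (P 1) (P 2) (P 4) ≤ r
  | 1 => ClaimOk x N t φ0 (P 1) (P 2) (P 6) ∧ 2 * rank x N t (P 1) (P 2) (P 6) + 1 ≤ r
  | 2 => (ClaimOk x N t φ0 (P 1) (P 2) (P 6) ∧ ClaimOk x N t φ0 (P 1) (P 8) (P 4) ∧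
      ClaimOk x N t φ0 (P 1) (P 10) (P 4)) ∧ 2 * rank x N t (P 1) (P 2) (P 6) + 1 ≤ r ∧
      2 * rank x N t (P 1) (P 8) (P 4) + 1 ≤ r ∧ 2 * rank x N t (P 1) (P 10) (P 4) + 1 ≤ r
  | _ => True

/-! ### Length and correctness of the game -/

section

variable {τ : Vocabulary} {x : Inp} {N M t j u v d : ℕ} {φ φ0 : Formula τ} {A : FinStructure τ}
  {P Q : ℕ → ℕ}

theorem Game.weight_le (h : Game x N t φ0 A) (hu : Occ φ0.toks u φ) :
    weight x N u v ≤ nodeCount x N 0 := by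
  have h1 := hu.le_length
  have := φ.len_pos
  have h0 : Occ φ0.toks 0 φ0 := occ_root rfl
  have h2 := (h0.nodes_le hu (Nat.zero_le _) (by simp only [Formula.len] at *; omega)).1
  rw [← h.reads.nodeCount_eq hu, ← h.reads.nodeCount_eq h0] at h2
  rw [weight]
  grind

theorem rank_pos : 0 < rank x N t j u v := by
  rw [rank]
  grind

/-- The summand for the level dominates everything else. Hence handing a claim to the opponent one
level lower decreases the rank, even though its weight may be as large as that of the sentence. -/
theorem Game.rank_le (h : Game x N t φ0 A) (hu : Occ φ0.toks u φ) :
    rank x N t j u v < (j + 1) * (2 * (nodeCount x N 0).size + 4) := by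
  have := Nat.size_le_size (h.weight_le (v := v) hu)
  rw [rank, add_mul]
  grind

theorem Game.rank_pred (h : Game x N t φ0 A) (hu : Occ φ0.toks u φ) :
    rank x N t j u v < rank x N t (j + 1) u v := by
  refine (h.rank_le hu).trans_le ?_
  exact Nat.le_add_right _ _

/-- A claim allows twice its rank many moves, a split one more than twice the largest rank of its
claims. A move to a split lowers the rank, which pays for the two moves up to the next claim. -/
theorem Game.move_sound (h : Game x N t φ0 A) (hP : PosOk x N t φ0 P (d + 1))
    (hm : move x N A.card t P Q = true) :
    PosOk x N t φ0 Q d ∧ (¬ PosTrue x N t φ0 A Q → PosTrue x N t φ0 A P) := by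
  rcases (by omega : P 0 = 0 ∨ P 0 = 1 ∨ P 0 = 2 ∨ 2 < P 0) with h0 | h0 | h0 | h0
  · simp only [PosOk, h0] at hP
    obtain ⟨hX, hr⟩ := hP
    simp only [PosTrue.eq_def (P := P), h0]
    simp only [move, h0, neq_iff.2 rfl, cond_true] at hm
    by_cases huv : P 2 = P 4
    · simp only [huv, neq_iff.2 rfl, cond_true, Bool.and_eq_true, neq_iff, nlt_iff] at hm
      obtain ⟨φ, hφ⟩ := hX.occ
      rw [huv] at hφ
      simp only [PosOk, PosTrue, hm.1.1, true_and]
      rw [huv, h.claimTrue_hole hφ]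
      exact fun _ => ⟨hm.1.2, hm.2⟩
    · simp only [neq, huv, decide_false, cond_false, Bool.and_eq_true, decide_eq_true_iff] at hm
      obtain ⟨⟨⟨⟨e2, e3⟩, e4⟩, e5⟩, hm⟩ := hm
      by_cases hmis : mismatch x (orient t (P 1)) (P 2) = true
      · simp only [hmis, cond_true, Bool.and_eq_true, decide_eq_true_iff] at hm
        obtain ⟨i, hi, hok, htr⟩ := h.claimTrue_pred (α := P 3) (β := P 5) (A := A) hX huv hmis
        obtain ⟨φ, hφ⟩ := hX.occ
        have hrk := h.rank_pred (j := i) (v := P 4) hφ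
        rw [hi] at hm hr
        simp only [PosOk, PosTrue, hm.1, hm.2, e2, e3, e4, e5, Nat.add_sub_cancel]
        exact ⟨⟨hok, by omega⟩, htr.2⟩
      · simp only [hmis, cond_false, Bool.and_eq_true, decide_eq_true_iff, Bool.or_eq_true] at hm
        obtain ⟨e1, ⟨e0, hs⟩ | ⟨e0, hs⟩⟩ := hm
        · obtain ⟨s1, s2, s3⟩ := h.claimTrue_of_simpleSplit (α := P 3) (β := P 5) hX hs
          simp only [PosOk, PosTrue, e0, e1, e2, e3, not_not]
          exact ⟨⟨s1, by omega⟩, s2⟩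
        · obtain ⟨s1, s2, s3, s4, s5, s6, s7⟩ :=
            h.claimTrue_of_fullSplit (α := P 3) (β := P 5) hX hs
          simp only [PosOk, PosTrue, e0, e1, e2, e3, e4, e5, not_not]
          exact ⟨⟨⟨s1, s2, s3⟩, by omega, by omega, by omega⟩, fun H => s4 H.1 H.2.1 H.2.2⟩
  · simp only [PosOk, h0] at hP
    simp only [PosTrue.eq_def (P := P), h0]
    simp only [move, h0, neq, Bool.and_eq_true, Bool.or_eq_true, decide_eq_true_iff,
      show decide (1 = 0) = false from rfl, show ¬ (1 = 2) by omega, cond_false, false_and,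
      or_false] at hm
    obtain ⟨⟨⟨-, e0⟩, e1⟩, ⟨⟨e2, e3⟩, e4⟩, e5⟩ := hm
    simp only [PosOk, PosTrue, e0, e1, e2, e3, e4, e5]
    exact ⟨⟨hP.1, by omega⟩, id⟩
  · simp only [PosOk, h0] at hP
    simp only [PosTrue.eq_def (P := P), h0]
    simp only [move, h0, neq, Bool.and_eq_true, Bool.or_eq_true, decide_eq_true_iff,
      show decide (2 = 0) = false from rfl, cond_false, true_and] at hm
    obtain ⟨⟨⟨-, e0⟩, e1⟩, ⟨⟨⟨e2, e3⟩, e4⟩, e5⟩ | ⟨⟨e4, e5⟩, ⟨e2, e3⟩ | ⟨e2, e3⟩⟩⟩ := hm <;>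
      simp only [PosOk, PosTrue, e0, e1, e2, e3, e4, e5]
    · exact ⟨⟨hP.1.1, by omega⟩, by tauto⟩
    · exact ⟨⟨hP.1.2.1, by omega⟩, by tauto⟩
    grind
  · have h1 : nle (P 0) 2 = false := by simp [nle]; omega
    have h2 : neq (P 0) 0 = false := by simp [neq]; omega
    simp [move, h1, h2] at hm

/-- The winning move is read off from the truth of the position: prove the hole, hand over a
mismatched quantifier, split by `exists_split`, or challenge a false claim of a split. It is given
as a list of digits, filled up with zeros; the bound `4 ≤ M` provides the tags `0` to `3`. -/
theorem Game.move_complete (h : Game x N t φ0 A) (hM : CodesBelow x N M φ0 A) (hL : φ0.len < M)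
    (h4 : 4 ≤ M) (hP : PosOk x N t φ0 P (d + 1)) (hlt : ∀ i, P i < M)
    (hT : PosTrue x N t φ0 A P) : ∃ q < M ^ 12, move x N A.card t P (dig M q) = true ∧
      ¬ PosTrue x N t φ0 A (dig M q) := by
  have mk : ∀ l : List ℕ, (∀ a ∈ l, a < M) → ∃ q < M ^ 12, ∀ i < 12, dig M q i = l.getD i 0 :=
    exists_dig (by omega)
  have key : ∀ l : List ℕ, (∀ a ∈ l, a < M) →
      (∀ Q : ℕ → ℕ, (∀ i < 12, Q i = l.getD i 0) → move x N A.card t P Q = true ∧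
        ¬ PosTrue x N t φ0 A Q) → ∃ q < M ^ 12, move x N A.card t P (dig M q) = true ∧
          ¬ PosTrue x N t φ0 A (dig M q) := by
    intro l hl H
    obtain ⟨q, hq, hd⟩ := mk l hl
    exact ⟨q, hq, H _ hd⟩
  clear mk
  have claim : ∀ {u α v β}, u < M → α < M → v < M → β < M → (P 0 = 1 ∨ P 0 = 2) →
      ((u = P 2 ∧ α = P 3 ∧ v = P 6 ∧ β = P 7) ∨ P 0 = 2 ∧ v = P 4 ∧ β = P 5 ∧
        ((u = P 8 ∧ α = P 9) ∨ (u = P 10 ∧ α = P 11))) →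
      ¬ ClaimTrue x N t φ0 A (P 1) u α v β → ∃ q < M ^ 12, move x N A.card t P (dig M q) = true ∧
        ¬ PosTrue x N t φ0 A (dig M q) := by
    intro u α v β b1 b2 b3 b4 hP0 hc H
    refine key [0, P 1, u, α, v, β] (by simp; have := hlt 1; omega) fun Q hQ => ?_
    have e0 := hQ 0 (by omega)
    have e1 := hQ 1 (by omega)
    have e2 := hQ 2 (by omega)
    have e3 := hQ 3 (by omega)
    have e4 := hQ 4 (by omega)
    have e5 := hQ 5 (by omega)
    simp only [List.getD_cons_zero, List.getD_cons_succ] at e0 e1 e2 e3 e4 e5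
    simp only [PosTrue, e0, e1, e2, e3, e4, e5, H, not_false_eq_true, and_true]
    have h1 : nle (P 0) 2 = true := by simp; omega
    have h2 : neq (P 0) 0 = false := by simp [neq]; omega
    simp only [move, h1, h2, e0, e1, e2, e3, e4, e5, cond_false, Bool.and_eq_true,
      Bool.or_eq_true, neq_iff, true_and]
    simpa [and_assoc] using hc
  rcases (by omega : P 0 = 0 ∨ P 0 = 1 ∨ P 0 = 2 ∨ 2 < P 0) with h0 | h0 | h0 | h0
  · simp only [PosOk, h0] at hP
    simp only [PosTrue, h0] at hT
    obtain ⟨hX, hr⟩ := hP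
    clear claim
    by_cases huv : P 2 = P 4
    · refine key [3] (by simp; omega) fun Q hQ => ?_
      obtain ⟨φ, hφ⟩ := hX.occ
      rw [← huv, h.claimTrue_hole hφ] at hT
      have e0 := hQ 0 (by omega)
      simp only [List.getD_cons_zero] at e0
      simp only [PosTrue, e0, not_false_eq_true, and_true]
      simp [move, h0, huv ▸ hT.2, huv, hT.1, e0]
    have split : ∀ (k j : ℕ) (l : List ℕ), k < M → j < M → (∀ a ∈ l, a < M) →
        (∀ Q : ℕ → ℕ, Q 0 = k → Q 1 = j → Q 2 = P 2 → Q 3 = P 3 → Q 4 = P 4 → Q 5 = P 5 →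
          (∀ i < 6, Q (i + 6) = l.getD i 0) →
          (bif mismatch x (orient t (P 1)) (P 2) then neq k 0 && neq j (P 1 - 1)
            else neq j (P 1) && (neq k 1 && simpleSplit x N A.card t (P 1) (P 2) (P 4) (Q 6) (Q 7)
              || neq k 2 && fullSplit x N A.card t (P 1) (P 2) (P 4) (Q 6) (Q 7) (Q 8) (Q 9)
                (Q 10) (Q 11))) = true ∧ ¬ PosTrue x N t φ0 A Q) →
        ∃ q < M ^ 12, move x N A.card t P (dig M q) = true ∧
          ¬ PosTrue x N t φ0 A (dig M q) := by
      intro k j l hk hj hl H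
      refine key ([k, j, P 2, P 3, P 4, P 5] ++ l) ?_ fun Q hQ => ?_
      · grind
      · have e0 : Q 0 = k := hQ 0 (by omega)
        have e1 : Q 1 = j := hQ 1 (by omega)
        have e2 : Q 2 = P 2 := hQ 2 (by omega)
        have e3 : Q 3 = P 3 := hQ 3 (by omega)
        have e4 : Q 4 = P 4 := hQ 4 (by omega)
        have e5 : Q 5 = P 5 := hQ 5 (by omega)
        obtain ⟨H1, H2⟩ := H Q e0 e1 e2 e3 e4 e5 fun i hi => hQ (i + 6) (by omega)
        refine ⟨?_, H2⟩
        have hne : neq (P 2) (P 4) = false := by simp [neq, huv]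
        simpa [move, h0, hne, e0, e1, e2, e3, e4, e5] using H1
    by_cases hmis : mismatch x (orient t (P 1)) (P 2) = true
    · obtain ⟨i, hi, hok, htr⟩ := h.claimTrue_pred (α := P 3) (β := P 5) (A := A) hX huv hmis
      refine split 0 i [] (by omega) (by have := hlt 1; omega) (by simp)
        fun Q e0 e1 e2 e3 e4 e5 _ => ⟨by rw [hmis]; simp [hi], ?_⟩
      simp only [PosTrue, e0, e1, e2, e3, e4, e5]
      exact htr.1 hT
    · rcases h.exists_split hM hL hX huv hmis hT with ⟨c, γ, a1, a2, a3, a4⟩ |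
        ⟨c, γ, d, δ, e, ε, a1, a2, a3, a4, a5, a6, a7, a8, a9, a10⟩
      · refine split 1 (P 1) [c, γ] (by omega) (hlt 1) (by simp [a1, a2])
          fun Q e0 e1 e2 e3 e4 e5 H => ?_
        have e6 : Q 6 = c := H 0 (by omega)
        have e7 : Q 7 = γ := H 1 (by omega)
        simp only [PosTrue, e0, e1, e2, e3, e6, e7, not_not]
        exact ⟨by simp [hmis, a3], a4⟩
      · refine split 2 (P 1) [c, γ, d, δ, e, ε] (by omega) (hlt 1)
          (by simp [a1, a2, a3, a4, a5, a6]) fun Q e0 e1 e2 e3 e4 e5 H => ?_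
        have e6 : Q 6 = c := H 0 (by omega)
        have e7 : Q 7 = γ := H 1 (by omega)
        have e8 : Q 8 = d := H 2 (by omega)
        have e9 : Q 9 = δ := H 3 (by omega)
        have e10 : Q 10 = e := H 4 (by omega)
        have e11 : Q 11 = ε := H 5 (by omega)
        simp only [PosTrue, e0, e1, e2, e3, e4, e5, e6, e7, e8, e9, e10, e11, not_not]
        exact ⟨by simp [hmis, a7], a8, a9, a10⟩
  · simp only [PosTrue, h0] at hT
    exact claim (hlt 2) (hlt 3) (hlt 6) (hlt 7) (.inl h0) (.inl ⟨rfl, rfl, rfl, rfl⟩) hT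
  · simp only [PosTrue, h0] at hT
    by_cases H1 : ClaimTrue x N t φ0 A (P 1) (P 2) (P 3) (P 6) (P 7)
    · by_cases H2 : ClaimTrue x N t φ0 A (P 1) (P 8) (P 9) (P 4) (P 5)
      · exact claim (hlt 10) (hlt 11) (hlt 4) (hlt 5) (.inr h0)
          (.inr ⟨h0, rfl, rfl, .inr ⟨rfl, rfl⟩⟩) fun H3 => hT ⟨H1, H2, H3⟩
      · exact claim (hlt 8) (hlt 9) (hlt 4) (hlt 5) (.inr h0)
          (.inr ⟨h0, rfl, rfl, .inl ⟨rfl, rfl⟩⟩) H2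
    · exact claim (hlt 2) (hlt 3) (hlt 6) (hlt 7) (.inr h0) (.inl ⟨rfl, rfl, rfl, rfl⟩) H1
  · rw [PosTrue] at hT
    split at hT <;> first | omega | exact hT.elim

/-- Ranks are positive, so with no moves left only a lost position is possible. Otherwise soundness
and completeness of the moves give the two directions. -/
theorem Game.win_iff (h : Game x N t φ0 A) (hM : CodesBelow x N M φ0 A) (hL : φ0.len < M)
    (h4 : 4 ≤ M) {p : ℕ} (hP : PosOk x N t φ0 (dig M p) d) :
    win (M ^ 12) (fun p q => move x N A.card t (dig M p) (dig M q)) d p = true ↔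
      PosTrue x N t φ0 A (dig M p) := by
  induction d generalizing p with
  | zero =>
    simp only [win, Bool.false_eq_true, false_iff]
    rw [PosOk] at hP
    rw [PosTrue]
    split at hP
    · have := rank_pos (x := x) (N := N) (t := t) (j := dig M p 1) (u := dig M p 2)
        (v := dig M p 4)
      omega
    · omega
    · omega
    · simp
  | succ d ih =>
    rw [win, bex_iff]
    constructor
    · rintro ⟨q, hq, H⟩
      rw [Bool.and_eq_true, Bool.not_eq_true'] at H
      obtain ⟨h1, h2⟩ := h.move_sound hP H.1
      grind
    · intro hT
      obtain ⟨q, hq, h1, h2⟩ := h.move_complete hM hL h4 hP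
        (fun i => Nat.mod_lt _ (by omega)) hT
      refine ⟨q, hq, ?_⟩
      rw [← ih (h.move_sound hP h1).1] at h2
      simpa [h1] using h2

end

/-! ### Depth-first search -/

/-- One step of the search. In the state `(S, d, r)` the digits of `S` in base `B` are the
positions on the current path, the last one being the current position, from which at most `d`
moves are considered. Either the current position has the value `r < 2`, or the moves to the
positions `q ≥ r - 2` are still to be tried. -/
def searchStep (B D L : ℕ) (mv : ℕ → ℕ → Bool) (s : ℕ × ℕ × ℕ) : ℕ × ℕ × ℕ :=
  bif nlt s.2.2 2 then
    bif neq s.2.1 D then s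
    else (s.1 / B, s.2.1 + 1, bif neq s.2.2 1 then s.1 % B + 3 else 1)
  else bif neq s.2.1 0 || nle (B + 2) s.2.2 then (s.1, s.2.1, 0)
  else bif mv (s.1 % B) (s.2.2 - 2) && nle (s.1 * B + (s.2.2 - 2)) L then
    (s.1 * B + (s.2.2 - 2), s.2.1 - 1, 2)
  else (s.1, s.2.1, s.2.2 + 1)

/-- The value of the position `p`, determined by `L` steps of the search. -/
def search (B D L : ℕ) (mv : ℕ → ℕ → Bool) (p : ℕ) : Bool :=
  neq (iter L (p, D, 2) fun _ => searchStep B D L mv).2.2 1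

/-- The bound holds for arbitrary data, because a step that would push the path beyond `L` is
refused. Linear space must be guaranteed for all arguments, including those for which the search is
meaningless. -/
theorem searchStep_bound {B D L p : ℕ} {mv : ℕ → ℕ → Bool} (i : ℕ) :
    let s := iter i (p, D, 2) fun _ => searchStep B D L mv
    s.1 ≤ p + L ∧ s.2.1 ≤ D ∧ s.2.2 ≤ p + L + B + 3 := by
  induction i with
  | zero => simp [iter]
  | succ i ih =>
    simp only [iter] at ih ⊢
    generalize (iter i (p, D, 2) fun _ => searchStep B D L mv) = s at ih
    obtain ⟨S, d, r⟩ := s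
    simp only [searchStep, Bool.cond_eq_ite, nlt_iff, neq_iff, nle_iff, Bool.or_eq_true,
      Bool.and_eq_true] at ih ⊢
    have h1 : S / B ≤ S := Nat.div_le_self _ _
    have h2 : S % B ≤ S := Nat.mod_le _ _
    generalize S / B = S1 at *
    generalize S % B = S2 at *
    generalize S * B = S3
    split_ifs <;> simp only <;> omega

theorem ls_search {α : Type} [Obj α] {B D L p : α → ℕ} {mv : α → ℕ → ℕ → Bool} (hB : LS false B)
    (hD : LS false D) (hL : LS false L) (hp : LS false p)
    (hmv : LS false (fun q : α × ℕ × ℕ => mv q.1 q.2.1 q.2.2)) :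
    LS false (fun a => search (B a) (D a) (L a) (mv a) (p a)) := by
  have hG : LS false (fun a => p a + L a + B a + D a + 3) := by fun_prop
  obtain ⟨c, hc⟩ := hG.len_le
  have hit : LS false (fun a => iter (L a) (p a, D a, 2) fun _ =>
      searchStep (B a) (D a) (L a) (mv a)) := by
    refine LS.iter (c := 5 * c + 10) hL (by fun_prop) ?_ fun x a ha i _ => ?_
    · have h' := hmv.comp (g := fun q : α × ℕ × ℕ × ℕ × ℕ =>
        (q.1, q.2.2.1 % B q.1, q.2.2.2.2 - 2)) (by fun_prop)
      unfold searchStep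
      fun_prop
    · obtain ⟨h1, h2, h3⟩ := searchStep_bound (B := B a) (D := D a) (L := L a) (mv := mv a)
        (p := p a) i
      have h4 := hc x a ha
      generalize iter i (p a, D a, 2) _ = s at *
      rw [len_nat] at h4
      have g1 := Nat.size_le_size (show s.1 ≤ p a + L a + B a + D a + 3 by omega)
      have g2 := Nat.size_le_size (show s.2.1 ≤ p a + L a + B a + D a + 3 by omega)
      have g3 := Nat.size_le_size (show s.2.2 ≤ p a + L a + B a + D a + 3 by omega)
      rw [show s = (s.1, s.2.1, s.2.2) from rfl, len_prod, len_prod, len_nat, len_nat, len_nat]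
      nlinarith
  unfold search
  fun_prop

theorem iter_eq_iterate {β : Type} (n : ℕ) (z : β) (h : β → β) :
    iter n z (fun _ => h) = h^[n] z := by
  induction n with
  | zero => rfl
  | succ n ih => rw [iter, ih, Function.iterate_succ_apply']

/-- `F` leads from `s` to `s'` in at most `m` steps. -/
def Leads {β : Type} (F : β → β) (m : ℕ) (s s' : β) : Prop := ∃ k ≤ m, F^[k] s = s'

theorem Leads.trans {β : Type} {F : β → β} {m m' : ℕ} {s s' s'' : β} (h : Leads F m s s')
    (h' : Leads F m' s' s'') : Leads F (m + m') s s'' := by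
  obtain ⟨k, hk, rfl⟩ := h
  obtain ⟨k', hk', rfl⟩ := h'
  exact ⟨k' + k, by omega, Function.iterate_add_apply F k' k s⟩

theorem Leads.step {β : Type} {F : β → β} {s s' : β} (h : F s = s') : Leads F 1 s s' :=
  ⟨1, le_rfl, h⟩

theorem Leads.mono {β : Type} {F : β → β} {m m' : ℕ} {s s' : β} (h : Leads F m s s')
    (hm : m ≤ m') : Leads F m' s s' := by
  obtain ⟨k, hk, rfl⟩ := h
  exact ⟨k, by omega, rfl⟩

/-- The number `S` has the `e + 1` digits of the path from the root, and since `d` is kept, leading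
zeros do no harm. Each of the `B` candidates costs one evaluation at depth `d` and two steps to
descend and return, and one step ends the loop; this is at most `(B + 3) ^ (d + 2)` for depth `d +
1`. -/
theorem leads_search {B D L : ℕ} {mv : ℕ → ℕ → Bool} (hB : 0 < B) (hL : B ^ (D + 1) ≤ L) {d e S : ℕ}
    (hde : d + e = D) (hS : S < B ^ (e + 1)) :
    Leads (searchStep B D L mv) ((B + 3) ^ (d + 1)) (S, d, 2)
      (S, d, bif win B mv d (S % B) then 1 else 0) := by
  induction d generalizing e S with
  | zero =>
    refine (Leads.step ?_).mono (Nat.one_le_pow _ _ (by omega))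
    simp [searchStep, win, nlt, neq]
  | succ d ih =>
    -- Induction on the number of candidates left. The third component is `q + 2`, because `0` and
    -- `1` are reserved for the value of a position.
    have key : ∀ m q, q + m = B → Leads (searchStep B D L mv) (m * ((B + 3) ^ (d + 1) + 2) + 1)
        (S, d + 1, q + 2) (S, d + 1, if ∃ i < B, q ≤ i ∧ mv (S % B) i = true ∧
          win B mv d i = false then 1 else 0) := by
      intro m
      induction m with
      | zero =>
        intro q hq
        refine (Leads.step ?_).mono (by omega)
        rw [if_neg (by rintro ⟨i, h1, h2, -⟩; omega)]
        have n1 : nlt (q + 2) 2 = false := by simp [nlt]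
        have n2 : nle (B + 2) (q + 2) = true := by simp; omega
        simp [searchStep, n1, n2]
      | succ m ihm =>
        intro q hq
        have hrest := ihm (q + 1) (by omega)
        have hnext : ¬ (mv (S % B) q = true ∧ win B mv d q = false) →
            ((∃ i < B, q ≤ i ∧ mv (S % B) i = true ∧ win B mv d i = false) ↔
              ∃ i < B, q + 1 ≤ i ∧ mv (S % B) i = true ∧ win B mv d i = false) := by
          intro hn
          refine ⟨fun ⟨i, h1, h2, h3⟩ => ⟨i, h1, ?_, h3⟩,
            fun ⟨i, h1, h2, h3⟩ => ⟨i, h1, by omega, h3⟩⟩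
          rcases Nat.eq_or_lt_of_le h2 with rfl | h2
          · exact absurd h3 hn
          · exact h2
        have hS' : S * B + q < B ^ (e + 1 + 1) := by
          rw [pow_succ _ (e + 1)]
          calc S * B + q < (S + 1) * B := by rw [add_mul]; omega
            _ ≤ B ^ (e + 1) * B := Nat.mul_le_mul_right _ hS
        have hle : S * B + q ≤ L := by
          have : B ^ (e + 1 + 1) ≤ B ^ (D + 1) := Nat.pow_le_pow_right hB (by omega)
          omega
        have e1 : (S * B + q) / B = S := by
          rw [mul_comm, Nat.mul_add_div hB, Nat.div_eq_of_lt (by omega), add_zero]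
        have e2 : (S * B + q) % B = q := by
          rw [mul_comm, Nat.mul_add_mod, Nat.mod_eq_of_lt (by omega)]
        have n1 : nlt (q + 2) 2 = false := by simp [nlt]
        have n2 : nle (B + 2) (q + 2) = false := by simp [nle]; omega
        by_cases hmv : mv (S % B) q = true
        · have s1 : searchStep B D L mv (S, d + 1, q + 2) = (S * B + q, d, 2) := by
            simp [searchStep, n1, n2, hmv, nle_iff.2 hle, neq]
          have s2 := ih (e := e + 1) (S := S * B + q) (by omega) hS'
          rw [e2] at s2
          have hdD : neq d D = false := by simp [neq]; omega
          cases hw : win B mv d q with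
          | true =>
            rw [hw, cond_true] at s2
            -- The opponent wins from `q`, so the search backtracks: the last digit of the path
            -- tells which candidate comes next.
            have s3 : searchStep B D L mv (S * B + q, d, 1) = (S, d + 1, q + 1 + 2) := by
              simp [searchStep, nlt, hdD, e1, e2, neq_iff.2 (rfl : 1 = 1)]
            simp only [hnext (by simp [hw])]
            exact ((((Leads.step s1).trans s2).trans (Leads.step s3)).trans hrest).mono (by
              rw [add_mul]; omega)
          | false =>
            rw [hw, cond_false] at s2
            have s3 : searchStep B D L mv (S * B + q, d, 0) = (S, d + 1, 1) := by
              simp [searchStep, nlt, hdD, e1, show neq 0 1 = false from rfl]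
            rw [if_pos ⟨q, by omega, le_rfl, hmv, hw⟩]
            exact (((Leads.step s1).trans s2).trans (Leads.step s3)).mono (by
              rw [add_mul]; omega)
        · have s1 : searchStep B D L mv (S, d + 1, q + 2) = (S, d + 1, q + 1 + 2) := by
            simp [searchStep, n1, n2, hmv, neq]
          simp only [hnext (by simp [hmv])]
          exact ((Leads.step s1).trans hrest).mono (by rw [add_mul]; omega)
    have h1 := key B 0 (by omega)
    have h2 : (if ∃ i < B, 0 ≤ i ∧ mv (S % B) i = true ∧ win B mv d i = false then 1 else 0) =
        bif win B mv (d + 1) (S % B) then 1 else 0 := by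
      rw [Bool.cond_eq_ite]
      congr 1
      simp [win]
    rw [h2] at h1
    refine h1.mono ?_
    have h3 : (B + 3) ^ 1 ≤ (B + 3) ^ (d + 1) := Nat.pow_le_pow_right (by omega) (by omega)
    rw [pow_succ _ (d + 1)]
    nlinarith

/-- The same number `L` bounds the codes of paths and the number of steps. A finished search does
not change any more, so running exactly `L` steps is harmless. -/
theorem search_eq {B D L : ℕ} {mv : ℕ → ℕ → Bool} {p : ℕ} (hp : p < B)
    (hL : (B + 3) ^ (D + 1) ≤ L) : search B D L mv p = win B mv D p := by
  obtain ⟨k, hk, H⟩ := leads_search (mv := mv) (D := D) (L := L) (d := D) (e := 0) (S := p)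
    (by omega : 0 < B) ((Nat.pow_le_pow_left (by omega) _).trans hL) rfl (by simpa using hp)
  rw [Nat.mod_eq_of_lt hp] at H
  have hfix : ∀ m b, (searchStep B D L mv)^[m] (p, D, bif b then 1 else 0) =
      (p, D, bif b then 1 else 0) := fun m b =>
    Function.iterate_fixed (by cases b <;> simp [searchStep, nlt, neq_iff.2 (rfl : D = D)]) m
  rw [search, iter_eq_iterate, ← Nat.sub_add_cancel (hk.trans hL), Function.iterate_add_apply,
    Nat.sub_add_cancel (hk.trans hL), H, hfix]
  cases win B mv D p <;> simp [neq]

/-! ### Recognizing formulas -/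

/-- The token at `u` is compatible with the tokens that follow it and with the vocabulary. -/
def validNode (x : Inp) (N u : ℕ) : Bool :=
  (!(nle 6 (kd x u) && nle (kd x u) 9) || neq (get x 0 u 1) 0) &&
  (!neq (kd x u) 4 || neq (kds x (num x N 0 u + 1)) 4) &&
  (!neq (kd x u) 6 || neq (fend x N u) (u + 3)) &&
  (!neq (kd x u) 5 || arityIs x (num x N 0 u) (fend x N u - (u + 1))) &&
  (!(neq (kd x u) 7 || isQuant x u) || isNode x (u + 1)) &&
  (!isBin x u || (isNode x (u + 1) && isNode x (fend x N (u + 1))))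

/-- The first section is a formula over the vocabulary of the structure. -/
def validFormula (x : Inp) (N : ℕ) : Bool :=
  isNode x 0 && neq (kd x (fend x N 0)) 0 && ball N (validNode x N)

section

variable {α : Type} [Obj α] {x : α → Inp} {N u : α → ℕ}

@[fun_prop] theorem ls_validNode (hx : LS false x) (hN : LS false N) (hu : LS false u) :
    LS false (fun a => validNode (x a) (N a) (u a)) := by unfold validNode; fun_prop

@[fun_prop] theorem ls_validFormula (hx : LS false x) (hN : LS false N) :
    LS false (fun a => validFormula (x a) (N a)) := by unfold validFormula; fun_prop

end

section

variable {τ : Vocabulary} {x : Inp} {N u : ℕ} {T : List (Letter × ℕ)} {φ : Formula τ}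
  {A : FinStructure τ}

theorem FinStructure.kindAt_toks (A : FinStructure τ) (c : ℕ) :
    kindAt A.toks (c + 1) = 4 ↔ c < τ.numConsts := by
  simp only [kindAt, FinStructure.toks, structToks, List.getElem?_cons_succ]
  by_cases hc : c < τ.numConsts
  · rw [List.getElem?_append_left (by simpa [FinStructure.consts] using hc)]
    simp [FinStructure.consts, hc]
  · rw [List.getElem?_append_right (by simpa [FinStructure.consts] using hc)]
    simp only [hc, iff_false]
    cases e : (blockToks A.blocks)[c - (A.consts.map fun c => (Letter.con, c)).length]? with
    | none => simp
    | some t =>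
      have := List.mem_of_getElem? e
      simp only [blockToks, tupleToks, List.mem_flatMap, List.mem_cons, List.mem_map] at this
      obtain ⟨b, -, rfl | ⟨tt, -, rfl | ⟨a, -, rfl⟩⟩⟩ := this <;> simp

theorem exists_getElem?_of_kindAt {l : Letter} (h : kindAt T u = l.code) :
    ∃ n, T[u]? = some (l, n) := by
  rw [kindAt] at h
  cases e : T[u]? with
  | none => rw [e] at h; cases l <;> simp [Letter.code] at h
  | some t =>
    obtain ⟨l', n⟩ := t
    rw [e] at h
    simp only [Option.elim_some] at h
    refine ⟨n, ?_⟩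
    cases l <;> cases l' <;> first | rfl | exact absurd h (by decide)

theorem drop_eq_cons {a : Letter × ℕ} (h : T[u]? = some a) : T.drop u = a :: T.drop (u + 1) := by
  obtain ⟨hu, rfl⟩ := List.getElem?_eq_some_iff.1 h
  exact List.drop_eq_getElem_cons hu

theorem Reads.index_eq_zero (h : Reads x N T) {l : Letter} {n : ℕ} (e : T[u]? = some (l, n))
    (h0 : get x 0 u 1 = 0) : n = 0 := by
  rw [h.get_eq, tokenGet_succ e] at h0
  simp only [bitCode, Bool.cond_eq_ite, nlt_iff] at h0
  split_ifs at h0 with h1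
  by_contra hne
  exact h1 (Nat.size_pos.2 (by omega))

/-- Nothing is known yet about the list being a formula. At an atom the count is in surplus
immediately, so the computed end is the first position after it that does not hold a term, and such
a position exists at the end of the list at the latest. -/
theorem Reads.fend_atom (h : Reads x N T) (hk : kindAt T u = 5 ∨ kindAt T u = 6) :
    u < fend x N u ∧ (∀ z, u < z → z < fend x N u → kindAt T z = 3 ∨ kindAt T z = 4) ∧
      kindAt T (fend x N u) ≠ 3 ∧ kindAt T (fend x N u) ≠ 4 := by
  have hu := lt_of_kindAt (T := T) (z := u) (by omega)
  have hN := h.length_le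
  have hatom : ∀ m, (bcount (u + m + 1) fun i => nle u i && isAtom x i) ≠ 0 := by
    intro m
    rw [bcount_eq, Finset.card_ne_zero]
    refine ⟨u, ?_⟩
    simp only [Finset.mem_filter, Finset.mem_range, Bool.and_eq_true, nle_iff, isAtom,
      Bool.or_eq_true, neq_iff, h.kd_eq]
    omega
  have key : ∀ z, u < z → (∀ y, u < y → y < z → kindAt T y = 3 ∨ kindAt T y = 4) →
      ((nlt u z && !isTerm x z && nlt (bcount z fun i => nle u i && isBin x i)
        (bcount z fun i => nle u i && isAtom x i)) = true ↔
          kindAt T z ≠ 3 ∧ kindAt T z ≠ 4) := by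
    intro z hz hy
    have h0 : (bcount z fun i => nle u i && isBin x i) = 0 := by
      rw [bcount_eq, Finset.card_eq_zero, Finset.filter_eq_empty_iff]
      intro y hy'
      simp only [Bool.and_eq_true, nle_iff, isBin, Bool.or_eq_true, neq_iff, h.kd_eq]
      grind
    obtain ⟨m, rfl⟩ := Nat.exists_eq_add_of_lt hz
    have := hatom m
    simp only [h0, Bool.and_eq_true, nlt_iff, Bool.not_eq_true', isTerm, Bool.or_eq_false_iff, neq,
      decide_eq_false_iff_not, h.kd_eq]
    omega
  have hbelow : ∀ z, u < z → z < fend x N u → kindAt T z = 3 ∨ kindAt T z = 4 := by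
    intro z
    induction z using Nat.strong_induction_on with
    | _ z ih =>
      intro h1 h2
      have := bmin_min h2
      grind
  have hlt : fend x N u < N + 1 := by
    by_contra hcon
    have := hbelow T.length hu (by omega)
    rw [kindAt_of_le le_rfl] at this
    omega
  have hspec := bmin_spec hlt
  have hpos : u < fend x N u := by
    simp only [Bool.and_eq_true, nlt_iff] at hspec
    exact hspec.1.1
  exact ⟨hpos, hbelow, (key _ hpos hbelow).1 hspec⟩

theorem exists_term (hs : Sections x T A.toks (List.ofFn τ.arity)) (hr : Reads x N T)
    (hA : A.toks.length ≤ N) (hv : validNode x N u = true)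
    (hk : kindAt T u = 3 ∨ kindAt T u = 4) : ∃ t : Term τ, T[u]? = some t.tok := by
  rcases hk with hk | hk
  · exact ⟨.var _, getElem?_of_kindAt_var hk⟩
  · obtain ⟨n, hn⟩ := exists_getElem?_of_kindAt (l := .con) hk
    simp only [validNode, Bool.and_eq_true] at hv
    obtain ⟨⟨⟨⟨⟨-, hv⟩, -⟩, -⟩, -⟩, -⟩ := hv
    simp only [hr.kd_eq, hk, neq, decide_true, Bool.not_true, Bool.false_or, decide_eq_true_iff,
      hs.kds_eq, num_eq hr.get_eq N hn, A.kindAt_toks] at hv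
    have hlen : τ.numConsts + 1 ≤ A.toks.length := by
      simp [FinStructure.toks, structToks, FinStructure.consts]
    exact ⟨.const ⟨n, by omega⟩, hn⟩

/-- The sections of a valid input contain a formula at every node. -/
theorem exists_occ_of_isNode (hs : Sections x T A.toks (List.ofFn τ.arity)) (hr : Reads x N T)
    (hA : A.toks.length ≤ N) (hv : ∀ u < N, validNode x N u = true) (hu : isNode x u = true) :
    ∃ φ : Formula τ, Occ T u φ := by
  have hN := hr.length_le
  -- The list is parsed from its end: what follows `u` has been recognized already, so `fend` is
  -- known to be correct for the first immediate subformula when the second one is looked up.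
  induction hm : T.length - u using Nat.strong_induction_on generalizing u with
  | _ m ih =>
    simp only [isNode, Bool.and_eq_true, nle_iff, hr.kd_eq] at hu
    have huT := lt_of_kindAt (T := T) (z := u) (by omega)
    have ih' : ∀ {c}, u < c → isNode x c = true → ∃ φ : Formula τ, Occ T c φ := by
      intro c hc hn
      have hn' := hn
      simp only [isNode, Bool.and_eq_true, nle_iff, hr.kd_eq] at hn'
      have := lt_of_kindAt (T := T) (z := c) (by omega)
      exact ih _ (by omega) hn rfl
    have hvu := hv u (by omega)
    simp only [validNode, Bool.and_eq_true] at hvu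
    obtain ⟨⟨⟨⟨⟨v1, -⟩, v3⟩, v4⟩, v5⟩, v6⟩ := hvu
    simp only [hr.kd_eq, isBin, isQuant, neq, nle] at v1 v3 v4 v5 v6
    have hterm : ∀ i, kindAt T u = 5 ∨ kindAt T u = 6 → u + 1 + i < fend x N u →
        ∃ t : Term τ, T[u + 1 + i]? = some t.tok := by
      intro i hk hi
      have hk' := (hr.fend_atom hk).2.1 (u + 1 + i) (by omega) hi
      have := lt_of_kindAt (T := T) (z := u + 1 + i) (by omega)
      exact exists_term hs hr hA (hv _ (by omega)) hk'
    have unary : ∀ (l : Letter) (F : Formula τ → Formula τ) (n : ℕ), T[u]? = some (l, n) →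
        (∀ φ, (F φ).toks = (l, n) :: φ.toks) → isNode x (u + 1) = true →
        ∃ φ : Formula τ, Occ T u φ := by
      intro l F n hn hF hc
      obtain ⟨φ, h1, h2⟩ := ih' (by omega) hc
      refine ⟨F φ, ?_, ?_⟩
      · rw [drop_eq_cons hn, hF]
        grind
      · rwa [Formula.len, hF, List.length_cons, ← Formula.len, add_comm φ.len, ← add_assoc]
    have binary : ∀ (l : Letter) (F : Formula τ → Formula τ → Formula τ), T[u]? = some (l, 0) →
        (∀ φ ψ, (F φ ψ).toks = (l, 0) :: (φ.toks ++ ψ.toks)) →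
        isNode x (u + 1) = true ∧ isNode x (fend x N (u + 1)) = true →
        ∃ φ : Formula τ, Occ T u φ := by
      intro l F hn hF hc
      obtain ⟨φ, hφ⟩ := ih' (by omega) hc.1
      rw [hr.fend_eq hφ] at hc
      obtain ⟨ψ, h1, h2⟩ := ih' (by omega) hc.2
      obtain ⟨⟨R, hR⟩, -⟩ := hφ
      refine ⟨F φ ψ, ?_, ?_⟩
      · rw [drop_eq_cons hn, hF]
        refine (List.prefix_append_right_inj [(l, 0)]).2 ?_
        rw [← hR]
        refine (List.prefix_append_right_inj _).2 ?_
        rwa [← List.drop_drop, ← hR, Formula.len, List.drop_left] at h1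
      · rw [Formula.len, hF, List.length_cons, List.length_append, ← Formula.len, ← Formula.len]
        convert h2 using 3 <;> ring
    rcases (by omega : kindAt T u = 5 ∨ kindAt T u = 6 ∨ kindAt T u = 7 ∨ kindAt T u = 8 ∨
      kindAt T u = 9 ∨ kindAt T u = 10 ∨ kindAt T u = 11) with hk | hk | hk | hk | hk | hk | hk
    · obtain ⟨n, hn⟩ := exists_getElem?_of_kindAt (l := .rel) hk
      simp only [hk, decide_true, Bool.not_true, Bool.false_or, num_eq hr.get_eq N hn,
        hs.arityIs_iff] at v4
      obtain ⟨hlt, har⟩ := List.getElem?_eq_some_iff.1 v4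
      have hf := hr.fend_atom (.inl hk)
      rw [List.length_ofFn] at hlt
      have hrels : τ.numRels ≤ A.toks.length := by
        rw [← List.length_ofFn (f := τ.arity), A.goodBlocks.length, ← countP_structToks]
        exact List.countP_le_length
      have hmin : min n (N + 1) = n := by omega
      simp only [hmin, List.getElem_ofFn] at hlt har
      choose ts hts using fun j : Fin (τ.arity ⟨n, hlt⟩) => hterm j (.inl hk) (by omega)
      have hlen : u + (Formula.rel ⟨n, hlt⟩ ts).len = fend x N u := by rw [len_rel]; omega
      refine ⟨.rel ⟨n, hlt⟩ ts, ?_, hlen ▸ hf.2.2⟩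
      have hp : (List.ofFn fun j => (ts j).tok) <+: T.drop (u + 1) := by
        refine List.prefix_iff_getElem?.2 fun i hi => ?_
        rw [List.length_ofFn] at hi
        rw [List.getElem?_drop, hts ⟨i, hi⟩, List.getElem_ofFn]
      rw [drop_eq_cons hn, Formula.toks]
      exact (List.prefix_append_right_inj [(_, _)]).2 hp
    · obtain ⟨n, hn⟩ := exists_getElem?_of_kindAt (l := .equal) hk
      obtain rfl := hr.index_eq_zero hn (by simpa [hk] using v1)
      have hfe : fend x N u = u + 3 := by simpa [hk] using v3
      have hf := hr.fend_atom (.inr hk)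
      obtain ⟨t, ht⟩ := hterm 0 (.inr hk) (by omega)
      obtain ⟨s, hs⟩ := hterm 1 (.inr hk) (by omega)
      refine ⟨.equal t s, ?_, by rw [len_equal, ← hfe]; exact hf.2.2⟩
      rw [drop_eq_cons hn, drop_eq_cons ht, drop_eq_cons hs]
      exact ⟨_, rfl⟩
    · obtain ⟨n, hn⟩ := exists_getElem?_of_kindAt (l := .neg) hk
      obtain rfl := hr.index_eq_zero hn (by simpa [hk] using v1)
      exact unary _ .neg _ hn (fun _ => rfl) (by simpa [hk] using v5)
    · obtain ⟨n, hn⟩ := exists_getElem?_of_kindAt (l := .and) hk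
      obtain rfl := hr.index_eq_zero hn (by simpa [hk] using v1)
      exact binary _ .and hn (fun _ _ => rfl) (by simpa [hk] using v6)
    · obtain ⟨n, hn⟩ := exists_getElem?_of_kindAt (l := .or) hk
      obtain rfl := hr.index_eq_zero hn (by simpa [hk] using v1)
      exact binary _ .or hn (fun _ _ => rfl) (by simpa [hk] using v6)
    · obtain ⟨n, hn⟩ := exists_getElem?_of_kindAt (l := .ex) hk
      exact unary _ (.ex n) _ hn (fun _ => rfl) (by simpa [hk] using v5)
    · obtain ⟨n, hn⟩ := exists_getElem?_of_kindAt (l := .all) hk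
      exact unary _ (.all n) _ hn (fun _ => rfl) (by simpa [hk] using v5)

theorem exists_formula_of_valid (hs : Sections x T A.toks (List.ofFn τ.arity)) (hr : Reads x N T)
    (hA : A.toks.length ≤ N) (hv : validFormula x N = true) :
    ∃ φ : Formula τ, T = φ.toks := by
  simp only [validFormula, Bool.and_eq_true, ball_iff, neq_iff] at hv
  obtain ⟨⟨h1, h2⟩, h3⟩ := hv
  obtain ⟨φ, hφ⟩ := exists_occ_of_isNode hs hr hA h3 h1
  rw [hr.fend_eq hφ, hr.kd_eq, zero_add] at h2
  obtain ⟨⟨R, hR⟩, -⟩ := hφ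
  rw [List.drop_zero] at hR
  refine ⟨φ, ?_⟩
  rcases R with _ | ⟨a, R⟩
  · rw [← hR, List.append_nil]
  · have : T[φ.len]? = some a := by
      rw [← hR, List.getElem?_append_right (by simp [Formula.len])]
      simp [Formula.len]
    rw [kindAt, this] at h2
    obtain ⟨l, n⟩ := a
    cases l <;> simp [Letter.code] at h2

theorem Formula.con_lt (φ : Formula τ) (n : ℕ) (h : (Letter.con, n) ∈ φ.toks) :
    n < τ.numConsts := by
  have ht : ∀ t : Term τ, (Letter.con, n) = t.tok → n < τ.numConsts := by
    rintro (y | c) e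
    · simp [Term.tok] at e
    · simp only [Term.tok, Prod.mk.injEq, true_and] at e
      exact e ▸ c.2
  induction φ with
  | equal t s =>
    simp only [Formula.toks, List.mem_cons, Prod.mk.injEq, List.not_mem_nil, or_false,
      reduceCtorEq, false_and, false_or] at h
    exact h.elim (ht t) (ht s)
  | rel i ts =>
    simp only [Formula.toks, List.mem_cons, Prod.mk.injEq, List.mem_ofFn, reduceCtorEq,
      false_and, false_or] at h
    obtain ⟨j, h⟩ := h
    exact ht _ h.symm
  | neg φ ih | ex y φ ih | all y φ ih =>
    simp only [Formula.toks, List.mem_cons, Prod.mk.injEq, reduceCtorEq, false_and, false_or] at h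
    exact ih h
  | and φ ψ ih1 ih2 | or φ ψ ih1 ih2 =>
    simp only [Formula.toks, List.mem_cons, Prod.mk.injEq, reduceCtorEq, false_and, false_or,
      List.mem_append] at h
    exact h.elim ih1 ih2

theorem Setup.validFormula (h : Setup x N φ A) : validFormula x N = true := by
  have h0 : Occ φ.toks 0 φ := occ_root rfl
  simp only [ModelChecking.validFormula, Bool.and_eq_true, ball_iff, neq_iff]
  refine ⟨⟨(isNode_iff_occ h.reads).2 ⟨φ, h0⟩, ?_⟩, fun u _ => ?_⟩
  · rw [h.reads.fend_eq h0, h.reads.kd_eq]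
    exact kindAt_of_le (by simp [Formula.len])
  have hcon : kindAt φ.toks u = 4 → kds x (num x N 0 u + 1) = 4 := by
    intro hk
    obtain ⟨n, hn⟩ := exists_getElem?_of_kindAt (l := .con) hk
    have hlt := φ.con_lt n (List.mem_of_getElem? hn)
    have := h.const_lt ⟨n, hlt⟩
    rw [num_eq h.reads.get_eq N hn, h.sections.kds_eq, A.kindAt_toks]
    simp only at this ⊢
    omega
  have htrue : ∀ {a b : Bool}, (a = true → b = true) → (!a || b) = true := by decide
  by_cases hk : 5 ≤ kindAt φ.toks u
  · obtain ⟨ψ, hψ⟩ := exists_occ_of_kindAt (φ0 := φ) rfl hk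
    have hkd := hψ.kindAt
    have e0 := hψ.getElem? (i := 0) ψ.len_pos
    have hf := h.reads.fend_eq hψ
    rw [add_zero] at e0
    have hnode : ∀ {d χ}, Child u ψ d χ → isNode x d = true :=
      fun hd => (isNode_iff_occ h.reads).2 ⟨_, hd.occ hψ⟩
    simp only [validNode, Bool.and_eq_true, h.reads.kd_eq, hkd, isBin, isQuant]
    refine ⟨⟨⟨⟨⟨htrue fun hk => ?_, htrue fun hk => ?_⟩, htrue fun hk => ?_⟩, htrue fun hk => ?_⟩,
      htrue fun hk => ?_⟩, htrue fun hk => ?_⟩ <;>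
      simp only [Bool.and_eq_true, nle_iff, neq_iff, Bool.or_eq_true] at hk ⊢
    · have key : ∀ l, φ.toks[u]? = some (l, 0) → get x 0 u 1 = 0 := fun l e => by
        rw [h.reads.get_eq, tokenGet_succ e]; rfl
      cases ψ <;> simp only [Formula.kind] at hk <;> first | omega | exact key _ e0
    · have := ψ.kind_bounds; omega
    · cases ψ <;> simp only [Formula.kind] at hk <;> first | omega | exact hf
    · cases ψ with
      | rel i ts =>
        have := h.rel_lt i
        rw [hf, num_eq h.reads.get_eq N e0, h.sections.arityIs_iff, len_rel]
        grind
      | equal | neg | and | or | ex | all => simp [Formula.kind] at hk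
    · cases ψ <;> simp only [Formula.kind] at hk <;>
        first | omega | exact hnode (.neg _ _) | exact hnode (.ex _ _ _) | exact hnode (.all _ _ _)
    · cases ψ with
      | and φ ψ =>
        rw [h.reads.fend_eq ((Child.andLeft u φ ψ).occ hψ)]
        exact ⟨hnode (.andLeft _ _ _), hnode (.andRight _ _ _)⟩
      | or φ ψ =>
        rw [h.reads.fend_eq ((Child.orLeft u φ ψ).occ hψ)]
        exact ⟨hnode (.orLeft _ _ _), hnode (.orRight _ _ _)⟩
      | equal | neg | rel | ex | all => simp [Formula.kind] at hk
  · simp only [validNode, Bool.and_eq_true, h.reads.kd_eq, isBin, isQuant]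
    refine ⟨⟨⟨⟨⟨htrue fun hk => ?_, htrue fun hk => ?_⟩, htrue fun hk => ?_⟩, htrue fun hk => ?_⟩,
      htrue fun hk => ?_⟩, htrue fun hk => ?_⟩ <;>
      simp only [Bool.and_eq_true, nle_iff, neq_iff, Bool.or_eq_true] at hk ⊢
    case refine_2 => exact hcon hk
    all_goals omega

end

open Prog in
/-- A machine that searches for the least number `N` with a given property and then evaluates a
predicate, in space linear in the length of `N`. -/
theorem exists_machine {R C : Inp × ℕ → Bool} (hR : LS false R) (hC : LS false C) :
    ∃ (M : TuringMachine) (c : ℕ), ∀ (x : List Bool) (N : ℕ), R (⟨x⟩, N) = true →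
      (∀ i < N, R (⟨x⟩, i) = false) →
      (∃ n, M.halt (M.run x n).state = some (C (⟨x⟩, N))) ∧
        M.RunsInSpace x (c * (N.size + 1)) := by
  have hI : LS false (fun x : Inp => (x, 0)) := by fun_prop
  have hF : LS false (fun p : Inp × ℕ => (p.1, p.2 + 1)) := by fun_prop
  have hR' : LS false (fun p => !R p) := by fun_prop
  obtain ⟨P, Q, K, c, hK, hP, hQ, H⟩ := hF.exists_common hR'
  obtain ⟨P1, K1, c1, hK1, hP1, H1⟩ := hI
  obtain ⟨P2, K2, c2, hK2, hP2, H2⟩ := hC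
  let L := K1 + (K + 2) + K2
  let W : Prog := P1 ;; Prog.while K Q P ;; P2
  have hW : W.RegsBelow L :=
    ⟨hP1.mono (by omega), (while_regsBelow hQ hP).mono (by omega), hP2.mono (by omega)⟩
  refine ⟨W.decider.toTM L, L * (2 * (c + c1 + c2 + 1) + 1), fun x N hN hN' => ?_⟩
  have hlen : ∀ i, len ((⟨x⟩, i) : Inp × ℕ) = i.size + 1 := fun i => by
    rw [len_pair, len_nat]; simp [len, Obj.enc]
  have hcompat : ∀ i, Obj.compat x ((⟨x⟩, i) : Inp × ℕ) := fun i => ⟨rfl, trivial⟩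
  let S := (c + c1 + c2 + 1) * (N.size + 1 + 1)
  have hS : ∀ i ≤ N, ∀ d ≤ c + c1 + c2 + 1, d * (len ((⟨x⟩, i) : Inp × ℕ) + 1) ≤ S := by
    intro i hi d hd
    have := Nat.size_le_size hi
    rw [hlen]
    exact Nat.mul_le_mul hd (by omega)
  have r1 : Runs false L P1 x S [] (Obj.enc ((⟨x⟩, 0) : Inp × ℕ)) :=
    (H1 x ⟨x⟩ rfl).2.mono (by omega) (Nat.mul_le_mul (by omega) (by simp [len, Obj.enc]))
  have r2 : Runs false L (Prog.while K Q P) x S (Obj.enc ((⟨x⟩, 0) : Inp × ℕ))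
      (Obj.enc ((⟨x⟩, N) : Inp × ℕ)) := by
    -- The loop increases the candidate, starting from `0`, as long as the property fails; all
    -- candidates are at most `N`, so they have at most its length.
    refine (Runs.while hK (fun i => Obj.enc ((⟨x⟩, i) : Inp × ℕ)) (fun i hi => ?_) (fun i hi => ?_)
      (fun i hi => ?_)).mono (by omega) le_rfl
    · have := hS i hi 1 (by omega)
      change len ((⟨x⟩, i) : Inp × ℕ) ≤ S
      omega
    · have := (H x _ (hcompat i)).2.2.2.2.2.mono le_rfl (hS i hi c (by omega))
      rcases hi.lt_or_eq with h | rfl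
      · simpa [h, hN' i h, Obj.enc] using this
      · simpa [hN, Obj.enc] using this
    · exact (H x _ (hcompat i)).2.2.2.2.1.mono le_rfl (hS i hi.le c (by omega))
  have r3 := (H2 x _ (hcompat N)).2.mono (show K2 ≤ L by omega) (hS N le_rfl c2 (by omega))
  obtain ⟨h', hex, -⟩ := (r1.seq (r2.seq r3)) (fun _ => []) 0 rfl fun _ _ _ => rfl
  obtain ⟨h1, h2, h3⟩ := decider_spec hW (by omega) hex
  refine ⟨?_, h2, h3.trans ?_⟩
  · obtain ⟨n, hn⟩ := h1
    refine ⟨n, hn.trans ?_⟩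
    cases C (⟨x⟩, N) <;> simp [Obj.enc]
  · norm_cast
    simp only [S]
    nlinarith [Nat.zero_le (L * (c + c1 + c2 + 1) * N.size), Nat.zero_le (L * N.size)]

/-! ### The algorithm -/

/-- An atomic formula whose relation is empty. -/
def emptyAtom (x : Inp) (N : ℕ) : Bool :=
  neq (kds x N) 0 && neq (kd x 0) 5 &&
    ball N fun q => !(neq (kds x q) 13 && neq (relCount x q) (num x N 0 0 + 1))

/-- The number `N` is large enough to read the input. -/
def readable (x : Inp) (N : ℕ) : Bool :=
  neq (kds x N) 0 && neq (kd x N) 0 && (ball N fun j => neq (get x 0 j (N + 1)) 0) &&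
    nle (num x N 1 0) N

/-- The vocabulary is relational and there are at most `s` variables, if such a bound is given. -/
def boundedVars (r : Option ℕ) (x : Inp) (N : ℕ) : Bool :=
  match r with
  | none => true
  | some s => nle (varCount x N) s && !neq (kds x 1) 4

/-- The input is a pair of a structure and a sentence of the given class. -/
def wellFormed (r : Option ℕ) (t : ℕ) (x : Inp) (N : ℕ) : Bool :=
  validStruct x N && validFormula x N && (ball N fun z => !freeOcc x N 0 z) &&
    inLevel x N true t 0 && boundedVars r x N

/-- The number of moves of the game. -/
def depth (t : ℕ) (x : Inp) (N : ℕ) : ℕ := 2 * ((t + 1) * (2 * (nodeCount x N 0).size + 4))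

/-- The digits of the positions are less than `M`, and `N` bounds the duration of the search. -/
def enough (t : ℕ) (x : Inp) (N M : ℕ) : Bool :=
  nle (t + 4) M && nlt (fend x N 0) M &&
    (ball N fun u => !isNode x u || nle (tpow (M - 1) (num x N 1 0) (freeCount x N u)) (M - 1)) &&
    nle (tpow N (M ^ 12 + 3) (depth t x N + 1)) N

/-- The number `N` suffices to treat the input. -/
def ready (r : Option ℕ) (t : ℕ) (x : Inp) (N : ℕ) : Bool :=
  !format x || emptyAtom x N ||
    (readable x N && (!wellFormed r t x N || bex (N + 1) fun M => enough t x N M))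

/-- The position at the beginning of the game. -/
def startPos (t : ℕ) (x : Inp) (N M : ℕ) : ℕ :=
  bmin (M ^ 12) fun p => neq (dig M p 0) 0 && neq (dig M p 1) t && neq (dig M p 2) 0 &&
    neq (dig M p 4) (fend x N 0)

/-- The sentence holds, according to the game. -/
def evalGame (t : ℕ) (x : Inp) (N M : ℕ) : Bool :=
  search (M ^ 12) (depth t x N) N
    (fun p q => move x N (num x N 1 0) t (dig M p) (dig M q)) (startPos t x N M)

/-- The input is accepted. -/
def accepts (r : Option ℕ) (t : ℕ) (x : Inp) (N : ℕ) : Bool :=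
  format x && !emptyAtom x N && wellFormed r t x N &&
    evalGame t x N (bmin (N + 1) fun M => enough t x N M)

section

variable {α : Type} [Obj α] {x : α → Inp} {N M : α → ℕ}

@[fun_prop] theorem ls_emptyAtom (hx : LS false x) (hN : LS false N) :
    LS false (fun a => emptyAtom (x a) (N a)) := by unfold emptyAtom; fun_prop

@[fun_prop] theorem ls_readable (hx : LS false x) (hN : LS false N) :
    LS false (fun a => readable (x a) (N a)) := by unfold readable; fun_prop

@[fun_prop] theorem ls_wellFormed (r : Option ℕ) (t : ℕ) (hx : LS false x) (hN : LS false N) :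
    LS false (fun a => wellFormed r t (x a) (N a)) := by
  have h1 : LS false (fun a => boundedVars r (x a) (N a)) := by
    unfold boundedVars; cases r <;> simp only <;> fun_prop
  have h2 := (ls_inLevel t).comp (g := fun a => (x a, N a, true, 0)) (by fun_prop)
  unfold wellFormed
  fun_prop

@[fun_prop] theorem ls_depth (t : ℕ) (hx : LS false x) (hN : LS false N) :
    LS false (fun a => depth t (x a) (N a)) := by unfold depth; fun_prop

@[fun_prop] theorem ls_enough (t : ℕ) (hx : LS false x) (hN : LS false N) (hM : LS false M) :
    LS false (fun a => enough t (x a) (N a) (M a)) := by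
  have := LS.pow_const hM 12
  unfold enough
  fun_prop

@[fun_prop] theorem ls_ready (r : Option ℕ) (t : ℕ) (hx : LS false x) (hN : LS false N) :
    LS false (fun a => ready r t (x a) (N a)) := by unfold ready; fun_prop

@[fun_prop] theorem ls_evalGame (t : ℕ) (hx : LS false x) (hN : LS false N) (hM : LS false M) :
    LS false (fun a => evalGame t (x a) (N a) (M a)) := by
  have h1 := LS.pow_const hM 12
  refine ls_search h1 (by fun_prop) hN (by unfold startPos; fun_prop) ?_
  fun_prop

@[fun_prop] theorem ls_accepts (r : Option ℕ) (t : ℕ) (hx : LS false x) (hN : LS false N) :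
    LS false (fun a => accepts r t (x a) (N a)) := by unfold accepts; fun_prop

end

/-- The classes `Σ_t` and `Σ_t^s`. -/
def boundedClass (r : Option ℕ) (t : ℕ) : FormulaClass :=
  match r with
  | none => SigmaClass t
  | some s => BoundedSigmaClass s t

section

variable {τ : Vocabulary} {x : Inp} {N M t : ℕ} {r : Option ℕ} {T0 T1 : List (Letter × ℕ)}
  {ar : List ℕ} {φ : Formula τ} {A : FinStructure τ}

theorem kindAt_eq_zero {T : List (Letter × ℕ)} {z : ℕ} : kindAt T z = 0 ↔ T.length ≤ z := by
  refine ⟨fun h => ?_, kindAt_of_le⟩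
  by_contra hlt
  rw [kindAt, List.getElem?_eq_getElem (by omega)] at h
  generalize T[z]'(by omega) = a at h
  obtain ⟨l, n⟩ := a
  cases l <;> simp [Letter.code] at h

theorem bitCode_eq_zero {n k : ℕ} : bitCode n k = 0 ↔ n.size ≤ k := by
  rw [bitCode, Bool.cond_eq_ite]
  simp only [nlt_iff]
  split_ifs with h
  · simp [h]
  · simp [not_lt.1 h]

/-- For the formula, `N` bounds the number of tokens and the lengths of their numbers, not the
numbers themselves. Only the size of the universe has to be bounded as a number. -/
theorem Sections.readable_iff (h : Sections x T0 T1 ar) : readable x N = true ↔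
    T1.length ≤ N ∧ Reads x N T0 ∧ ∀ t, T1[0]? = some t → t.2 ≤ N := by
  have hkd : ∀ j, kd x j = kindAt T0 j := fun j => by
    rw [kd, h.formula, tokenGet_zero, kindAt]
    cases e : T0[j]? <;> simp [e, numTok]
  simp only [readable, Bool.and_eq_true, neq_iff, ball_iff, nle_iff, h.kds_eq, hkd, kindAt_eq_zero,
    h.formula, and_assoc]
  refine and_congr_right fun h1 => ?_
  have hnum : num x N 1 0 ≤ N ↔ ∀ t, T1[0]? = some t → t.2 ≤ N := by
    cases e : T1[0]? with
    | some t => rw [num_eq h.struct N e]; simp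
    | none =>
      refine iff_of_true ?_ (by simp)
      rw [num, bmin_eq (m := 0) (by omega)] <;> simp [h.struct, tokenGet, e, bitCode, nlt]
  rw [hnum]
  constructor
  · rintro ⟨h2, h3, h4⟩
    refine ⟨⟨h.formula, h2, fun t ht => ?_⟩, h4⟩
    obtain ⟨j, hj, rfl⟩ := List.mem_iff_getElem.1 ht
    have := h3 j (by omega)
    rwa [tokenGet_succ (List.getElem?_eq_getElem hj), bitCode_eq_zero] at this
  · rintro ⟨h2, h4⟩
    refine ⟨h2.length_le, fun j _ => ?_, h4⟩
    cases e : T0[j]? with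
    | none => simp [tokenGet, e]
    | some t => rw [tokenGet_succ e, bitCode_eq_zero]; exact h2.size_le t (List.mem_of_getElem? e)

theorem Sections.setup_iff (h : Sections x φ.toks A.toks (List.ofFn τ.arity)) :
    readable x N = true ↔ Setup x N φ A := by
  rw [h.readable_iff]
  have : A.toks[0]? = some (.univ, A.card) := rfl
  simp only [this, Option.some.injEq, forall_eq']
  exact ⟨fun H => ⟨h, H.2.1, H.1, H.2.2⟩, fun H => ⟨H.length_le, H.reads, H.card_le⟩⟩

theorem Sections.exists_readable (h : Sections x T0 T1 ar) :
    ∃ N0, ∀ N, N0 ≤ N → readable x N = true := by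
  refine ⟨T1.length + T0.length + (T0.map fun t => t.2.size).sum + (T1[0]?).elim 0 Prod.snd,
    fun N hN => h.readable_iff.2 ⟨by omega, ⟨h.formula, by omega, fun t ht => ?_⟩, fun t ht => ?_⟩⟩
  · have := List.single_le_sum (l := T0.map fun t => t.2.size) (by simp) _ (List.mem_map_of_mem ht)
    omega
  · rw [ht] at hN
    simp only [Option.elim_some] at hN
    omega

theorem Formula.isHead_toks (φ : Formula τ) : ∀ t ∈ φ.toks, t.1.IsHead := by
  have ht : ∀ s : Term τ, s.tok.1.IsHead := by rintro (_ | _) <;> trivial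
  intro t h
  induction φ with
  | equal s s' =>
    simp only [Formula.toks, List.mem_cons, List.not_mem_nil, or_false] at h
    obtain rfl | rfl | rfl := h
    exacts [trivial, ht s, ht s']
  | rel i ts =>
    simp only [Formula.toks, List.mem_cons, List.mem_ofFn] at h
    obtain rfl | ⟨j, rfl⟩ := h
    exacts [trivial, ht _]
  | neg φ ih | ex y φ ih | all y φ ih =>
    obtain rfl | h := List.mem_cons.1 h
    exacts [trivial, ih h]
  | and φ ψ ih1 ih2 | or φ ψ ih1 ih2 =>
    obtain rfl | h := List.mem_cons.1 h
    · trivial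
    · exact (List.mem_append.1 h).elim ih1 ih2

theorem FinStructure.isHead_toks (A : FinStructure τ) : ∀ t ∈ A.toks, t.1.IsHead := by
  intro t ht
  simp only [FinStructure.toks, structToks, blockToks, tupleToks, List.mem_cons, List.mem_append,
    List.mem_map, List.mem_flatMap] at ht
  obtain rfl | ⟨c, -, rfl⟩ | ⟨b, -, rfl | ⟨tt, -, rfl | ⟨a, -, rfl⟩⟩⟩ := ht <;> trivial

theorem sections_of_word (h0 : ∀ t ∈ T0, t.1.IsHead) (h1 : ∀ t ∈ T1, t.1.IsHead)
    (hx : x.word = toBinary (sections (T0.map numTok) (T1.map numTok) (ar.map arityTok))) :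
    Sections x T0 T1 ar := by
  have H := get_sections (List.forall_mem_map.2 h0) (List.forall_mem_map.2 h1)
    (T2 := ar.map arityTok) (List.forall_mem_map.2 fun _ _ => trivial) hx
  exact ⟨fun j i => (H j i).1, fun j i => (H j i).2.1, fun j i => (H j i).2.2⟩

theorem sections_encodePair (φ : Formula τ) (A : FinStructure τ) :
    Sections ⟨encodePair φ A⟩ φ.toks A.toks (List.ofFn τ.arity) :=
  sections_of_word φ.isHead_toks A.isHead_toks (encodePair_eq φ A)

theorem format_encodePair (φ : Formula τ) (A : FinStructure τ) :
    format ⟨encodePair φ A⟩ = true := by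
  rw [encodePair_eq]
  exact format_of_sections φ.isHead_toks A.isHead_toks

theorem Setup.wellFormed_iff (h : Setup x N φ A) : wellFormed r t x N = true ↔
    φ.IsSentence ∧ φ ∈ boundedClass r t τ := by
  have h0 : Occ φ.toks 0 φ := occ_root rfl
  have hN := h.reads.length_le
  have h1 : validStruct x N = true :=
    (h.sections.validStruct_iff h.length_le h.card_le).2 A.goodBlocks
  have h2 : (ball N fun z => !freeOcc x N 0 z) = true ↔ φ.IsSentence := by
    simp only [ball_iff, Bool.not_eq_true', Formula.IsSentence, Finset.eq_empty_iff_forall_notMem,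
      h.reads.mem_freeVars h0, not_exists, not_and]
    constructor
    · intro H X z hz
      have := h.reads.freeOcc_lt hz
      rw [H z (by omega)] at hz
      cases hz
    · intro H z _
      by_contra hz
      exact H _ z (by simpa using hz) rfl
  have h3 : inLevel x N true t 0 = true ↔ φ ∈ SigmaClass t τ := h.reads.inLevel_iff h0 true t
  simp only [wellFormed, Bool.and_eq_true, h1, h.validFormula, h2, h3, true_and, and_assoc]
  refine and_congr_right fun _ => ?_
  cases r with
  | none => simp [boundedVars, boundedClass]
  | some s =>
    have hc : neq (kds x 1) 4 = false ↔ τ.numConsts = 0 := by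
      have := A.kindAt_toks 0
      rw [← Bool.not_eq_true, neq_iff, h.sections.kds_eq, this]
      omega
    simp only [boundedVars, boundedClass, BoundedSigmaClass, FOClass, Set.mem_inter_iff,
      Set.mem_ofPred_eq, Bool.and_eq_true, nle_iff, h.reads.varCount_eq h0 rfl, Bool.not_eq_true',
      hc]
    tauto

/-- A readable well-formed input encodes a formula and a structure. -/
theorem Sections.exists_setup_of_wellFormed (h : Sections x T0 T1 ar) (hr : readable x N = true)
    (hw : wellFormed r t x N = true) : ∃ (τ : Vocabulary) (φ : Formula τ) (A : FinStructure τ),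
      T0 = φ.toks ∧ T1 = A.toks ∧ List.ofFn τ.arity = ar := by
  simp only [wellFormed, Bool.and_eq_true, and_assoc] at hw
  obtain ⟨h1, h2, -⟩ := hw
  obtain ⟨hN, hR, hn⟩ := h.readable_iff.1 hr
  obtain ⟨n, cs, B, rfl⟩ := h.exists_structToks hN h1
  obtain ⟨τ, A, e, rfl⟩ :=
    ((h.validStruct_iff hN (hn (.univ, n) rfl)).1 h1).exists_structure
  rw [e] at h hN
  obtain ⟨φ, hφ⟩ := exists_formula_of_valid h hR hN h2
  exact ⟨τ, φ, A, hφ, e, rfl⟩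

theorem Setup.depth_eq (h : Setup x N φ A) :
    depth t x N = 2 * ((t + 1) * (2 * φ.nodes.size + 4)) := by
  rw [depth, h.reads.nodeCount_eq (occ_root rfl)]

theorem Setup.num_card (h : Setup x N φ A) : num x N 1 0 = A.card := by
  rw [num_eq h.sections.struct N (show A.toks[0]? = some (.univ, A.card) from rfl)]
  have := h.card_le
  exact min_eq_left (by simp only; omega)

theorem Setup.enough_iff (h : Setup x N φ A) : enough t x N M = true ↔ t + 4 ≤ M ∧ φ.len < M ∧
    CodesBelow x N M φ A ∧ (M ^ 12 + 3) ^ (depth t x N + 1) ≤ N := by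
  simp only [enough, Bool.and_eq_true, nle_iff, nlt_iff, ball_iff, Bool.or_eq_true,
    Bool.not_eq_true', h.num_card, and_assoc, h.reads.fend_eq (occ_root rfl), zero_add,
    (tpow_le_iff A.card_pos _).1, (tpow_le_iff (show 0 < M ^ 12 + 3 by omega) _).1]
  refine and_congr_right fun hM => and_congr_right fun _ => and_congr_left fun _ => ?_
  have hN := h.reads.length_le
  constructor
  · intro H c ψ hc
    have h1 := hc.le_length
    have h2 := ψ.len_pos
    have h3 := (isNode_iff_occ h.reads).2 ⟨ψ, hc⟩
    rcases H c (by omega) with h4 | h4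
    · rw [h3] at h4; cases h4
    · omega
  · intro H u _
    by_cases hu : isNode x u = true
    · obtain ⟨ψ, hψ⟩ := (isNode_iff_occ h.reads).1 hu
      have := H u ψ hψ
      exact .inr (by omega)
    · exact .inl (by simpa using hu)

theorem holds_iff_realize (hs : φ.IsSentence) (w : ℕ → Fin A.card) :
    φ.Holds A ↔ φ.Realize A w :=
  ⟨fun H => H w, fun H _ => realize_congr rfl (by rw [hs]; simp) H⟩

/-- The game starts with the claim of level `t` that the sentence is true. The hole is placed at the
end of the formula, hence outside; the assignment and the filling are irrelevant, and the
corresponding digits are left unspecified. -/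
theorem Setup.evalGame_iff (h : Setup x N φ A) (hs : φ.IsSentence)
    (hl : inLevel x N true t 0 = true) (hM : enough t x N M = true) :
    evalGame t x N M = true ↔ φ.Holds A := by
  obtain ⟨h1, h2, h3, h4⟩ := h.enough_iff.1 hM
  have h0 : Occ φ.toks 0 φ := occ_root rfl
  have hg : Game x N t φ A := ⟨h, hl⟩
  have hf : fend x N 0 = φ.len := by rw [h.reads.fend_eq h0, zero_add]
  have hout : inside x N 0 φ.len = false := by
    rw [← Bool.not_eq_true, h.reads.inside_iff h0]; omega
  -- This position shows that the search for a starting position succeeds.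
  obtain ⟨q, hq, hd⟩ := exists_dig (M := M) (by omega) [0, t, 0, 0, φ.len] (by simp; omega)
  have hle : startPos t x N M ≤ q := by
    by_contra hlt
    have := bmin_min (not_le.1 hlt)
    simp [hd 0 (by omega), hd 1 (by omega), hd 2 (by omega), hd 4 (by omega), hf, neq] at this
  have hp := bmin_spec (hle.trans_lt hq)
  rw [← startPos] at hp
  simp only [Bool.and_eq_true, neq_iff, hf] at hp
  obtain ⟨⟨⟨p0, p1⟩, p2⟩, p4⟩ := hp
  have hok : PosOk x N t φ (dig M (startPos t x N M)) (depth t x N) := by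
    simp only [PosOk, p0, p1, p2, p4, depth]
    exact ⟨⟨⟨φ, h0⟩, by rwa [orient_self], by simp [hout]⟩,
      Nat.mul_le_mul_left 2 (hg.rank_le h0).le⟩
  rw [evalGame, search_eq (hle.trans_lt hq) h4, h.num_card, hg.win_iff h3 h2 (by omega) hok]
  simp only [PosTrue, p0, p1, p2, p4]
  rw [claimTrue_iff h0, ev_iff_realize (by omega), orient_self]
  rw [holds_iff_realize hs (codeAsg x N φ.toks A.card_pos 0 (dig M (startPos t x N M) 3))]
  simp [sgn, negParity_zero]

/-- An atomic formula whose relation is empty does not hold. -/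
theorem Sections.not_holds_of_emptyAtom (h : Sections x φ.toks A.toks (List.ofFn τ.arity))
    (hE : emptyAtom x N = true) : ¬ φ.Holds A := by
  intro H
  -- The given `N` need not be large enough to read the formula, so the atom is evaluated with a
  -- larger number; the test with `N` has already covered all tuples of the structure.
  obtain ⟨N', hN'⟩ := h.exists_readable
  have hs := h.setup_iff.1 (hN' N' le_rfl)
  have h0 : Occ φ.toks 0 φ := occ_root rfl
  simp only [emptyAtom, Bool.and_eq_true, neq_iff, ball_iff, Bool.not_eq_true',
    Bool.and_eq_false_imp, h.kds_eq, kindAt_eq_zero, hs.reads.kd_eq, h0.kindAt] at hE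
  obtain ⟨⟨hN, hk⟩, hE⟩ := hE
  have := (hs.atomVal_iff (α := 0) h0 (by omega)).2 (H _)
  simp only [atomVal, hs.reads.kd_eq, h0.kindAt, hk, show neq 5 6 = false from rfl, cond_false,
    bex_iff, Bool.and_eq_true, neq_iff, h.kds_eq] at this
  obtain ⟨q, -, ⟨h1, h2⟩, -⟩ := this
  have hq := lt_of_kindAt (T := A.toks) (z := q) (by omega)
  have h3 := hE q (by omega) h1
  cases φ with
  | rel i ts =>
    have e : (Formula.rel i ts).toks[0]? = some (.rel, (i : ℕ)) := rfl
    have hrels : τ.numRels ≤ A.toks.length := by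
      rw [← List.length_ofFn (f := τ.arity), A.goodBlocks.length, ← countP_structToks]
      exact List.countP_le_length
    have := hs.rel_lt i
    have := i.2
    rw [num_eq h.formula _ e] at h2 h3
    simp only [neq, decide_eq_false_iff_not] at h2 h3
    omega
  | equal | neg | and | or | ex | all => simp [Formula.kind] at hk

/-- Readiness of `N` certifies everything that the evaluation relies on, so no minimality of `N` is
needed. An input that passes the format check and the tests is the encoding of a pair; conversely, a
pair that satisfies the sentence is not rejected by `emptyAtom`. -/
theorem accepts_iff (hN : ready r t x N = true) :
    accepts r t x N = true ↔ x.word ∈ mc (boundedClass r t) := by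
  constructor
  · intro H
    simp only [accepts, Bool.and_eq_true, Bool.not_eq_true', and_assoc] at H
    obtain ⟨h1, h2, h3, h4⟩ := H
    simp only [ready, h1, h2, h3, Bool.not_true, Bool.false_or, Bool.and_eq_true, bex_iff] at hN
    obtain ⟨hr, M, hM, hM'⟩ := hN
    obtain ⟨T0, T1, ar, hT0, hT1, hx⟩ := exists_sections_of_format h1
    have hsec := sections_of_word hT0 hT1 hx
    obtain ⟨τ, φ, A, rfl, rfl, rfl⟩ := hsec.exists_setup_of_wellFormed hr h3
    have hs := hsec.setup_iff.1 hr
    have hw := hs.wellFormed_iff.1 h3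
    have hmin : bmin (N + 1) (fun M => enough t x N M) < N + 1 := by
      by_contra hcon
      have := bmin_min (f := fun M => enough t x N M) (i := M) (by omega : M < bmin (N + 1) _)
      simp [hM'] at this
    have hl : inLevel x N true t 0 = true := by
      simp only [wellFormed, Bool.and_eq_true] at h3
      exact h3.1.2
    exact ⟨τ, φ, A, hx.trans (encodePair_eq φ A).symm, hw.1, hw.2,
      (hs.evalGame_iff hw.1 hl (bmin_spec hmin)).1 h4⟩
  · rintro ⟨τ, φ, A, hx, h1, h2, h3⟩
    obtain ⟨x⟩ := x
    obtain rfl : x = encodePair φ A := hx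
    have hsec := sections_encodePair φ A
    have hE : emptyAtom ⟨encodePair φ A⟩ N = false := by
      by_contra hE
      exact hsec.not_holds_of_emptyAtom (by simpa using hE) h3
    simp only [ready, format_encodePair, hE, Bool.not_true, Bool.false_or, Bool.and_eq_true] at hN
    obtain ⟨hr, hN⟩ := hN
    have hs := hsec.setup_iff.1 hr
    have hw : wellFormed r t ⟨encodePair φ A⟩ N = true := hs.wellFormed_iff.2 ⟨h1, h2⟩
    simp only [hw, Bool.not_true, Bool.false_or, bex_iff] at hN
    obtain ⟨M, hM, hM'⟩ := hN
    have hmin : bmin (N + 1) (fun M => enough t ⟨encodePair φ A⟩ N M) < N + 1 := by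
      by_contra hcon
      have := bmin_min (f := fun M => enough t ⟨encodePair φ A⟩ N M) (i := M)
        (by omega : M < bmin (N + 1) _)
      simp [hM'] at this
    have hl : inLevel ⟨encodePair φ A⟩ N true t 0 = true := by
      simp only [wellFormed, Bool.and_eq_true] at hw
      exact hw.1.2
    simp only [accepts, format_encodePair, hE, hw, Bool.not_false, Bool.and_self, Bool.true_and]
    exact (hs.evalGame_iff h1 hl (bmin_spec hmin)).2 h3

/-! ### Numbers that suffice -/

theorem Formula.card_freeVars_le_width (φ : Formula τ) : φ.freeVars.card ≤ φ.width := by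
  cases φ <;> simp [Formula.width]

theorem Occ.card_freeVars_le {T : List (Letter × ℕ)} {u c : ℕ} {ψ : Formula τ} (hu : Occ T u φ)
    (hc : Occ T c ψ) (h1 : u ≤ c) (h2 : c < u + φ.len) : ψ.freeVars.card ≤ φ.width := by
  induction hn : φ.nodes using Nat.strong_induction_on generalizing u φ with
  | _ n ih =>
    rcases Nat.eq_or_lt_of_le h1 with rfl | h1
    · rw [hc.unique hu]
      exact φ.card_freeVars_le_width
    · obtain ⟨d, χ, hd, h3, h4⟩ := exists_child (hu.kind_of_inside hc h1 h2) h1 h2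
      refine (ih _ (hn ▸ hd.nodes_lt) (hd.occ hu) h3 h4 rfl).trans ?_
      cases hd <;> simp [Formula.width]

/-- Numbers that suffice for a given sentence and structure. -/
theorem Setup.ready_of_le (h : Setup x N φ A) (hM : t + 4 ≤ M) (hL : φ.len < M)
    (hw : A.card ^ φ.width < M)
    (hN : (M ^ 12 + 3) ^ (2 * ((t + 1) * (2 * φ.nodes.size + 4)) + 1) ≤ N) :
    ready r t x N = true := by
  have h0 : Occ φ.toks 0 φ := occ_root rfl
  have hle : M ≤ N := by
    refine le_trans ?_ hN
    have h1 := Nat.le_self_pow (show 12 ≠ 0 by omega) M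
    have h2 := Nat.le_self_pow (show 2 * ((t + 1) * (2 * φ.nodes.size + 4)) + 1 ≠ 0 by omega)
      (M ^ 12 + 3)
    omega
  have he : enough t x N M = true := by
    refine h.enough_iff.2 ⟨hM, hL, fun c ψ hc => ?_, by rwa [h.depth_eq]⟩
    have h1 := hc.le_length
    have h2 := ψ.len_pos
    rw [h.reads.freeCount_eq hc]
    refine (Nat.pow_le_pow_right A.card_pos (h0.card_freeVars_le hc (Nat.zero_le _) ?_)).trans_lt hw
    simp only [Formula.len] at *
    omega
  simp only [ready, Bool.or_eq_true, Bool.and_eq_true, bex_iff]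
  exact .inr ⟨h.sections.setup_iff.2 h, .inr ⟨M, by omega, he⟩⟩

/-- The machine has to halt on every binary string: ill-formed inputs are settled by the format
check or by a failing test at some readable `N`, and for a well-formed input any sufficiently large
number will do. -/
theorem exists_ready (r : Option ℕ) (t : ℕ) (x : Inp) : ∃ N, ready r t x N = true := by
  cases hf : format x with
  | false => exact ⟨0, by simp [ready, hf]⟩
  | true =>
    obtain ⟨T0, T1, ar, hT0, hT1, hx⟩ := exists_sections_of_format hf
    have hsec := sections_of_word hT0 hT1 hx
    obtain ⟨N0, hN0⟩ := hsec.exists_readable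
    cases hw : wellFormed r t x N0 with
    | false => exact ⟨N0, by simp [ready, hw, hN0 N0 le_rfl]⟩
    | true =>
      obtain ⟨τ, φ, A, rfl, rfl, rfl⟩ := hsec.exists_setup_of_wellFormed (hN0 N0 le_rfl) hw
      exact ⟨N0 + ((t + 4 + φ.len + 1 + A.card ^ φ.width) ^ 12 + 3) ^
        (2 * ((t + 1) * (2 * φ.nodes.size + 4)) + 1),
        (hsec.setup_iff.1 (hN0 _ (by omega))).ready_of_le
          (M := t + 4 + φ.len + 1 + A.card ^ φ.width) (by omega) (by omega) (by omega) (by omega)⟩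

/-- Only the tokens of the structure are counted here, not those of the formula. If the relation is
empty, its arity, and with it the length of the atom, is not bounded by the size of the structure.
-/
theorem ready_of_empty {i : Fin τ.numRels} {ts : Fin (τ.arity i) → Term τ} (hi : A.rel i = ∅) :
    ready r t ⟨encodePair (.rel i ts) A⟩ A.toks.length = true := by
  have hsec := sections_encodePair (.rel i ts) A
  have hkd : kd ⟨encodePair (.rel i ts) A⟩ 0 = 5 := by
    rw [kd, hsec.formula, tokenGet_zero]
    rfl
  have hrels : τ.numRels ≤ A.toks.length := by
    rw [← List.length_ofFn (f := τ.arity), A.goodBlocks.length, ← countP_structToks]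
    exact List.countP_le_length
  have hnum := num_eq hsec.formula A.toks.length
    (show (Formula.rel i ts).toks[0]? = some (.rel, (i : ℕ)) from rfl)
  have hE : emptyAtom ⟨encodePair (.rel i ts) A⟩ A.toks.length = true := by
    simp only [emptyAtom, Bool.and_eq_true, neq_iff, ball_iff, Bool.not_eq_true',
      Bool.and_eq_false_imp, hsec.kds_eq, kindAt_eq_zero, hkd, hnum, le_refl, true_and]
    intro q hq hk
    obtain ⟨B1, b1, l, b2, B2, hB, rfl⟩ := exists_split_of_kindAt hk
    have hsec' := hsec
    simp only [FinStructure.toks] at hsec' hq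
    rw [hB] at hsec'
    obtain ⟨-, -, a3, -⟩ := hsec'.at_tuple le_rfl
    rw [a3]
    simp only [neq, decide_eq_false_iff_not]
    intro e
    have hBi : A.blocks[(i : ℕ)]? = some (b1 ++ l :: b2) := by
      rw [hB, show (i : ℕ) = B1.length by have := i.2; omega]
      simp
    obtain ⟨hi', H⟩ := A.mem_blocks hBi
    obtain ⟨t', ht', -⟩ := (H l).1 (by simp)
    exact Finset.notMem_empty t' (hi ▸ ht' : t' ∈ (∅ : Finset (Fin (τ.arity i) → Fin A.card)))
  simp [ready, hE]

end

/-! ### Sizes of encodings -/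

section

variable {τ : Vocabulary} {N M t : ℕ} {r : Option ℕ} {φ : Formula τ} {A : FinStructure τ}

theorem length_toBinary (w : List Letter) : (toBinary w).length = 4 * w.length := by
  induction w with
  | nil => rfl
  | cons l w ih =>
    rw [toBinary, List.flatMap_cons, List.length_append, ← toBinary, ih, List.length_cons]
    cases l <;> simp [Letter.toBits] <;> omega

theorem length_render (T : List (Letter × ℕ)) : T.length ≤ (render (T.map numTok)).length ∧
    ∀ t ∈ T, t.2.size < (render (T.map numTok)).length := by
  induction T with
  | nil => simp
  | cons a T ih =>
    obtain ⟨l, n⟩ := a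
    have e : (render (((l, n) :: T).map numTok)).length =
        n.size + (render (T.map numTok)).length + 1 := by
      rw [List.map_cons, render_cons, List.length_cons, List.length_append, writeNat,
        List.length_map, Nat.size_eq_bits_len]
    rw [e, List.length_cons]
    refine ⟨by omega, fun t ht => ?_⟩
    rcases List.mem_cons.1 ht with rfl | ht
    · simp only; omega
    · have := ih.2 t ht
      omega

theorem Formula.four_le_size (φ : Formula τ) : 4 ≤ φ.size := by
  rw [Formula.size, length_toBinary, ← render_toks]
  have h1 := (length_render φ.toks).1
  have h2 := φ.len_pos
  rw [Formula.len] at h2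
  omega

theorem Formula.len_le_size (φ : Formula τ) : φ.len ≤ φ.size := by
  rw [Formula.size, length_toBinary, ← render_toks]
  have h1 := (length_render φ.toks).1
  rw [Formula.len]
  omega

theorem Formula.index_size_le (φ : Formula τ) : ∀ t ∈ φ.toks, t.2.size ≤ φ.size := by
  intro t ht
  rw [Formula.size, length_toBinary, ← render_toks]
  have := (length_render φ.toks).2 t ht
  omega

theorem Formula.nodes_le_size (φ : Formula τ) : φ.nodes ≤ φ.size := by
  refine le_trans ?_ φ.len_le_size
  rw [← (toks_count φ).2]
  exact List.countP_le_length

theorem Formula.nodes_pos (φ : Formula τ) : 1 ≤ φ.nodes := by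
  cases φ <;> simp [Formula.nodes] <;> omega

theorem FinStructure.card_block (A : FinStructure τ) (i : Fin τ.numRels) :
    ((allTuples A.card (τ.arity i)).filter fun t => decide (t ∈ A.rel i)).length =
      (A.rel i).card := by
  classical
  rw [← List.toFinset_card_of_nodup]
  · congr 1
    ext t
    simp [mem_allTuples]
  · refine List.Nodup.filter _ ?_
    have h := pairwise_allTuples A.card (τ.arity i)
    exact h.imp fun {a b} hab e => by subst e; exact lt_irrefl _ hab

theorem length_blockToks (B : List (List (List ℕ))) : (blockToks B).length =
    (B.map fun b => (b.map fun t => t.length + 1).sum + 1).sum := by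
  simp [blockToks, tupleToks, List.length_flatMap]

/-- A tuple of positive length has at most twice as many tokens as entries. An empty tuple
contributes nothing to the sum in $|\mathbf A|$ but still has a token; there is at most one for each
relation symbol, and it is charged to $|\tau|$. -/
theorem FinStructure.length_toks_le (A : FinStructure τ) : A.toks.length ≤ 3 * A.size := by
  have h1 : (blockToks A.blocks).length =
      ∑ i, ((A.rel i).card * (τ.arity i + 1) + 1) := by
    rw [length_blockToks, FinStructure.blocks, List.map_ofFn, List.sum_ofFn]
    refine Finset.sum_congr rfl fun i _ => ?_
    simp [Function.comp_def, A.card_block, mul_add_one]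
  have h2 : ∀ i, (A.rel i).card * (τ.arity i + 1) + 1 ≤ 2 * ((A.rel i).card * τ.arity i) + 2 := by
    intro i
    rcases Nat.eq_zero_or_pos (τ.arity i) with h | h
    · have : (A.rel i).card ≤ 1 := by
        refine (Finset.card_le_univ _).trans ?_
        simp [h]
      rw [mul_add_one, mul_eq_zero_of_right _ h]
      omega
    · nlinarith [Nat.mul_le_mul_left (A.rel i).card h]
  have h3 := Finset.sum_le_sum fun (i : Fin τ.numRels) (_ : i ∈ Finset.univ) => h2 i
  rw [← h1, Finset.sum_add_distrib, ← Finset.mul_sum, Finset.sum_const, Finset.card_univ,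
    Fintype.card_fin, smul_eq_mul] at h3
  have h4 := A.card_pos
  simp only [FinStructure.toks, structToks, List.length_cons, List.length_append, List.length_map,
    FinStructure.consts, List.length_ofFn, FinStructure.size, pow_zero, Finset.sum_const,
    Finset.card_univ, Fintype.card_fin, smul_eq_mul]
  omega

theorem FinStructure.card_le_size (A : FinStructure τ) : A.card ≤ A.size := by
  rw [FinStructure.size]; omega

theorem setup_encodePair {L : ℕ} (h1 : φ.len ≤ L) (h2 : ∀ t ∈ φ.toks, t.2.size ≤ L)
    (hN : L + 3 * A.size ≤ N) : Setup ⟨encodePair φ A⟩ N φ A := by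
  have h3 := A.length_toks_le
  have h4 := A.card_le_size
  have hs := sections_encodePair φ A
  refine ⟨hs, ⟨hs.formula, ?_, fun t ht => (h2 t ht).trans (by omega)⟩, by omega, by omega⟩
  rw [Formula.len] at h1
  omega

theorem Formula.freeVars_subset_vars (φ : Formula τ) : φ.freeVars ⊆ φ.vars := by
  induction φ with
  | equal | rel => exact subset_rfl
  | neg φ ih => exact ih
  | and φ ψ ih1 ih2 | or φ ψ ih1 ih2 => exact Finset.union_subset_union ih1 ih2
  | ex y φ ih | all y φ ih =>
    exact (Finset.erase_subset _ _).trans (ih.trans (Finset.subset_insert _ _))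

theorem Formula.width_le_card_vars (φ : Formula τ) : φ.width ≤ φ.vars.card := by
  have h := Finset.card_le_card φ.freeVars_subset_vars
  induction φ with
  | equal | rel => exact h
  | neg φ ih => exact max_le h (ih (Finset.card_le_card φ.freeVars_subset_vars))
  | and φ ψ ih1 ih2 | or φ ψ ih1 ih2 =>
    exact max_le h (max_le
      ((ih1 (Finset.card_le_card φ.freeVars_subset_vars)).trans
        (Finset.card_le_card Finset.subset_union_left))
      ((ih2 (Finset.card_le_card ψ.freeVars_subset_vars)).trans
        (Finset.card_le_card Finset.subset_union_right)))
  | ex y φ ih | all y φ ih =>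
    exact max_le h ((ih (Finset.card_le_card φ.freeVars_subset_vars)).trans
      (Finset.card_le_card (Finset.subset_insert _ _)))

end

/-! ### Logarithms -/

theorem size_le_log {n : ℕ} (hn : 1 ≤ n) : (n.size : ℝ) ≤ 2 * Real.log n + 1 := by
  have h1 : 2 ^ (n.size - 1) ≤ n := Nat.lt_size.1 (by have := Nat.size_pos.2 hn; omega)
  have h2 : ((2 : ℝ) ^ (n.size - 1)) ≤ n := by exact_mod_cast h1
  have h3 := Real.log_le_log (by positivity) h2
  rw [Real.log_pow] at h3
  have h4 : ((n.size - 1 : ℕ) : ℝ) = n.size - 1 := by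
    rw [Nat.cast_sub (Nat.size_pos.2 hn)]; simp
  rw [h4] at h3
  have h5 := Real.log_two_gt_d9
  have h6 : (1 : ℝ) ≤ n.size := by exact_mod_cast Nat.size_pos.2 hn
  nlinarith

theorem one_le_log {n : ℕ} (hn : 4 ≤ n) : 1 ≤ Real.log n := by
  have h1 : Real.log 4 ≤ Real.log n := Real.log_le_log (by norm_num) (by exact_mod_cast hn)
  have h2 : Real.log 4 = 2 * Real.log 2 := by
    rw [show (4 : ℝ) = 2 ^ 2 by norm_num, Real.log_pow]; norm_num
  have := Real.log_two_gt_d9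
  linarith

theorem log_cast_nonneg (n : ℕ) : 0 ≤ Real.log n := Real.log_natCast_nonneg n

/-- The constant in the bound for the logarithm of the duration of the search. -/
noncomputable def searchConst (t : ℕ) : ℝ := 200 * (t + 1) * (Real.log (t + 7) + 1)

/-- The logarithm is a product of the exponent, which is $O((t+1)(\log n+1))$, and of $\log M$,
which is $O_t(1+\log L+w\log k)$ because the sum $M$ is at most a constant times the product of its
parts. The size `a` of the structure occurs only as a factor outside the power, so that $\log a$ is
not multiplied by the depth. -/
theorem log_search_le {t L k w n a : ℕ} (hL : 1 ≤ L) (hk : 1 ≤ k) (hn : 1 ≤ n) (ha : 1 ≤ a) :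
    Real.log (((t + 5 + L + k ^ w) ^ 12 + 3) ^ (2 * ((t + 1) * (2 * n.size + 4)) + 1) + L + 3 * a :
      ℕ) ≤ searchConst t * ((Real.log n + 1) * (1 + Real.log L + w * Real.log k)) + Real.log a := by
  set M := t + 5 + L + k ^ w with hM
  set E := 2 * ((t + 1) * (2 * n.size + 4)) + 1 with hE
  have hkw : 1 ≤ k ^ w := Nat.one_le_pow _ _ hk
  have hM7 : M ≤ (t + 7) * (L * k ^ w) := by
    have h1 : L ≤ L * k ^ w := Nat.le_mul_of_pos_right _ hkw
    have h2 : k ^ w ≤ L * k ^ w := Nat.le_mul_of_pos_left _ hL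
    nlinarith
  -- Here `M ^ 12 + 3 ≤ M ^ 13`, and two more factors `M` absorb the remaining summands, since `16 ≤
  -- M ^ 2`.
  have hN : (M ^ 12 + 3) ^ E + L + 3 * a ≤ M ^ (13 * E + 2) * a := by
    have h1 : M ^ 12 + 3 ≤ M ^ 13 := by
      have : 1 ≤ M ^ 12 := Nat.one_le_pow _ _ (by omega)
      rw [pow_succ M 12]
      nlinarith
    have h2 : (M ^ 12 + 3) ^ E ≤ M ^ (13 * E) := by
      rw [pow_mul]; exact Nat.pow_le_pow_left h1 E
    have h3 : M ≤ M ^ (13 * E) := Nat.le_self_pow (by omega) M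
    have h4 : 16 ≤ M ^ 2 := by nlinarith
    rw [pow_add M (13 * E) 2]
    generalize M ^ (13 * E) = X at h2 h3
    have h5 : (M ^ 12 + 3) ^ E + L + 3 * a ≤ 2 * X + 3 * a := by omega
    have h6 : 2 * X + 3 * a ≤ X * 16 * a := by nlinarith
    exact h5.trans (h6.trans (Nat.mul_le_mul_right _ (Nat.mul_le_mul_left _ h4)))
  have hMpos : (0 : ℝ) < M := by exact_mod_cast (by omega : 0 < M)
  have hapos : (0 : ℝ) < a := by exact_mod_cast ha
  have l1 : Real.log ((M ^ 12 + 3) ^ E + L + 3 * a : ℕ) ≤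
      (13 * E + 2) * Real.log M + Real.log a := by
    refine (Real.log_le_log (by exact_mod_cast (by omega)) (Nat.cast_le.2 hN)).trans ?_
    push_cast
    rw [Real.log_mul (by positivity) hapos.ne', Real.log_pow]
    push_cast
    rfl
  have l2 : Real.log M ≤ Real.log (t + 7) + (Real.log L + w * Real.log k) := by
    refine (Real.log_le_log hMpos (Nat.cast_le.2 hM7)).trans ?_
    have : (0 : ℝ) < k := by exact_mod_cast hk
    have : (0 : ℝ) < L := by exact_mod_cast hL
    push_cast
    rw [Real.log_mul (by positivity) (by positivity), Real.log_mul (by positivity) (by positivity),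
      Real.log_pow]
  have l3 : (13 * E + 2 : ℝ) ≤ 200 * (t + 1) * (Real.log n + 1) := by
    have h1 := size_le_log hn
    have h2 := log_cast_nonneg n
    have h3 : (0 : ℝ) ≤ t := Nat.cast_nonneg t
    rw [hE]
    push_cast
    nlinarith [mul_le_mul_of_nonneg_left h1 h3, mul_nonneg h3 h2]
  have h1 := log_cast_nonneg n
  have h2 : 0 ≤ Real.log L + w * Real.log k :=
    add_nonneg (log_cast_nonneg L) (mul_nonneg (Nat.cast_nonneg _) (log_cast_nonneg k))
  have h3 : 0 ≤ Real.log ((t : ℝ) + 7) :=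
    Real.log_nonneg (by have : (0 : ℝ) ≤ t := Nat.cast_nonneg t; linarith)
  have h4 : Real.log M ≤ (Real.log (t + 7) + 1) * (1 + (Real.log L + w * Real.log k)) := by
    nlinarith [mul_nonneg h3 h2]
  refine l1.trans (add_le_add_left ?_ _)
  have h5 : 0 ≤ Real.log (M : ℝ) := log_cast_nonneg M
  have h6 : (0 : ℝ) ≤ 200 * (t + 1) * (Real.log n + 1) := by positivity
  calc _ ≤ (200 * (t + 1) * (Real.log n + 1)) *
        ((Real.log (t + 7) + 1) * (1 + (Real.log L + w * Real.log k))) :=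
        mul_le_mul l3 h4 h5 h6
    _ = _ := by rw [searchConst]; ring

/-! ### The model-checking machine and its space -/

theorem TuringMachine.RunsInSpace.mono {M : TuringMachine} {x : List Bool} {S S' : ℝ}
    (h : M.RunsInSpace x S) (hS : S ≤ S') : M.RunsInSpace x S' := ⟨h.1, h.2.trans hS⟩

/-- There is a machine that decides `mc (boundedClass r t)` and whose space is logarithmic in
every number that suffices to treat the input. -/
theorem exists_decider (r : Option ℕ) (t : ℕ) : ∃ M : TuringMachine,
    M.Decides (mc (boundedClass r t)) ∧ ∃ c : ℝ, 0 ≤ c ∧ ∀ (x : List Bool) (N : ℕ), 1 ≤ N →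
      ready r t ⟨x⟩ N = true → M.RunsInSpace x (c * (2 * Real.log N + 2)) := by
  obtain ⟨M, c, H⟩ := exists_machine
    (ls_ready (x := Prod.fst) (N := Prod.snd) r t (by fun_prop) (by fun_prop))
    (ls_accepts (x := Prod.fst) (N := Prod.snd) r t (by fun_prop) (by fun_prop))
  refine ⟨M, fun x => ?_, c, Nat.cast_nonneg c, fun x N hN hr => ?_⟩
  · have hx := exists_ready r t ⟨x⟩
    have hr := Nat.find_spec hx
    obtain ⟨⟨n, hn⟩, -⟩ := H x (Nat.find hx) hr fun i hi => by
      simpa using Nat.find_min hx hi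
    exact ⟨n, _, hn, accepts_iff hr⟩
  · have hx : ∃ N, ready r t ⟨x⟩ N = true := ⟨N, hr⟩
    refine (H x (Nat.find hx) (Nat.find_spec hx) fun i hi => by
      simpa using Nat.find_min hx hi).2.mono ?_
    -- The machine stops at the least ready number, which is at most the given one.
    have h1 : ((Nat.find hx).size : ℝ) ≤ N.size :=
      Nat.cast_le.2 (Nat.size_le_size (Nat.find_min' hx hr))
    have h2 := size_le_log hN
    exact mul_le_mul_of_nonneg_left (by linarith) (Nat.cast_nonneg c)

section

variable {τ : Vocabulary} {φ : Formula τ} {A : FinStructure τ}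

/-- If the tokens of `φ` are bounded by `L`, then some number whose logarithm is bounded in terms
of `L`, the number of nodes and the width of `φ` suffices to treat `(φ, A)`. -/
theorem exists_ready_log_le (r : Option ℕ) (t : ℕ) {L : ℕ} (hL : 1 ≤ L) (h1 : φ.len ≤ L)
    (h2 : ∀ t ∈ φ.toks, t.2.size ≤ L) : ∃ N : ℕ, 1 ≤ N ∧ ready r t ⟨encodePair φ A⟩ N = true ∧
      Real.log N ≤ searchConst t * ((Real.log φ.nodes + 1) *
        (1 + Real.log L + φ.width * Real.log A.card)) + Real.log A.size :=
  ⟨_, by omega, (setup_encodePair h1 h2 (by omega)).ready_of_le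
    (M := t + 5 + L + A.card ^ φ.width) (by omega) (by omega) (by omega) (by omega),
    log_search_le hL A.card_pos φ.nodes_pos (A.card_pos.trans_le A.card_le_size)⟩

theorem searchConst_nonneg (t : ℕ) : 0 ≤ searchConst t := by
  have h1 : (0 : ℝ) ≤ t := Nat.cast_nonneg t
  have h2 : 0 ≤ Real.log ((t : ℝ) + 7) := Real.log_nonneg (by linarith)
  rw [searchConst]
  positivity

/-- In the class, the width is at most the number `s` of variables. Additive constants are absorbed
because the encoding of a formula has at least four bits, so its logarithm is at least `1`. -/
theorem exists_ready_bounded (s t : ℕ) (φ : Formula τ) (A : FinStructure τ) :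
    ∃ N : ℕ, 1 ≤ N ∧ ready (some s) t ⟨encodePair φ A⟩ N = true ∧
      2 * Real.log N + 2 ≤ (2 * (searchConst t * (4 + 2 * s) + 2) + 2) *
        (Real.log φ.size * (Real.log φ.size + Real.log A.size)) := by
  have hf := one_le_log φ.four_le_size
  have ha := log_cast_nonneg A.size
  have hK := searchConst_nonneg t
  have hs : (0 : ℝ) ≤ s := Nat.cast_nonneg s
  have hpos := A.card_pos.trans_le A.card_le_size
  have hH : Real.log φ.size + Real.log A.size ≤
      Real.log φ.size * (Real.log φ.size + Real.log A.size) :=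
    le_mul_of_one_le_left (by linarith) hf
  have hKs := mul_nonneg hK (show (0 : ℝ) ≤ 4 + 2 * s by positivity)
  by_cases hc : φ ∈ BoundedSigmaClass s t τ
  · obtain ⟨N, h1, h2, h3⟩ := exists_ready_log_le (A := A) (some s) t
      (by have := φ.four_le_size; omega) φ.len_le_size φ.index_size_le
    refine ⟨N, h1, h2, ?_⟩
    have hw : (φ.width : ℝ) ≤ s := Nat.cast_le.2 (φ.width_le_card_vars.trans hc.1.2)
    have hn : Real.log φ.nodes ≤ Real.log φ.size :=
      Real.log_le_log (by exact_mod_cast φ.nodes_pos) (Nat.cast_le.2 φ.nodes_le_size)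
    have hk : Real.log A.card ≤ Real.log A.size :=
      Real.log_le_log (by exact_mod_cast A.card_pos) (Nat.cast_le.2 A.card_le_size)
    have hwk := mul_le_mul hw hk (log_cast_nonneg A.card) hs
    have hsf : 0 ≤ s * Real.log φ.size := mul_nonneg hs (by linarith)
    have e1 : (Real.log φ.nodes + 1) * (1 + Real.log φ.size + φ.width * Real.log A.card) ≤
        (2 * Real.log φ.size) * ((2 + s) * (Real.log φ.size + Real.log A.size)) := by
      refine mul_le_mul (by linarith) (by linarith) ?_ (by linarith)
      have := mul_nonneg (Nat.cast_nonneg (α := ℝ) φ.width) (log_cast_nonneg A.card)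
      linarith
    have e2 := mul_le_mul_of_nonneg_left e1 hK
    linarith
  -- Outside the class the width is not controlled by `s`. But then a number that is just large
  -- enough to read the input already shows that it is to be rejected, and no game is played.
  · have hN : φ.size + 3 * A.size ≤ φ.size ^ 2 * A.size := by
      nlinarith [φ.four_le_size, Nat.mul_le_mul φ.four_le_size hpos]
    have hset := setup_encodePair (A := A) φ.len_le_size φ.index_size_le le_rfl
    have hw : wellFormed (some s) t ⟨encodePair φ A⟩ (φ.size + 3 * A.size) = false := by
      rw [← Bool.not_eq_true, hset.wellFormed_iff]
      exact fun h => hc h.2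
    refine ⟨φ.size + 3 * A.size, by omega, ?_, ?_⟩
    · simp [ready, hw, hset.sections.setup_iff.2 hset]
    · have hfp : (0 : ℝ) < φ.size := by exact_mod_cast (by have := φ.four_le_size; omega)
      have hap : (0 : ℝ) < A.size := by exact_mod_cast hpos
      have e : Real.log (φ.size + 3 * A.size : ℕ) ≤ 2 * Real.log φ.size + Real.log A.size := by
        refine (Real.log_le_log (by exact_mod_cast (by omega)) (Nat.cast_le.2 hN)).trans ?_
        push_cast
        rw [Real.log_mul (by positivity) (by positivity), Real.log_pow]
        norm_num
      nlinarith [mul_nonneg hKs (show 0 ≤ Real.log φ.size + Real.log A.size by linarith)]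

theorem Term.index_size_le {u : Term τ} (hu : u.vars = ∅) (A : FinStructure τ) :
    u.tok.2.size ≤ A.size := by
  cases u with
  | var x => simp [Term.vars] at hu
  | const c =>
    have h1 := Nat.size_le.2 (Nat.lt_two_pow_self (n := (c : ℕ)))
    have h2 := c.2
    simp only [Term.tok, FinStructure.size]
    omega

/-- The tokens of an atomic sentence are bounded by the size of the structure, unless the relation
is empty. -/
theorem atom_bounds (hs : φ.IsSentence) (hn : φ.nodes = 1) (A : FinStructure τ) :
    2 ≤ A.size ∧ φ.width = 0 ∧ ((∃ i ts, φ = .rel i ts ∧ A.rel i = ∅) ∨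
      φ.len ≤ A.size + 3 ∧ ∀ t ∈ φ.toks, t.2.size ≤ A.size + 3) := by
  have hA := A.card_pos
  cases φ with
  | equal u v =>
    obtain ⟨hu, hv⟩ := Finset.union_eq_empty.1 hs
    have h1 := Term.index_size_le hu A
    have h2 := Term.index_size_le hv A
    refine ⟨?_, by rw [Formula.width, hs, Finset.card_empty], .inr ⟨?_, ?_⟩⟩
    · cases u with
      | var x => simp [Term.vars] at hu
      | const c => rw [FinStructure.size]; have := c.2; omega
    · simp [Formula.len, Formula.toks]
    · simp only [Formula.toks, List.mem_cons, List.not_mem_nil, or_false, forall_eq_or_imp,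
        forall_eq, Nat.size_zero]
      omega
  | rel i ts =>
    refine ⟨by rw [FinStructure.size]; have := i.2; omega,
      by rw [Formula.width, hs, Finset.card_empty], ?_⟩
    rcases (A.rel i).eq_empty_or_nonempty with h | h
    · exact .inl ⟨i, ts, rfl, h⟩
    · have h1 : τ.arity i ≤ (A.rel i).card * τ.arity i :=
        Nat.le_mul_of_pos_left _ h.card_pos
      have h2 : (A.rel i).card * τ.arity i ≤ ∑ i, (A.rel i).card * τ.arity i :=
        Finset.single_le_sum (f := fun i => (A.rel i).card * τ.arity i)
          (fun _ _ => Nat.zero_le _) (Finset.mem_univ i)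
      have h3 := Nat.size_le.2 (Nat.lt_two_pow_self (n := (i : ℕ)))
      refine .inr ⟨?_, ?_⟩
      · rw [Formula.len, Formula.toks, List.length_cons, List.length_ofFn, FinStructure.size]
        omega
      · intro w hw
        rw [Formula.toks, List.mem_cons, List.mem_ofFn] at hw
        rcases hw with rfl | ⟨j, rfl⟩
        · have := i.2
          simp only [FinStructure.size]
          omega
        · have hj : (ts j).vars = ∅ := Finset.subset_empty.1 <| by
            rw [← show (Formula.rel i ts).freeVars = ∅ from hs]
            exact Finset.subset_biUnion_of_mem (fun j => (ts j).vars) (Finset.mem_univ j)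
          exact (Term.index_size_le hj A).trans (by omega)
  | neg φ => have := φ.nodes_pos; rw [Formula.nodes] at hn; omega
  | and φ ψ | or φ ψ => have := φ.nodes_pos; rw [Formula.nodes] at hn; omega
  | ex x φ | all x φ => have := φ.nodes_pos; rw [Formula.nodes] at hn; omega

theorem log_le_three_mul {N a : ℕ} (hN : 1 ≤ N) (h : N ≤ a ^ 3) :
    Real.log N ≤ 3 * Real.log a := by
  refine (Real.log_le_log (by exact_mod_cast hN) (Nat.cast_le.2 h)).trans ?_
  push_cast
  rw [Real.log_pow]
  norm_num

/-- With at least two nodes, $\log\|\varphi\|$ is bounded away from zero and the product with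
$\log|\varphi|$ absorbs all constants. A single node has to be treated separately, since then only
the summand $\log|\mathbf A|$ is left. -/
theorem exists_ready_sentence (t : ℕ) (hs : φ.IsSentence) (A : FinStructure τ) :
    ∃ N : ℕ, 1 ≤ N ∧ ready none t ⟨encodePair φ A⟩ N = true ∧
      2 * Real.log N + 2 ≤ (2 * (5 * searchConst t + 3) + 4) *
        (Real.log φ.nodes * φ.width * Real.log A.card + Real.log φ.nodes * Real.log φ.size +
          Real.log A.size) := by
  have hK := searchConst_nonneg t
  have ha := log_cast_nonneg A.size
  have hlog := Real.log_two_gt_d9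
  rcases φ.nodes_pos.eq_or_lt' with hn | hn
  -- An atomic sentence contains constants or a relation symbol, so the structure has size at least
  -- two and its logarithm absorbs constants. Its tokens are bounded by the structure, and the bound
  -- `L = A.size + 3` replaces the length of the formula.
  · obtain ⟨ha2, hw, H⟩ := atom_bounds hs hn A
    have ha' : Real.log 2 ≤ Real.log A.size :=
      Real.log_le_log (by norm_num) (by exact_mod_cast ha2)
    have hKa := mul_nonneg hK ha
    have ha3 : 4 * A.size ≤ A.size ^ 3 := by
      rw [pow_succ]
      exact Nat.mul_le_mul_right _ (Nat.pow_le_pow_left ha2 2)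
    simp only [hn, hw, Nat.cast_one, Real.log_one, Nat.cast_zero, zero_mul, zero_add]
    rcases H with ⟨i, ts, rfl, hi⟩ | ⟨h1, h2⟩
    · have hN : 1 ≤ A.toks.length := by simp [FinStructure.toks, structToks]
      refine ⟨_, hN, ready_of_empty hi, ?_⟩
      have := log_le_three_mul hN (A.length_toks_le.trans (by omega : _ ≤ A.size ^ 3))
      linarith
    · obtain ⟨N, h3, h4, h5⟩ := exists_ready_log_le (A := A) none t (by omega) h1 h2
      refine ⟨N, h3, h4, ?_⟩
      simp only [hn, hw, Nat.cast_one, Real.log_one, Nat.cast_zero, zero_mul, zero_add, one_mul,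
        add_zero] at h5
      have h6 := log_le_three_mul (by omega) (by omega : A.size + 3 ≤ A.size ^ 3)
      have h7 := mul_le_mul_of_nonneg_left
        (show 1 + Real.log (A.size + 3 : ℕ) ≤ 5 * Real.log A.size by linarith) hK
      linarith
  · have hf := one_le_log φ.four_le_size
    have hn' : Real.log 2 ≤ Real.log φ.nodes :=
      Real.log_le_log (by norm_num) (by exact_mod_cast hn)
    obtain ⟨N, h1, h2, h3⟩ := exists_ready_log_le (A := A) none t
      (by have := φ.four_le_size; omega) φ.len_le_size φ.index_size_le
    refine ⟨N, h1, h2, ?_⟩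
    have hwk := mul_nonneg (Nat.cast_nonneg (α := ℝ) φ.width) (log_cast_nonneg A.card)
    have e1 : (Real.log φ.nodes + 1) * (1 + Real.log φ.size + φ.width * Real.log A.card) ≤
        (5 / 2 * Real.log φ.nodes) * (2 * (Real.log φ.size + φ.width * Real.log A.card)) :=
      mul_le_mul (by linarith) (by linarith) (by linarith) (by linarith)
    have e2 := mul_le_mul_of_nonneg_left e1 hK
    have e3 : 1 / 2 ≤ Real.log φ.nodes * Real.log φ.size := by nlinarith
    have e4 := mul_nonneg (show 0 ≤ Real.log φ.nodes by linarith) hwk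
    have e5 := mul_nonneg hK ha
    linarith

end

end ModelChecking

theorem theorem4 :
    (∀ s t : ℕ, ∃ M : ModelChecking.TuringMachine,
      M.Decides (ModelChecking.mc (ModelChecking.BoundedSigmaClass s t)) ∧
      ∃ C : ℝ, ∀ (τ : ModelChecking.Vocabulary) (φ : ModelChecking.Formula τ)
        (A : ModelChecking.FinStructure τ), φ.IsSentence →
        M.RunsInSpace (ModelChecking.encodePair φ A)
          (C * (Real.log φ.size * (Real.log φ.size + Real.log A.size)))) ∧
    (∀ t : ℕ, 1 ≤ t → ∃ M : ModelChecking.TuringMachine,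
      M.Decides (ModelChecking.mc (ModelChecking.SigmaClass t)) ∧
      ∃ C : ℝ, ∀ (τ : ModelChecking.Vocabulary) (φ : ModelChecking.Formula τ)
        (A : ModelChecking.FinStructure τ), φ.IsSentence →
        M.RunsInSpace (ModelChecking.encodePair φ A)
          (C * (Real.log φ.nodes * φ.width * Real.log A.card +
            Real.log φ.nodes * Real.log φ.size + Real.log A.size))) := by
  constructor
  · intro s t
    obtain ⟨M, hM, c, hc, H⟩ := ModelChecking.exists_decider (some s) t
    refine ⟨M, hM, c * (2 * (ModelChecking.searchConst t * (4 + 2 * s) + 2) + 2),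
      fun τ φ A _ => ?_⟩
    obtain ⟨N, h₁, h₂, h₃⟩ := ModelChecking.exists_ready_bounded s t φ A
    rw [mul_assoc]
    exact (H _ N h₁ h₂).mono (mul_le_mul_of_nonneg_left h₃ hc)
  · intro t _
    obtain ⟨M, hM, c, hc, H⟩ := ModelChecking.exists_decider none t
    refine ⟨M, hM, c * (2 * (5 * ModelChecking.searchConst t + 3) + 4), fun τ φ A hs => ?_⟩
    obtain ⟨N, h₁, h₂, h₃⟩ := ModelChecking.exists_ready_sentence t hs A
    rw [mul_assoc]
    exact (H _ N h₁ h₂).mono (mul_le_mul_of_nonneg_left h₃ hc)
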